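/- **Setting.** A polyhedral domain $\Omega\subset\mathbb R^3$ is subdivided conformingly into finitely many closed tetrahedra $\Lambda_1,\dots,\Lambda_L$ (macro-elements); some edges of the subdivision are singular, and each $\Lambda_\ell$ contains at most one singular edge. Let $\mathcal T_h$ be a conforming tetrahedral mesh of $\overline\Omega$, each element of which lies in one macro-element. If $\Lambda$ is a macro-element with singular edge $e$, let $\pi_e$ be the orthogonal projection along the direction of $e$. There is a finite family $\mathcal P$ of planes, each spanned by a point of $e$ and the edge of $\Lambda$ opposite to $e$, such that the planes contain all nodes in $\Lambda$ and meet no open element, each element in $\Lambda$ has an edge parallel to $e$, and the projections under $\pi_e$ of the elements in $\Lambda$ are triangles of one conforming planar triangulation with all angles at least $\theta>0$. Let $\mathcal N_c$ be the set of vertices of macro-elements, $\mathcal N_s$ the set of nodes on singular edges, and $\mathcal N_0$ the set of all other nodes. **The operator.** For each $n\in\mathcal N_0$ an edge $\sigma_n$ of the mesh with endpoint $n$ is given such that $\sigma_n$ lies in every macro-element, and in every boundary face of a macro-element, that contains $n$; if $n\in\Lambda$ with $\Lambda$ as above, then $\sigma_n$ lies in one of the planes of $\mathcal P$, and if $n_1,n_2\in\mathcal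 N_0\cap\Lambda$ satisfy $\pi_e(n_1)=\pi_e(n_2)$, then $\pi_e(\sigma_{n_1})=\pi_e(\sigma_{n_2})$. With the piecewise linear nodal basis $(\phi_n)$ and the $L^2(\sigma)$-projection $\Pi_\sigma$ onto the polynomials of degree at most one on $\sigma$, put $$D_hu=\sum_{n\in\mathcal N_0}(\Pi_{\sigma_n}u)(n)\,\phi_n .$$ **Lengths and patch.** Let $T\subset\Lambda$ be an element, $\Lambda$ as above, and let $x_1,x_2,x_3$ be Cartesian coordinates with the $x_3$-axis parallel to $e$. Let $h_{3,T}$ be the length of the edge $e_{3,T}$ of $T$ parallel to $e$, and let $h_{1,T}=h_{2,T}$ be the mean length of two edges of $T$ which join $e_{3,T}$ to the other two vertices of $T$ and each of which lies in a plane of $\mathcal P$. The patch $S_T\subset\Lambda$ is a connected open set, the interior of the union of a set of closed elements including $T$, with $\sigma_n\subset\overline{S_T}$ for all $n\in\mathcal N_0$ that are vertices of $T$; it is a prism whose top and bottom lie in two planes of $\mathcal P$ and whose other faces are parallel to $e$; and it consists of the least number of elements for which all this is possible. **Lemma (anisotropic needle element, full regularity).** For every subdivision as above, every $\theta>0$ and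 every $C_0$ there is a constant $C$ such that the following holds for all such meshes, all admissible choices of the $\sigma_n$, all elements $T$ in a macro-element with a singular edge which have no vertex in $\mathcal N_c\cup\mathcal N_s$ and satisfy $h_{1,T}=h_{2,T}\le C_0h_{3,T}$, all patches $S_T$, and all $u\in H^2(S_T)$. The function $u$ has square-integrable traces on the edges $\sigma_n$, $n$ a vertex of $T$ (it has a representative that is continuous on $S_T$ and up to the interiors of these edges), $u-D_hu\in H^1(T)$, and $$|u-D_hu|_{H^1(T)}\le C\sum_{|\alpha|=1}h_T^\alpha\,|D^\alpha u|_{H^1(S_T)} = C\sum_{i=1}^3 h_{i,T}\,|\partial_iu|_{H^1(S_T)} .$$ -/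

import Mathlib

open MeasureTheory
open scoped ContDiff

noncomputable section

/-- Three-dimensional Euclidean space. -/
abbrev E3 : Type := EuclideanSpace ℝ (Fin 3)

/-! ### Sobolev spaces through weak derivatives -/

/-- `g` is the weak derivative of `f` in the direction `e` on the open set `U`. -/
def HasWeakPartial (U : Set E3) (e : E3) (f g : E3 → ℝ) : Prop :=
  LocallyIntegrableOn f U ∧ LocallyIntegrableOn g U ∧
    ∀ η : E3 → ℝ, ContDiff ℝ ∞ η → HasCompactSupport η → tsupport η ⊆ U →
      ∫ x in U, f x * fderiv ℝ η x e = -∫ x in U, g x * η x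

open Classical in
/-- The weak derivative of `f` in the direction `e` on `U` (unique up to null sets);
zero if there is none. -/
def weakPartial (U : Set E3) (e : E3) (f : E3 → ℝ) : E3 → ℝ :=
  if h : ∃ g, HasWeakPartial U e f g then h.choose else 0

/-- `f ∈ H¹(U)`. -/
def MemH1 (U : Set E3) (f : E3 → ℝ) : Prop :=
  MemLp f 2 (volume.restrict U) ∧
    ∀ e : E3, ∃ g, HasWeakPartial U e f g ∧ MemLp g 2 (volume.restrict U)

/-- `f ∈ H²(U)`. -/
def MemH2 (U : Set E3) (f : E3 → ℝ) : Prop :=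
  MemH1 U f ∧ ∀ e : E3, MemH1 U (weakPartial U e f)

/-- The norm of `L²(U)`. -/
def l2Norm (U : Set E3) (f : E3 → ℝ) : ℝ :=
  (eLpNorm f 2 (volume.restrict U)).toReal

/-- The seminorm `|f|_{H¹(U)}`, written in the Cartesian frame `b`. -/
def h1Seminorm (b : OrthonormalBasis (Fin 3) ℝ E3) (U : Set E3) (f : E3 → ℝ) : ℝ :=
  Real.sqrt (∑ i, l2Norm U (weakPartial U (b i) f) ^ 2)

/-! ### The `L²`-projection onto the affine functions on an edge -/

/-- The `L²(0,1)`-projection of `f` onto the polynomials of degree at most one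
(see `integral_sub_affineL2Proj_mul` for the orthogonality that characterizes it). -/
def affineL2Proj (f : ℝ → ℝ) (t : ℝ) : ℝ :=
  (4 * (∫ s in (0 : ℝ)..1, f s) - 6 * ∫ s in (0 : ℝ)..1, s * f s) +
    (12 * (∫ s in (0 : ℝ)..1, s * f s) - 6 * ∫ s in (0 : ℝ)..1, f s) * t

theorem integral_sub_affineL2Proj_mul (f : ℝ → ℝ)
    (hf : IntervalIntegrable f volume 0 1) (p q : ℝ) :
    ∫ s in (0 : ℝ)..1, (f s - affineL2Proj f s) * (p + q * s) = 0 := by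
  have hsf : IntervalIntegrable (fun s => s * f s) volume 0 1 :=
    hf.continuousOn_mul continuousOn_id
  set m0 := ∫ s in (0 : ℝ)..1, f s with hm0
  set m1 := ∫ s in (0 : ℝ)..1, s * f s with hm1
  have e : (fun s => (f s - affineL2Proj f s) * (p + q * s)) =
      fun s => (p * f s + q * (s * f s)) -
        ((4 * m0 - 6 * m1) * p + ((4 * m0 - 6 * m1) * q + (12 * m1 - 6 * m0) * p) * s
          + ((12 * m1 - 6 * m0) * q) * s ^ 2) := by
    funext s
    simp only [affineL2Proj, ← hm0, ← hm1]
    ring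
  have hpoly : IntervalIntegrable (fun s : ℝ => (4 * m0 - 6 * m1) * p
      + ((4 * m0 - 6 * m1) * q + (12 * m1 - 6 * m0) * p) * s
      + ((12 * m1 - 6 * m0) * q) * s ^ 2) volume 0 1 :=
    Continuous.intervalIntegrable (by fun_prop) _ _
  have h2 : ∀ A B D : ℝ, ∫ s in (0 : ℝ)..1, (A + B * s + D * s ^ 2) = A + B / 2 + D / 3 := by
    intro A B D
    rw [intervalIntegral.integral_add (Continuous.intervalIntegrable (by fun_prop) _ _)
      (Continuous.intervalIntegrable (by fun_prop) _ _),
      intervalIntegral.integral_add (Continuous.intervalIntegrable (by fun_prop) _ _)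
      (Continuous.intervalIntegrable (by fun_prop) _ _),
      intervalIntegral.integral_const_mul B (fun s => s),
      intervalIntegral.integral_const_mul D (fun s => s ^ 2),
      integral_pow, integral_id, intervalIntegral.integral_const, smul_eq_mul]
    norm_num
    ring
  rw [e, intervalIntegral.integral_sub ((hf.const_mul p).add (hsf.const_mul q)) hpoly,
    intervalIntegral.integral_add (hf.const_mul p) (hsf.const_mul q),
    intervalIntegral.integral_const_mul, intervalIntegral.integral_const_mul, h2, ← hm0, ← hm1]
  ring

/-- The value `(Π_σ v)(n)` at the endpoint `n` of the `L²(σ)`-projection of `v` onto the affine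
functions on the edge `σ = [n, m]`. -/
def edgeProjValue (v : E3 → ℝ) (n m : E3) : ℝ :=
  affineL2Proj (fun s => v (AffineMap.lineMap n m s)) 0

/-! ### Triangulations and nodal bases -/

/-- The tetrahedra (as sets of four vertices) of a simplicial complex. -/
def tets (K : Geometry.SimplicialComplex ℝ E3) : Set (Finset E3) :=
  {T | T ∈ K.faces ∧ T.card = 4}

/-- The closed tetrahedron (segment, triangle) with vertex set `T`. -/
def cell (T : Finset E3) : Set E3 := convexHull ℝ (T : Set E3)

/-- `w` are the barycentric coordinates of `x` with respect to the triangulation `K`. -/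
def IsBarycentric (K : Geometry.SimplicialComplex ℝ E3) (x : E3) (w : E3 → ℝ) : Prop :=
  ∃ s ∈ K.faces, (∀ m, 0 ≤ w m) ∧ (∀ m ∉ s, w m = 0) ∧ ∑ m ∈ s, w m = 1 ∧ ∑ m ∈ s, w m • m = x

open Classical in
/-- The piecewise linear nodal basis function `φ_n` of the triangulation `K`. -/
def nodalBasis (K : Geometry.SimplicialComplex ℝ E3) (n x : E3) : ℝ :=
  if h : ∃ w, IsBarycentric K x w then h.choose n else 0

/-- A finite complex of tetrahedra. -/
structure IsTriangulation (K : Geometry.SimplicialComplex ℝ E3) : Prop where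
  finite : K.faces.Finite
  pure : ∀ s ∈ K.faces, ∃ T ∈ tets K, s ⊆ T

/-- A subdivision of a polyhedral domain into tetrahedral macro-elements, together with the
singular edges. Each macro-element contains at most one singular edge. -/
structure MacroPartition where
  K : Geometry.SimplicialComplex ℝ E3
  triangulation : IsTriangulation K
  singEdges : Set (Finset E3)
  singEdges_subset : ∀ e ∈ singEdges, e ∈ K.faces ∧ e.card = 2
  singEdges_unique : ∀ Λ ∈ tets K, ∀ e₁ ∈ singEdges, ∀ e₂ ∈ singEdges,
    e₁ ⊆ Λ → e₂ ⊆ Λ → e₁ = e₂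

/-- The polyhedral domain. -/
def MacroPartition.Ω (P : MacroPartition) : Set E3 := interior P.K.space

/-- `Λ` is a macro-element which contains the singular edge `e`; these are the macro-elements in
which the mesh is anisotropic. -/
def MacroPartition.IsSingular (P : MacroPartition) (Λ e : Finset E3) : Prop :=
  Λ ∈ tets P.K ∧ e ∈ P.singEdges ∧ e ⊆ Λ

/-- Orthogonal projection along the direction of the edge `e`. -/
def projAlong (e : Finset E3) (x : E3) : E3 :=
  (vectorSpan ℝ (e : Set E3))ᗮ.starProjection x

/-- The plane through the point `p` of the edge `e` of `Λ` and the edge of `Λ` opposite to `e`. -/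
def cutPlane (Λ e : Finset E3) (p : E3) : AffineSubspace ℝ E3 :=
  affineSpan ℝ (insert p ((Λ : Set E3) \ (e : Set E3)))

/-- The part of `Λ` between the planes `cutPlane Λ e p` and `cutPlane Λ e q`. -/
def strip (Λ e : Finset E3) (p q : E3) : Set E3 :=
  convexHull ℝ ({p, q} ∪ ((Λ : Set E3) \ (e : Set E3)))

/-- The nodes of a triangulation `K` of the domain which are neither vertices of a macro-element
(coupling nodes) nor on a singular edge. -/
def freeNodes (P : MacroPartition) (K : Geometry.SimplicialComplex ℝ E3) : Set E3 :=
  {n | n ∈ K.vertices ∧ n ∉ P.K.vertices ∧ ∀ e ∈ P.singEdges, n ∉ cell e}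

/-- A triangulation of the domain, graded anisotropically in the macro-elements with a singular
edge, together with the edges `σ_n = [n, sigma n]` that define the quasi-interpolant. -/
structure GradedMesh (P : MacroPartition) where
  K : Geometry.SimplicialComplex ℝ E3
  triangulation : IsTriangulation K
  space_eq : K.space = P.K.space
  /-- The mesh matches the macro-elements. -/
  subordinate : ∀ T ∈ tets K, ∃ Λ ∈ tets P.K, cell T ⊆ cell Λ
  /-- The points where the family of planes of `Λ` meets the singular edge `e`. -/
  cuts : Finset E3 → Finset E3 → Finset E3
  cuts_subset : ∀ Λ e, P.IsSingular Λ e → (cuts Λ e : Set E3) ⊆ cell e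
  /-- The planes contain all nodes. -/
  nodes_on_planes : ∀ Λ e, P.IsSingular Λ e → ∀ n ∈ K.vertices, n ∈ cell Λ →
    ∃ p ∈ cuts Λ e, n ∈ cutPlane Λ e p
  /-- No (open) element intersects a plane. -/
  planes_split : ∀ Λ e, P.IsSingular Λ e → ∀ T ∈ tets K, cell T ⊆ cell Λ → ∀ p ∈ cuts Λ e,
    Disjoint (interior (cell T)) (cutPlane Λ e p : Set E3)
  /-- Each element has an edge parallel to the singular edge. -/
  vertical_edge : ∀ Λ e, P.IsSingular Λ e → ∀ T ∈ tets K, cell T ⊆ cell Λ →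
    ∃ x ∈ T, ∃ y ∈ T, x ≠ y ∧ y - x ∈ vectorSpan ℝ (e : Set E3)
  /-- Along the direction of the singular edge all elements project onto the triangles of one
  planar triangulation: the planes carry the same triangulation. -/
  proj_conforming : ∀ Λ e, P.IsSingular Λ e →
    ∀ T₁ ∈ tets K, ∀ T₂ ∈ tets K, cell T₁ ⊆ cell Λ → cell T₂ ⊆ cell Λ →
      projAlong e '' cell T₁ ∩ projAlong e '' cell T₂ ⊆
        convexHull ℝ (projAlong e '' (T₁ : Set E3) ∩ projAlong e '' (T₂ : Set E3))
  /-- The second endpoint of the edge `σ_n`. -/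
  sigma : E3 → E3
  sigma_edge : ∀ n ∈ freeNodes P K, n ≠ sigma n ∧ ∃ s ∈ K.faces, (s : Set E3) = {n, sigma n}
  /-- `n` and `σ_n` belong to the same macro-elements. -/
  sigma_macro : ∀ n ∈ freeNodes P K, ∀ Λ ∈ tets P.K, n ∈ cell Λ → sigma n ∈ cell Λ
  /-- If `n` is on a boundary face, then `σ_n` is contained in that face. -/
  sigma_boundary : ∀ n ∈ freeNodes P K, ∀ F ∈ P.K.faces, F.card = 3 →
    cell F ⊆ frontier P.Ω → n ∈ cell F → sigma n ∈ cell F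
  /-- In macro-elements with a singular edge, `σ_n` lies in one of the planes. -/
  sigma_plane : ∀ n ∈ freeNodes P K, ∀ Λ e, P.IsSingular Λ e → n ∈ cell Λ →
    ∃ p ∈ cuts Λ e, n ∈ cutPlane Λ e p ∧ sigma n ∈ cutPlane Λ e p
  /-- If `n₁` and `n₂` have the same projection, then so have `σ_{n₁}` and `σ_{n₂}`. -/
  sigma_proj : ∀ n₁ ∈ freeNodes P K, ∀ n₂ ∈ freeNodes P K, ∀ Λ e, P.IsSingular Λ e →
    n₁ ∈ cell Λ → n₂ ∈ cell Λ → projAlong e n₁ = projAlong e n₂ →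
      projAlong e (sigma n₁) = projAlong e (sigma n₂)

/-- The elements of the mesh in macro-elements with a singular edge project, along that edge, onto
triangles with all angles at least `θ`. -/
def GradedMesh.MinAngle {P : MacroPartition} (M : GradedMesh P) (θ : ℝ) : Prop :=
  ∀ Λ e, P.IsSingular Λ e → ∀ T ∈ tets M.K, cell T ⊆ cell Λ → ∀ x ∈ T, ∀ y ∈ T, ∀ z ∈ T,
    projAlong e x ≠ projAlong e y → projAlong e y ≠ projAlong e z →
    projAlong e x ≠ projAlong e z →
      θ ≤ EuclideanGeometry.angle (projAlong e x) (projAlong e y) (projAlong e z)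

theorem GradedMesh.freeNodes_finite {P : MacroPartition} (M : GradedMesh P) :
    (freeNodes P M.K).Finite := by
  have h : (M.K.vertices).Finite := by
    have h1 : M.K.vertices = (fun x : E3 => ({x} : Finset E3)) ⁻¹' M.K.faces := by
      ext x; rfl
    rw [h1]
    exact M.triangulation.finite.preimage (Finset.singleton_injective.injOn)
  exact h.subset fun n hn => hn.1

/-- The quasi-interpolant `D_h v = ∑ₙ (Π_{σ_n} v)(n) φ_n`, the sum being over the nodes which are
neither coupling nodes nor on a singular edge. -/
def GradedMesh.Dh {P : MacroPartition} (M : GradedMesh P) (v : E3 → ℝ) (x : E3) : ℝ :=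
  ∑ n ∈ M.freeNodes_finite.toFinset, edgeProjValue v n (M.sigma n) * nodalBasis M.K n x

/-- `h₁` (`= h₂`) and `h₃` are the lengths of the element `T` in the macro-element `Λ` with singular
edge `e`: `h₃` is the length of the edge `e₃ = [x, y]` parallel to `e`, and `h₁` is the mean of the
lengths of two edges which join `e₃` to the other vertices and lie in planes of the family. -/
def GradedMesh.IsLengths {P : MacroPartition} (M : GradedMesh P) (Λ e T : Finset E3)
    (h₁ h₃ : ℝ) : Prop :=
  ∃ x y z w x' y' : E3, (T : Set E3) = {x, y, z, w} ∧ x ≠ y ∧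
    y - x ∈ vectorSpan ℝ (e : Set E3) ∧ h₃ = dist x y ∧
    (x' = x ∨ x' = y) ∧ (y' = x ∨ y' = y) ∧
    (∃ p ∈ M.cuts Λ e, x' ∈ cutPlane Λ e p ∧ z ∈ cutPlane Λ e p) ∧
    (∃ p ∈ M.cuts Λ e, y' ∈ cutPlane Λ e p ∧ w ∈ cutPlane Λ e p) ∧
    h₁ = (dist x' z + dist y' w) / 2

/-- The open union of the elements in `Q` (the elements with the faces between them). -/
def patchSet (Q : Finset (Finset E3)) : Set E3 := interior (⋃ T ∈ Q, cell T)

/-- The requirements on the patch `S_T`, except for its minimality. -/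
structure GradedMesh.IsAdmissible {P : MacroPartition} (M : GradedMesh P) (Λ e T : Finset E3)
    (Q : Finset (Finset E3)) : Prop where
  subset : ∀ T' ∈ Q, T' ∈ tets M.K
  mem : T ∈ Q
  connected : IsConnected (patchSet Q)
  sigma_subset : ∀ n ∈ T, n ∈ freeNodes P M.K → segment ℝ n (M.sigma n) ⊆ closure (patchSet Q)
  subset_macro : patchSet Q ⊆ cell Λ
  /-- The patch is a prism: top and bottom lie in two planes of the family, and the remaining faces
  are parallel to the singular edge. -/
  prism : ∃ p ∈ M.cuts Λ e, ∃ q ∈ M.cuts Λ e, p ≠ q ∧ ∃ B : Set E3,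
    patchSet Q = interior (strip Λ e p q) ∩ projAlong e ⁻¹' B

/-- `Q` is the set of elements of a patch `S_T`: an admissible patch with as few elements as
possible. -/
def GradedMesh.IsPatch {P : MacroPartition} (M : GradedMesh P) (Λ e T : Finset E3)
    (Q : Finset (Finset E3)) : Prop :=
  M.IsAdmissible Λ e T Q ∧ ∀ Q', M.IsAdmissible Λ e T Q' → Q.card ≤ Q'.card

/-- `v` is the representative of `u` on the patch of `Q` that is continuous up to the interiors of
the edges `σ_n`, `n ∈ T`, and square integrable on these edges; its values on these edges are the
traces of `u`. (The values of `v` in the patch and on the interiors of the `σ_n` are unique.) -/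
def GradedMesh.IsTraceRep {P : MacroPartition} (M : GradedMesh P) (T : Finset E3)
    (Q : Finset (Finset E3)) (u v : E3 → ℝ) : Prop :=
  v =ᵐ[volume.restrict (patchSet Q)] u ∧
  ContinuousOn v (patchSet Q ∪ ⋃ n ∈ T, openSegment ℝ n (M.sigma n)) ∧
  ∀ n ∈ T, MemLp (fun s : ℝ => v (AffineMap.lineMap n (M.sigma n) s)) 2
    (volume.restrict (Set.Icc 0 1))

end

noncomputable section

/-! ### Weak derivatives -/

theorem HasWeakPartial.mono {U V : Set E3} (hU : IsOpen U) (hVU : V ⊆ U) {e : E3}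
    {f g : E3 → ℝ} (h : HasWeakPartial U e f g) : HasWeakPartial V e f g := by
  refine ⟨h.1.mono_set hVU, h.2.1.mono_set hVU, fun η hη hc hs => ?_⟩
  have key := h.2.2 η hη hc (hs.trans hVU)
  rw [setIntegral_eq_of_subset_of_forall_sdiff_eq_zero hU.measurableSet hVU (f := fun x => f x * fderiv ℝ η x e) ?_,
    setIntegral_eq_of_subset_of_forall_sdiff_eq_zero hU.measurableSet hVU (f := fun x => g x * η x) ?_] at key
  · exact key
  · intro x hx
    have : x ∉ tsupport η := fun h => hx.2 (hs h)
    simp [image_eq_zero_of_notMem_tsupport this]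
  · intro x hx
    have : x ∉ tsupport η := fun h => hx.2 (hs h)
    have h2 : fderiv ℝ η x = 0 := by
      have : x ∉ tsupport (fderiv ℝ η) := fun h => this (tsupport_fderiv_subset ℝ h)
      exact image_eq_zero_of_notMem_tsupport this
    simp [h2]

theorem LocallyIntegrableOn.integrableOn_mul_test {U : Set E3} {f η : E3 → ℝ}
    (hf : LocallyIntegrableOn f U) (hU : IsOpen U) (hη : Continuous η) (hc : HasCompactSupport η)
    (hs : tsupport η ⊆ U) : IntegrableOn (fun x => f x * η x) U := by
  have h1 : IntegrableOn f (tsupport η) := hf.integrableOn_compact_subset hs hc.isCompact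
  have h2 : IntegrableOn (fun x => f x * η x) (tsupport η) := by
    have := h1.mul_continuousOn hη.continuousOn hc.isCompact
    exact this
  refine h2.of_forall_sdiff_eq_zero hU.measurableSet fun x hx => ?_
  simp [image_eq_zero_of_notMem_tsupport hx.2]

theorem HasWeakPartial.ae_eq {U : Set E3} (hU : IsOpen U) {e : E3} {f g g' : E3 → ℝ}
    (h : HasWeakPartial U e f g) (h' : HasWeakPartial U e f g') :
    g =ᵐ[volume.restrict U] g' := by
  have hl : LocallyIntegrableOn (fun x => g x - g' x) U := h.2.1.sub h'.2.1
  have := hU.ae_eq_zero_of_integral_contDiff_smul_eq_zero hl (μ := volume) ?_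
  · rw [Filter.EventuallyEq, ae_restrict_iff' hU.measurableSet]
    filter_upwards [this] with x hx hxU
    exact sub_eq_zero.1 (hx hxU)
  · intro η hη hc hs
    have hη' : ContDiff ℝ ∞ η := hη
    have a := h.2.2 η hη' hc hs
    have b := h'.2.2 η hη' hc hs
    have i1 := LocallyIntegrableOn.integrableOn_mul_test h.2.1 hU hη'.continuous hc hs
    have i2 := LocallyIntegrableOn.integrableOn_mul_test h'.2.1 hU hη'.continuous hc hs
    have e1 : ∫ x, η x • (g x - g' x) = ∫ x in U, η x • (g x - g' x) := by
      rw [← setIntegral_univ, setIntegral_eq_of_subset_of_forall_sdiff_eq_zero MeasurableSet.univ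
        (Set.subset_univ U)]
      intro x hx
      have : x ∉ tsupport η := fun h => hx.2 (hs h)
      simp [image_eq_zero_of_notMem_tsupport this]
    rw [e1]
    have e2 : ∀ x, η x • (g x - g' x) = g x * η x - g' x * η x := fun x => by
      simp only [smul_eq_mul]; ring
    simp_rw [e2]
    rw [integral_sub i1 i2]
    linarith

theorem HasWeakPartial.congr_ae {U : Set E3} {e : E3} {f f' g g' : E3 → ℝ} (hU : IsOpen U)
    (h : HasWeakPartial U e f g) (hf : f =ᵐ[volume.restrict U] f')
    (hg : g =ᵐ[volume.restrict U] g') : HasWeakPartial U e f' g' := by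
  have aux : ∀ {a b : E3 → ℝ}, a =ᵐ[volume.restrict U] b → LocallyIntegrableOn a U →
      LocallyIntegrableOn b U := by
    intro a b hab ha
    rw [locallyIntegrableOn_iff hU.isLocallyClosed] at ha ⊢
    intro k hk hkc
    exact (ha k hk hkc).congr_fun_ae (ae_restrict_of_ae_restrict_of_subset hk hab)
  refine ⟨aux hf h.1, aux hg h.2.1, fun η hη hc hs => ?_⟩
  have e1 : ∫ x in U, f' x * fderiv ℝ η x e = ∫ x in U, f x * fderiv ℝ η x e :=
    integral_congr_ae (by filter_upwards [hf] with x hx; rw [hx])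
  have e2 : ∫ x in U, g' x * η x = ∫ x in U, g x * η x :=
    integral_congr_ae (by filter_upwards [hg] with x hx; rw [hx])
  rw [e1, e2]
  exact h.2.2 η hη hc hs

theorem hasWeakPartial_weakPartial {U : Set E3} {e : E3} {f g : E3 → ℝ}
    (h : HasWeakPartial U e f g) : HasWeakPartial U e f (weakPartial U e f) := by
  have h' : ∃ g, HasWeakPartial U e f g := ⟨g, h⟩
  unfold weakPartial
  rw [dif_pos h']
  exact h'.choose_spec

theorem MemH1.hasWeakPartial {U : Set E3} {f : E3 → ℝ} (h : MemH1 U f) (e : E3) :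
    HasWeakPartial U e f (weakPartial U e f) := by
  obtain ⟨g, hg, -⟩ := h.2 e
  exact hasWeakPartial_weakPartial hg

theorem MemH1.memLp_weakPartial {U : Set E3} (hU : IsOpen U) {f : E3 → ℝ} (h : MemH1 U f) (e : E3) :
    MemLp (weakPartial U e f) 2 (volume.restrict U) := by
  obtain ⟨g, hg, hg2⟩ := h.2 e
  exact hg2.ae_eq (hg.ae_eq hU (h.hasWeakPartial e))

theorem contDiff_fderiv_apply_const {η : E3 → ℝ} (hη : ContDiff ℝ ∞ η) (e : E3) :
    ContDiff ℝ ∞ (fun x => fderiv ℝ η x e) :=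
  (hη.fderiv_right (m := ∞) (by simp)).clm_apply contDiff_const

theorem tsupport_fderiv_apply_subset' (η : E3 → ℝ) (e : E3) :
    tsupport (fun x => fderiv ℝ η x e) ⊆ tsupport η := by
  refine (closure_mono ?_).trans (tsupport_fderiv_subset ℝ)
  intro x hx h
  exact hx (by simp [h])

theorem HasWeakPartial.symm_second {U : Set E3} {e e' : E3} {f g g' h : E3 → ℝ}
    (hg : HasWeakPartial U e f g) (hg' : HasWeakPartial U e' f g')
    (hh : HasWeakPartial U e' g h) : HasWeakPartial U e g' h := by
  refine ⟨hg'.2.1, hh.2.1, fun η hη hc hs => ?_⟩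
  have hc1 : ∀ v : E3, HasCompactSupport (fun x => fderiv ℝ η x v) := fun v =>
    hc.of_isClosed_subset (isClosed_tsupport _) (tsupport_fderiv_apply_subset' η v)
  have a1 := hg'.2.2 _ (contDiff_fderiv_apply_const hη e) (hc1 e)
    ((tsupport_fderiv_apply_subset' η e).trans hs)
  have a2 := hg.2.2 _ (contDiff_fderiv_apply_const hη e') (hc1 e')
    ((tsupport_fderiv_apply_subset' η e').trans hs)
  have a3 := hh.2.2 η hη hc hs
  have hsymm : ∀ x, fderiv ℝ (fun x => fderiv ℝ η x e) x e' =
      fderiv ℝ (fun x => fderiv ℝ η x e') x e := by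
    intro x
    have hd : DifferentiableAt ℝ (fderiv ℝ η) x :=
      ((hη.fderiv_right (m := ∞) (by simp)).differentiable (by simp)) x
    have : IsSymmSndFDerivAt ℝ η x := by
      apply hη.contDiffAt.isSymmSndFDerivAt
      simp only [minSmoothness_of_isRCLikeNormedField]
      exact WithTop.coe_le_coe.2 le_top
    rw [fderiv_clm_apply hd (differentiableAt_const _), fderiv_clm_apply hd (differentiableAt_const _)]
    simpa using this.eq e' e
  simp_rw [hsymm] at a1
  linarith

theorem HasWeakPartial.sub {U : Set E3} (hU : IsOpen U) {e : E3} {f g f' g' : E3 → ℝ}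
    (h : HasWeakPartial U e f g) (h' : HasWeakPartial U e f' g') :
    HasWeakPartial U e (fun x => f x - f' x) (fun x => g x - g' x) := by
  refine ⟨h.1.sub h'.1, h.2.1.sub h'.2.1, fun η hη hc hs => ?_⟩
  have hc1 : HasCompactSupport (fun x => fderiv ℝ η x e) :=
    hc.of_isClosed_subset (isClosed_tsupport _) (tsupport_fderiv_apply_subset' η e)
  have hs1 := (tsupport_fderiv_apply_subset' η e).trans hs
  have hcn := (contDiff_fderiv_apply_const hη e).continuous
  simp_rw [sub_mul]
  rw [integral_sub (LocallyIntegrableOn.integrableOn_mul_test h.1 hU hcn hc1 hs1)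
    (LocallyIntegrableOn.integrableOn_mul_test h'.1 hU hcn hc1 hs1),
    integral_sub (LocallyIntegrableOn.integrableOn_mul_test h.2.1 hU hη.continuous hc hs)
    (LocallyIntegrableOn.integrableOn_mul_test h'.2.1 hU hη.continuous hc hs),
    h.2.2 η hη hc hs, h'.2.2 η hη hc hs]
  ring

theorem hasWeakPartial_affine (U : Set E3) (e : E3) (L : E3 →L[ℝ] ℝ) (c : ℝ) :
    HasWeakPartial U e (fun x => L x + c) (fun _ => L e) := by
  have hcont : Continuous fun x => L x + c := by fun_prop
  refine ⟨hcont.locallyIntegrable.locallyIntegrableOn U,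
    continuous_const.locallyIntegrable.locallyIntegrableOn U, fun η hη hc hs => ?_⟩
  have hc1 : HasCompactSupport (fun x => fderiv ℝ η x e) :=
    hc.of_isClosed_subset (isClosed_tsupport _) (tsupport_fderiv_apply_subset' η e)
  have hcn := (contDiff_fderiv_apply_const hη e).continuous
  have aux : ∀ F : E3 → ℝ, (∀ x ∉ tsupport η, F x = 0) → ∫ x in U, F x = ∫ x, F x := by
    intro F hF
    rw [← setIntegral_univ (μ := volume) (f := F),
      setIntegral_eq_of_subset_of_forall_sdiff_eq_zero MeasurableSet.univ (Set.subset_univ U)]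
    intro x hx
    exact hF x fun h => hx.2 (hs h)
  rw [aux, aux]
  · have hfd : ∀ x, fderiv ℝ (fun x => L x + c) x = L := fun x => by
      rw [fderiv_add_const]; exact L.fderiv
    have := integral_mul_fderiv_eq_neg_fderiv_mul_of_integrable (μ := (volume : Measure E3))
      (f := fun x => L x + c) (g := η) (v := e) ?_ ?_ ?_
      (fun x _ => by fun_prop) (fun x _ => hη.differentiable (by simp) x)
    · simpa [hfd] using this
    · simp only [hfd]
      exact (continuous_const.mul hη.continuous).integrable_of_hasCompactSupport hc.mul_left
    · exact (hcont.mul hcn).integrable_of_hasCompactSupport hc1.mul_left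
    · exact (hcont.mul hη.continuous).integrable_of_hasCompactSupport hc.mul_left
  · intro x hx; simp [image_eq_zero_of_notMem_tsupport hx]
  · intro x hx
    have := image_eq_zero_of_notMem_tsupport (f := fun x => fderiv ℝ η x e)
      (fun h => hx (tsupport_fderiv_apply_subset' η e h))
    simp [this]

/-! ### Mollification -/

/-- A sequence of smooth bump functions with supports shrinking to the origin. -/
def bumpSeq (j : ℕ) : ContDiffBump (0 : E3) where
  rIn := 1 / (2 * (j + 1))
  rOut := 1 / (j + 1)
  rIn_pos := by positivity
  rIn_lt_rOut := by
    apply one_div_lt_one_div_of_lt <;> [positivity; nlinarith [(Nat.cast_nonneg j : (0:ℝ) ≤ j)]]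

theorem tendsto_bumpSeq_rOut : Filter.Tendsto (fun j => (bumpSeq j).rOut) Filter.atTop (nhds 0) :=
  tendsto_one_div_add_atTop_nhds_zero_nat

/-- The mollification of `f` on `U`. -/
def moll (U : Set E3) (f : E3 → ℝ) (j : ℕ) : E3 → ℝ :=
  convolution ((bumpSeq j).normed volume) (U.indicator f) (ContinuousLinearMap.lsmul ℝ ℝ) volume

theorem memLp_indicator_univ {U : Set E3} (hU : IsOpen U) {f : E3 → ℝ}
    (hf : MemLp f 2 (volume.restrict U)) : MemLp (U.indicator f) 2 volume :=
  (memLp_indicator_iff_restrict hU.measurableSet).2 hf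

theorem locallyIntegrable_indicator {U : Set E3} (hU : IsOpen U) {f : E3 → ℝ}
    (hf : MemLp f 2 (volume.restrict U)) : LocallyIntegrable (U.indicator f) volume :=
  (memLp_indicator_univ hU hf).locallyIntegrable (by norm_num)

theorem contDiff_moll {U : Set E3} (hU : IsOpen U) {f : E3 → ℝ}
    (hf : MemLp f 2 (volume.restrict U)) (j : ℕ) : ContDiff ℝ ∞ (moll U f j) :=
  (bumpSeq j).hasCompactSupport_normed.contDiff_convolution_left _ (bumpSeq j).contDiff_normed
    (locallyIntegrable_indicator hU hf)

theorem moll_apply (U : Set E3) (f : E3 → ℝ) (j : ℕ) (x : E3) (hU : IsOpen U) :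
    moll U f j x = ∫ y in U, f y * (bumpSeq j).normed volume (x - y) := by
  unfold moll
  rw [convolution_eq_swap, ← integral_indicator hU.measurableSet]
  congr 1
  ext y
  by_cases hy : y ∈ U <;> simp [hy, mul_comm]

theorem fderiv_moll {U : Set E3} (hU : IsOpen U) {e : E3} {f g : E3 → ℝ}
    (hf : MemLp f 2 (volume.restrict U)) (h : HasWeakPartial U e f g) {j : ℕ} {x : E3}
    (hx : Metric.closedBall x (bumpSeq j).rOut ⊆ U) :
    fderiv ℝ (moll U f j) x e = moll U g j x := by
  set φ := (bumpSeq j).normed (volume : Measure E3) with hφ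
  have hφs : ContDiff ℝ ∞ φ := (bumpSeq j).contDiff_normed
  have hφc : HasCompactSupport φ := (bumpSeq j).hasCompactSupport_normed
  have hloc := locallyIntegrable_indicator hU hf
  have hd := hφc.hasFDerivAt_convolution_left (ContinuousLinearMap.lsmul ℝ ℝ)
    (hφs.of_le (by simp)) hloc x
  have hd' : fderiv ℝ (moll U f j) x = _ := hd.fderiv
  rw [hd']
  have hex : ConvolutionExistsAt (fderiv ℝ φ) (U.indicator f) x
      ((ContinuousLinearMap.lsmul ℝ ℝ).precompL E3) volume :=
    (hφc.fderiv ℝ).convolutionExists_left _ (hφs.continuous_fderiv (by simp)) hloc x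
  unfold convolution
  rw [ContinuousLinearMap.integral_apply hex]
  rw [← integral_sub_left_eq_self _ _ x, moll_apply U g j x hU]
  have hη : ContDiff ℝ ∞ (fun y => φ (x - y)) := hφs.comp (contDiff_const.sub contDiff_id)
  have hts : tsupport (fun y => φ (x - y)) ⊆ Metric.closedBall x (bumpSeq j).rOut := by
    refine closure_minimal ?_ Metric.isClosed_closedBall
    intro y hy
    have h1 : x - y ∈ Function.support φ := hy
    rw [hφ, (bumpSeq j).support_normed_eq] at h1
    rw [Metric.mem_closedBall, dist_comm, dist_eq_norm]
    simpa using (mem_ball_zero_iff.1 h1).le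
  have hcs : HasCompactSupport (fun y => φ (x - y)) :=
    (isCompact_closedBall _ _).of_isClosed_subset (isClosed_tsupport _) hts
  have key := h.2.2 _ hη hcs (hts.trans hx)
  have hfd : ∀ y, fderiv ℝ (fun y => φ (x - y)) y e = -(fderiv ℝ φ (x - y) e) := by
    intro y
    have := ((hφs.differentiable (by simp)) (x - y)).hasFDerivAt.comp y
      ((hasFDerivAt_id y).const_sub x)
    have h2 : fderiv ℝ (fun y => φ (x - y)) y = _ := this.fderiv
    rw [h2]; simp
  simp_rw [hfd] at key
  rw [← neg_inj, ← key, ← integral_indicator hU.measurableSet, ← integral_neg]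
  congr 1
  ext y
  by_cases hy : y ∈ U <;> simp [hy, ContinuousLinearMap.precompL_apply, mul_comm]

theorem ae_tendsto_moll {U : Set E3} (hU : IsOpen U) {f : E3 → ℝ}
    (hf : MemLp f 2 (volume.restrict U)) :
    ∀ᵐ x ∂(volume.restrict U), Filter.Tendsto (fun j => moll U f j x) Filter.atTop (nhds (f x)) := by
  rw [ae_restrict_iff' hU.measurableSet]
  have := ContDiffBump.ae_convolution_tendsto_right_of_locallyIntegrable (μ := (volume : Measure E3))
    (φ := bumpSeq) (K := 2) tendsto_bumpSeq_rOut (Filter.Eventually.of_forall fun j => by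
      show (1 : ℝ) / (j + 1) ≤ 2 * (1 / (2 * (j + 1)))
      field_simp; rfl) (locallyIntegrable_indicator hU hf)
  filter_upwards [this] with x hx hxU
  simpa [hxU, moll] using hx

theorem tendsto_moll_of_continuousAt {U : Set E3} (hU : IsOpen U) {f : E3 → ℝ}
    (hf : MemLp f 2 (volume.restrict U)) {x : E3} (hx : x ∈ U) (hc : ContinuousAt f x) :
    Filter.Tendsto (fun j => moll U f j x) Filter.atTop (nhds (f x)) := by
  refine ContDiffBump.convolution_tendsto_right (φ := bumpSeq) (g := fun _ => U.indicator f)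
    (k := fun _ => x) tendsto_bumpSeq_rOut
    (Filter.Eventually.of_forall fun _ => (memLp_indicator_univ hU hf).1) ?_ tendsto_const_nhds
  have : ContinuousAt (U.indicator f) x :=
    hc.congr (Filter.mem_of_superset (hU.mem_nhds hx) fun y hy => by simp [Set.indicator_of_mem hy])
  have h2 : Filter.Tendsto (U.indicator f) (nhds x) (nhds (f x)) := by
    simpa [Set.indicator_of_mem hx] using this.tendsto
  exact h2.comp Filter.tendsto_snd

theorem lintegral_moll_sq_le {U : Set E3} (hU : IsOpen U) {f : E3 → ℝ}
    (hf : MemLp f 2 (volume.restrict U)) (j : ℕ) :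
    ∫⁻ x, ‖moll U f j x‖ₑ ^ 2 ≤ ∫⁻ x in U, ‖f x‖ₑ ^ 2 := by
  set φ := (bumpSeq j).normed (volume : Measure E3) with hφ
  have hφcont : Continuous φ := (bumpSeq j).contDiff_normed (n := 0) |>.continuous
  have hφ1 : ∀ x, ∫⁻ y, ‖φ (x - y)‖ₑ = 1 := by
    intro x
    rw [lintegral_sub_left_eq_self (fun y => ‖φ y‖ₑ) x, ← ofReal_integral_norm_eq_lintegral_enorm
      (bumpSeq j).integrable_normed]
    have : ∀ y, ‖(bumpSeq j).normed (volume : Measure E3) y‖ = (bumpSeq j).normed volume y :=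
      fun y => by rw [Real.norm_eq_abs, abs_of_nonneg ((bumpSeq j).nonneg_normed y)]
    rw [integral_congr_ae (Filter.Eventually.of_forall this), (bumpSeq j).integral_normed]; simp
  set F := U.indicator f with hF
  have hFm : AEMeasurable F volume := (memLp_indicator_univ hU hf).1.aemeasurable
  have hpt : ∀ x, ‖moll U f j x‖ₑ ^ 2 ≤ ∫⁻ y, ‖φ (x - y)‖ₑ * ‖F y‖ₑ ^ 2 := by
    intro x
    have h0 : ‖moll U f j x‖ₑ ≤ ∫⁻ y, ‖φ (x - y)‖ₑ * ‖F y‖ₑ := by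
      unfold moll
      rw [convolution_eq_swap]
      refine (enorm_integral_le_lintegral_enorm _).trans (le_of_eq ?_)
      congr 1; ext y
      simp [enorm_mul, hF, hφ]
    have hm1 : AEMeasurable (fun y => ‖φ (x - y)‖ₑ) volume :=
      (hφcont.comp (continuous_const.sub continuous_id)).enorm.aemeasurable
    have h1 := ENNReal.lintegral_mul_le_Lp_mul_Lq volume Real.HolderConjugate.two_two
      (f := fun y => ‖φ (x - y)‖ₑ ^ (1/2:ℝ)) (g := fun y => ‖φ (x - y)‖ₑ ^ (1/2:ℝ) * ‖F y‖ₑ)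
      (hm1.pow_const _) ((hm1.pow_const _).mul hFm.enorm)
    have h2 : ∀ y, ((fun y => ‖φ (x - y)‖ₑ ^ (1/2:ℝ)) * (fun y => ‖φ (x - y)‖ₑ ^ (1/2:ℝ) * ‖F y‖ₑ)) y
        = ‖φ (x - y)‖ₑ * ‖F y‖ₑ := by
      intro y
      simp only [Pi.mul_apply]
      rw [← mul_assoc, ← ENNReal.rpow_add_of_nonneg _ _ (by norm_num) (by norm_num)]
      norm_num
    have h3 : ∀ y, (‖φ (x - y)‖ₑ ^ (1/2:ℝ)) ^ (2:ℝ) = ‖φ (x - y)‖ₑ := by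
      intro y; rw [← ENNReal.rpow_mul]; norm_num
    have h4 : ∀ y, (‖φ (x - y)‖ₑ ^ (1/2:ℝ) * ‖F y‖ₑ) ^ (2:ℝ) = ‖φ (x - y)‖ₑ * ‖F y‖ₑ ^ 2 := by
      intro y
      rw [ENNReal.mul_rpow_of_nonneg _ _ (by norm_num), h3]
      norm_num
    simp_rw [h2, h3, h4, hφ1] at h1
    calc ‖moll U f j x‖ₑ ^ 2 ≤ (∫⁻ y, ‖φ (x - y)‖ₑ * ‖F y‖ₑ) ^ 2 := by gcongr
      _ ≤ (1 ^ (1 / (2:ℝ)) * (∫⁻ y, ‖φ (x - y)‖ₑ * ‖F y‖ₑ ^ 2) ^ (1 / (2:ℝ))) ^ 2 := by gcongr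
      _ = _ := by
        rw [ENNReal.one_rpow, one_mul, ← ENNReal.rpow_natCast, ← ENNReal.rpow_mul]
        norm_num
  calc ∫⁻ x, ‖moll U f j x‖ₑ ^ 2 ≤ ∫⁻ x, ∫⁻ y, ‖φ (x - y)‖ₑ * ‖F y‖ₑ ^ 2 :=
        lintegral_mono hpt
    _ = ∫⁻ y, ∫⁻ x, ‖φ (x - y)‖ₑ * ‖F y‖ₑ ^ 2 := by
        refine lintegral_lintegral_swap ?_
        have a1 : AEMeasurable (fun p : E3 × E3 => ‖φ (p.1 - p.2)‖ₑ) (volume.prod volume) :=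
          (hφcont.comp (continuous_fst.sub continuous_snd)).enorm.aemeasurable
        have a2 : AEMeasurable (fun p : E3 × E3 => ‖F p.2‖ₑ ^ 2) (volume.prod volume) :=
          (hFm.comp_snd (μ := volume)).enorm.pow_const 2
        exact a1.mul a2
    _ = ∫⁻ y, ‖F y‖ₑ ^ 2 := by
        congr 1; ext y
        have hm : AEMeasurable (fun x => ‖φ (x - y)‖ₑ) volume :=
          (hφcont.comp (continuous_id.sub continuous_const)).enorm.aemeasurable
        rw [lintegral_mul_const'' _ hm,
          lintegral_sub_right_eq_self (fun x => ‖φ x‖ₑ) y]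
        have := hφ1 0
        rw [lintegral_sub_left_eq_self (fun y => ‖φ y‖ₑ) 0] at this
        rw [this, one_mul]
    _ = ∫⁻ y in U, ‖f y‖ₑ ^ 2 := by
        rw [← lintegral_indicator hU.measurableSet]
        congr 1; ext y
        by_cases hy : y ∈ U <;> simp [hF, hy]

end

noncomputable section

/-! ### Integral inequalities for smooth functions on convex sets -/

section Homothety

variable {X : Type*} [NormedAddCommGroup X] [NormedSpace ℝ X] [FiniteDimensional ℝ X]
  [MeasurableSpace X] [BorelSpace X] {μ : Measure X} [μ.IsAddHaarMeasure]

theorem lintegral_homothety_le (h3 : Module.finrank ℝ X = 3) {K : Set X} (hK : MeasurableSet K)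
    {a : X} {r : ℝ} (hr : 0 < r) (hst : ∀ k ∈ K, a + r • (k - a) ∈ K) (G : X → ENNReal) :
    ∫⁻ k in K, G (a + r • (k - a)) ∂μ ≤ ENNReal.ofReal (r ^ 3)⁻¹ * ∫⁻ k in K, G k ∂μ := by
  have e : X ≃ₜ X := (Homeomorph.smulOfNeZero r hr.ne').trans (Homeomorph.addRight (a - r • a))
  have h1 : ∫⁻ k in K, G (a + r • (k - a)) ∂μ ≤ ∫⁻ k, (K.indicator G) (r • k + (a - r • a)) ∂μ := by
    rw [← lintegral_indicator hK]
    refine lintegral_mono fun k => ?_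
    have ek : a + r • (k - a) = r • k + (a - r • a) := by rw [smul_sub]; abel
    by_cases hk : k ∈ K
    · have := hst k hk
      rw [ek] at this
      simp [hk, this, ek]
    · simp [hk]
  refine h1.trans (le_of_eq ?_)
  have h2 : ∫⁻ k, (K.indicator G) (r • k + (a - r • a)) ∂μ =
      ∫⁻ k, (fun y => (K.indicator G) (y + (a - r • a))) k ∂(Measure.map (fun x => r • x) μ) := by
    have hm : MeasurableEmbedding (fun x : X => r • x) :=
      (Homeomorph.smulOfNeZero r hr.ne').measurableEmbedding
    rw [hm.lintegral_map]
  rw [h2, Measure.map_addHaar_smul μ hr.ne', lintegral_smul_measure,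
    lintegral_add_right_eq_self, lintegral_indicator hK, h3, abs_of_pos (by positivity)]
  rfl

theorem lintegral_le_sqrt_mul_eLpNorm {α : Type*} [MeasurableSpace α] {ν : Measure α} {F : α → ℝ}
    (hF : AEStronglyMeasurable F ν) :
    ∫⁻ k, ‖F k‖ₑ ∂ν ≤ ν Set.univ ^ (1 / 2 : ℝ) * eLpNorm F 2 ν := by
  have := ENNReal.lintegral_mul_le_Lp_mul_Lq ν Real.HolderConjugate.two_two
      (f := fun _ => 1) (g := fun y => ‖F y‖ₑ) aemeasurable_const hF.enorm
  simp only [ENNReal.one_rpow, lintegral_const, one_mul] at this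
  rw [eLpNorm_eq_lintegral_rpow_enorm_toReal (by norm_num) (by norm_num)]
  simpa using this

theorem eLpNorm_two_sq {α : Type*} [MeasurableSpace α] {ν : Measure α} (F : α → ℝ) :
    eLpNorm F 2 ν ^ 2 = ∫⁻ k, ‖F k‖ₑ ^ 2 ∂ν := by
  rw [eLpNorm_eq_lintegral_rpow_enorm_toReal (by norm_num) (by norm_num), ← ENNReal.rpow_natCast,
    ← ENNReal.rpow_mul]
  norm_num

theorem eLpNorm_two_eq {α : Type*} [MeasurableSpace α] {ν : Measure α} (F : α → ℝ) :
    eLpNorm F 2 ν = (∫⁻ k, ‖F k‖ₑ ^ 2 ∂ν) ^ (1 / 2 : ℝ) := by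
  rw [eLpNorm_eq_lintegral_rpow_enorm_toReal (by norm_num) (by norm_num)]
  norm_num

theorem lintegral_homothety_le_eLpNorm (h3 : Module.finrank ℝ X = 3) {K : Set X}
    (hK : MeasurableSet K) {a : X} {r : ℝ} (hr : 0 < r) (hst : ∀ k ∈ K, a + r • (k - a) ∈ K)
    {F : X → ℝ} (hF : Continuous F) :
    ∫⁻ k in K, ‖F (a + r • (k - a))‖ₑ ∂μ ≤
      ENNReal.ofReal (r ^ (-(3 / 2) : ℝ)) * (μ K ^ (1 / 2 : ℝ) * eLpNorm F 2 (μ.restrict K)) := by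
  have hc : Continuous fun k => F (a + r • (k - a)) := by fun_prop
  refine (lintegral_le_sqrt_mul_eLpNorm hc.aestronglyMeasurable).trans ?_
  rw [Measure.restrict_apply_univ, mul_left_comm]
  gcongr
  rw [eLpNorm_two_eq, eLpNorm_two_eq]
  have := lintegral_homothety_le (μ := μ) h3 hK hr hst (fun x => ‖F x‖ₑ ^ 2)
  refine (ENNReal.rpow_le_rpow this (by norm_num)).trans (le_of_eq ?_)
  rw [ENNReal.mul_rpow_of_nonneg _ _ (by norm_num), ENNReal.ofReal_rpow_of_pos (by positivity)]
  congr 2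
  rw [← Real.rpow_natCast, ← Real.rpow_neg hr.le, ← Real.rpow_mul hr.le]
  norm_num

theorem lintegral_rpow_Ioc : ∫⁻ r in Set.Ioc (0 : ℝ) 1, ENNReal.ofReal (r ^ (-(3 / 4) : ℝ)) = 4 := by
  have hi : IntervalIntegrable (fun r : ℝ => r ^ (-(3 / 4) : ℝ)) volume 0 1 :=
    intervalIntegral.intervalIntegrable_rpow' (by norm_num)
  rw [← ofReal_integral_eq_lintegral_ofReal
    ((intervalIntegrable_iff_integrableOn_Ioc_of_le zero_le_one).1 hi),
    ← intervalIntegral.integral_of_le zero_le_one, integral_rpow (Or.inl (by norm_num))]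
  · norm_num
  · rw [Filter.EventuallyLE, ae_restrict_iff' measurableSet_Ioc]
    exact Filter.Eventually.of_forall fun r hr => Real.rpow_nonneg hr.1.le _

theorem lintegral_lintegral_homothety_le (h3 : Module.finrank ℝ X = 3) {K : Set X}
    (hK : MeasurableSet K) {a : X}
    (hst : ∀ k ∈ K, ∀ r : ℝ, 0 < r → r ≤ 1 → a + r • (k - a) ∈ K)
    {F : X → ℝ} (hF : Continuous F) {w : ℝ → ℝ} (hw : Continuous w) {A : ℝ} (hA : 0 ≤ A)
    (hwA : ∀ r, 0 < r → r ≤ 1 → w r ≤ A * r ^ (3 / 4 : ℝ)) :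
    ∫⁻ k in K, (∫⁻ r in Set.Ioc (0 : ℝ) 1, ENNReal.ofReal (w r) * ‖F (a + r • (k - a))‖ₑ) ∂μ ≤
      ENNReal.ofReal (4 * A) * (μ K ^ (1 / 2 : ℝ) * eLpNorm F 2 (μ.restrict K)) := by
  rw [lintegral_lintegral_swap]
  · calc ∫⁻ r in Set.Ioc (0 : ℝ) 1, ∫⁻ k in K, ENNReal.ofReal (w r) * ‖F (a + r • (k - a))‖ₑ ∂μ
        ≤ ∫⁻ r in Set.Ioc (0 : ℝ) 1, (ENNReal.ofReal A * (μ K ^ (1 / 2 : ℝ) *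
            eLpNorm F 2 (μ.restrict K))) * ENNReal.ofReal (r ^ (-(3 / 4) : ℝ)) := by
          refine setLIntegral_mono' measurableSet_Ioc fun r hr => ?_
          have hFr : Continuous fun k => F (a + r • (k - a)) := by fun_prop
          rw [lintegral_const_mul _ hFr.enorm.measurable]
          refine (mul_le_mul_right (lintegral_homothety_le_eLpNorm h3 hK hr.1
            (fun k hk => hst k hk r hr.1 hr.2) hF) _).trans ?_
          rw [← mul_assoc, ← ENNReal.ofReal_mul' (Real.rpow_nonneg hr.1.le _), mul_right_comm,
            ← ENNReal.ofReal_mul hA]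
          refine mul_le_mul_left (ENNReal.ofReal_le_ofReal ?_) _
          calc w r * r ^ (-(3 / 2) : ℝ) ≤ A * r ^ (3 / 4 : ℝ) * r ^ (-(3 / 2) : ℝ) := by
                gcongr
                exacts [Real.rpow_nonneg hr.1.le _, hwA r hr.1 hr.2]
            _ = A * r ^ (-(3 / 4) : ℝ) := by
                rw [mul_assoc, ← Real.rpow_add hr.1]; norm_num
      _ = _ := by
          rw [lintegral_const_mul _ (by fun_prop), lintegral_rpow_Ioc, mul_comm, ← mul_assoc,
            ENNReal.ofReal_mul (p := 4) (by norm_num)]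
          norm_num
  · have h1 : Continuous fun p : X × ℝ => F (a + p.2 • (p.1 - a)) := by fun_prop
    have h2 : Continuous fun p : X × ℝ => w p.2 := by fun_prop
    exact (h2.measurable.ennreal_ofReal.mul h1.enorm.measurable).aemeasurable

/-! #### One-dimensional identities -/

theorem taylor_min {φ : ℝ → ℝ} (hφ : ContDiff ℝ 2 φ) {s : ℝ} (hs0 : 0 < s) (hs1 : s ≤ 1) :
    φ 0 = φ s - s * deriv φ 1 + ∫ r in (0 : ℝ)..1, min r s * deriv (deriv φ) r := by
  have hd1 : ContDiff ℝ 1 (deriv φ) := ((contDiff_succ_iff_deriv (n := 1)).1 hφ).2.2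
  have hd : Differentiable ℝ φ := hφ.differentiable (by norm_num)
  have hdd : Differentiable ℝ (deriv φ) := hd1.differentiable (by norm_num)
  have hc2 : Continuous (deriv (deriv φ)) := hd1.continuous_deriv le_rfl
  have hci : ∀ a b, IntervalIntegrable (fun r => min r s * deriv (deriv φ) r) volume a b :=
    fun a b => Continuous.intervalIntegrable (by fun_prop) _ _
  rw [← intervalIntegral.integral_add_adjacent_intervals (hci 0 s) (hci s 1)]
  have e1 : ∫ r in (0 : ℝ)..s, min r s * deriv (deriv φ) r = ∫ r in (0 : ℝ)..s, r * deriv (deriv φ) r := by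
    refine intervalIntegral.integral_congr fun r hr => ?_
    rw [Set.uIcc_of_le hs0.le] at hr
    simp [min_eq_left hr.2]
  have e2 : ∫ r in s..1, min r s * deriv (deriv φ) r = ∫ r in s..1, s * deriv (deriv φ) r := by
    refine intervalIntegral.integral_congr fun r hr => ?_
    rw [Set.uIcc_of_le hs1] at hr
    simp [min_eq_right hr.1]
  rw [e1, e2, intervalIntegral.integral_const_mul,
    intervalIntegral.integral_deriv_eq_sub (fun x _ => hdd x) (hc2.intervalIntegrable _ _),
    intervalIntegral.integral_mul_deriv_eq_deriv_mul (u := fun r => r) (u' := fun _ => 1)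
      (v := deriv φ) (fun x _ => hasDerivAt_id x) (fun x _ => (hdd x).hasDerivAt)
      (Continuous.intervalIntegrable (by fun_prop) _ _) (hc2.intervalIntegrable _ _)]
  simp only [one_mul, zero_mul, sub_zero]
  rw [intervalIntegral.integral_deriv_eq_sub (fun x _ => hd x)
    (hd1.continuous.intervalIntegrable _ _)]
  ring

theorem enorm_intervalIntegral_le {f : ℝ → ℝ} :
    ‖∫ r in (0 : ℝ)..1, f r‖ₑ ≤ ∫⁻ r in Set.Ioc (0 : ℝ) 1, ‖f r‖ₑ := by
  rw [intervalIntegral.integral_of_le zero_le_one]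
  exact enorm_integral_le_lintegral_enorm _

variable {Y : Type*} [NormedAddCommGroup Y] [NormedSpace ℝ Y]

theorem deriv_comp_line {v : Y → ℝ} (hv : Differentiable ℝ v) (x d : Y) (r : ℝ) :
    HasDerivAt (fun r : ℝ => v (x + r • d)) (fderiv ℝ v (x + r • d) d) r := by
  have h1 : HasDerivAt (fun r : ℝ => x + r • d) d r := by
    simpa using ((hasDerivAt_id r).smul_const d).const_add x
  exact (hv _).hasFDerivAt.comp_hasDerivAt r h1

theorem deriv_fderiv_line {v : Y → ℝ} (hv : ContDiff ℝ 2 v) (x d e : Y) (r : ℝ) :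
    HasDerivAt (fun r : ℝ => fderiv ℝ v (x + r • d) e) (fderiv ℝ (fderiv ℝ v) (x + r • d) d e) r := by
  have h1 : HasDerivAt (fun r : ℝ => x + r • d) d r := by
    simpa using ((hasDerivAt_id r).smul_const d).const_add x
  have h2 : Differentiable ℝ (fderiv ℝ v) :=
    (hv.fderiv_right (m := 1) (by norm_num)).differentiable (by norm_num)
  have := (h2 (x + r • d)).hasFDerivAt.comp_hasDerivAt r h1
  simpa using this.clm_apply (hasDerivAt_const r e)

theorem enorm_sub_le_of_taylor {v : Y → ℝ} (hv : ContDiff ℝ 2 v) {a k : Y} {s : ℝ} (hs0 : 0 < s)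
    (hs1 : s ≤ 1) {D1 D2 : Y → ℝ} (h1 : |fderiv ℝ v k (k - a)| ≤ D1 k)
    (h2 : ∀ r : ℝ, 0 < r → r ≤ 1 → |fderiv ℝ (fderiv ℝ v) (a + r • (k - a)) (k - a) (k - a)| ≤
      D2 (a + r • (k - a))) :
    ‖v a - v (a + s • (k - a))‖ₑ ≤ ENNReal.ofReal s * ‖D1 k‖ₑ +
      ∫⁻ r in Set.Ioc (0 : ℝ) 1, ENNReal.ofReal (min r s) * ‖D2 (a + r • (k - a))‖ₑ := by
  set φ : ℝ → ℝ := fun r => v (a + r • (k - a)) with hφ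
  have hφc : ContDiff ℝ 2 φ := hv.comp (contDiff_const.add (contDiff_id.smul contDiff_const))
  have hd : deriv φ = fun r => fderiv ℝ v (a + r • (k - a)) (k - a) :=
    funext fun r => (deriv_comp_line (hv.differentiable (by norm_num)) a (k - a) r).deriv
  have hdd : deriv (deriv φ) = fun r => fderiv ℝ (fderiv ℝ v) (a + r • (k - a)) (k - a) (k - a) := by
    rw [hd]
    exact funext fun r => (deriv_fderiv_line hv a (k - a) (k - a) r).deriv
  have key := taylor_min hφc hs0 hs1
  have e0 : φ 0 = v a := by simp [hφ]
  have e1 : deriv φ 1 = fderiv ℝ v k (k - a) := by rw [hd]; simp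
  rw [e0, e1] at key
  have : v a - v (a + s • (k - a)) = -(s * fderiv ℝ v k (k - a)) +
      ∫ r in (0 : ℝ)..1, min r s * deriv (deriv φ) r := by
    rw [key]; simp only [hφ]; ring
  rw [this]
  refine (enorm_add_le _ _).trans (add_le_add ?_ (enorm_intervalIntegral_le.trans ?_))
  · rw [enorm_neg, enorm_mul, Real.enorm_of_nonneg hs0.le]
    gcongr
    exact enorm_le_iff_norm_le.2 (by simpa using h1.trans (le_abs_self _))
  · refine setLIntegral_mono' measurableSet_Ioc fun r hr => ?_
    rw [enorm_mul, Real.enorm_of_nonneg (le_min hr.1.le hs0.le), hdd]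
    gcongr
    exact enorm_le_iff_norm_le.2 (by simpa using (h2 r hr.1 hr.2).trans (le_abs_self _))

theorem min_le_rpow {r s : ℝ} (hr : 0 < r) (hs : 0 < s) :
    min r s ≤ s ^ (1 / 4 : ℝ) * r ^ (3 / 4 : ℝ) := by
  have hm : 0 < min r s := lt_min hr hs
  calc min r s = min r s ^ (1 / 4 : ℝ) * min r s ^ (3 / 4 : ℝ) := by
        rw [← Real.rpow_add hm]; norm_num
    _ ≤ s ^ (1 / 4 : ℝ) * r ^ (3 / 4 : ℝ) := by
        gcongr
        exacts [min_le_right _ _, min_le_left _ _]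

theorem Convex.star_mem {K : Set Y} (hK : Convex ℝ K) {a k : Y} (ha : a ∈ K) (hk : k ∈ K) {r : ℝ}
    (h0 : 0 ≤ r) (h1 : r ≤ 1) : a + r • (k - a) ∈ K := by
  have := hK.lineMap_mem ha hk ⟨h0, h1⟩
  rwa [AffineMap.lineMap_apply, vsub_eq_sub, vadd_eq_add, add_comm] at this

theorem lintegral_enorm_sub_homothety_le (h3 : Module.finrank ℝ X = 3) {K : Set X} (hKo : IsOpen K)
    (hK : Convex ℝ K) {v : X → ℝ} (hv : ContDiff ℝ 2 v) {a : X} (ha : a ∈ K) {s : ℝ} (hs0 : 0 < s)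
    (hs1 : s ≤ 1) {D1 D2 : X → ℝ} (hD1 : Continuous D1) (hD2 : Continuous D2)
    (h1 : ∀ x ∈ K, ∀ y ∈ K, ∀ z ∈ K, |fderiv ℝ v x (y - z)| ≤ D1 x)
    (h2 : ∀ x ∈ K, ∀ y ∈ K, ∀ z ∈ K, |fderiv ℝ (fderiv ℝ v) x (y - z) (y - z)| ≤ D2 x) :
    ∫⁻ k in K, ‖v a - v (a + s • (k - a))‖ₑ ∂μ ≤ μ K ^ (1 / 2 : ℝ) *
      (ENNReal.ofReal s * eLpNorm D1 2 (μ.restrict K) +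
        ENNReal.ofReal (4 * s ^ (1 / 4 : ℝ)) * eLpNorm D2 2 (μ.restrict K)) := by
  calc ∫⁻ k in K, ‖v a - v (a + s • (k - a))‖ₑ ∂μ
      ≤ ∫⁻ k in K, (ENNReal.ofReal s * ‖D1 k‖ₑ +
        ∫⁻ r in Set.Ioc (0 : ℝ) 1, ENNReal.ofReal (min r s) * ‖D2 (a + r • (k - a))‖ₑ) ∂μ := by
        refine setLIntegral_mono' hKo.measurableSet fun k hk => ?_
        exact enorm_sub_le_of_taylor hv hs0 hs1 (h1 k hk k hk a ha)
          fun r hr0 hr1 => h2 _ (hK.star_mem ha hk hr0.le hr1) k hk a ha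
    _ = ENNReal.ofReal s * (∫⁻ k in K, ‖D1 k‖ₑ ∂μ) + ∫⁻ k in K,
        (∫⁻ r in Set.Ioc (0 : ℝ) 1, ENNReal.ofReal (min r s) * ‖D2 (a + r • (k - a))‖ₑ) ∂μ := by
        rw [lintegral_add_left (by fun_prop), lintegral_const_mul _ (by fun_prop)]
    _ ≤ _ := by
        rw [mul_add]
        refine add_le_add ?_ ?_
        · rw [mul_left_comm]
          gcongr
          have := lintegral_le_sqrt_mul_eLpNorm (ν := μ.restrict K) (F := D1) hD1.aestronglyMeasurable
          rwa [Measure.restrict_apply_univ] at this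
        · rw [mul_left_comm]
          exact lintegral_lintegral_homothety_le h3 hKo.measurableSet
            (fun k hk r hr0 hr1 => hK.star_mem ha hk hr0.le hr1) hD2 (by fun_prop)
            (by positivity) fun r hr0 _ => min_le_rpow hr0 hs0

theorem mul_le_of_le_sqrt_mul {m x y : ENNReal} (hm0 : m ≠ 0) (hm : m ≠ ⊤)
    (h : m * x ≤ m ^ (1 / 2 : ℝ) * y) : m ^ (1 / 2 : ℝ) * x ≤ y := by
  have e : m = m ^ (1 / 2 : ℝ) * m ^ (1 / 2 : ℝ) := by
    rw [← ENNReal.rpow_add_of_nonneg _ _ (by norm_num) (by norm_num)]; norm_num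
  rw [show m * x = m ^ (1 / 2 : ℝ) * (m ^ (1 / 2 : ℝ) * x) by rw [← mul_assoc, ← e]] at h
  exact (ENNReal.mul_le_mul_iff_right (by simp [hm0, hm]) (by simp [hm0, hm])).1 h

theorem enorm_sub_le_smooth (h3 : Module.finrank ℝ X = 3) {K : Set X} (hKo : IsOpen K)
    (hK : Convex ℝ K) (hfin : μ K ≠ ⊤) {v : X → ℝ} (hv : ContDiff ℝ 2 v) {a b : X} (ha : a ∈ K)
    (hb : b ∈ K) {D1 D2 : X → ℝ} (hD1 : Continuous D1) (hD2 : Continuous D2)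
    (h1 : ∀ x ∈ K, ∀ y ∈ K, ∀ z ∈ K, |fderiv ℝ v x (y - z)| ≤ D1 x)
    (h2 : ∀ x ∈ K, ∀ y ∈ K, ∀ z ∈ K, |fderiv ℝ (fderiv ℝ v) x (y - z) (y - z)| ≤ D2 x) :
    μ K ^ (1 / 2 : ℝ) * ‖v a - v b‖ₑ ≤
      2 * (eLpNorm D1 2 (μ.restrict K) + 4 * eLpNorm D2 2 (μ.restrict K)) := by
  have hm0 : μ K ≠ 0 := (hKo.measure_pos μ ⟨a, ha⟩).ne'
  refine mul_le_of_le_sqrt_mul hm0 hfin ?_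
  have A := fun c hc => lintegral_enorm_sub_homothety_le (μ := μ) h3 hKo hK hv (a := c) hc one_pos le_rfl
    hD1 hD2 h1 h2
  simp only [one_smul, add_sub_cancel, Real.one_rpow, mul_one, ENNReal.ofReal_one, one_mul] at A
  have hvc := hv.continuous
  calc μ K * ‖v a - v b‖ₑ = ∫⁻ k in K, ‖v a - v b‖ₑ ∂μ := by
        rw [setLIntegral_const, mul_comm]
    _ ≤ ∫⁻ k in K, (‖v a - v k‖ₑ + ‖v b - v k‖ₑ) ∂μ := by
        refine lintegral_mono fun k => ?_
        calc ‖v a - v b‖ₑ = ‖(v a - v k) - (v b - v k)‖ₑ := by congr 1; ring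
          _ ≤ _ := enorm_sub_le
    _ ≤ _ := by
        rw [lintegral_add_left (by fun_prop)]
        refine (add_le_add (A a ha) (A b hb)).trans (le_of_eq ?_)
        rw [← two_mul, mul_left_comm]
        norm_num

theorem enorm_sub_le_smooth_modulus (h3 : Module.finrank ℝ X = 3) {K : Set X} (hKo : IsOpen K)
    (hK : Convex ℝ K) (hfin : μ K ≠ ⊤) {v : X → ℝ} (hv : ContDiff ℝ 2 v) {a b : X} (ha : a ∈ K)
    (hb : b ∈ K) {D0 D1 D2 : X → ℝ} (hD0 : Continuous D0) (hD1 : Continuous D1) (hD2 : Continuous D2)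
    (h0 : ∀ x ∈ K, ∀ h, |fderiv ℝ v x h| ≤ D0 x * ‖h‖)
    (h1 : ∀ x ∈ K, ∀ y ∈ K, ∀ z ∈ K, |fderiv ℝ v x (y - z)| ≤ D1 x)
    (h2 : ∀ x ∈ K, ∀ y ∈ K, ∀ z ∈ K, |fderiv ℝ (fderiv ℝ v) x (y - z) (y - z)| ≤ D2 x)
    {s : ℝ} (hs0 : 0 < s) (hs1 : s ≤ 1) :
    μ K ^ (1 / 2 : ℝ) * ‖v a - v b‖ₑ ≤
      2 * (ENNReal.ofReal s * eLpNorm D1 2 (μ.restrict K) +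
        ENNReal.ofReal (4 * s ^ (1 / 4 : ℝ)) * eLpNorm D2 2 (μ.restrict K)) +
      ENNReal.ofReal (‖a - b‖ * s ^ (-(3 / 2) : ℝ)) * eLpNorm D0 2 (μ.restrict K) := by
  have hm0 : μ K ≠ 0 := (hKo.measure_pos μ ⟨a, ha⟩).ne'
  refine mul_le_of_le_sqrt_mul hm0 hfin ?_
  have A := fun c hc => lintegral_enorm_sub_homothety_le (μ := μ) h3 hKo hK hv (a := c) hc hs0 hs1
    hD1 hD2 h1 h2
  have hvc := hv.continuous
  have B : ∫⁻ k in K, ‖v (a + s • (k - a)) - v (b + s • (k - b))‖ₑ ∂μ ≤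
      μ K ^ (1 / 2 : ℝ) * (ENNReal.ofReal (‖a - b‖ * s ^ (-(3 / 2) : ℝ)) *
        eLpNorm D0 2 (μ.restrict K)) := by
    set c : ℝ → X := fun t => b + t • (a - b) with hc
    have hcK : ∀ t ∈ Set.Ioc (0 : ℝ) 1, c t ∈ K := fun t ht => hK.star_mem hb ha ht.1.le ht.2
    have hpt : ∀ k ∈ K, ‖v (a + s • (k - a)) - v (b + s • (k - b))‖ₑ ≤
        ∫⁻ t in Set.Ioc (0 : ℝ) 1, ‖a - b‖ₑ * ‖D0 (c t + s • (k - c t))‖ₑ := by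
      intro k hk
      set d := (1 - s) • (a - b) with hd
      have hx : ∀ t : ℝ, c t + s • (k - c t) = (b + s • (k - b)) + t • d := by
        intro t; simp only [hc, hd]; module
      have hder := fun t : ℝ => deriv_comp_line (hv.differentiable (by norm_num)) (b + s • (k - b)) d t
      have hcont : Continuous fun t : ℝ => fderiv ℝ v ((b + s • (k - b)) + t • d) d := by
        have := hv.continuous_fderiv (by norm_num); fun_prop
      have hint := intervalIntegral.integral_eq_sub_of_hasDerivAt (a := 0) (b := 1)
        (fun t _ => hder t) (hcont.intervalIntegrable _ _)
      have e1 : (b + s • (k - b)) + (1 : ℝ) • d = a + s • (k - a) := by simp only [hd]; module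
      have e0 : (b + s • (k - b)) + (0 : ℝ) • d = b + s • (k - b) := by simp
      rw [e1, e0] at hint
      rw [← hint]
      refine enorm_intervalIntegral_le.trans (setLIntegral_mono' measurableSet_Ioc fun t ht => ?_)
      have hmem : c t + s • (k - c t) ∈ K := hK.star_mem (hcK t ht) hk hs0.le hs1
      rw [hx t] at hmem ⊢
      rw [show ‖a - b‖ₑ = ‖‖a - b‖‖ₑ by simp, ← enorm_mul]
      refine enorm_le_iff_norm_le.2 ?_
      have hdn : ‖d‖ ≤ ‖a - b‖ := by
        rw [hd, norm_smul, Real.norm_of_nonneg (by linarith)]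
        exact mul_le_of_le_one_left (norm_nonneg _) (by linarith)
      calc ‖fderiv ℝ v ((b + s • (k - b)) + t • d) d‖ ≤ D0 (b + s • (k - b) + t • d) * ‖d‖ :=
            h0 _ hmem d
        _ ≤ |D0 (b + s • (k - b) + t • d)| * ‖a - b‖ := by
            gcongr; exact le_abs_self _
        _ = _ := by simp [mul_comm]
    calc ∫⁻ k in K, ‖v (a + s • (k - a)) - v (b + s • (k - b))‖ₑ ∂μ
        ≤ ∫⁻ k in K, (∫⁻ t in Set.Ioc (0 : ℝ) 1, ‖a - b‖ₑ * ‖D0 (c t + s • (k - c t))‖ₑ) ∂μ :=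
          setLIntegral_mono' hKo.measurableSet hpt
      _ = ∫⁻ t in Set.Ioc (0 : ℝ) 1, (∫⁻ k in K, ‖a - b‖ₑ * ‖D0 (c t + s • (k - c t))‖ₑ ∂μ) := by
          refine lintegral_lintegral_swap ?_
          have : Continuous fun p : X × ℝ => D0 (c p.2 + s • (p.1 - c p.2)) := by
            simp only [hc]; fun_prop
          exact (this.enorm.measurable.const_mul _).aemeasurable
      _ ≤ ∫⁻ t in Set.Ioc (0 : ℝ) 1, ‖a - b‖ₑ * (ENNReal.ofReal (s ^ (-(3 / 2) : ℝ)) *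
            (μ K ^ (1 / 2 : ℝ) * eLpNorm D0 2 (μ.restrict K))) := by
          refine setLIntegral_mono' measurableSet_Ioc fun t ht => ?_
          have : Continuous fun k => D0 (c t + s • (k - c t)) := by fun_prop
          rw [lintegral_const_mul _ this.enorm.measurable]
          refine mul_le_mul_right ?_ _
          exact lintegral_homothety_le_eLpNorm h3 hKo.measurableSet hs0
            (fun k hk => hK.star_mem (hcK t ht) hk hs0.le hs1) hD0
      _ = _ := by
          rw [setLIntegral_const, Real.volume_Ioc, ENNReal.ofReal_mul (norm_nonneg _), ofReal_norm]
          norm_num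
          ring
  calc μ K * ‖v a - v b‖ₑ = ∫⁻ k in K, ‖v a - v b‖ₑ ∂μ := by
        rw [setLIntegral_const, mul_comm]
    _ ≤ ∫⁻ k in K, (‖v a - v (a + s • (k - a))‖ₑ + (‖v b - v (b + s • (k - b))‖ₑ +
          ‖v (a + s • (k - a)) - v (b + s • (k - b))‖ₑ)) ∂μ := by
        refine lintegral_mono fun k => ?_
        calc ‖v a - v b‖ₑ = ‖(v a - v (a + s • (k - a))) - ((v b - v (b + s • (k - b))) -
              (v (a + s • (k - a)) - v (b + s • (k - b))))‖ₑ := by congr 1; ring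
          _ ≤ _ := enorm_sub_le.trans (add_le_add le_rfl enorm_sub_le)
    _ ≤ _ := by
        have m1 : Measurable fun k => ‖v a - v (a + s • (k - a))‖ₑ :=
          (by fun_prop : Continuous fun k => v a - v (a + s • (k - a))).enorm.measurable
        have m2 : Measurable fun k => ‖v b - v (b + s • (k - b))‖ₑ :=
          (by fun_prop : Continuous fun k => v b - v (b + s • (k - b))).enorm.measurable
        rw [lintegral_add_left m1, lintegral_add_left m2]
        refine (add_le_add (A a ha) (add_le_add (A b hb) B)).trans (le_of_eq ?_)
        ring

/-! #### Poincaré inequality -/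

theorem lintegral_lintegral_sub_sq_le (h3 : Module.finrank ℝ X = 3) {K : Set X} (hKo : IsOpen K)
    (hK : Convex ℝ K) {v : X → ℝ} (hv : ContDiff ℝ 1 v) {D1 : X → ℝ} (hD1 : Continuous D1)
    (h1 : ∀ x ∈ K, ∀ y ∈ K, ∀ z ∈ K, |fderiv ℝ v x (y - z)| ≤ D1 x) :
    ∫⁻ x in K, (∫⁻ y in K, ‖v y - v x‖ₑ ^ 2 ∂μ) ∂μ ≤
      8 * μ K * eLpNorm D1 2 (μ.restrict K) ^ 2 := by
  have hpt : ∀ x ∈ K, ∀ y ∈ K, ‖v y - v x‖ₑ ^ 2 ≤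
      ∫⁻ t in Set.Ioc (0 : ℝ) 1, ‖D1 (x + t • (y - x))‖ₑ ^ 2 := by
    intro x hx y hy
    have hder := fun t : ℝ => deriv_comp_line (hv.differentiable (by norm_num)) x (y - x) t
    have hcont : Continuous fun t : ℝ => fderiv ℝ v (x + t • (y - x)) (y - x) := by
      have := hv.continuous_fderiv (by norm_num); fun_prop
    have hint := intervalIntegral.integral_eq_sub_of_hasDerivAt (a := 0) (b := 1)
        (fun t _ => hder t) (hcont.intervalIntegrable _ _)
    simp only [one_smul, add_sub_cancel, zero_smul, add_zero] at hint
    rw [← hint]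
    have hDc : Continuous fun t : ℝ => D1 (x + t • (y - x)) := by fun_prop
    have hle : ‖∫ t in (0 : ℝ)..1, fderiv ℝ v (x + t • (y - x)) (y - x)‖ₑ ≤
        ∫⁻ t in Set.Ioc (0 : ℝ) 1, ‖D1 (x + t • (y - x))‖ₑ := by
      refine enorm_intervalIntegral_le.trans (setLIntegral_mono' measurableSet_Ioc fun t ht => ?_)
      exact enorm_le_iff_norm_le.2
        ((h1 _ (hK.star_mem hx hy ht.1.le ht.2) y hy x hx).trans (le_abs_self _))
    have h2 := lintegral_le_sqrt_mul_eLpNorm (ν := volume.restrict (Set.Ioc (0 : ℝ) 1))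
      hDc.aestronglyMeasurable
    have hu : (volume.restrict (Set.Ioc (0 : ℝ) 1)) Set.univ ^ (1 / 2 : ℝ) = 1 := by simp
    rw [hu, one_mul] at h2
    calc _ ≤ (eLpNorm (fun t : ℝ => D1 (x + t • (y - x))) 2 (volume.restrict (Set.Ioc (0 : ℝ) 1))) ^ 2 := by
          gcongr; exact hle.trans h2
      _ = _ := eLpNorm_two_sq _
  have hc3 : Continuous fun p : (X × X) × ℝ => D1 (p.1.1 + p.2 • (p.1.2 - p.1.1)) := by fun_prop
  set ν := μ.restrict K with hν
  have hI : ∀ t ∈ Set.Ioc (0 : ℝ) 1, ∫⁻ x, ∫⁻ y, ‖D1 (x + t • (y - x))‖ₑ ^ 2 ∂ν ∂ν ≤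
      8 * μ K * eLpNorm D1 2 ν ^ 2 := by
    have key : ∀ r : ℝ, 1 / 2 ≤ r → r ≤ 1 → ∀ x ∈ K,
        ∫⁻ y, ‖D1 (x + r • (y - x))‖ₑ ^ 2 ∂ν ≤ 8 * eLpNorm D1 2 ν ^ 2 := by
      intro r hr0 hr1 x hx
      refine (lintegral_homothety_le (μ := μ) h3 hKo.measurableSet (by linarith)
        (fun k hk => hK.star_mem hx hk (by linarith) hr1) (fun x => ‖D1 x‖ₑ ^ 2)).trans ?_
      rw [eLpNorm_two_sq]
      gcongr
      rw [show (8 : ENNReal) = ENNReal.ofReal 8 by norm_num]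
      apply ENNReal.ofReal_le_ofReal
      rw [inv_le_comm₀ (by positivity) (by norm_num)]
      calc (8 : ℝ)⁻¹ = (1 / 2) ^ 3 := by norm_num
        _ ≤ r ^ 3 := by gcongr
    have fin : ∀ G : X → ENNReal, (∀ x ∈ K, G x ≤ 8 * eLpNorm D1 2 ν ^ 2) →
        ∫⁻ x, G x ∂ν ≤ 8 * μ K * eLpNorm D1 2 ν ^ 2 := by
      intro G hG
      refine (setLIntegral_mono' hKo.measurableSet hG).trans (le_of_eq ?_)
      rw [setLIntegral_const]; ring
    intro t ht
    rcases le_total (1 / 2) t with h | h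
    · exact fin _ (key t h ht.2)
    · have hc2 : Continuous fun p : X × X => D1 (p.1 + t • (p.2 - p.1)) := by fun_prop
      rw [lintegral_lintegral_swap (hc2.enorm.measurable.pow_const 2).aemeasurable]
      refine fin _ fun y hy => ?_
      have := key (1 - t) (by linarith) (by linarith [ht.1]) y hy
      refine (le_of_eq ?_).trans this
      congr 1; ext x
      rw [show x + t • (y - x) = y + (1 - t) • (x - y) by module]
  calc ∫⁻ x, (∫⁻ y, ‖v y - v x‖ₑ ^ 2 ∂ν) ∂ν
      ≤ ∫⁻ x, ∫⁻ y, (∫⁻ t in Set.Ioc (0 : ℝ) 1, ‖D1 (x + t • (y - x))‖ₑ ^ 2) ∂ν ∂ν := by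
        refine setLIntegral_mono' hKo.measurableSet fun x hx => ?_
        exact setLIntegral_mono' hKo.measurableSet fun y hy => hpt x hx y hy
    _ = ∫⁻ x, (∫⁻ t in Set.Ioc (0 : ℝ) 1, ∫⁻ y, ‖D1 (x + t • (y - x))‖ₑ ^ 2 ∂ν) ∂ν := by
        congr 1; ext x
        have : Continuous fun p : X × ℝ => D1 (x + p.2 • (p.1 - x)) := by fun_prop
        rw [lintegral_lintegral_swap (this.enorm.measurable.pow_const 2).aemeasurable]
    _ = ∫⁻ t in Set.Ioc (0 : ℝ) 1, ∫⁻ x, ∫⁻ y, ‖D1 (x + t • (y - x))‖ₑ ^ 2 ∂ν ∂ν := by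
        rw [lintegral_lintegral_swap]
        refine Measurable.aemeasurable ?_
        have hm : Measurable fun p : (X × ℝ) × X => ‖D1 (p.1.1 + p.1.2 • (p.2 - p.1.1))‖ₑ ^ 2 :=
          ((by fun_prop : Continuous fun p : (X × ℝ) × X =>
            D1 (p.1.1 + p.1.2 • (p.2 - p.1.1))).enorm.measurable).pow_const 2
        exact hm.lintegral_prod_right'
    _ ≤ ∫⁻ t in Set.Ioc (0 : ℝ) 1, 8 * μ K * eLpNorm D1 2 ν ^ 2 :=
        setLIntegral_mono' measurableSet_Ioc hI
    _ = _ := by rw [setLIntegral_const]; simp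

end Homothety

end

noncomputable section

/-! ### The trace estimate on the bottom of a slab -/

/-- The Euclidean plane. -/
abbrev E2 : Type := EuclideanSpace ℝ (Fin 2)

instance : (volume : Measure (E2 × ℝ)).IsAddHaarMeasure := by
  rw [Measure.volume_eq_prod]; infer_instance

theorem finrank_E2_prod : Module.finrank ℝ (E2 × ℝ) = 3 := by simp

theorem enorm_sub_le_slab_aux {A : Set E2} (hA : Convex ℝ A) {h : ℝ} (hh : 0 < h) {v : E2 × ℝ → ℝ}
    (hv : ContDiff ℝ 2 v) {a k : E2} (ha : a ∈ A) (hk : k ∈ A) {τ : ℝ} (hτ : τ ∈ Set.Ioo 0 h)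
    {D1 D2 : E2 × ℝ → ℝ}
    (h1 : ∀ x ∈ A ×ˢ Set.Ioo 0 h, ∀ y ∈ A, ∀ z ∈ A, |fderiv ℝ v x (y - z, 0)| ≤ D1 x)
    (h2 : ∀ x ∈ A ×ˢ Set.Ioo 0 h, ∀ y ∈ A, ∀ z ∈ A, ∀ t ∈ Set.Ioo 0 h,
      |fderiv ℝ (fderiv ℝ v) x (y - z, t) (y - z, 0)| ≤ D2 x)
    (h3 : ∀ x ∈ A ×ˢ Set.Ioo 0 h, ∀ y ∈ A, ∀ z ∈ A,
      |fderiv ℝ (fderiv ℝ v) x (0, h) (y - z, 0)| ≤ D2 x) :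
    ‖v (a, 0) - v (k, 0)‖ₑ ≤ ‖D1 (k, τ)‖ₑ +
      (∫⁻ r in Set.Ioc (0 : ℝ) 1, ENNReal.ofReal r * ‖D2 ((a, 0) + r • ((k, τ) - (a, 0)))‖ₑ) +
      ∫⁻ r in Set.Ioc (0 : ℝ) 1, ∫⁻ t in Set.Ioo 0 h,
        ENNReal.ofReal (r / h) * ‖D2 ((a, 0) + r • ((k, t) - (a, 0)))‖ₑ := by
  set d : E2 × ℝ := (k - a, 0) with hd
  set c : E2 × ℝ := (k, τ) - (a, 0) with hc
  have hcv : c = (k - a, τ) := by simp [hc]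
  have hmem : ∀ r ∈ Set.Ioc (0 : ℝ) 1, ∀ t ∈ Set.Ioo 0 h,
      ((a, 0) : E2 × ℝ) + r • ((k, t) - (a, 0)) ∈ A ×ˢ Set.Ioo 0 h := by
    intro r hr t ht
    refine ⟨hA.star_mem ha hk hr.1.le hr.2, ?_⟩
    simp only [Prod.snd_add, Prod.smul_snd, Prod.snd_sub, sub_zero, zero_add, smul_eq_mul]
    exact ⟨mul_pos hr.1 ht.1, (mul_le_of_le_one_left ht.1.le hr.2).trans_lt ht.2⟩
  have hdv : Continuous (fderiv ℝ v) := hv.continuous_fderiv (by norm_num)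
  have hdvd : ContDiff ℝ 1 (fderiv ℝ v) := hv.fderiv_right (by norm_num)
  have hddv : Continuous (fderiv ℝ (fderiv ℝ v)) := hdvd.continuous_fderiv (by norm_num)
  have e1 : v (k, 0) - v (a, 0) = ∫ r in (0 : ℝ)..1, fderiv ℝ v ((a, 0) + r • d) d := by
    have := intervalIntegral.integral_eq_sub_of_hasDerivAt (a := 0) (b := 1)
      (fun t _ => deriv_comp_line (hv.differentiable (by norm_num)) ((a, 0) : E2 × ℝ) d t)
      (Continuous.intervalIntegrable (by fun_prop) _ _)
    rw [this]; simp [hd]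
  have e2 : ∫ r in (0 : ℝ)..1, fderiv ℝ v ((a, 0) + r • c) d =
      fderiv ℝ v (k, τ) d - ∫ r in (0 : ℝ)..1, r * fderiv ℝ (fderiv ℝ v) ((a, 0) + r • c) c d := by
    have := intervalIntegral.integral_mul_deriv_eq_deriv_mul (a := 0) (b := 1) (u := fun r => r)
      (u' := fun _ => 1)
      (v := fun r : ℝ => fderiv ℝ v ((a, 0) + r • c) d) (fun x _ => hasDerivAt_id x)
      (fun x _ => deriv_fderiv_line hv (a, 0) c d x)
      (Continuous.intervalIntegrable (by fun_prop) _ _)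
      (Continuous.intervalIntegrable (by fun_prop) _ _)
    simp only [one_mul, zero_mul, sub_zero, one_smul] at this
    rw [this]
    simp [hc]
  have e3 : v (a, 0) - v (k, 0) = -fderiv ℝ v (k, τ) d +
      (∫ r in (0 : ℝ)..1, r * fderiv ℝ (fderiv ℝ v) ((a, 0) + r • c) c d) +
      ∫ r in (0 : ℝ)..1, (fderiv ℝ v ((a, 0) + r • c) d - fderiv ℝ v ((a, 0) + r • d) d) := by
    rw [intervalIntegral.integral_sub (Continuous.intervalIntegrable (by fun_prop) _ _)
      (Continuous.intervalIntegrable (by fun_prop) _ _), e2, ← e1]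
    ring
  rw [e3]
  refine (enorm_add_le _ _).trans (add_le_add ((enorm_add_le _ _).trans (add_le_add ?_ ?_)) ?_)
  · rw [enorm_neg]
    exact enorm_le_iff_norm_le.2 ((h1 _ ⟨hk, hτ⟩ k hk a ha).trans (le_abs_self _))
  · refine enorm_intervalIntegral_le.trans (setLIntegral_mono' measurableSet_Ioc fun r hr => ?_)
    rw [enorm_mul, Real.enorm_of_nonneg hr.1.le]
    gcongr
    have := h2 _ (hmem r hr τ hτ) k hk a ha τ hτ
    rw [← hcv] at this
    exact enorm_le_iff_norm_le.2 (this.trans (le_abs_self _))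
  · refine enorm_intervalIntegral_le.trans (setLIntegral_mono' measurableSet_Ioc fun r hr => ?_)
    have hder : ∀ t : ℝ, HasDerivAt (fun t : ℝ => fderiv ℝ v (((a, 0) + r • d) + t • ((0, r) : E2 × ℝ)) d)
        (fderiv ℝ (fderiv ℝ v) (((a, 0) + r • d) + t • ((0, r) : E2 × ℝ)) (0, r) d) t :=
      fun t => deriv_fderiv_line hv _ _ _ t
    have := intervalIntegral.integral_eq_sub_of_hasDerivAt (a := 0) (b := τ)
      (fun t _ => hder t) (Continuous.intervalIntegrable (by fun_prop) _ _)
    have ex : ∀ t : ℝ, ((a, 0) + r • d) + t • ((0, r) : E2 × ℝ) = (a, 0) + r • ((k, t) - (a, 0)) := by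
      intro t
      ext1
      · simp [hd]
      · simp [hd, mul_comm]
    have e0 : ((a, 0) + r • d) + (0 : ℝ) • ((0, r) : E2 × ℝ) = (a, 0) + r • d := by simp
    have eτ : ((a, 0) + r • d) + τ • ((0, r) : E2 × ℝ) = (a, 0) + r • c := ex τ
    rw [e0, eτ] at this
    rw [← this, intervalIntegral.integral_of_le hτ.1.le]
    refine (enorm_integral_le_lintegral_enorm _).trans ?_
    refine (lintegral_mono_set (Set.Ioc_subset_Ioo_right hτ.2)).trans ?_
    refine setLIntegral_mono' measurableSet_Ioo fun t ht => ?_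
    rw [ex t]
    have er : ((0, r) : E2 × ℝ) = (r / h) • ((0, h) : E2 × ℝ) := by
      ext1
      · simp
      · simp [hh.ne']
    rw [er, map_smul, smul_apply, smul_eq_mul, enorm_mul,
      Real.enorm_of_nonneg (div_nonneg hr.1.le hh.le)]
    gcongr
    exact enorm_le_iff_norm_le.2 ((h3 _ (hmem r hr t ht) k hk a ha).trans (le_abs_self _))

theorem lintegral_slab_average {A : Set E2} {h : ℝ} (hh : 0 < h) {g : E2 → ℝ → ℝ → ENNReal}
    (hg : Measurable fun p : (E2 × ℝ) × ℝ => g p.1.1 p.1.2 p.2) :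
    ∫⁻ k in A ×ˢ Set.Ioo 0 h, (∫⁻ r in Set.Ioc (0 : ℝ) 1, ∫⁻ t in Set.Ioo 0 h,
        ENNReal.ofReal (r / h) * g k.1 r t) =
      ∫⁻ k in A ×ˢ Set.Ioo 0 h, ∫⁻ r in Set.Ioc (0 : ℝ) 1, ENNReal.ofReal r * g k.1 r k.2 := by
  have m1 : Measurable fun p : (E2 × ℝ) × ℝ => ENNReal.ofReal (p.1.2 / h) * g p.1.1 p.1.2 p.2 :=
    (by fun_prop : Measurable fun p : (E2 × ℝ) × ℝ => ENNReal.ofReal (p.1.2 / h)).mul hg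
  have m2 : Measurable fun p : E2 × ℝ => ∫⁻ t in Set.Ioo 0 h, ENNReal.ofReal (p.2 / h) * g p.1 p.2 t :=
    m1.lintegral_prod_right'
  have m3 : Measurable fun k : E2 => ∫⁻ r in Set.Ioc (0 : ℝ) 1, ∫⁻ t in Set.Ioo 0 h,
      ENNReal.ofReal (r / h) * g k r t := m2.lintegral_prod_right'
  have m4 : Measurable fun k : E2 × ℝ => ∫⁻ r in Set.Ioc (0 : ℝ) 1, ∫⁻ t in Set.Ioo 0 h,
      ENNReal.ofReal (r / h) * g k.1 r t := m3.comp measurable_fst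
  have i5 : Measurable fun p : (E2 × ℝ) × ℝ => ((p.1.1, p.2), p.1.2) := by fun_prop
  have m5 : Measurable fun p : (E2 × ℝ) × ℝ => g p.1.1 p.2 p.1.2 := hg.comp i5
  have m6 : Measurable fun p : (E2 × ℝ) × ℝ => ENNReal.ofReal p.2 * g p.1.1 p.2 p.1.2 :=
    (by fun_prop : Measurable fun p : (E2 × ℝ) × ℝ => ENNReal.ofReal p.2).mul m5
  have m7 : Measurable fun k : E2 × ℝ => ∫⁻ r in Set.Ioc (0 : ℝ) 1, ENNReal.ofReal r * g k.1 r k.2 :=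
    m6.lintegral_prod_right'
  rw [Measure.volume_eq_prod, ← Measure.prod_restrict, lintegral_prod _ m4.aemeasurable,
    lintegral_prod _ m7.aemeasurable]
  refine lintegral_congr fun k => ?_
  have n1 : Measurable fun r : ℝ => ∫⁻ t in Set.Ioo 0 h, ENNReal.ofReal (r / h) * g k r t :=
    m2.comp (by fun_prop : Measurable fun r : ℝ => (k, r))
  have n2 : Measurable fun q : ℝ × ℝ => ENNReal.ofReal q.2 * g k q.2 q.1 :=
    m6.comp (by fun_prop : Measurable fun q : ℝ × ℝ => ((k, q.1), q.2))
  simp only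
  rw [setLIntegral_const, Real.volume_Ioo, sub_zero, mul_comm, ← lintegral_const_mul _ n1,
    lintegral_lintegral_swap (f := fun t r => ENNReal.ofReal r * g k r t) n2.aemeasurable]
  refine lintegral_congr fun r => ?_
  have n3 : Measurable fun t : ℝ => ENNReal.ofReal (r / h) * g k r t :=
    m1.comp (by fun_prop : Measurable fun t : ℝ => ((k, r), t))
  rw [← lintegral_const_mul _ n3]
  refine lintegral_congr fun t => ?_
  rw [← mul_assoc, ← ENNReal.ofReal_mul hh.le, mul_div_cancel₀ _ hh.ne']

theorem lintegral_enorm_sub_slab_le {A : Set E2} (hAo : IsOpen A) (hA : Convex ℝ A) {h : ℝ}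
    (hh : 0 < h) {v : E2 × ℝ → ℝ} (hv : ContDiff ℝ 2 v) {a : E2} (ha : a ∈ A)
    {D1 D2 : E2 × ℝ → ℝ} (hD1 : Continuous D1) (hD2 : Continuous D2)
    (h1 : ∀ x ∈ A ×ˢ Set.Ioo 0 h, ∀ y ∈ A, ∀ z ∈ A, |fderiv ℝ v x (y - z, 0)| ≤ D1 x)
    (h2 : ∀ x ∈ A ×ˢ Set.Ioo 0 h, ∀ y ∈ A, ∀ z ∈ A, ∀ t ∈ Set.Ioo 0 h,
      |fderiv ℝ (fderiv ℝ v) x (y - z, t) (y - z, 0)| ≤ D2 x)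
    (h3 : ∀ x ∈ A ×ˢ Set.Ioo 0 h, ∀ y ∈ A, ∀ z ∈ A,
      |fderiv ℝ (fderiv ℝ v) x (0, h) (y - z, 0)| ≤ D2 x) :
    ∫⁻ k in A ×ˢ Set.Ioo 0 h, ‖v (a, 0) - v (k.1, 0)‖ₑ ≤
      volume (A ×ˢ Set.Ioo 0 h) ^ (1 / 2 : ℝ) *
        (eLpNorm D1 2 (volume.restrict (A ×ˢ Set.Ioo 0 h)) +
          8 * eLpNorm D2 2 (volume.restrict (A ×ˢ Set.Ioo 0 h))) := by
  set K := A ×ˢ Set.Ioo 0 h with hK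
  have hKm : MeasurableSet K := hAo.measurableSet.prod measurableSet_Ioo
  have hst : ∀ k ∈ K, ∀ r : ℝ, 0 < r → r ≤ 1 → ((a, 0) : E2 × ℝ) + r • (k - (a, 0)) ∈ K := by
    rintro ⟨k, t⟩ hk r hr0 hr1
    refine ⟨hA.star_mem ha hk.1 hr0.le hr1, ?_⟩
    simp only [Prod.snd_add, Prod.smul_snd, Prod.snd_sub, sub_zero, zero_add, smul_eq_mul]
    exact ⟨mul_pos hr0 hk.2.1, (mul_le_of_le_one_left hk.2.1.le hr1).trans_lt hk.2.2⟩
  have J := lintegral_lintegral_homothety_le (μ := (volume : Measure (E2 × ℝ))) finrank_E2_prod hKm hst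
    hD2 continuous_id (A := 1) zero_le_one fun r hr0 hr1 => by
      have := min_le_rpow hr0 one_pos
      simpa [min_eq_left hr1] using this
  simp only [mul_one, id] at J
  set G : E2 → ℝ → ℝ → ENNReal := fun k r t => ‖D2 ((a, 0) + r • ((k, t) - (a, 0)))‖ₑ with hG
  have hGm : Measurable fun p : (E2 × ℝ) × ℝ => G p.1.1 p.1.2 p.2 :=
    (by fun_prop : Continuous fun p : (E2 × ℝ) × ℝ =>
      D2 ((a, 0) + p.1.2 • ((p.1.1, p.2) - (a, 0)))).enorm.measurable
  have hT := lintegral_slab_average (A := A) hh hGm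
  calc ∫⁻ k in K, ‖v (a, 0) - v (k.1, 0)‖ₑ
      ≤ ∫⁻ k in K, (‖D1 k‖ₑ +
      (∫⁻ r in Set.Ioc (0 : ℝ) 1, ENNReal.ofReal r * ‖D2 ((a, 0) + r • (k - (a, 0)))‖ₑ) +
      ∫⁻ r in Set.Ioc (0 : ℝ) 1, ∫⁻ t in Set.Ioo 0 h, ENNReal.ofReal (r / h) * G k.1 r t) := by
        refine setLIntegral_mono' hKm ?_
        rintro ⟨k, τ⟩ hk
        exact enorm_sub_le_slab_aux hA hh hv ha hk.1 hk.2 h1 h2 h3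
    _ ≤ _ := by
        have hm2 : Measurable fun k : E2 × ℝ => ∫⁻ r in Set.Ioc (0 : ℝ) 1,
            ENNReal.ofReal r * ‖D2 ((a, 0) + r • (k - (a, 0)))‖ₑ := by
          refine Measurable.lintegral_prod_right' (f := fun q : (E2 × ℝ) × ℝ =>
            ENNReal.ofReal q.2 * ‖D2 ((a, 0) + q.2 • (q.1 - (a, 0)))‖ₑ) ?_
          exact (measurable_snd.ennreal_ofReal).mul ((by fun_prop : Continuous fun q : (E2 × ℝ) × ℝ =>
            D2 ((a, 0) + q.2 • (q.1 - (a, 0)))).enorm.measurable)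
        have m12 : Measurable fun k => ‖D1 k‖ₑ + ∫⁻ r in Set.Ioc (0 : ℝ) 1,
            ENNReal.ofReal r * ‖D2 ((a, 0) + r • (k - (a, 0)))‖ₑ := hD1.enorm.measurable.add hm2
        rw [lintegral_add_left m12, lintegral_add_left hD1.enorm.measurable,
          hT]
        have N := lintegral_le_sqrt_mul_eLpNorm (ν := volume.restrict K) hD1.aestronglyMeasurable
        rw [Measure.restrict_apply_univ] at N
        refine (add_le_add (add_le_add N J) J).trans (le_of_eq ?_)
        rw [show ENNReal.ofReal 4 = 4 by norm_num]
        ring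

theorem enorm_sub_le_slab {A : Set E2} (hAo : IsOpen A) (hA : Convex ℝ A) {h : ℝ}
    (hh : 0 < h) (hfin : volume A ≠ ⊤) {v : E2 × ℝ → ℝ} (hv : ContDiff ℝ 2 v) {a b : E2} (ha : a ∈ A)
    (hb : b ∈ A)
    {D1 D2 : E2 × ℝ → ℝ} (hD1 : Continuous D1) (hD2 : Continuous D2)
    (h1 : ∀ x ∈ A ×ˢ Set.Ioo 0 h, ∀ y ∈ A, ∀ z ∈ A, |fderiv ℝ v x (y - z, 0)| ≤ D1 x)
    (h2 : ∀ x ∈ A ×ˢ Set.Ioo 0 h, ∀ y ∈ A, ∀ z ∈ A, ∀ t ∈ Set.Ioo 0 h,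
      |fderiv ℝ (fderiv ℝ v) x (y - z, t) (y - z, 0)| ≤ D2 x)
    (h3 : ∀ x ∈ A ×ˢ Set.Ioo 0 h, ∀ y ∈ A, ∀ z ∈ A,
      |fderiv ℝ (fderiv ℝ v) x (0, h) (y - z, 0)| ≤ D2 x) :
    volume (A ×ˢ Set.Ioo 0 h) ^ (1 / 2 : ℝ) * ‖v (a, 0) - v (b, 0)‖ₑ ≤
        2 * (eLpNorm D1 2 (volume.restrict (A ×ˢ Set.Ioo 0 h)) +
          8 * eLpNorm D2 2 (volume.restrict (A ×ˢ Set.Ioo 0 h))) := by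
  set K := A ×ˢ Set.Ioo 0 h with hK
  have hKo : IsOpen K := hAo.prod isOpen_Ioo
  have hm0 : volume K ≠ 0 := (hKo.measure_pos volume ⟨(a, h / 2), ha, by constructor <;> simp [hh]⟩).ne'
  have hmt : volume K ≠ ⊤ := by
    rw [hK, Measure.volume_eq_prod, Measure.prod_prod, Real.volume_Ioo]
    exact ENNReal.mul_ne_top hfin ENNReal.ofReal_ne_top
  refine mul_le_of_le_sqrt_mul hm0 hmt ?_
  have I := fun c hc => lintegral_enorm_sub_slab_le hAo hA hh hv (a := c) hc hD1 hD2 h1 h2 h3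
  have hvc := hv.continuous
  calc volume K * ‖v (a, 0) - v (b, 0)‖ₑ = ∫⁻ k in K, ‖v (a, 0) - v (b, 0)‖ₑ := by
        rw [setLIntegral_const, mul_comm]
    _ ≤ ∫⁻ k in K, (‖v (a, 0) - v (k.1, 0)‖ₑ + ‖v (b, 0) - v (k.1, 0)‖ₑ) := by
        refine lintegral_mono fun k => ?_
        calc ‖v (a, 0) - v (b, 0)‖ₑ = ‖(v (a, 0) - v (k.1, 0)) - (v (b, 0) - v (k.1, 0))‖ₑ := by
              congr 1; ring
          _ ≤ _ := enorm_sub_le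
    _ ≤ _ := by
        have m1 : Measurable fun k : E2 × ℝ => ‖v (a, 0) - v (k.1, 0)‖ₑ :=
          (by fun_prop : Continuous fun k : E2 × ℝ => v (a, 0) - v (k.1, 0)).enorm.measurable
        rw [lintegral_add_left m1]
        refine (add_le_add (I a ha) (I b hb)).trans (le_of_eq ?_)
        ring

end

noncomputable section

/-! ### Estimates for functions with weak derivatives -/

/-- `v ∈ H²(U)` with first derivatives `g i` and second derivatives `g2 i k` in the frame `b`. -/
structure IsH2 (b : OrthonormalBasis (Fin 3) ℝ E3) (U : Set E3) (v : E3 → ℝ) (g : Fin 3 → E3 → ℝ)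
    (g2 : Fin 3 → Fin 3 → E3 → ℝ) : Prop where
  mem : MemLp v 2 (volume.restrict U)
  mem1 : ∀ i, MemLp (g i) 2 (volume.restrict U)
  mem2 : ∀ i k, MemLp (g2 i k) 2 (volume.restrict U)
  partial1 : ∀ i, HasWeakPartial U (b i) v (g i)
  partial2 : ∀ i k, HasWeakPartial U (b k) (g i) (g2 i k)

variable {b : OrthonormalBasis (Fin 3) ℝ E3} {U : Set E3} {v : E3 → ℝ} {g : Fin 3 → E3 → ℝ}
  {g2 : Fin 3 → Fin 3 → E3 → ℝ}

theorem IsH2.mono (h : IsH2 b U v g g2) (hU : IsOpen U) {V : Set E3} (hVU : V ⊆ U) :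
    IsH2 b V v g g2 where
  mem := h.mem.mono_measure (Measure.restrict_mono hVU le_rfl)
  mem1 i := (h.mem1 i).mono_measure (Measure.restrict_mono hVU le_rfl)
  mem2 i k := (h.mem2 i k).mono_measure (Measure.restrict_mono hVU le_rfl)
  partial1 i := (h.partial1 i).mono hU hVU
  partial2 i k := (h.partial2 i k).mono hU hVU

theorem IsH2.congr (h : IsH2 b U v g g2) (hU : IsOpen U) {v' : E3 → ℝ}
    (hv : v =ᵐ[volume.restrict U] v') : IsH2 b U v' g g2 where
  mem := h.mem.ae_eq hv
  mem1 := h.mem1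
  mem2 := h.mem2
  partial1 i := (h.partial1 i).congr_ae hU hv (Filter.EventuallyEq.refl _ _)
  partial2 := h.partial2

theorem MemH2.isH2 (b : OrthonormalBasis (Fin 3) ℝ E3) (hU : IsOpen U) (h : MemH2 U v) :
    IsH2 b U v (fun i => weakPartial U (b i) v)
      (fun i k => weakPartial U (b k) (weakPartial U (b i) v)) where
  mem := h.1.1
  mem1 i := h.1.memLp_weakPartial hU (b i)
  mem2 i k := (h.2 (b i)).memLp_weakPartial hU (b k)
  partial1 i := h.1.hasWeakPartial (b i)
  partial2 i k := (h.2 (b i)).hasWeakPartial (b k)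

theorem IsH2.sub_affine (h : IsH2 b U v g g2) (hU : IsOpen U) (hfin : volume U ≠ ⊤)
    (hbd : Bornology.IsBounded U) (L : E3 →L[ℝ] ℝ) (c : ℝ) :
    IsH2 b U (fun x => v x - (L x + c)) (fun i x => g i x - L (b i)) g2 := by
  have : IsFiniteMeasure (volume.restrict U) := ⟨by simpa using hfin.lt_top⟩
  refine ⟨h.mem.sub ?_, fun i => (h.mem1 i).sub (memLp_const _), h.mem2,
    fun i => (h.partial1 i).sub hU (hasWeakPartial_affine U (b i) L c), fun i k => ?_⟩
  · obtain ⟨R, hR⟩ := hbd.subset_closedBall 0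
    refine MemLp.of_bound (by fun_prop : Continuous fun x => L x + c).aestronglyMeasurable
      (‖L‖ * R + |c|) ?_
    rw [ae_restrict_iff' hU.measurableSet]
    refine Filter.Eventually.of_forall fun x hx => ?_
    have hx' : ‖x‖ ≤ R := by simpa using hR hx
    calc ‖L x + c‖ ≤ ‖L x‖ + ‖c‖ := norm_add_le _ _
      _ ≤ ‖L‖ * R + |c| := by
        gcongr
        exact (L.le_opNorm x).trans (by gcongr)
        exact le_rfl
  · have := (h.partial2 i k).sub hU (hasWeakPartial_affine U (b k) 0 (L (b i)))
    simpa using this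

theorem norm_clm_le_sum (b : OrthonormalBasis (Fin 3) ℝ E3) (T : E3 →L[ℝ] ℝ) {d : E3}
    {w : Fin 3 → ℝ} (hw : ∀ i, |inner ℝ (b i) d| ≤ w i) : |T d| ≤ ∑ i, w i * |T (b i)| := by
  conv_lhs => rw [← b.sum_repr' d]
  rw [map_sum]
  refine (Finset.abs_sum_le_sum_abs _ _).trans (Finset.sum_le_sum fun i _ => ?_)
  rw [map_smul, smul_eq_mul, abs_mul]
  gcongr
  exact hw i

theorem IsH2.fderiv_moll_le (h : IsH2 b U v g g2) (hU : IsOpen U) {j : ℕ} {x : E3}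
    (hx : Metric.closedBall x (bumpSeq j).rOut ⊆ U) {d : E3} {w : Fin 3 → ℝ}
    (hw : ∀ i, |inner ℝ (b i) d| ≤ w i) :
    |fderiv ℝ (moll U v j) x d| ≤ ∑ i, w i * |moll U (g i) j x| := by
  refine (norm_clm_le_sum b _ hw).trans (le_of_eq ?_)
  simp_rw [fderiv_moll hU h.mem (h.partial1 _) hx]

theorem IsH2.fderiv_fderiv_moll_le (h : IsH2 b U v g g2) (hU : IsOpen U) {j : ℕ} {V : Set E3}
    (hV : IsOpen V) (hVU : ∀ x ∈ V, Metric.closedBall x (bumpSeq j).rOut ⊆ U) {x : E3} (hx : x ∈ V)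
    {d d' : E3} {w w' : Fin 3 → ℝ}
    (hw : ∀ i, |inner ℝ (b i) d| ≤ w i) (hw' : ∀ i, |inner ℝ (b i) d'| ≤ w' i) :
    |fderiv ℝ (fderiv ℝ (moll U v j)) x d' d| ≤ ∑ i, ∑ k, w i * w' k * |moll U (g2 i k) j x| := by
  have hw0 : ∀ i, 0 ≤ w i := fun i => (abs_nonneg _).trans (hw i)
  have hsm := contDiff_moll hU h.mem j
  have hd : DifferentiableAt ℝ (fderiv ℝ (moll U v j)) x :=
    ((hsm.fderiv_right (m := ∞) (by simp)).differentiable (by simp)) x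
  have e : ∀ i k, fderiv ℝ (fderiv ℝ (moll U v j)) x (b k) (b i) = moll U (g2 i k) j x := by
    intro i k
    have h1 : fderiv ℝ (fun y => fderiv ℝ (moll U v j) y (b i)) x =
        fderiv ℝ (moll U (g i) j) x := by
      refine Filter.EventuallyEq.fderiv_eq ?_
      filter_upwards [hV.mem_nhds hx] with y hy
      exact fderiv_moll hU h.mem (h.partial1 i) (hVU y hy)
    have h2 := fderiv_moll hU (h.mem1 i) (h.partial2 i k) (hVU x hx)
    rw [← h2, ← h1, fderiv_clm_apply hd (differentiableAt_const _)]
    simp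
  calc |fderiv ℝ (fderiv ℝ (moll U v j)) x d' d|
      ≤ ∑ i, w i * |fderiv ℝ (fderiv ℝ (moll U v j)) x d' (b i)| := norm_clm_le_sum b _ hw
    _ ≤ ∑ i, w i * ∑ k, w' k * |moll U (g2 i k) j x| := by
        refine Finset.sum_le_sum fun i _ => mul_le_mul_of_nonneg_left ?_ (hw0 i)
        have := norm_clm_le_sum b ((fderiv ℝ (fderiv ℝ (moll U v j)) x).flip (b i)) hw'
        simpa [e] using this
    _ = _ := by
        refine Finset.sum_congr rfl fun i _ => ?_
        rw [Finset.mul_sum]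
        exact Finset.sum_congr rfl fun k _ => by ring

theorem eLpNorm_moll_le (hU : IsOpen U) {f : E3 → ℝ} (hf : MemLp f 2 (volume.restrict U)) (j : ℕ)
    (V : Set E3) :
    eLpNorm (moll U f j) 2 (volume.restrict V) ≤ eLpNorm f 2 (volume.restrict U) := by
  rw [eLpNorm_two_eq, eLpNorm_two_eq]
  refine ENNReal.rpow_le_rpow ?_ (by norm_num)
  exact (setLIntegral_le_lintegral _ _).trans (lintegral_moll_sq_le hU hf j)

theorem continuous_moll (hU : IsOpen U) {f : E3 → ℝ} (hf : MemLp f 2 (volume.restrict U)) (j : ℕ) :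
    Continuous (moll U f j) := (contDiff_moll hU hf j).continuous

theorem eLpNorm_sum_mul_abs_le {α ι : Type*} [MeasurableSpace α] {ν : Measure α} (s : Finset ι)
    {w : ι → ℝ} (hw : ∀ i, 0 ≤ w i) {F : ι → α → ℝ} (hF : ∀ i, AEStronglyMeasurable (F i) ν) :
    eLpNorm (fun x => ∑ i ∈ s, w i * |F i x|) 2 ν ≤
      ∑ i ∈ s, ENNReal.ofReal (w i) * eLpNorm (F i) 2 ν := by
  have e : (fun x => ∑ i ∈ s, w i * |F i x|) = ∑ i ∈ s, fun x => w i * ‖F i x‖ := by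
    ext x; simp
  rw [e]
  refine (eLpNorm_sum_le (fun i _ => ((hF i).norm.const_mul _)) (by norm_num)).trans
    (Finset.sum_le_sum fun i _ => ?_)
  have : eLpNorm (fun x => w i * ‖F i x‖) 2 ν = ‖w i‖ₑ * eLpNorm (fun x => ‖F i x‖) 2 ν :=
    eLpNorm_const_smul (w i) (fun x => ‖F i x‖) 2 ν
  rw [this, eLpNorm_norm, Real.enorm_of_nonneg (hw i)]

/-- The sum `∑ wᵢ ‖gᵢ‖`. -/
def wNorm1 (U : Set E3) (w : Fin 3 → ℝ) (g : Fin 3 → E3 → ℝ) : ENNReal :=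
  ∑ i, ENNReal.ofReal (w i) * eLpNorm (g i) 2 (volume.restrict U)

/-- The sum `∑ wᵢ w'ₖ ‖gᵢₖ‖`. -/
def wNorm2 (U : Set E3) (w w' : Fin 3 → ℝ) (g2 : Fin 3 → Fin 3 → E3 → ℝ) : ENNReal :=
  ∑ i, ∑ k, ENNReal.ofReal (w i * w' k) * eLpNorm (g2 i k) 2 (volume.restrict U)

theorem eLpNorm_D1_le (hU : IsOpen U) (hg : ∀ i, MemLp (g i) 2 (volume.restrict U)) {w : Fin 3 → ℝ}
    (hw : ∀ i, 0 ≤ w i) (j : ℕ) (V : Set E3) :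
    eLpNorm (fun x => ∑ i, w i * |moll U (g i) j x|) 2 (volume.restrict V) ≤ wNorm1 U w g := by
  refine (eLpNorm_sum_mul_abs_le _ hw fun i =>
    (continuous_moll hU (hg i) j).aestronglyMeasurable).trans ?_
  exact Finset.sum_le_sum fun i _ => by gcongr; exact eLpNorm_moll_le hU (hg i) j V

theorem eLpNorm_D2_le (hU : IsOpen U) (hg : ∀ i k, MemLp (g2 i k) 2 (volume.restrict U))
    {w w' : Fin 3 → ℝ} (hw : ∀ i, 0 ≤ w i) (hw' : ∀ i, 0 ≤ w' i) (j : ℕ) (V : Set E3) :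
    eLpNorm (fun x => ∑ i, ∑ k, w i * w' k * |moll U (g2 i k) j x|) 2 (volume.restrict V) ≤
      wNorm2 U w w' g2 := by
  have e : (fun x => ∑ i, ∑ k, w i * w' k * |moll U (g2 i k) j x|) =
      ∑ i, fun x => ∑ k, w i * w' k * |moll U (g2 i k) j x| := by
    ext x; simp
  have hc : ∀ i k, AEStronglyMeasurable (moll U (g2 i k) j) (volume.restrict V) := fun i k =>
    (continuous_moll hU (hg i k) j).aestronglyMeasurable
  rw [e, wNorm2]
  refine (eLpNorm_sum_le (fun i _ => Continuous.aestronglyMeasurable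
    (continuous_finsetSum _ fun k _ => continuous_const.mul (continuous_moll hU (hg i k) j).abs))
    (by norm_num)).trans (Finset.sum_le_sum fun i _ => ?_)
  refine (eLpNorm_sum_mul_abs_le (F := fun k => moll U (g2 i k) j) Finset.univ
    (fun k => mul_nonneg (hw i) (hw' k)) (hc i)).trans ?_
  exact Finset.sum_le_sum fun k _ => by gcongr; exact eLpNorm_moll_le hU (hg i k) j V

/-! #### Exhaustion of a convex set -/

theorem closedBall_homothety_subset {E : Type*} [NormedAddCommGroup E] [NormedSpace ℝ E]
    {K : Set E} (hK : Convex ℝ K) {x₀ : E} {ρ t : ℝ}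
    (ht0 : 0 ≤ t) (ht1 : t < 1) (hρ : Metric.closedBall x₀ ρ ⊆ K) {k : E} (hk : k ∈ K) :
    Metric.closedBall (AffineMap.homothety x₀ t k) ((1 - t) * ρ) ⊆ K := by
  intro y hy
  have h1 : 0 < 1 - t := by linarith
  set z := x₀ + (1 - t)⁻¹ • (y - AffineMap.homothety x₀ t k) with hz
  have hzK : z ∈ K := by
    apply hρ
    rw [Metric.mem_closedBall, dist_eq_norm, hz, add_sub_cancel_left, norm_smul,
      Real.norm_of_nonneg (by positivity), inv_mul_le_iff₀ h1]
    rwa [Metric.mem_closedBall, dist_eq_norm] at hy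
  have : y = t • k + (1 - t) • z := by
    rw [hz, smul_add, smul_inv_smul₀ h1.ne', AffineMap.homothety_apply, vsub_eq_sub, vadd_eq_add]
    module
  rw [this]
  exact hK hk hzK ht0 h1.le (by ring)

theorem exists_exhaustion {K : Set E3} (hKo : IsOpen K) (hK : Convex ℝ K) (hne : K.Nonempty) :
    ∃ (K' : ℕ → Set E3) (m : ℕ → ℕ), (∀ n, IsOpen (K' n)) ∧ (∀ n, Convex ℝ (K' n)) ∧
      (∀ n, K' n ⊆ K) ∧ (∀ x ∈ K, ∀ᶠ n in Filter.atTop, x ∈ K' n) ∧ (∀ n, n ≤ m n) ∧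
      (∀ n j, m n ≤ j → ∀ x ∈ K' n, Metric.closedBall x (bumpSeq j).rOut ⊆ K) ∧
      ∀ n, volume K ≤ 8 * volume (K' n) := by
  obtain ⟨x₀, hx₀⟩ := hne
  obtain ⟨ρ, hρ0, hρ⟩ := Metric.nhds_basis_closedBall.mem_iff.1 (hKo.mem_nhds hx₀)
  set t : ℕ → ℝ := fun n => 1 - 1 / ((n : ℝ) + 2) with ht
  have ht1 : ∀ n, t n < 1 := fun n => by simp only [ht]; linarith [show (0:ℝ) < 1 / ((n : ℝ) + 2) by positivity]
  have ht2 : ∀ n, 1 / 2 ≤ t n := fun n => by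
    simp only [ht]
    have : 1 / ((n : ℝ) + 2) ≤ 1 / 2 := by
      apply one_div_le_one_div_of_le <;> [norm_num; linarith [(Nat.cast_nonneg n : (0:ℝ) ≤ n)]]
    linarith
  have ht0 : ∀ n, 0 < t n := fun n => by linarith [ht2 n]
  have htl : Filter.Tendsto t Filter.atTop (nhds 1) := by
    have h0 : Filter.Tendsto (fun n : ℕ => 1 / ((n : ℝ) + 2)) Filter.atTop (nhds 0) := by
      have := (tendsto_one_div_add_atTop_nhds_zero_nat (𝕜 := ℝ)).comp (Filter.tendsto_add_atTop_nat 1)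
      refine this.congr fun n => ?_
      simp; ring
    simpa [ht] using h0.const_sub 1
  have hj : ∀ n, ∃ m, n ≤ m ∧ ∀ j, m ≤ j → (bumpSeq j).rOut ≤ (1 - t n) * ρ := by
    intro n
    have hpos : 0 < (1 - t n) * ρ := mul_pos (by linarith [ht1 n]) hρ0
    obtain ⟨m, hm⟩ := Filter.eventually_atTop.1 (tendsto_bumpSeq_rOut.eventually (gt_mem_nhds hpos))
    exact ⟨max n m, le_max_left _ _, fun j hj => (hm j ((le_max_right _ _).trans hj)).le⟩
  choose m hm1 hm2 using hj
  have hball : ∀ n, ∀ x ∈ AffineMap.homothety x₀ (t n) '' K,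
      Metric.closedBall x ((1 - t n) * ρ) ⊆ K := by
    rintro n _ ⟨k, hk, rfl⟩
    exact closedBall_homothety_subset hK (ht0 n).le (ht1 n) hρ hk
  refine ⟨fun n => AffineMap.homothety x₀ (t n) '' K, m, fun n => ?_, fun n => hK.affine_image _,
    fun n => ?_, fun x hx => ?_, hm1, fun n j hj x hx => ?_, fun n => ?_⟩
  · exact (AffineMap.homothety_isOpenMap x₀ (t n) (ht0 n).ne') K hKo
  · intro x hx
    exact hball n x hx (Metric.mem_closedBall_self (mul_nonneg (by linarith [ht1 n]) hρ0.le))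
  · have hc : Filter.Tendsto (fun n => x₀ + (t n)⁻¹ • (x - x₀)) Filter.atTop (nhds x) := by
      have := ((htl.inv₀ one_ne_zero).smul_const (x - x₀)).const_add x₀
      simpa using this
    filter_upwards [hc.eventually (hKo.mem_nhds hx)] with n hn
    refine ⟨_, hn, ?_⟩
    rw [AffineMap.homothety_apply, vsub_eq_sub, vadd_eq_add, add_sub_cancel_left,
      smul_inv_smul₀ (ht0 n).ne']
    abel
  · exact (Metric.closedBall_subset_closedBall (hm2 n j hj)).trans (hball n x hx)
  · rw [Measure.addHaar_image_homothety]
    have h3 : Module.finrank ℝ E3 = 3 := by simp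
    rw [h3, ← mul_assoc]
    refine le_mul_of_one_le_left' ?_
    rw [abs_of_pos (pow_pos (ht0 n) 3), show (8 : ENNReal) = ENNReal.ofReal 8 by norm_num,
      ← ENNReal.ofReal_mul (by norm_num), ENNReal.one_le_ofReal]
    have : (1 / 2 : ℝ) ^ 3 ≤ t n ^ 3 := by gcongr; exact ht2 n
    linarith

/-! #### Poincaré inequality and pointwise estimates -/

theorem poincare_convex {K : Set E3} (hKo : IsOpen K) (hK : Convex ℝ K) (hne : K.Nonempty)
    {f : E3 → ℝ} {f' : Fin 3 → E3 → ℝ} (hf : MemLp f 2 (volume.restrict K))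
    (hf' : ∀ i, MemLp (f' i) 2 (volume.restrict K)) (hp : ∀ i, HasWeakPartial K (b i) f (f' i))
    {w : Fin 3 → ℝ} (hw : ∀ x ∈ K, ∀ y ∈ K, ∀ i, |inner ℝ (b i) (x - y)| ≤ w i) :
    ∫⁻ x in K, (∫⁻ y in K, ‖f y - f x‖ₑ ^ 2) ≤ 8 * volume K * wNorm1 K w f' ^ 2 := by
  obtain ⟨K', m, hK'o, hK'c, hK'K, hev, hnm, hball, -⟩ := exists_exhaustion hKo hK hne
  have hw0 : ∀ i, 0 ≤ w i := by
    obtain ⟨x, hx⟩ := hne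
    exact fun i => (abs_nonneg _).trans (hw x hx x hx i)
  set ν := volume.restrict K with hν
  set F : ℕ → E3 × E3 → ENNReal := fun n z => (K' n ×ˢ K' n).indicator
    (fun z => ‖moll K f (m n) z.2 - moll K f (m n) z.1‖ₑ ^ 2) z with hF
  have hcm : ∀ j, Continuous (moll K f j) := continuous_moll hKo hf
  have hFm0 : ∀ n, Measurable fun z : E3 × E3 => ‖moll K f (m n) z.2 - moll K f (m n) z.1‖ₑ ^ 2 :=
    fun n => ((((hcm _).comp continuous_snd).sub ((hcm _).comp continuous_fst)).enorm.measurable).pow_const 2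
  have hFm : ∀ n, Measurable (F n) := fun n =>
    (hFm0 n).indicator ((hK'o n).measurableSet.prod (hK'o n).measurableSet)
  have hFle : ∀ n, ∫⁻ z, F n z ∂(ν.prod ν) ≤ 8 * volume K * wNorm1 K w f' ^ 2 := by
    intro n
    set D : E3 → ℝ := fun x => ∑ i, w i * |moll K (f' i) (m n) x| with hD
    have hDc : Continuous D := continuous_finsetSum _ fun i _ =>
      continuous_const.mul (continuous_moll hKo (hf' i) _).abs
    have key := lintegral_lintegral_sub_sq_le (μ := (volume : Measure E3)) (by simp) (hK'o n) (hK'c n)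
      (v := moll K f (m n)) ((contDiff_moll hKo hf _).of_le (by simp)) hDc (by
        intro x hx y hy z hz
        refine (norm_clm_le_sum b _ (hw y (hK'K n hy) z (hK'K n hz))).trans (le_of_eq ?_)
        simp_rw [fderiv_moll hKo hf (hp _) (hball n _ le_rfl x hx)]
        rfl)
    have e : ∫⁻ z, F n z ∂(ν.prod ν) = ∫⁻ x in K' n, (∫⁻ y in K' n,
        ‖moll K f (m n) y - moll K f (m n) x‖ₑ ^ 2) := by
      rw [lintegral_indicator ((hK'o n).measurableSet.prod (hK'o n).measurableSet),
        ← Measure.prod_restrict, hν, Measure.restrict_restrict_of_subset (hK'K n),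
        lintegral_prod _ (hFm0 n).aemeasurable]
    rw [e]
    refine key.trans ?_
    gcongr
    · exact hK'K n
    · exact eLpNorm_D1_le hKo hf' hw0 _ _
  have hae : ∀ᵐ z ∂(ν.prod ν), Filter.Tendsto (fun n => F n z) Filter.atTop
      (nhds (‖f z.2 - f z.1‖ₑ ^ 2)) := by
    have h1 := ae_tendsto_moll hKo hf
    have h2 : ∀ᵐ x ∂ν, x ∈ K := ae_restrict_mem hKo.measurableSet
    filter_upwards [Measure.quasiMeasurePreserving_fst.ae h1, Measure.quasiMeasurePreserving_snd.ae h1,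
      Measure.quasiMeasurePreserving_fst.ae h2, Measure.quasiMeasurePreserving_snd.ae h2] with z a1 a2 a3 a4
    have hm : Filter.Tendsto m Filter.atTop Filter.atTop :=
      Filter.tendsto_atTop_mono hnm Filter.tendsto_id
    have h3 : Filter.Tendsto (fun n => ‖moll K f (m n) z.2 - moll K f (m n) z.1‖ₑ ^ 2) Filter.atTop
        (nhds (‖f z.2 - f z.1‖ₑ ^ 2)) := by
      have := ((a2.comp hm).sub (a1.comp hm)).enorm
      exact ENNReal.Tendsto.pow this
    refine h3.congr' ?_
    filter_upwards [hev _ a3, hev _ a4] with n h5 h6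
    simp only [hF]
    rw [Set.indicator_of_mem (show z ∈ K' n ×ˢ K' n from ⟨h5, h6⟩)]
  have hfm : AEStronglyMeasurable f ν := hf.1
  have hmeas : AEMeasurable (fun z : E3 × E3 => ‖f z.2 - f z.1‖ₑ ^ 2) (ν.prod ν) :=
    ((hfm.comp_snd (μ := ν)).sub (hfm.comp_fst (ν := ν))).enorm.pow_const 2
  calc ∫⁻ x in K, (∫⁻ y in K, ‖f y - f x‖ₑ ^ 2) = ∫⁻ z, ‖f z.2 - f z.1‖ₑ ^ 2 ∂(ν.prod ν) := by
        rw [lintegral_prod _ hmeas]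
    _ = ∫⁻ z, Filter.liminf (fun n => F n z) Filter.atTop ∂(ν.prod ν) := by
        refine lintegral_congr_ae ?_
        filter_upwards [hae] with z hz
        exact hz.liminf_eq.symm
    _ ≤ Filter.liminf (fun n => ∫⁻ z, F n z ∂(ν.prod ν)) Filter.atTop := lintegral_liminf_le hFm
    _ ≤ _ := Filter.liminf_le_of_le (by isBoundedDefault) fun c hc => by
        obtain ⟨n, hn⟩ := hc.exists
        exact hn.trans (hFle n)

theorem rpow_half_le_of_le_eight {x y z : ENNReal} (h : x ≤ 8 * y) :
    x ^ (1 / 2 : ℝ) * z ≤ 3 * (y ^ (1 / 2 : ℝ) * z) := by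
  rw [← mul_assoc]
  gcongr
  calc x ^ (1 / 2 : ℝ) ≤ (8 * y) ^ (1 / 2 : ℝ) := ENNReal.rpow_le_rpow h (by norm_num)
    _ = 8 ^ (1 / 2 : ℝ) * y ^ (1 / 2 : ℝ) := ENNReal.mul_rpow_of_nonneg _ _ (by norm_num)
    _ ≤ (3 ^ (2 : ℝ)) ^ (1 / 2 : ℝ) * y ^ (1 / 2 : ℝ) := by
        gcongr
        norm_num
    _ = 3 * y ^ (1 / 2 : ℝ) := by rw [← ENNReal.rpow_mul]; norm_num

theorem IsH2.enorm_sub_le {K : Set E3} (h : IsH2 b K v g g2) (hKo : IsOpen K) (hK : Convex ℝ K)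
    (hfin : volume K ≠ ⊤) (hc : ContinuousOn v K) {w : Fin 3 → ℝ}
    (hw : ∀ x ∈ K, ∀ y ∈ K, ∀ i, |inner ℝ (b i) (x - y)| ≤ w i) {x y : E3} (hx : x ∈ K)
    (hy : y ∈ K) :
    volume K ^ (1 / 2 : ℝ) * ‖v x - v y‖ₑ ≤ 6 * (wNorm1 K w g + 4 * wNorm2 K w w g2) := by
  obtain ⟨K', m, hK'o, hK'c, hK'K, hev, hnm, hball, hvol⟩ := exists_exhaustion hKo hK ⟨x, hx⟩
  have hw0 : ∀ i, 0 ≤ w i := fun i => (abs_nonneg _).trans (hw x hx x hx i)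
  obtain ⟨n, hn1, hn2⟩ := ((hev x hx).and (hev y hy)).exists
  have hfin' : volume (K' n) ≠ ⊤ := ne_top_of_le_ne_top hfin (measure_mono (hK'K n))
  have hsm : ∀ᶠ j in Filter.atTop, volume K ^ (1 / 2 : ℝ) * ‖moll K v j x - moll K v j y‖ₑ ≤
      6 * (wNorm1 K w g + 4 * wNorm2 K w w g2) := by
    filter_upwards [Filter.eventually_ge_atTop (m n)] with j hj
    have := enorm_sub_le_smooth (μ := (volume : Measure E3)) (by simp) (hK'o n) (hK'c n) hfin'
      (v := moll K v j) ((contDiff_moll hKo h.mem j).of_le (WithTop.coe_le_coe.2 le_top)) hn1 hn2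
      (D1 := fun x => ∑ i, w i * |moll K (g i) j x|)
      (D2 := fun x => ∑ i, ∑ k, w i * w k * |moll K (g2 i k) j x|)
      (continuous_finsetSum _ fun i _ => continuous_const.mul (continuous_moll hKo (h.mem1 i) _).abs)
      (continuous_finsetSum _ fun i _ => continuous_finsetSum _ fun k _ =>
        continuous_const.mul (continuous_moll hKo (h.mem2 i k) _).abs)
      (fun z hz p hp q hq => h.fderiv_moll_le hKo (hball n j hj z hz)
        (hw p (hK'K n hp) q (hK'K n hq)))
      (fun z hz p hp q hq => h.fderiv_fderiv_moll_le hKo (hK'o n) (hball n j hj) hz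
        (hw p (hK'K n hp) q (hK'K n hq)) (hw p (hK'K n hp) q (hK'K n hq)))
    refine (rpow_half_le_of_le_eight (hvol n)).trans ((mul_le_mul_right this 3).trans ?_)
    rw [← mul_assoc]
    norm_num only
    gcongr
    · exact eLpNorm_D1_le hKo h.mem1 hw0 _ _
    · exact eLpNorm_D2_le hKo h.mem2 hw0 hw0 _ _
  have hcx := tendsto_moll_of_continuousAt hKo h.mem hx (hc.continuousAt (hKo.mem_nhds hx))
  have hcy := tendsto_moll_of_continuousAt hKo h.mem hy (hc.continuousAt (hKo.mem_nhds hy))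
  refine le_of_tendsto (ENNReal.Tendsto.const_mul (hcx.sub hcy).enorm (Or.inr ?_)) hsm
  exact ENNReal.rpow_ne_top_of_nonneg (by norm_num) hfin

end

noncomputable section

variable {b : OrthonormalBasis (Fin 3) ℝ E3} {U : Set E3} {v : E3 → ℝ} {g : Fin 3 → E3 → ℝ}
  {g2 : Fin 3 → Fin 3 → E3 → ℝ}

/-! ### The continuous representative -/

theorem wNorm1_ne_top (hg : ∀ i, MemLp (g i) 2 (volume.restrict U)) (w : Fin 3 → ℝ) :
    wNorm1 U w g ≠ ⊤ :=
  ENNReal.sum_ne_top.2 fun i _ => ENNReal.mul_ne_top ENNReal.ofReal_ne_top (hg i).2.ne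

theorem wNorm2_ne_top (hg : ∀ i k, MemLp (g2 i k) 2 (volume.restrict U)) (w w' : Fin 3 → ℝ) :
    wNorm2 U w w' g2 ≠ ⊤ :=
  ENNReal.sum_ne_top.2 fun i _ => ENNReal.sum_ne_top.2 fun k _ =>
    ENNReal.mul_ne_top ENNReal.ofReal_ne_top (hg i k).2.ne

theorem exists_modulus {a₁ a₂ a₃ : ENNReal} (h₁ : a₁ ≠ ⊤) (h₂ : a₂ ≠ ⊤) (h₃ : a₃ ≠ ⊤) {ε : ENNReal}
    (hε : 0 < ε) : ∃ δ > (0 : ℝ), ∃ s : ℝ, 0 < s ∧ s ≤ 1 ∧ ∀ r : ℝ, r ≤ δ →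
      ENNReal.ofReal s * a₁ + ENNReal.ofReal (4 * s ^ (1 / 4 : ℝ)) * a₂ +
        ENNReal.ofReal (r * s ^ (-(3 / 2) : ℝ)) * a₃ < ε := by
  have c1 : Filter.Tendsto (fun s : ℝ => ENNReal.ofReal s * a₁ +
      ENNReal.ofReal (4 * s ^ (1 / 4 : ℝ)) * a₂) (nhds 0) (nhds 0) := by
    have : Continuous fun s : ℝ => ENNReal.ofReal s * a₁ +
      ENNReal.ofReal (4 * s ^ (1 / 4 : ℝ)) * a₂ := by
      refine Continuous.add ?_ ?_
      · exact (ENNReal.continuous_mul_const h₁).comp ENNReal.continuous_ofReal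
      · exact (ENNReal.continuous_mul_const h₂).comp (ENNReal.continuous_ofReal.comp
          (continuous_const.mul (Real.continuous_rpow_const (by norm_num))))
    have h := this.tendsto 0
    simpa using h
  have ev := (c1.eventually (gt_mem_nhds hε)).filter_mono (nhdsWithin_le_nhds (s := Set.Ioi 0))
  have ev2 : ∀ᶠ s : ℝ in nhdsWithin 0 (Set.Ioi 0), s ≤ 1 :=
    ((gt_mem_nhds one_pos).mono fun s hs => le_of_lt hs : ∀ᶠ s : ℝ in nhds 0, s ≤ 1).filter_mono
      nhdsWithin_le_nhds
  obtain ⟨s, ⟨hs1, hs2⟩, hs0⟩ := ((ev.and ev2).and self_mem_nhdsWithin).exists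
  have c2 : Filter.Tendsto (fun r : ℝ => ENNReal.ofReal s * a₁ +
      ENNReal.ofReal (4 * s ^ (1 / 4 : ℝ)) * a₂ + ENNReal.ofReal (r * s ^ (-(3 / 2) : ℝ)) * a₃)
      (nhds 0) (nhds (ENNReal.ofReal s * a₁ + ENNReal.ofReal (4 * s ^ (1 / 4 : ℝ)) * a₂)) := by
    have : Continuous fun r : ℝ => ENNReal.ofReal s * a₁ +
      ENNReal.ofReal (4 * s ^ (1 / 4 : ℝ)) * a₂ + ENNReal.ofReal (r * s ^ (-(3 / 2) : ℝ)) * a₃ := by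
      refine continuous_const.add ?_
      exact (ENNReal.continuous_mul_const h₃).comp (ENNReal.continuous_ofReal.comp
          (continuous_id.mul continuous_const))
    have h := this.tendsto 0
    simpa using h
  obtain ⟨δ, hδ, hδ0⟩ := (((c2.eventually (gt_mem_nhds hs1)).filter_mono
    (nhdsWithin_le_nhds (s := Set.Ioi 0))).and self_mem_nhdsWithin).exists
  refine ⟨δ, hδ0, s, hs0, hs2, fun r hr => lt_of_le_of_lt ?_ hδ⟩
  gcongr

theorem IsH2.equicontinuous_moll (h : IsH2 b U v g g2) (hU : IsOpen U) {K : Set E3} (hKU : K ⊆ U)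
    (hKo : IsOpen K) (hK : Convex ℝ K) (hbd : Bornology.IsBounded K) {ε : ℝ} (hε : 0 < ε) :
    ∃ δ > (0 : ℝ), ∀ x ∈ K, ∀ y ∈ K, dist x y ≤ δ →
      ∀ᶠ j in Filter.atTop, |moll U v j x - moll U v j y| ≤ ε := by
  rcases K.eq_empty_or_nonempty with rfl | hne
  · exact ⟨1, one_pos, by simp⟩
  obtain ⟨K', m, hK'o, hK'c, hK'K, hev, hnm, hball, hvol⟩ := exists_exhaustion hKo hK hne
  have hfin : volume K ≠ ⊤ := hbd.measure_lt_top.ne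
  have hpos : volume K ≠ 0 := (hKo.measure_pos volume hne).ne'
  obtain ⟨R, hR⟩ := Metric.isBounded_iff.1 hbd
  set w : Fin 3 → ℝ := fun _ => R with hw
  have hwK : ∀ x ∈ K, ∀ y ∈ K, ∀ i, |inner ℝ (b i) (x - y)| ≤ w i := fun x hx y hy i =>
    (abs_real_inner_le_norm _ _).trans (by simpa [hw, dist_eq_norm] using hR hx hy)
  have hw0 : ∀ i, 0 ≤ w i := by
    obtain ⟨x, hx⟩ := hne
    exact fun i => (abs_nonneg _).trans (hwK x hx x hx i)
  have hKhalf : volume K ^ (1 / 2 : ℝ) ≠ 0 := by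
    simp [hpos, hfin]
  have hε' : 0 < volume K ^ (1 / 2 : ℝ) * ENNReal.ofReal ε / 6 := by
    refine ENNReal.div_pos (mul_ne_zero hKhalf (by simpa using hε)) (by simp)
  obtain ⟨δ, hδ, s, hs0, hs1, hs⟩ := exists_modulus (wNorm1_ne_top h.mem1 w)
    (wNorm2_ne_top h.mem2 w w) (wNorm1_ne_top h.mem1 fun _ => 1) hε'
  refine ⟨δ, hδ, fun x hx y hy hxy => ?_⟩
  obtain ⟨n, hn1, hn2⟩ := ((hev x hx).and (hev y hy)).exists
  have hfin' : volume (K' n) ≠ ⊤ := ne_top_of_le_ne_top hfin (measure_mono (hK'K n))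
  filter_upwards [Filter.eventually_ge_atTop (m n)] with j hj
  have hballU : ∀ z ∈ K' n, Metric.closedBall z (bumpSeq j).rOut ⊆ U := fun z hz =>
    (hball n j hj z hz).trans hKU
  have key := enorm_sub_le_smooth_modulus (μ := (volume : Measure E3)) (by simp) (hK'o n) (hK'c n)
    hfin' (v := moll U v j) ((contDiff_moll hU h.mem j).of_le (WithTop.coe_le_coe.2 le_top)) hn1 hn2
    (D0 := fun x => ∑ i, (fun _ => 1 : Fin 3 → ℝ) i * |moll U (g i) j x|)
    (D1 := fun x => ∑ i, w i * |moll U (g i) j x|)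
    (D2 := fun x => ∑ i, ∑ k, w i * w k * |moll U (g2 i k) j x|)
    (continuous_finsetSum _ fun i _ => continuous_const.mul (continuous_moll hU (h.mem1 i) _).abs)
    (continuous_finsetSum _ fun i _ => continuous_const.mul (continuous_moll hU (h.mem1 i) _).abs)
    (continuous_finsetSum _ fun i _ => continuous_finsetSum _ fun k _ =>
      continuous_const.mul (continuous_moll hU (h.mem2 i k) _).abs)
    (fun z hz d => by
      refine (h.fderiv_moll_le hU (hballU z hz) (w := fun _ => ‖d‖)
        (fun i => (abs_real_inner_le_norm _ _).trans (by simp))).trans (le_of_eq ?_)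
      rw [Finset.sum_mul]
      exact Finset.sum_congr rfl fun i _ => by ring)
    (fun z hz p hp q hq => h.fderiv_moll_le hU (hballU z hz)
      (hwK p (hK'K n hp) q (hK'K n hq)))
    (fun z hz p hp q hq => h.fderiv_fderiv_moll_le hU (hK'o n) hballU hz
      (hwK p (hK'K n hp) q (hK'K n hq)) (hwK p (hK'K n hp) q (hK'K n hq))) hs0 hs1
  have key2 : volume K ^ (1 / 2 : ℝ) * ‖moll U v j x - moll U v j y‖ₑ ≤
      volume K ^ (1 / 2 : ℝ) * ENNReal.ofReal ε := by
    refine (rpow_half_le_of_le_eight (hvol n)).trans ((mul_le_mul_right key 3).trans ?_)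
    have b1 := eLpNorm_D1_le hU h.mem1 hw0 j (K' n)
    have b2 := eLpNorm_D2_le hU h.mem2 hw0 hw0 j (K' n)
    have b0 := eLpNorm_D1_le hU h.mem1 (w := fun _ => 1) (fun _ => zero_le_one) j (K' n)
    have b3 := (hs ‖x - y‖ (by rwa [← dist_eq_norm])).le
    have six : (6 : ENNReal) * (volume K ^ (1 / 2 : ℝ) * ENNReal.ofReal ε / 6) =
        volume K ^ (1 / 2 : ℝ) * ENNReal.ofReal ε :=
      ENNReal.mul_div_cancel (by simp) (by simp)
    rw [← six]
    calc _ ≤ 3 * (2 * (ENNReal.ofReal s * wNorm1 U w g +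
          ENNReal.ofReal (4 * s ^ (1 / 4 : ℝ)) * wNorm2 U w w g2) +
          ENNReal.ofReal (‖x - y‖ * s ^ (-(3 / 2) : ℝ)) * wNorm1 U (fun _ => 1) g) := by gcongr
      _ ≤ 3 * (2 * (ENNReal.ofReal s * wNorm1 U w g +
          ENNReal.ofReal (4 * s ^ (1 / 4 : ℝ)) * wNorm2 U w w g2) +
          2 * (ENNReal.ofReal (‖x - y‖ * s ^ (-(3 / 2) : ℝ)) * wNorm1 U (fun _ => 1) g)) := by
          have : ∀ z : ENNReal, z ≤ 2 * z := fun z => le_mul_of_one_le_left' (by norm_num)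
          exact mul_le_mul_right (add_le_add_right (this _) _) _
      _ = 6 * (ENNReal.ofReal s * wNorm1 U w g +
          ENNReal.ofReal (4 * s ^ (1 / 4 : ℝ)) * wNorm2 U w w g2 +
          ENNReal.ofReal (‖x - y‖ * s ^ (-(3 / 2) : ℝ)) * wNorm1 U (fun _ => 1) g) := by
          rw [← mul_add, ← mul_assoc]; norm_num only
      _ ≤ _ := by gcongr
  have key3 := (ENNReal.mul_le_mul_iff_right hKhalf
    (ENNReal.rpow_ne_top_of_nonneg (by norm_num) hfin)).1 key2
  rwa [← ofReal_norm, ENNReal.ofReal_le_ofReal_iff hε.le, Real.norm_eq_abs] at key3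

theorem IsH2.exists_continuous_rep (h : IsH2 b U v g g2) (hU : IsOpen U) :
    ∃ v', v =ᵐ[volume.restrict U] v' ∧ ContinuousOn v' U ∧
      ∀ K ⊆ U, IsOpen K → Convex ℝ K → Bornology.IsBounded K → UniformContinuousOn v' K := by
  have hae := ae_tendsto_moll hU h.mem
  have hdense : ∀ x ∈ U, ∀ δ > (0 : ℝ), ∃ y ∈ U, dist x y ≤ δ ∧
      Filter.Tendsto (fun j => moll U v j y) Filter.atTop (nhds (v y)) := by
    intro x hx δ hδ
    have hO : IsOpen (U ∩ Metric.ball x δ) := hU.inter Metric.isOpen_ball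
    have hne : (volume.restrict U) (U ∩ Metric.ball x δ) ≠ 0 := by
      rw [Measure.restrict_eq_self _ Set.inter_subset_left]
      exact (hO.measure_pos volume ⟨x, hx, Metric.mem_ball_self hδ⟩).ne'
    obtain ⟨y, hy, hy2⟩ := Filter.Frequently.exists (Filter.Frequently.and_eventually
      (frequently_ae_mem_iff.2 hne) hae)
    exact ⟨y, hy.1, by rw [dist_comm]; exact (Metric.mem_ball.1 hy.2).le, hy2⟩
  have hlim : ∀ x ∈ U, ∃ l, Filter.Tendsto (fun j => moll U v j x) Filter.atTop (nhds l) := by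
    intro x hx
    obtain ⟨r, hr, hrU⟩ := Metric.isOpen_iff.1 hU x hx
    refine cauchySeq_tendsto_of_complete (Metric.cauchySeq_iff'.2 fun ε hε => ?_)
    obtain ⟨δ, hδ, H⟩ := h.equicontinuous_moll hU hrU Metric.isOpen_ball (convex_ball x r)
      Metric.isBounded_ball (ε := ε / 4) (by positivity)
    obtain ⟨y, -, hxy, hy⟩ := hdense x hx (min δ (r / 2)) (lt_min hδ (by positivity))
    have hyB : y ∈ Metric.ball x r := by
      rw [Metric.mem_ball, dist_comm]
      linarith [min_le_right δ (r / 2)]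
    have e1 := H x (Metric.mem_ball_self hr) y hyB (hxy.trans (min_le_left _ _))
    have e2 := Metric.tendsto_nhds.1 hy (ε / 4) (by positivity)
    obtain ⟨N, hN⟩ := Filter.eventually_atTop.1 (e1.and e2)
    refine ⟨N, fun n hn => ?_⟩
    have a1 := abs_le.1 (hN n hn).1
    have a2 := abs_le.1 (hN N le_rfl).1
    have a3 := abs_lt.1 (by simpa [Real.dist_eq] using (hN n hn).2)
    have a4 := abs_lt.1 (by simpa [Real.dist_eq] using (hN N le_rfl).2)
    rw [Real.dist_eq, abs_lt]
    constructor <;> linarith [a1.1, a1.2, a2.1, a2.2, a3.1, a3.2, a4.1, a4.2]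
  choose! v' hv' using hlim
  have huc : ∀ K ⊆ U, IsOpen K → Convex ℝ K → Bornology.IsBounded K → UniformContinuousOn v' K := by
    intro K hKU hKo hK hbd
    refine Metric.uniformContinuousOn_iff_le.2 fun ε hε => ?_
    obtain ⟨δ, hδ, H⟩ := h.equicontinuous_moll hU hKU hKo hK hbd hε
    refine ⟨δ, hδ, fun x hx y hy hxy => ?_⟩
    rw [Real.dist_eq]
    exact le_of_tendsto ((hv' x (hKU hx)).sub (hv' y (hKU hy))).abs (H x hx y hy hxy)
  refine ⟨v', ?_, fun x hx => ?_, huc⟩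
  · filter_upwards [hae, ae_restrict_mem hU.measurableSet] with x h1 h2
    exact tendsto_nhds_unique h1 (hv' x h2)
  · obtain ⟨r, hr, hrU⟩ := Metric.isOpen_iff.1 hU x hx
    have := (huc _ hrU Metric.isOpen_ball (convex_ball x r) Metric.isBounded_ball).continuousOn
    exact (this.continuousAt (Metric.ball_mem_nhds x hr)).continuousWithinAt

theorem exists_tendsto_nhdsWithin {S K : Set E3} {f : E3 → ℝ} (hS : IsOpen S)
    (hf : ContinuousOn f S) (hK : UniformContinuousOn f K) {x : E3}
    {O : Set E3} (hO : O ∈ nhds x) (hSO : S ∩ O ⊆ closure K) (hx : x ∈ closure K) :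
    ∃ l, Filter.Tendsto f (nhdsWithin x S) (nhds l) := by
  have hc : Cauchy (Filter.map f (nhdsWithin x K)) := by
    have : (nhdsWithin x K).NeBot := mem_closure_iff_nhdsWithin_neBot.1 hx
    refine (Metric.cauchy_iff).2 ⟨Filter.map_neBot, fun ε hε => ?_⟩
    obtain ⟨δ, hδ, H⟩ := Metric.uniformContinuousOn_iff.1 hK ε hε
    refine ⟨f '' (Metric.ball x (δ / 2) ∩ K), Filter.image_mem_map
      (Filter.inter_mem (nhdsWithin_le_nhds (Metric.ball_mem_nhds x (by positivity))) self_mem_nhdsWithin), ?_⟩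
    rintro _ ⟨y, ⟨hy, hyK⟩, rfl⟩ _ ⟨z, ⟨hz, hzK⟩, rfl⟩
    refine H y hyK z hzK ?_
    have := dist_triangle_right y z x
    rw [Metric.mem_ball] at hy hz
    linarith
  obtain ⟨l, hl⟩ := CompleteSpace.complete hc
  refine ⟨l, Metric.tendsto_nhds.2 fun ε hε => ?_⟩
  obtain ⟨r, hr, hball⟩ := Metric.mem_nhdsWithin_iff.1 (Metric.tendsto_nhds.1
    (show Filter.Tendsto f (nhdsWithin x K) (nhds l) from hl) (ε / 2) (by positivity))
  filter_upwards [self_mem_nhdsWithin, nhdsWithin_le_nhds hO,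
    nhdsWithin_le_nhds (Metric.ball_mem_nhds x hr)] with y hyS hyO hyr
  have hycl := hSO ⟨hyS, hyO⟩
  have hcy : Filter.Tendsto f (nhdsWithin y K) (nhds (f y)) :=
    (hf.continuousAt (hS.mem_nhds hyS)).tendsto.mono_left nhdsWithin_le_nhds
  have : (nhdsWithin y K).NeBot := mem_closure_iff_nhdsWithin_neBot.1 hycl
  have hle : dist (f y) l ≤ ε / 2 := by
    refine le_of_tendsto (hcy.dist tendsto_const_nhds) ?_
    filter_upwards [self_mem_nhdsWithin, nhdsWithin_le_nhds (Metric.isOpen_ball.mem_nhds hyr)]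
      with z hz1 hz2
    exact (show dist (f z) l < ε / 2 from hball ⟨hz2, hz1⟩).le
  linarith

end

noncomputable section

variable {b : OrthonormalBasis (Fin 3) ℝ E3} {U : Set E3} {v : E3 → ℝ} {g : Fin 3 → E3 → ℝ}
  {g2 : Fin 3 → Fin 3 → E3 → ℝ}

/-! ### The trace estimate on a sheared slab -/

/-- The affine parametrization `x ↦ o + L x` of `E3` by the product of the plane and the line. -/
def param (L : (E2 × ℝ) ≃L[ℝ] E3) (o : E3) (x : E2 × ℝ) : E3 := o + L x

theorem param_add (L : (E2 × ℝ) ≃L[ℝ] E3) (o : E3) (x y : E2 × ℝ) :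
    param L (o + L x) y = param L o (x + y) := by
  simp [param, add_assoc]

theorem isOpenMap_param (L : (E2 × ℝ) ≃L[ℝ] E3) (o : E3) : IsOpenMap (param L o) :=
  (isOpenMap_add_left o).comp L.toHomeomorph.isOpenMap

theorem continuous_param (L : (E2 × ℝ) ≃L[ℝ] E3) (o : E3) : Continuous (param L o) :=
  continuous_const.add L.continuous

theorem injective_param (L : (E2 × ℝ) ≃L[ℝ] E3) (o : E3) : Function.Injective (param L o) :=
  (add_right_injective o).comp L.injective

theorem exists_map_param (L : (E2 × ℝ) ≃L[ℝ] E3) : ∃ c : ENNReal, c ≠ 0 ∧ c ≠ ⊤ ∧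
    ∀ o, Measure.map (param L o) (volume : Measure (E2 × ℝ)) = c • (volume : Measure E3) := by
  have h1 : (Measure.map L (volume : Measure (E2 × ℝ))).IsAddHaarMeasure :=
    L.isAddHaarMeasure_map volume
  have hc := Measure.isAddLeftInvariant_eq_smul (Measure.map L (volume : Measure (E2 × ℝ)))
    (volume : Measure E3)
  set c : NNReal := Measure.addHaarScalarFactor (Measure.map L (volume : Measure (E2 × ℝ)))
    (volume : Measure E3)
  have hc0 : c ≠ 0 := (Measure.addHaarScalarFactor_pos_of_isAddHaarMeasure _ _).ne'
  refine ⟨c, by simpa using hc0, by simp, fun o => ?_⟩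
  have : param L o = (fun x => o + x) ∘ L := rfl
  rw [this, ← Measure.map_map (measurable_const_add o) L.continuous.measurable, hc,
    Measure.map_smul, map_add_left_eq_self]
  rfl

theorem map_restrict_param {L : (E2 × ℝ) ≃L[ℝ] E3} {c : ENNReal} {o : E3}
    (h : Measure.map (param L o) (volume : Measure (E2 × ℝ)) = c • (volume : Measure E3))
    {B : Set (E2 × ℝ)} (hB : IsOpen B) :
    Measure.map (param L o) (volume.restrict B) = c • volume.restrict (param L o '' B) := by
  have hm : MeasurableSet (param L o '' B) := (isOpenMap_param L o B hB).measurableSet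
  rw [← Measure.restrict_smul, ← h, Measure.restrict_map (continuous_param L o).measurable hm,
    Set.preimage_image_eq _ (injective_param L o)]

theorem volume_param_image {L : (E2 × ℝ) ≃L[ℝ] E3} {c : ENNReal} {o : E3}
    (h : Measure.map (param L o) (volume : Measure (E2 × ℝ)) = c • (volume : Measure E3))
    {B : Set (E2 × ℝ)} (hB : IsOpen B) : volume B = c * volume (param L o '' B) := by
  have hm : MeasurableSet (param L o '' B) := (isOpenMap_param L o B hB).measurableSet
  rw [← smul_eq_mul, ← Measure.smul_apply, ← h, Measure.map_apply (continuous_param L o).measurable hm,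
    Set.preimage_image_eq _ (injective_param L o)]

theorem eLpNorm_comp_param {L : (E2 × ℝ) ≃L[ℝ] E3} {c : ENNReal} (hc : c ≠ 0) {o : E3}
    (h : Measure.map (param L o) (volume : Measure (E2 × ℝ)) = c • (volume : Measure E3))
    {B : Set (E2 × ℝ)} (hB : IsOpen B) {f : E3 → ℝ} (hf : Continuous f) :
    eLpNorm (fun x => f (param L o x)) 2 (volume.restrict B) =
      c ^ (1 / 2 : ℝ) * eLpNorm f 2 (volume.restrict (param L o '' B)) := by
  have h1 := eLpNorm_map_measure (p := 2) (μ := volume.restrict B) (f := param L o) (g := f)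
    hf.aestronglyMeasurable (continuous_param L o).aemeasurable
  rw [map_restrict_param h hB, eLpNorm_smul_measure_of_ne_zero hc] at h1
  have e : (fun x => f (param L o x)) = f ∘ param L o := rfl
  rw [e, ← h1]
  norm_num

theorem exists_shrink {A : Set E2} (hAo : IsOpen A) (hA : Convex ℝ A) {y z : E2} (hy : y ∈ A)
    (hz : z ∈ A) : ∃ A' ρ, IsOpen A' ∧ Convex ℝ A' ∧ y ∈ A' ∧ z ∈ A' ∧ 0 < ρ ∧
      (∀ x ∈ A', Metric.closedBall x ρ ⊆ A) ∧ volume A ≤ 4 * volume A' := by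
  obtain ⟨ρ, hρ0, hρ⟩ := Metric.nhds_basis_closedBall.mem_iff.1 (hAo.mem_nhds hy)
  have hc : Filter.Tendsto (fun t : ℝ => y + t⁻¹ • (z - y)) (nhds 1) (nhds z) := by
    have := ((Filter.tendsto_id (α := ℝ) (x := nhds 1)).inv₀ one_ne_zero).smul_const (z - y)
      |>.const_add y
    simpa using this
  have e1 := (hc.eventually (hAo.mem_nhds hz)).filter_mono (nhdsWithin_le_nhds (s := Set.Iio 1))
  have e2 : ∀ᶠ t : ℝ in nhdsWithin 1 (Set.Iio 1), 1 / 2 < t :=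
    (lt_mem_nhds (by norm_num : (1 / 2 : ℝ) < 1)).filter_mono nhdsWithin_le_nhds
  obtain ⟨t, ⟨ht, ht2⟩, ht1⟩ := ((e1.and e2).and self_mem_nhdsWithin).exists
  have ht1 : t < 1 := ht1
  have ht0 : 0 < t := by linarith
  have hball : ∀ x ∈ AffineMap.homothety y t '' A, Metric.closedBall x ((1 - t) * ρ) ⊆ A := by
    rintro _ ⟨k, hk, rfl⟩
    exact closedBall_homothety_subset hA ht0.le ht1 hρ hk
  refine ⟨AffineMap.homothety y t '' A, (1 - t) * ρ, AffineMap.homothety_isOpenMap y t ht0.ne' A hAo,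
    hA.affine_image _, ⟨y, hy, by simp⟩, ⟨_, ht, ?_⟩, mul_pos (by linarith) hρ0, hball, ?_⟩
  · rw [AffineMap.homothety_apply, vsub_eq_sub, vadd_eq_add, add_sub_cancel_left,
      smul_inv_smul₀ ht0.ne']
    abel
  · rw [Measure.addHaar_image_homothety]
    have h3 : Module.finrank ℝ E2 = 2 := by simp
    rw [h3, ← mul_assoc]
    refine le_mul_of_one_le_left' ?_
    rw [abs_of_pos (pow_pos ht0 2), show (4 : ENNReal) = ENNReal.ofReal 4 by norm_num,
      ← ENNReal.ofReal_mul (by norm_num), ENNReal.one_le_ofReal]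
    have : (1 / 2 : ℝ) ^ 2 ≤ t ^ 2 := by gcongr
    linarith

theorem IsH2.enorm_sub_le_slab {L : (E2 × ℝ) ≃L[ℝ] E3} {o : E3} {A : Set E2} {H : ℝ} {K : Set E3}
    (hKA : K = param L o '' (A ×ˢ Set.Ioo 0 H)) (h : IsH2 b K v g g2) (hAo : IsOpen A)
    (hA : Convex ℝ A) (hfin : volume A ≠ ⊤) (hc : ContinuousOn v K) {w w2 : Fin 3 → ℝ}
    (hw : ∀ y ∈ A, ∀ z ∈ A, ∀ i, |inner ℝ (b i) (L (y - z, 0))| ≤ w i)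
    (hw2 : ∀ y ∈ A, ∀ z ∈ A, ∀ t ∈ Set.Ioo 0 H, ∀ i, |inner ℝ (b i) (L (y - z, t))| ≤ w2 i)
    (hw2' : ∀ i, |inner ℝ (b i) (L (0, H))| ≤ w2 i) {y z : E2} (hy : y ∈ A) (hz : z ∈ A) {δ : ℝ}
    (hδ : δ ∈ Set.Ioo 0 (H / 4)) :
    volume K ^ (1 / 2 : ℝ) * ‖v (param L o (y, δ)) - v (param L o (z, δ))‖ₑ ≤
      6 * (wNorm1 K w g + 8 * wNorm2 K w w2 g2) := by
  obtain ⟨hδ0, hδH⟩ := hδ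
  have hH : 0 < H := by linarith
  have hw0 : ∀ i, 0 ≤ w i := fun i => (abs_nonneg _).trans (hw y hy y hy i)
  have hw20 : ∀ i, 0 ≤ w2 i := fun i => (abs_nonneg _).trans (hw2' i)
  have hKo : IsOpen K := hKA ▸ isOpenMap_param L o _ (hAo.prod isOpen_Ioo)
  obtain ⟨A', ρ, hA'o, hA'c, hyA, hzA, hρ, hball, hvol⟩ := exists_shrink hAo hA hy hz
  have hA'A : A' ⊆ A := fun x hx => hball x hx (Metric.mem_closedBall_self hρ.le)
  obtain ⟨c, hc0, hct, hmap⟩ := exists_map_param L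
  set o' := o + L (0, δ) with ho'
  set H' := H - 2 * δ with hH'
  have hH'0 : 0 < H' := by linarith
  set B : Set (E2 × ℝ) := A' ×ˢ Set.Ioo 0 H' with hB
  have hBo : IsOpen B := hA'o.prod isOpen_Ioo
  have hpar : ∀ x : E2 × ℝ, param L o' x = param L o (x.1, δ + x.2) := fun x => by
    rw [ho', param_add]; congr 1; ext <;> simp
  have hBK : param L o' '' B ⊆ K := by
    rintro _ ⟨x, hx, rfl⟩
    have h1 := hx.2.1
    have h2 := hx.2.2
    rw [hpar, hKA]
    exact ⟨(x.1, δ + x.2), ⟨hA'A hx.1, by simp only; linarith, by simp only; linarith⟩, rfl⟩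
  have hfin' : volume A' ≠ ⊤ := ne_top_of_le_ne_top hfin (measure_mono hA'A)
  have hvolK : c * volume K ≤ 8 * volume B := by
    rw [hKA, ← volume_param_image (hmap o) (hAo.prod isOpen_Ioo), hB, Measure.volume_eq_prod,
      Measure.prod_prod, Measure.prod_prod, Real.volume_Ioo, Real.volume_Ioo, sub_zero, sub_zero]
    calc volume A * ENNReal.ofReal H ≤ (4 * volume A') * ENNReal.ofReal (2 * H') := by
          gcongr; linarith
      _ = (4 * volume A') * (2 * ENNReal.ofReal H') := by
          rw [ENNReal.ofReal_mul (by norm_num)]; norm_num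
      _ = _ := by ring
  have hnear : ∃ r > 0, ∀ x ∈ B, Metric.closedBall (param L o' x) r ⊆ K := by
    set M := ‖(L.symm : E3 →L[ℝ] E2 × ℝ)‖ with hM
    set r := min ρ (δ / 2) / (M + 1) with hr
    have hM0 : 0 ≤ M := norm_nonneg _
    have hr0 : 0 < r := div_pos (lt_min hρ (by linarith)) (by linarith)
    refine ⟨r, hr0, fun x hx q hq => ?_⟩
    set d := L.symm (q - param L o' x) with hd
    have hdn : ‖d‖ ≤ min ρ (δ / 2) := by
      calc ‖d‖ ≤ M * ‖q - param L o' x‖ := (L.symm : E3 →L[ℝ] E2 × ℝ).le_opNorm _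
        _ ≤ (M + 1) * r := by
          rw [Metric.mem_closedBall, dist_eq_norm] at hq
          gcongr; linarith
        _ = _ := by rw [hr]; field_simp
    have hqe : q = param L o (x.1 + d.1, δ + x.2 + d.2) := by
      have : q = param L o' x + L d := by simp [hd]
      rw [this, hpar, param, param, add_assoc, ← map_add]
      rfl
    have h1 : ‖d.1‖ ≤ ρ := (norm_fst_le d).trans (hdn.trans (min_le_left _ _))
    have h2 : |d.2| ≤ δ / 2 := (norm_snd_le d).trans (hdn.trans (min_le_right _ _))
    rw [hqe, hKA]
    refine ⟨_, ⟨hball x.1 hx.1 (by simpa using h1), ?_, ?_⟩, rfl⟩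
    · have := (abs_le.1 h2).1; have := hx.2.1; simp only; linarith
    · have := (abs_le.1 h2).2; have := hx.2.2; simp only; linarith
  obtain ⟨r, hr, hnear⟩ := hnear
  have hsm : ∀ᶠ j in Filter.atTop, volume K ^ (1 / 2 : ℝ) *
      ‖moll K v j (param L o' (y, 0)) - moll K v j (param L o' (z, 0))‖ₑ ≤
      6 * (wNorm1 K w g + 8 * wNorm2 K w w2 g2) := by
    filter_upwards [tendsto_bumpSeq_rOut.eventually (gt_mem_nhds hr)] with j hj
    have hballs : ∀ q ∈ param L o' '' B, Metric.closedBall q (bumpSeq j).rOut ⊆ K := by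
      rintro _ ⟨x, hx, rfl⟩
      exact (Metric.closedBall_subset_closedBall hj.le).trans (hnear x hx)
    have hVo : IsOpen (param L o' '' B) := isOpenMap_param L o' B hBo
    have hsmooth : ContDiff ℝ 2 (moll K v j) :=
      (contDiff_moll hKo h.mem j).of_le (WithTop.coe_le_coe.2 le_top)
    have hpd : ∀ x, HasFDerivAt (param L o') (L : E2 × ℝ →L[ℝ] E3) x := fun x =>
      L.hasFDerivAt.const_add o'
    have hV : ContDiff ℝ 2 fun x => moll K v j (param L o' x) :=
      hsmooth.comp (contDiff_const.add L.contDiff)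
    have hd1 : fderiv ℝ (fun x => moll K v j (param L o' x)) =
        fun x => (fderiv ℝ (moll K v j) (param L o' x)).comp (L : E2 × ℝ →L[ℝ] E3) := by
      ext1 x
      exact (((hsmooth.differentiable (by norm_num)) _).hasFDerivAt.comp x (hpd x)).fderiv
    have hd2 : ∀ x d d', fderiv ℝ (fderiv ℝ fun x => moll K v j (param L o' x)) x d d' =
        fderiv ℝ (fderiv ℝ (moll K v j)) (param L o' x) (L d) (L d') := by
      intro x d d'
      have hdd : DifferentiableAt ℝ (fderiv ℝ (moll K v j)) (param L o' x) :=
        ((hsmooth.fderiv_right (m := 1) (by norm_num)).differentiable (by norm_num)) _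
      have h0 := (hdd.hasFDerivAt.comp x (hpd x)).clm_comp
        (hasFDerivAt_const (L : E2 × ℝ →L[ℝ] E3) x)
      rw [hd1]
      have h00 := h0.fderiv
      simp only [Function.comp_def] at h00
      rw [h00]
      simp
    set D1 : E3 → ℝ := fun q => ∑ i, w i * |moll K (g i) j q| with hD1
    set D2 : E3 → ℝ := fun q => ∑ i, ∑ k, w i * w2 k * |moll K (g2 i k) j q| with hD2
    have hD1c : Continuous D1 := continuous_finsetSum _ fun i _ => continuous_const.mul
      (continuous_moll hKo (h.mem1 i) _).abs
    have hD2c : Continuous D2 := continuous_finsetSum _ fun i _ => continuous_finsetSum _ fun k _ =>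
      continuous_const.mul (continuous_moll hKo (h.mem2 i k) _).abs
    have key := _root_.enorm_sub_le_slab hA'o hA'c hH'0 hfin' hV hyA hzA
      (D1 := fun x => D1 (param L o' x)) (D2 := fun x => D2 (param L o' x))
      (hD1c.comp (continuous_param L o')) (hD2c.comp (continuous_param L o'))
      (fun x hx p hp q hq => by
        rw [hd1]
        exact h.fderiv_moll_le hKo (hballs _ ⟨x, hx, rfl⟩) (hw p (hA'A hp) q (hA'A hq)))
      (fun x hx p hp q hq t ht => by
        rw [hd2]
        exact h.fderiv_fderiv_moll_le hKo hVo hballs ⟨x, hx, rfl⟩ (hw p (hA'A hp) q (hA'A hq))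
          (hw2 p (hA'A hp) q (hA'A hq) t ⟨ht.1, by linarith [ht.2]⟩))
      (fun x hx p hp q hq => by
        rw [hd2]
        refine h.fderiv_fderiv_moll_le hKo hVo hballs ⟨x, hx, rfl⟩ (hw p (hA'A hp) q (hA'A hq))
          fun i => ?_
        have e : L ((0 : E2), H') = (H' / H) • L (0, H) := by
          rw [← map_smul]; congr 1; ext <;> simp [hH.ne']
        rw [e, inner_smul_right, abs_mul, abs_of_pos (div_pos hH'0 hH)]
        exact (mul_le_of_le_one_left (abs_nonneg _) ((div_le_one hH).2 (by linarith))).trans (hw2' i))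
    rw [eLpNorm_comp_param hc0 (hmap o') hBo hD1c, eLpNorm_comp_param hc0 (hmap o') hBo hD2c] at key
    have key2 := (rpow_half_le_of_le_eight hvolK).trans (mul_le_mul_right key 3)
    rw [ENNReal.mul_rpow_of_nonneg _ _ (by norm_num : (0 : ℝ) ≤ 1 / 2)] at key2
    have hcc : c ^ (1 / 2 : ℝ) ≠ 0 := by simp [hc0, hct]
    have hct' : c ^ (1 / 2 : ℝ) ≠ ⊤ := ENNReal.rpow_ne_top_of_nonneg (by norm_num) hct
    refine (ENNReal.mul_le_mul_iff_right hcc hct').1 ?_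
    rw [← mul_assoc]
    refine key2.trans ?_
    calc _ ≤ 3 * (2 * (c ^ (1 / 2 : ℝ) * wNorm1 K w g + 8 * (c ^ (1 / 2 : ℝ) * wNorm2 K w w2 g2))) := by
          gcongr
          · exact eLpNorm_D1_le hKo h.mem1 hw0 _ _
          · exact eLpNorm_D2_le hKo h.mem2 hw0 hw20 _ _
      _ = _ := by ring
  have hcont : ∀ q ∈ A, Filter.Tendsto (fun j => moll K v j (param L o' (q, 0))) Filter.atTop
      (nhds (v (param L o (q, δ)))) := by
    intro q hq
    have e : param L o' (q, 0) = param L o (q, δ) := by rw [hpar]; simp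
    have hqK : param L o (q, δ) ∈ K := by
      rw [hKA]; exact ⟨_, ⟨hq, hδ0, by simp only; linarith⟩, rfl⟩
    rw [e]
    exact tendsto_moll_of_continuousAt hKo h.mem hqK (hc.continuousAt (hKo.mem_nhds hqK))
  refine le_of_tendsto (ENNReal.Tendsto.const_mul ((hcont y hy).sub (hcont z hz)).enorm
    (Or.inr ?_)) hsm
  refine ENNReal.rpow_ne_top_of_nonneg (by norm_num) fun htop => ?_
  have : volume B ≠ ⊤ := by
    rw [hB, Measure.volume_eq_prod, Measure.prod_prod, Real.volume_Ioo]
    exact ENNReal.mul_ne_top hfin' ENNReal.ofReal_ne_top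
  rw [htop, ENNReal.mul_top hc0, top_le_iff] at hvolK
  exact ENNReal.mul_ne_top (by simp) this hvolK

end

noncomputable section

variable {b : OrthonormalBasis (Fin 3) ℝ E3} {U : Set E3} {v : E3 → ℝ} {g : Fin 3 → E3 → ℝ}
  {g2 : Fin 3 → Fin 3 → E3 → ℝ}

/-! ### Chains of overlapping sets -/

theorem wNorm1_mono {V : Set E3} (h : V ⊆ U) (w : Fin 3 → ℝ) (g : Fin 3 → E3 → ℝ) :
    wNorm1 V w g ≤ wNorm1 U w g :=
  Finset.sum_le_sum fun i _ => by
    gcongr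

theorem wNorm2_mono {V : Set E3} (h : V ⊆ U) (w w' : Fin 3 → ℝ) (g2 : Fin 3 → Fin 3 → E3 → ℝ) :
    wNorm2 V w w' g2 ≤ wNorm2 U w w' g2 :=
  Finset.sum_le_sum fun i _ => Finset.sum_le_sum fun k _ => by
    gcongr

theorem IsH2.eLpNorm_symm (h : IsH2 b U v g g2) (hU : IsOpen U) (i k : Fin 3) :
    eLpNorm (g2 i k) 2 (volume.restrict U) = eLpNorm (g2 k i) 2 (volume.restrict U) :=
  eLpNorm_congr_ae
    (((h.partial2 k i).ae_eq hU (HasWeakPartial.symm_second (h.partial1 i) (h.partial1 k)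
      (h.partial2 i k))).symm)

theorem exists_const_lintegral_sq_le {K : Set E3} (h0 : volume K ≠ 0)
    (hfin : volume K ≠ ⊤) {f : E3 → ℝ}
    (hf : AEStronglyMeasurable f (volume.restrict K)) {W : ENNReal}
    (h : ∫⁻ x in K, (∫⁻ y in K, ‖f y - f x‖ₑ ^ 2) ≤ 8 * volume K * W ^ 2) :
    ∃ c, ∫⁻ y in K, ‖f y - c‖ₑ ^ 2 ≤ 8 * W ^ 2 := by
  by_contra! hcon
  have : IsFiniteMeasure (volume.restrict K) := ⟨by simpa using hfin.lt_top⟩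
  have h1 : ∫⁻ _x in K, 8 * W ^ 2 < ∫⁻ x in K, (∫⁻ y in K, ‖f y - f x‖ₑ ^ 2) := by
    refine lintegral_strict_mono (by simpa using h0) ?_ ?_
      (Filter.Eventually.of_forall fun x => hcon _)
    · exact AEMeasurable.lintegral_prod_right' (f := fun z : E3 × E3 => ‖f z.2 - f z.1‖ₑ ^ 2)
        ((hf.comp_snd.sub hf.comp_fst).enorm.pow_const 2)
    rw [setLIntegral_const]
    refine ENNReal.mul_ne_top ?_ hfin
    exact ((hcon 0).trans_le le_top).ne
  rw [setLIntegral_const] at h1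
  exact absurd h1 (not_lt.2 (h.trans (le_of_eq (by ring))))

theorem enorm_sq_le_two_mul (a b c : ℝ) :
    ‖a - c‖ₑ ^ 2 ≤ 2 * ‖a - b‖ₑ ^ 2 + 2 * ‖b - c‖ₑ ^ 2 := by
  have e : ∀ x : ℝ, ‖x‖ₑ ^ 2 = ENNReal.ofReal (x ^ 2) := fun x => by
    rw [← ofReal_norm, ← ENNReal.ofReal_pow (norm_nonneg _), Real.norm_eq_abs, sq_abs]
  rw [e, e, e, show (2 : ENNReal) = ENNReal.ofReal 2 by norm_num,
    ← ENNReal.ofReal_mul zero_le_two, ← ENNReal.ofReal_mul zero_le_two,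
    ← ENNReal.ofReal_add (by positivity) (by positivity)]
  apply ENNReal.ofReal_le_ofReal
  nlinarith [sq_nonneg (a - b - (b - c))]

theorem lintegral_sq_transfer {K K' : Set E3} (hK : IsOpen K) (hK' : IsOpen K')
    (hne : (K ∩ K').Nonempty) (hfin : volume K' ≠ ⊤) {κ : ENNReal}
    (hκ : volume K' ≤ κ * volume (K ∩ K')) {f : E3 → ℝ}
    (hf : AEStronglyMeasurable f (volume.restrict K)) {W M : ENNReal} {c : ℝ}
    (h : ∫⁻ x in K', (∫⁻ y in K', ‖f y - f x‖ₑ ^ 2) ≤ 8 * volume K' * W ^ 2)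
    (hM : ∫⁻ y in K, ‖f y - c‖ₑ ^ 2 ≤ M) :
    ∫⁻ y in K', ‖f y - c‖ₑ ^ 2 ≤ κ * (16 * W ^ 2 + 2 * M) := by
  have hV0 : volume (K ∩ K') ≠ 0 := ((hK.inter hK').measure_pos volume hne).ne'
  have hVt : volume (K ∩ K') ≠ ⊤ := ne_top_of_le_ne_top hfin (measure_mono Set.inter_subset_right)
  refine (ENNReal.mul_le_mul_iff_right hV0 hVt).1 ?_
  have hfV : AEStronglyMeasurable f (volume.restrict (K ∩ K')) :=
    hf.mono_measure (Measure.restrict_mono Set.inter_subset_left le_rfl)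
  calc volume (K ∩ K') * ∫⁻ y in K', ‖f y - c‖ₑ ^ 2
      = ∫⁻ _x in K ∩ K', (∫⁻ y in K', ‖f y - c‖ₑ ^ 2) := by
        rw [setLIntegral_const, mul_comm]
    _ ≤ ∫⁻ x in K ∩ K', (2 * (∫⁻ y in K', ‖f y - f x‖ₑ ^ 2) + 2 * volume K' * ‖f x - c‖ₑ ^ 2) := by
        refine lintegral_mono fun x => ?_
        calc ∫⁻ y in K', ‖f y - c‖ₑ ^ 2
            ≤ ∫⁻ y in K', (2 * ‖f y - f x‖ₑ ^ 2 + 2 * ‖f x - c‖ₑ ^ 2) :=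
              lintegral_mono fun y => enorm_sq_le_two_mul _ _ _
          _ = _ := by
              rw [lintegral_add_right _ measurable_const, lintegral_const_mul' _ _ (by simp),
                setLIntegral_const]
              ring
    _ = 2 * (∫⁻ x in K ∩ K', (∫⁻ y in K', ‖f y - f x‖ₑ ^ 2)) +
          2 * volume K' * ∫⁻ x in K ∩ K', ‖f x - c‖ₑ ^ 2 := by
        have hm : AEMeasurable (fun x => 2 * volume K' * ‖f x - c‖ₑ ^ 2)
            (volume.restrict (K ∩ K')) :=
          ((hfV.sub aestronglyMeasurable_const).enorm.pow_const 2).const_mul _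
        rw [lintegral_add_right' _ hm, lintegral_const_mul' _ _ (by simp),
          lintegral_const_mul' _ _ (ENNReal.mul_ne_top (by simp) hfin)]
    _ ≤ 2 * (8 * volume K' * W ^ 2) + 2 * volume K' * M := by
        gcongr
        · exact (lintegral_mono_set Set.inter_subset_right).trans h
        · exact (lintegral_mono_set Set.inter_subset_left).trans hM
    _ = volume K' * (16 * W ^ 2 + 2 * M) := by ring
    _ ≤ (κ * volume (K ∩ K')) * (16 * W ^ 2 + 2 * M) := by gcongr
    _ = _ := by ring

/-- Poincaré's inequality on a chain of overlapping convex sets. -/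
theorem poincare_chain {S : Set E3} (hS : IsOpen S) {K : ℕ → Set E3} {n : ℕ}
    (hKo : ∀ i ≤ n, IsOpen (K i)) (hKc : ∀ i ≤ n, Convex ℝ (K i)) (hKS : ∀ i ≤ n, K i ⊆ S)
    (hfin : ∀ i ≤ n, volume (K i) ≠ ⊤)
    (hne' : ∀ i < n, (K i ∩ K (i + 1)).Nonempty)
    {κ : ENNReal} (hκ1 : 1 ≤ κ) (hκ : ∀ i < n, volume (K (i + 1)) ≤ κ * volume (K i ∩ K (i + 1)))
    {w : Fin 3 → ℝ} (hw : ∀ i ≤ n, ∀ x ∈ K i, ∀ y ∈ K i, ∀ l, |inner ℝ (b l) (x - y)| ≤ w l)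
    {f : E3 → ℝ} {f' : Fin 3 → E3 → ℝ} (hf : MemLp f 2 (volume.restrict S))
    (hf' : ∀ i, MemLp (f' i) 2 (volume.restrict S)) (hp : ∀ i, HasWeakPartial S (b i) f (f' i))
    {c : ℝ} (hc : ∫⁻ y in K 0, ‖f y - c‖ₑ ^ 2 ≤ 8 * wNorm1 S w f' ^ 2) :
    ∀ i ≤ n, ∫⁻ y in K i, ‖f y - c‖ₑ ^ 2 ≤ 8 * (4 * κ) ^ n * wNorm1 S w f' ^ 2 := by
  have h1 : ∀ i ≤ n, ∫⁻ y in K i, ‖f y - c‖ₑ ^ 2 ≤ 8 * (4 * κ) ^ i * wNorm1 S w f' ^ 2 := by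
    intro i
    induction i with
    | zero => intro _; simpa using hc
    | succ i ih =>
      intro hi
      have hneK : (K (i + 1)).Nonempty := (hne' i (by omega)).mono Set.inter_subset_right
      have hP := poincare_convex (hKo _ hi) (hKc _ hi) hneK
        (hf.mono_measure (Measure.restrict_mono (hKS _ hi) le_rfl))
        (fun l => (hf' l).mono_measure (Measure.restrict_mono (hKS _ hi) le_rfl))
        (fun l => (hp l).mono hS (hKS _ hi)) (hw _ hi)
      have hP' := hP.trans (by
        gcongr
        exact wNorm1_mono (hKS _ hi) w f' :
          _ ≤ 8 * volume (K (i + 1)) * wNorm1 S w f' ^ 2)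
      refine (lintegral_sq_transfer (hKo i (by omega)) (hKo _ hi) (hne' i (by omega)) (hfin _ hi)
        (hκ i (by omega)) (hf.1.mono_measure (Measure.restrict_mono (hKS i (by omega)) le_rfl)) hP'
        (ih (by omega))).trans ?_
      calc κ * (16 * wNorm1 S w f' ^ 2 + 2 * (8 * (4 * κ) ^ i * wNorm1 S w f' ^ 2))
          = κ * (16 * 1 * wNorm1 S w f' ^ 2 + 16 * (4 * κ) ^ i * wNorm1 S w f' ^ 2) := by ring
        _ ≤ κ * (16 * (4 * κ) ^ i * wNorm1 S w f' ^ 2 + 16 * (4 * κ) ^ i * wNorm1 S w f' ^ 2) := by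
            gcongr
            exact one_le_pow_of_one_le' (hκ1.trans (le_mul_of_one_le_left' (by norm_num))) i
        _ = _ := by ring
  intro i hi
  refine (h1 i hi).trans ?_
  gcongr
  exact hκ1.trans (le_mul_of_one_le_left' (by norm_num))

theorem osc_chain {α : Type*} {v : α → ℝ} {Z : ℕ → Set α} {n : ℕ} {N B : ENNReal}
    (hosc : ∀ i ≤ n, ∀ x ∈ Z i, ∀ y ∈ Z i, N * ‖v x - v y‖ₑ ≤ B)
    (hne : ∀ i < n, (Z i ∩ Z (i + 1)).Nonempty) {x : α} (hx : x ∈ Z 0) :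
    ∀ i ≤ n, ∀ y ∈ Z i, N * ‖v x - v y‖ₑ ≤ (i + 1) * B := by
  intro i
  induction i with
  | zero => intro h y hy; simpa using hosc 0 h x hx y hy
  | succ i ih =>
    intro hi y hy
    obtain ⟨z, hz1, hz2⟩ := hne i (by omega)
    have h1 := ih (by omega) z hz1
    have h2 := hosc _ hi z hz2 y hy
    calc N * ‖v x - v y‖ₑ ≤ N * (‖v x - v z‖ₑ + ‖v z - v y‖ₑ) := by
          gcongr
          rw [← sub_add_sub_cancel (v x) (v z) (v y)]
          exact enorm_add_le _ _
      _ ≤ (i + 1) * B + B := by rw [mul_add]; gcongr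
      _ = _ := by push_cast; ring

/-! ### The endpoint value of the projection on an edge -/

theorem edgeProjValue_sub_le {v : E3 → ℝ} {n m n' m' : E3}
    (h : MemLp (fun s : ℝ => v (AffineMap.lineMap n m s)) 2 (volume.restrict (Set.Icc 0 1)))
    (h' : MemLp (fun s : ℝ => v (AffineMap.lineMap n' m' s)) 2 (volume.restrict (Set.Icc 0 1)))
    {B : ℝ} (hB : ∀ s ∈ Set.Ioo (0 : ℝ) 1,
      |v (AffineMap.lineMap n m s) - v (AffineMap.lineMap n' m' s)| ≤ B) :
    |edgeProjValue v n m - edgeProjValue v n' m'| ≤ 4 * B := by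
  have key : ∀ f : ℝ → ℝ, MemLp f 2 (volume.restrict (Set.Icc 0 1)) →
      IntervalIntegrable f volume 0 1 ∧
      affineL2Proj f 0 = ∫ s in (0 : ℝ)..1, (4 - 6 * s) * f s := by
    intro f hf
    have h1 : Integrable f (volume.restrict (Set.Icc 0 1)) := hf.integrable (by norm_num)
    have hi : IntervalIntegrable f volume 0 1 :=
      (intervalIntegrable_iff_integrableOn_Icc_of_le zero_le_one).2 h1
    have his : IntervalIntegrable (fun s => s * f s) volume 0 1 := hi.continuousOn_mul continuousOn_id
    refine ⟨hi, ?_⟩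
    have e : (fun s => (4 - 6 * s) * f s) = fun s => 4 * f s - 6 * (s * f s) := by ext; ring
    rw [e, intervalIntegral.integral_sub (hi.const_mul 4) (his.const_mul 6),
      intervalIntegral.integral_const_mul, intervalIntegral.integral_const_mul]
    simp [affineL2Proj]
  obtain ⟨i1, e1⟩ := key _ h
  obtain ⟨i2, e2⟩ := key _ h'
  have c : Continuous fun s : ℝ => 4 - 6 * s := by fun_prop
  unfold edgeProjValue
  rw [e1, e2, ← intervalIntegral.integral_sub (i1.continuousOn_mul c.continuousOn)
    (i2.continuousOn_mul c.continuousOn)]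
  have hb : ∀ᵐ s : ℝ, s ∈ Set.uIoc (0 : ℝ) 1 → ‖(4 - 6 * s) * v (AffineMap.lineMap n m s) -
      (4 - 6 * s) * v (AffineMap.lineMap n' m' s)‖ ≤ 4 * B := by
    have h1 : ∀ᵐ s : ℝ, s ≠ 1 := by
      simp [ae_iff, measure_singleton]
    filter_upwards [h1] with s hs1 hs
    rw [Set.uIoc_of_le zero_le_one] at hs
    rw [← mul_sub, norm_mul, Real.norm_eq_abs, Real.norm_eq_abs]
    have hs2 : s < 1 := lt_of_le_of_ne hs.2 hs1
    have h4 : |4 - 6 * s| ≤ 4 := abs_le.2 ⟨by linarith, by linarith [hs.1]⟩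
    exact mul_le_mul h4 (hB s ⟨hs.1, hs2⟩) (abs_nonneg _) (by norm_num)
  have := intervalIntegral.norm_integral_le_of_norm_le_const_ae hb
  simpa using this

theorem edgeProjValue_affine (L : E3 →L[ℝ] ℝ) (c : ℝ) (n m : E3) :
    edgeProjValue (fun x => L x + c) n m = L n + c := by
  have e : ∀ s : ℝ, L (AffineMap.lineMap n m s) + c = (L n + c) + (L m - L n) * s := fun s => by
    rw [AffineMap.lineMap_apply_module']; simp; ring
  have e2 : ∀ s : ℝ, s * ((L n + c) + (L m - L n) * s) = (L n + c) * s + (L m - L n) * s ^ 2 :=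
    fun s => by ring
  have i1 : ∫ s in (0 : ℝ)..1, ((L n + c) + (L m - L n) * s) = (L n + c) + (L m - L n) / 2 := by
    rw [intervalIntegral.integral_add (Continuous.intervalIntegrable (by fun_prop) _ _)
      (Continuous.intervalIntegrable (by fun_prop) _ _),
      intervalIntegral.integral_const_mul _ (fun s => s), integral_id,
      intervalIntegral.integral_const, smul_eq_mul]
    norm_num
    ring
  have i2 : ∫ s in (0 : ℝ)..1, ((L n + c) * s + (L m - L n) * s ^ 2) =
      (L n + c) / 2 + (L m - L n) / 3 := by
    rw [intervalIntegral.integral_add (Continuous.intervalIntegrable (by fun_prop) _ _)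
      (Continuous.intervalIntegrable (by fun_prop) _ _),
      intervalIntegral.integral_const_mul _ (fun s => s),
      intervalIntegral.integral_const_mul _ (fun s => s ^ 2), integral_id, integral_pow]
    norm_num
    ring
  unfold edgeProjValue affineL2Proj
  simp only [e, e2, i1, i2]
  ring

theorem edgeProjValue_sub {v w : E3 → ℝ} {n m : E3}
    (h : MemLp (fun s : ℝ => v (AffineMap.lineMap n m s)) 2 (volume.restrict (Set.Icc 0 1)))
    (h' : MemLp (fun s : ℝ => w (AffineMap.lineMap n m s)) 2 (volume.restrict (Set.Icc 0 1))) :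
    edgeProjValue (fun x => v x - w x) n m = edgeProjValue v n m - edgeProjValue w n m := by
  have key : ∀ f : ℝ → ℝ, MemLp f 2 (volume.restrict (Set.Icc 0 1)) →
      IntervalIntegrable f volume 0 1 ∧ IntervalIntegrable (fun s => s * f s) volume 0 1 := by
    intro f hf
    have h1 : Integrable f (volume.restrict (Set.Icc 0 1)) := hf.integrable (by norm_num)
    have hi : IntervalIntegrable f volume 0 1 :=
      (intervalIntegrable_iff_integrableOn_Icc_of_le zero_le_one).2 h1
    exact ⟨hi, hi.continuousOn_mul continuousOn_id⟩
  obtain ⟨i1, j1⟩ := key _ h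
  obtain ⟨i2, j2⟩ := key _ h'
  unfold edgeProjValue affineL2Proj
  simp only [mul_sub]
  rw [intervalIntegral.integral_sub i1 i2, intervalIntegral.integral_sub j1 j2]
  ring

end

noncomputable section

/-! ### Shape regular triangles in the plane -/

/-- `t` is the set of vertices of a triangle, the sines of whose angles are at least `κ`. -/
structure Fat (κ : ℝ) (t : Finset E2) : Prop where
  card : t.card = 3
  fat : ∀ x ∈ t, ∀ y ∈ t, ∀ z ∈ t, x ≠ y → z ≠ y → x ≠ z →
    κ ^ 2 * (‖x - y‖ ^ 2 * ‖z - y‖ ^ 2) + inner ℝ (x - y) (z - y) ^ 2 ≤ ‖x - y‖ ^ 2 * ‖z - y‖ ^ 2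

theorem mul_norm_le_of_fat {κ : ℝ} {u v : E2} (hv : v ≠ 0)
    (h : κ ^ 2 * (‖u‖ ^ 2 * ‖v‖ ^ 2) + inner ℝ u v ^ 2 ≤ ‖u‖ ^ 2 * ‖v‖ ^ 2) (α β : ℝ) :
    κ * (|α| * ‖u‖) ≤ ‖α • u + β • v‖ := by
  refine abs_le_of_sq_le_sq' ?_ (norm_nonneg _) |>.2
  have hv0 : 0 < ‖v‖ ^ 2 := by positivity
  rw [norm_add_sq_real, norm_smul, norm_smul, inner_smul_left, inner_smul_right, mul_pow, mul_pow,
    mul_pow, Real.norm_eq_abs, Real.norm_eq_abs, sq_abs, mul_pow, sq_abs]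
  simp only [conj_trivial]
  refine le_of_mul_le_mul_right ?_ hv0
  nlinarith [sq_nonneg (β * ‖v‖ ^ 2 + α * inner ℝ u v), sq_nonneg α,
    mul_le_mul_of_nonneg_left h (sq_nonneg α)]

theorem Fat.mul_le {κ : ℝ} {t : Finset E2} (h : Fat κ t) {x y z : E2} (hx : x ∈ t)
    (hy : y ∈ t) (hz : z ∈ t) (hxy : x ≠ y) (hzy : z ≠ y) (hxz : x ≠ z) (α β : ℝ) :
    κ * (|α| * ‖x - y‖) ≤ ‖α • (x - y) + β • (z - y)‖ :=
  mul_norm_le_of_fat (sub_ne_zero.2 hzy) (h.fat x hx y hy z hz hxy hzy hxz) α β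

/-- A triangle with its vertices in a given order. -/
structure Tri (κ : ℝ) where
  B : AffineBasis (Fin 3) ℝ E2
  fat : ∀ i j k, i ≠ j → k ≠ j → i ≠ k → ∀ α β : ℝ,
    κ * (|α| * ‖B i - B j‖) ≤ ‖α • (B i - B j) + β • (B k - B j)‖

theorem Fat.exists_tri {κ : ℝ} (hκ : 0 < κ) {t : Finset E2} (h : Fat κ t) {x y z : E2} (hx : x ∈ t)
    (hy : y ∈ t) (hz : z ∈ t) (hxy : x ≠ y) (hyz : y ≠ z) (hxz : x ≠ z) :
    ∃ T : Tri κ, T.B 0 = x ∧ T.B 1 = y ∧ T.B 2 = z ∧ Set.range T.B = t := by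
  have hind : AffineIndependent ℝ ![x, y, z] := by
    rw [affineIndependent_iff_not_collinear_set, collinear_iff_of_mem (p₀ := y) (by simp)]
    rintro ⟨v, hv⟩
    obtain ⟨r, hr⟩ := hv x (by simp)
    obtain ⟨s, hs⟩ := hv z (by simp)
    have h1 : x - y = r • v := by rw [hr]; simp
    have h2 : z - y = s • v := by rw [hs]; simp
    have p1 : 0 < ‖x - y‖ := norm_pos_iff.2 (sub_ne_zero.2 hxy)
    have p2 : 0 < ‖z - y‖ := norm_pos_iff.2 (sub_ne_zero.2 hyz.symm)
    have := h.fat x hx y hy z hz hxy hyz.symm hxz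
    have e : inner ℝ (x - y) (z - y) ^ 2 = ‖x - y‖ ^ 2 * ‖z - y‖ ^ 2 := by
      rw [h1, h2, inner_smul_left, inner_smul_right, real_inner_self_eq_norm_sq, norm_smul, norm_smul]
      simp only [conj_trivial, Real.norm_eq_abs]
      rw [mul_pow |r|, mul_pow |s|, sq_abs, sq_abs]
      ring
    rw [e] at this
    have : 0 < κ ^ 2 * (‖x - y‖ ^ 2 * ‖z - y‖ ^ 2) := by positivity
    linarith
  have hspan : affineSpan ℝ (Set.range ![x, y, z]) = ⊤ := by
    rw [hind.affineSpan_eq_top_iff_card_eq_finrank_add_one]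
    simp
  have hmem : ∀ i, ![x, y, z] i ∈ t := by
    intro i; fin_cases i <;> simp [hx, hy, hz]
  refine ⟨⟨⟨![x, y, z], hind, hspan⟩, fun i j k hij hkj hik α β => ?_⟩, rfl, rfl, rfl, ?_⟩
  · exact h.mul_le (hmem i) (hmem j) (hmem k) (fun h => hij (hind.injective h))
      (fun h => hkj (hind.injective h)) (fun h => hik (hind.injective h)) α β
  · have hr : Set.range ![x, y, z] = (({x, y, z} : Finset E2) : Set E2) := by
      ext p; simp; tauto
    have hsub : ({x, y, z} : Finset E2) ⊆ t := by
      intro p hp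
      simp only [Finset.mem_insert, Finset.mem_singleton] at hp
      rcases hp with rfl | rfl | rfl <;> assumption
    have := Finset.eq_of_subset_of_card_le hsub (by
      rw [h.card, Finset.card_eq_three.2 ⟨x, y, z, hxy, hxz, hyz, rfl⟩])
    change Set.range ![x, y, z] = t
    rw [hr, this]

namespace Tri

variable {κ : ℝ} (T : Tri κ)

theorem map_eq (f : E2 →ᵃ[ℝ] ℝ) (p : E2) : f p = ∑ i, T.B.coord i p * f (T.B i) := by
  conv_lhs => rw [← T.B.affineCombination_coord_eq_self p]
  rw [Finset.map_affineCombination _ _ _ (T.B.sum_coord_apply_eq_one p),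
    Finset.affineCombination_eq_linear_combination _ _ _ (T.B.sum_coord_apply_eq_one p)]
  rfl

theorem sub_eq (p q : E2) (i j k : Fin 3) (hij : i ≠ j) (hkj : k ≠ j) (hik : i ≠ k) :
    p - q = (T.B.coord i p - T.B.coord i q) • (T.B i - T.B j) +
      (T.B.coord k p - T.B.coord k q) • (T.B k - T.B j) := by
  have h : ∀ p, p = T.B.coord i p • (T.B i - T.B j) + T.B.coord k p • (T.B k - T.B j) + T.B j := by
    intro p
    have h1 := T.B.linear_combination_coord_eq_self p
    have h2 := T.B.sum_coord_apply_eq_one p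
    have hu : (Finset.univ : Finset (Fin 3)) = {i, j, k} := by
      fin_cases i <;> fin_cases j <;> fin_cases k <;> simp_all <;> decide
    rw [hu, Finset.sum_insert (by simp [hij, hik]), Finset.sum_pair hkj.symm] at h1 h2
    conv_lhs => rw [← h1]
    have : T.B.coord j p = 1 - T.B.coord i p - T.B.coord k p := by linarith
    rw [this]
    module
  conv_lhs => rw [h p, h q]
  module

theorem abs_coord_sub_le (p q : E2) {i j : Fin 3} (hij : i ≠ j) :
    κ * (|T.B.coord i p - T.B.coord i q| * ‖T.B i - T.B j‖) ≤ ‖p - q‖ := by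
  obtain ⟨k, hkj, hik⟩ : ∃ k, k ≠ j ∧ i ≠ k := by
    revert i j; decide
  rw [T.sub_eq p q i j k hij hkj hik]
  exact T.fat i j k hij hkj hik _ _

theorem side_pos {i j : Fin 3} (hij : i ≠ j) : 0 < ‖T.B i - T.B j‖ :=
  norm_pos_iff.2 (sub_ne_zero.2 fun h => hij (T.B.ind.injective h))

theorem mem_convexHull_iff {p : E2} :
    p ∈ convexHull ℝ (Set.range T.B) ↔ ∀ i, 0 ≤ T.B.coord i p := by
  rw [T.B.convexHull_eq_nonneg_coord]; rfl

theorem mem_interior_iff {p : E2} :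
    p ∈ interior (convexHull ℝ (Set.range T.B)) ↔ ∀ i, 0 < T.B.coord i p := by
  rw [T.B.interior_convexHull]; rfl

theorem κ_le_one (T : Tri κ) : κ ≤ 1 := by
  have h1 := T.fat 0 1 2 (by decide) (by decide) (by decide) 1 0
  simp only [abs_one, one_mul, one_smul, zero_smul, add_zero] at h1
  exact le_of_mul_le_mul_right (by linarith) (T.side_pos (i := 0) (j := 1) (by decide))

/-- A ball whose radius is small compared to a coordinate at the centre. -/
theorem ball_coord_pos (hκ : 0 < κ) {o : E2} {r s c : ℝ} (i : Fin 3)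
    (hs : ∃ j, i ≠ j ∧ s ≤ ‖T.B i - T.B j‖) (hs0 : 0 < s) (hc : c ≤ T.B.coord i o) (hr : r ≤ κ * s * c)
    {p : E2} (hp : p ∈ Metric.ball o r) : 0 < T.B.coord i p := by
  obtain ⟨j, hij, hj⟩ := hs
  have h1 := T.abs_coord_sub_le p o hij
  rw [Metric.mem_ball, dist_eq_norm] at hp
  have h2 : κ * s * |T.B.coord i p - T.B.coord i o| < κ * s * c := by
    calc κ * s * |T.B.coord i p - T.B.coord i o|
        ≤ κ * (|T.B.coord i p - T.B.coord i o| * ‖T.B i - T.B j‖) := by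
          rw [mul_assoc, mul_comm s]; gcongr
      _ < _ := by linarith
  have h3 := lt_of_mul_lt_mul_left h2 (by positivity)
  have := (abs_lt.1 h3).1
  linarith

/-- Two triangles of a conforming triangulation with a common edge lie on different sides. -/
theorem coord_neg {T T' : Tri κ} (h0 : T.B 0 = T'.B 0) (h1 : T.B 1 = T'.B 1) (h2 : T.B 2 ≠ T'.B 2)
    (hconf : convexHull ℝ (Set.range T.B) ∩ convexHull ℝ (Set.range T'.B) ⊆
      convexHull ℝ (Set.range T.B ∩ Set.range T'.B)) : T.B.coord 2 (T'.B 2) < 0 := by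
  have hz : ∀ p ∈ convexHull ℝ (Set.range T.B ∩ Set.range T'.B), T.B.coord 2 p = 0 := by
    have hsub : Set.range T.B ∩ Set.range T'.B ⊆ {p | T.B.coord 2 p = 0} := by
      rintro p ⟨⟨i, rfl⟩, ⟨j, hj⟩⟩
      have hi : i ≠ 2 := by
        rintro rfl
        fin_cases j
        · exact absurd (T.B.ind.injective (h0.trans hj)) (by decide)
        · exact absurd (T.B.ind.injective (h1.trans hj)) (by decide)
        · exact h2 hj.symm
      simp only [Set.mem_ofPred_eq, AffineBasis.coord_apply, if_neg hi.symm]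
    have hconv : Convex ℝ {p | T.B.coord 2 p = 0} := by
      have : {p | T.B.coord 2 p = 0} = T.B.coord 2 ⁻¹' {0} := rfl
      rw [this]
      exact (convex_singleton 0).affine_preimage _
    exact convexHull_min hsub hconv
  by_contra! hcon
  rcases hcon.eq_or_lt with h | h
  · have := T'.map_eq (T.B.coord 2) (T.B 2)
    rw [Fin.sum_univ_three, ← h, ← h0, ← h1] at this
    simp at this
  · have hcont : ∀ i, Continuous fun ε : ℝ => T.B.coord i
        (AffineMap.lineMap ((1 / 2 : ℝ) • (T.B 0 + T.B 1)) (T'.B 2) ε) := fun i =>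
      (T.B.coord i).continuous_of_finiteDimensional.comp AffineMap.lineMap_continuous
    have hmid : ∀ (S : Tri κ) (i : Fin 3), S.B.coord i ((1 / 2 : ℝ) • (S.B 0 + S.B 1)) =
        1 / 2 * (S.B.coord i (S.B 0) + S.B.coord i (S.B 1)) := by
      intro S i
      have e : (1 / 2 : ℝ) • (S.B 0 + S.B 1) = AffineMap.lineMap (S.B 0) (S.B 1) (1 / 2 : ℝ) := by
        rw [AffineMap.lineMap_apply_module]; module
      rw [e, AffineMap.apply_lineMap, AffineMap.lineMap_apply_module]
      simp only [smul_eq_mul]; ring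
    have hev : ∀ i : Fin 3, i ≠ 2 → ∀ᶠ ε in nhds (0 : ℝ), 0 < T.B.coord i
        (AffineMap.lineMap ((1 / 2 : ℝ) • (T.B 0 + T.B 1)) (T'.B 2) ε) := by
      intro i hi
      refine ((hcont i).tendsto 0).eventually (lt_mem_nhds ?_)
      rw [AffineMap.lineMap_apply_zero, hmid, T.B.coord_apply, T.B.coord_apply]
      fin_cases i <;> simp at hi ⊢
    have ev := ((hev 0 (by decide)).and (hev 1 (by decide))).filter_mono
      (nhdsWithin_le_nhds (s := Set.Ioi 0))
    have ev1 : ∀ᶠ ε : ℝ in nhdsWithin 0 (Set.Ioi 0), ε < 1 :=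
      (gt_mem_nhds one_pos).filter_mono nhdsWithin_le_nhds
    obtain ⟨ε, ⟨⟨a0, a1⟩, hε1⟩, hε0⟩ := ((ev.and ev1).and self_mem_nhdsWithin).exists
    have hε0 : 0 < ε := hε0
    have a2 : T.B.coord 2 (AffineMap.lineMap ((1 / 2 : ℝ) • (T.B 0 + T.B 1)) (T'.B 2) ε) =
        ε * T.B.coord 2 (T'.B 2) := by
      rw [AffineMap.apply_lineMap, AffineMap.lineMap_apply_module, hmid]
      simp
    have m1 : AffineMap.lineMap ((1 / 2 : ℝ) • (T.B 0 + T.B 1)) (T'.B 2) ε ∈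
        convexHull ℝ (Set.range T.B) := by
      rw [T.mem_convexHull_iff]
      intro i
      fin_cases i
      · exact a0.le
      · exact a1.le
      · exact a2.symm ▸ (by positivity)
    have m2 : AffineMap.lineMap ((1 / 2 : ℝ) • (T.B 0 + T.B 1)) (T'.B 2) ε ∈
        convexHull ℝ (Set.range T'.B) := by
      rw [T'.mem_convexHull_iff, h0, h1]
      intro i
      rw [AffineMap.apply_lineMap, AffineMap.lineMap_apply_module, hmid, smul_eq_mul, smul_eq_mul]
      have : 0 ≤ 1 - ε := by linarith
      fin_cases i <;> simp [hε0.le, this]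
    have := hz _ (hconf ⟨m1, m2⟩)
    rw [a2] at this
    have h4 : 0 < ε * T.B.coord 2 (T'.B 2) := mul_pos hε0 h
    linarith

/-- Points near the common edge of two triangles lie in one of them. -/
theorem mem_union_of_coord_nonneg {T T' : Tri κ} (h0 : T.B 0 = T'.B 0) (h1 : T.B 1 = T'.B 1)
    (hneg : T.B.coord 2 (T'.B 2) < 0) {p : E2} (a0 : 0 ≤ T.B.coord 0 p) (a1 : 0 ≤ T.B.coord 1 p)
    (b0 : 0 ≤ T'.B.coord 0 p) (b1 : 0 ≤ T'.B.coord 1 p) :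
    p ∈ convexHull ℝ (Set.range T.B) ∪ convexHull ℝ (Set.range T'.B) := by
  rcases le_or_gt 0 (T.B.coord 2 p) with h | h
  · left
    rw [T.mem_convexHull_iff]
    intro i; fin_cases i <;> assumption
  · right
    rw [T'.mem_convexHull_iff]
    have := T'.map_eq (T.B.coord 2) p
    rw [Fin.sum_univ_three, ← h0, ← h1, T.B.coord_apply_ne (by decide),
      T.B.coord_apply_ne (by decide)] at this
    have h2 : 0 ≤ T'.B.coord 2 p := by
      by_contra! hc
      have := mul_pos_of_neg_of_neg hc hneg
      linarith
    intro i; fin_cases i <;> assumption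

end Tri

end

noncomputable section

/-! ### Chains of triangles in a planar triangulation -/

/-- The triangle with vertices `t`. -/
def hull (t : Finset E2) : Set E2 := convexHull ℝ (t : Set E2)

/-- The triangles of `𝒯` intersect in common vertices or edges only. -/
def Conforming (𝒯 : Finset (Finset E2)) : Prop :=
  ∀ t ∈ 𝒯, ∀ t' ∈ 𝒯, hull t ∩ hull t' ⊆ hull (t ∩ t')

theorem isClosed_hull (t : Finset E2) : IsClosed (hull t) :=
  Set.Finite.isClosed_convexHull ℝ t.finite_toSet

theorem subset_hull {t : Finset E2} {x : E2} (hx : x ∈ t) : x ∈ hull t :=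
  subset_convexHull ℝ _ hx

/-- All sides of the triangle `t` have lengths between `a` and `b`. -/
def SidesIn (t : Finset E2) (a b : ℝ) : Prop :=
  ∀ x ∈ t, ∀ y ∈ t, x ≠ y → a ≤ ‖x - y‖ ∧ ‖x - y‖ ≤ b

theorem Fat.κ_le_one {κ : ℝ} (hκ : 0 < κ) {t : Finset E2} (h : Fat κ t) : κ ≤ 1 := by
  obtain ⟨x, y, z, hxy, hxz, hyz, ht⟩ := Finset.card_eq_three.1 h.card
  obtain ⟨T, -⟩ := h.exists_tri hκ (x := x) (y := y) (z := z) (by simp [ht]) (by simp [ht])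
    (by simp [ht]) hxy hyz hxz
  exact T.κ_le_one

theorem Fat.side_le {κ : ℝ} (hκ : 0 < κ) {t : Finset E2} (h : Fat κ t) {x y p q : E2} (hx : x ∈ t)
    (hy : y ∈ t) (hp : p ∈ t) (hq : q ∈ t) (hxy : x ≠ y) (hpq : p ≠ q) :
    κ * ‖x - y‖ ≤ ‖p - q‖ := by
  have h1 := h.κ_le_one hκ
  have hself : κ * ‖x - y‖ ≤ ‖x - y‖ := mul_le_of_le_one_left (norm_nonneg _) h1
  have key : ∀ x ∈ t, ∀ y ∈ t, ∀ z ∈ t, x ≠ y → z ≠ y → x ≠ z → κ * ‖x - y‖ ≤ ‖x - z‖ := by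
    intro x hx y hy z hz hxy hzy hxz
    have := h.mul_le hx hy hz hxy hzy hxz 1 (-1)
    simp only [abs_one, one_mul, one_smul, neg_smul] at this
    refine this.trans (le_of_eq ?_)
    congr 1; abel
  by_cases h1 : p = x
  · subst h1
    by_cases h2 : q = y
    · subst h2; exact hself
    · exact key _ hx _ hy _ hq hxy h2 hpq
  by_cases h2 : p = y
  · subst h2
    by_cases h3 : q = x
    · subst h3; rwa [norm_sub_rev p q]
    · rw [norm_sub_rev x p]
      exact key _ hy _ hx _ hq hxy.symm h3 hpq
  by_cases h3 : q = x
  · subst h3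
    rw [norm_sub_rev p q]
    exact key _ hx _ hy _ hp hxy h2 (Ne.symm h1)
  by_cases h4 : q = y
  · subst h4
    rw [norm_sub_rev p q, norm_sub_rev x q]
    exact key _ hy _ hx _ hp hxy.symm h1 (Ne.symm h2)
  exfalso
  have hsub : ({x, y, p, q} : Finset E2) ⊆ t := by
    intro a ha
    simp only [Finset.mem_insert, Finset.mem_singleton] at ha
    rcases ha with rfl | rfl | rfl | rfl <;> assumption
  have hc := Finset.card_le_card hsub
  rw [h.card, Finset.card_insert_of_notMem (by simp [hxy, Ne.symm h1, Ne.symm h3]),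
    Finset.card_insert_of_notMem (by simp [Ne.symm h2, Ne.symm h4]), Finset.card_pair hpq] at hc
  omega

theorem Fat.sidesIn {κ : ℝ} (hκ : 0 < κ) {t : Finset E2} (h : Fat κ t) {x y : E2} (hx : x ∈ t)
    (hy : y ∈ t) (hxy : x ≠ y) {a b : ℝ} (ha : a ≤ ‖x - y‖) (hb : ‖x - y‖ ≤ b) :
    SidesIn t (κ * a) (κ⁻¹ * b) := fun p hp q hq hpq =>
  ⟨(mul_le_mul_of_nonneg_left ha hκ.le).trans (h.side_le hκ hx hy hp hq hxy hpq), by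
    rw [le_inv_mul_iff₀ hκ]
    exact (h.side_le hκ hp hq hx hy hpq hxy).trans hb⟩

theorem Fat.exists_ball {κ : ℝ} (hκ : 0 < κ) {t : Finset E2} (h : Fat κ t) {a b : ℝ}
    (hs : SidesIn t a b) (ha : 0 < a) : ∃ o, Metric.ball o (κ * a / 3) ⊆ interior (hull t) := by
  obtain ⟨x, y, z, hxy, hxz, hyz, ht⟩ := Finset.card_eq_three.1 h.card
  obtain ⟨T, h0, h1, h2, hr⟩ := h.exists_tri hκ (x := x) (y := y) (z := z) (by simp [ht])
    (by simp [ht]) (by simp [ht]) hxy hyz hxz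
  have hT : ∀ i, T.B i ∈ t := fun i => by
    have : T.B i ∈ (t : Set E2) := hr ▸ Set.mem_range_self i
    exact this
  refine ⟨Finset.univ.centroid ℝ T.B, fun p hp => ?_⟩
  rw [hull, ← hr, T.mem_interior_iff]
  intro i
  obtain ⟨j, hij⟩ := exists_ne i
  refine T.ball_coord_pos hκ (s := a) (c := 1 / 3) i ⟨j, hij.symm, ?_⟩ ha ?_ (by linarith) hp
  · exact (hs _ (hT i) _ (hT j) fun h => hij.symm (T.B.ind.injective h)).1
  · rw [T.B.coord_apply_centroid (Finset.mem_univ i)]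
    norm_num

/-- Barycentric coordinates of two triangles with the common side `[x, y]`. -/
theorem Fat.exists_tri_pair {κ : ℝ} (hκ : 0 < κ) {t t' : Finset E2} (h : Fat κ t) (h' : Fat κ t')
    (hne : t ≠ t') (hconf : hull t ∩ hull t' ⊆ hull (t ∩ t')) {x y : E2} (hx : x ∈ t ∩ t')
    (hy : y ∈ t ∩ t') (hxy : x ≠ y) : ∃ T T' : Tri κ, T.B 0 = x ∧ T.B 1 = y ∧ T'.B 0 = x ∧
      T'.B 1 = y ∧ Set.range T.B = t ∧ Set.range T'.B = t' ∧ T.B.coord 2 (T'.B 2) < 0 := by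
  rw [Finset.mem_inter] at hx hy
  have third : ∀ s : Finset E2, s.card = 3 → x ∈ s → y ∈ s → ∃ z ∈ s, x ≠ z ∧ y ≠ z := by
    intro s hs hx hy
    have : ((s.erase x).erase y).Nonempty := by
      rw [← Finset.card_pos, Finset.card_erase_of_mem (Finset.mem_erase.2 ⟨hxy.symm, hy⟩),
        Finset.card_erase_of_mem hx, hs]
      norm_num
    obtain ⟨z, hz⟩ := this
    simp only [Finset.mem_erase] at hz
    exact ⟨z, hz.2.2, Ne.symm hz.2.1, Ne.symm hz.1⟩
  obtain ⟨z, hz, hxz, hyz⟩ := third t h.card hx.1 hy.1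
  obtain ⟨z', hz', hxz', hyz'⟩ := third t' h'.card hx.2 hy.2
  obtain ⟨T, h0, h1, h2, hr⟩ := h.exists_tri hκ hx.1 hy.1 hz hxy hyz hxz
  obtain ⟨T', h0', h1', h2', hr'⟩ := h'.exists_tri hκ hx.2 hy.2 hz' hxy hyz' hxz'
  have hzz : T.B 2 ≠ T'.B 2 := by
    intro hEq
    refine hne (Finset.coe_injective ?_)
    rw [← hr, ← hr']
    congr 1
    ext i
    fin_cases i
    · simp only [Fin.zero_eta]; rw [h0, h0']
    · simp only [Fin.mk_one]; rw [h1, h1']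
    · exact congrFun (congrArg _ hEq) _
  refine ⟨T, T', h0, h1, h0', h1', hr, hr', Tri.coord_neg (h0.trans h0'.symm) (h1.trans h1'.symm) hzz (by
    rw [hr, hr', ← Finset.coe_inter]; exact hconf)⟩

theorem Fat.exists_link {κ : ℝ} (hκ : 0 < κ) {t t' : Finset E2} (h : Fat κ t) (h' : Fat κ t')
    (hne : t ≠ t') (hconf : hull t ∩ hull t' ⊆ hull (t ∩ t')) (hadj : 2 ≤ (t ∩ t').card)
    {a b : ℝ} (hs : SidesIn t a b) (hs' : SidesIn t' a b) (ha : 0 < a) :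
    ∃ m, Metric.ball m (κ * a / 2) ⊆ hull t ∪ hull t' ∧
      (∃ o, Metric.ball o (κ ^ 2 * a ^ 2 / (4 * b)) ⊆
        Metric.ball m (κ * a / 2) ∩ interior (hull t)) ∧
      ∃ o, Metric.ball o (κ ^ 2 * a ^ 2 / (4 * b)) ⊆
        Metric.ball m (κ * a / 2) ∩ interior (hull t') := by
  obtain ⟨x, hx, y, hy, hxy⟩ := Finset.one_lt_card.1 hadj
  obtain ⟨T, T', h0, h1, h0', h1', hr, hr', hneg⟩ := h.exists_tri_pair hκ h' hne hconf hx hy hxy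
  rw [Finset.mem_inter] at hx hy
  have hT2 : ∀ (S : Tri κ) (s : Finset E2), S.B 0 = x → S.B 1 = y → Set.range S.B = s →
      S.B 2 ∈ s ∧ x ≠ S.B 2 ∧ y ≠ S.B 2 := by
    intro S s e0 e1 er
    have := S.B.ind.injective
    refine ⟨by rw [← Finset.mem_coe, ← er]; exact ⟨2, rfl⟩, ?_, ?_⟩
    · rw [← e0]; exact this.ne (by decide)
    · rw [← e1]; exact this.ne (by decide)
  obtain ⟨hz, hxz, hyz⟩ := hT2 T t h0 h1 hr
  obtain ⟨hz', hxz', hyz'⟩ := hT2 T' t' h0' h1' hr'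
  have hb : 0 < b := ha.trans_le ((hs x hx.1 y hy.1 hxy).1.trans (hs x hx.1 y hy.1 hxy).2)
  have hab : a ≤ b := (hs x hx.1 y hy.1 hxy).1.trans (hs x hx.1 y hy.1 hxy).2
  have hκ1 := T.κ_le_one
  have hκa : κ * a ≤ b := (mul_le_of_le_one_left ha.le hκ1).trans hab
  set m : E2 := (1 / 2 : ℝ) • (x + y) with hm
  have hmcoord : ∀ (S : Tri κ), S.B 0 = x → S.B 1 = y → ∀ i, S.B.coord i m =
      1 / 2 * (S.B.coord i (S.B 0) + S.B.coord i (S.B 1)) := by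
    intro S e0 e1 i
    have e : m = AffineMap.lineMap (S.B 0) (S.B 1) (1 / 2 : ℝ) := by
      rw [AffineMap.lineMap_apply_module, e0, e1, hm]; module
    rw [e, AffineMap.apply_lineMap, AffineMap.lineMap_apply_module]
    simp only [smul_eq_mul]; ring
  have main : ∀ (S : Tri κ) (s : Finset E2) (w : E2), w ∈ s → x ∈ s → y ∈ s → S.B 0 = x → S.B 1 = y →
      S.B 2 = w → Set.range S.B = s → x ≠ w → y ≠ w → SidesIn s a b →
      (∀ p ∈ Metric.ball m (κ * a / 2), 0 < S.B.coord 0 p ∧ 0 < S.B.coord 1 p) ∧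
      ∃ o, Metric.ball o (κ ^ 2 * a ^ 2 / (4 * b)) ⊆
        Metric.ball m (κ * a / 2) ∩ interior (hull s) := by
    intro S s w hw hx hy e0 e1 e2 er hxw hyw hs
    have side : ∀ i, ∃ j, i ≠ j ∧ a ≤ ‖S.B i - S.B j‖ := by
      have hT : ∀ i, S.B i ∈ s := fun i => by
        have : S.B i ∈ (s : Set E2) := er ▸ Set.mem_range_self i
        exact this
      intro i
      obtain ⟨j, hij⟩ := exists_ne i
      exact ⟨j, hij.symm, (hs _ (hT i) _ (hT j) fun h => hij.symm (S.B.ind.injective h)).1⟩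
    constructor
    · intro p hp
      constructor
      · refine S.ball_coord_pos hκ (s := a) (c := 1 / 2) 0 (side 0) ha ?_ (by linarith) hp
        rw [hmcoord S e0 e1]; simp
      · refine S.ball_coord_pos hκ (s := a) (c := 1 / 2) 1 (side 1) ha ?_ (by linarith) hp
        rw [hmcoord S e0 e1]; simp
    · set ε := κ * a / (4 * b) with hε
      have hε0 : 0 < ε := by positivity
      have hε1 : ε ≤ 1 / 4 := by
        rw [hε, div_le_iff₀ (by positivity)]; linarith
      set o := AffineMap.lineMap m w ε with ho
      have hwm : ‖w - m‖ ≤ b := by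
        have e : w - m = (1 / 2 : ℝ) • ((w - x) + (w - y)) := by rw [hm]; module
        rw [e, norm_smul]
        have := norm_add_le (w - x) (w - y)
        have a1 := (hs w hw x hx hxw.symm).2
        have a2 := (hs w hw y hy hyw.symm).2
        norm_num
        linarith
      have hρ : κ ^ 2 * a ^ 2 / (4 * b) = κ * a * ε := by rw [hε]; ring
      have hom : dist o m ≤ κ * a / 4 := by
        rw [ho, dist_lineMap_left, dist_eq_norm, norm_sub_rev, Real.norm_of_nonneg hε0.le]
        calc ε * ‖w - m‖ ≤ ε * b := by gcongr
          _ = κ * a / 4 := by rw [hε]; field_simp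
      refine ⟨o, fun p hp => ⟨?_, ?_⟩⟩
      · rw [Metric.mem_ball] at hp ⊢
        have : κ ^ 2 * a ^ 2 / (4 * b) ≤ κ * a / 4 := by
          rw [hρ]; nlinarith [mul_pos hκ ha]
        linarith [dist_triangle p o m]
      · rw [hull, ← er, S.mem_interior_iff]
        intro i
        refine S.ball_coord_pos hκ (s := a) (c := ε) i (side i) ha ?_ hρ.le hp
        rw [ho, AffineMap.apply_lineMap, AffineMap.lineMap_apply_module, hmcoord S e0 e1, smul_eq_mul,
          smul_eq_mul, ← e2]
        fin_cases i
        · simp; linarith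
        · simp; linarith
        · simp
  obtain ⟨c1, o1⟩ := main T t _ hz hx.1 hy.1 h0 h1 rfl hr hxz hyz hs
  obtain ⟨c2, o2⟩ := main T' t' _ hz' hx.2 hy.2 h0' h1' rfl hr' hxz' hyz' hs'
  refine ⟨m, fun p hp => ?_, o1, o2⟩
  have := Tri.mem_union_of_coord_nonneg (h0.trans h0'.symm) (h1.trans h1'.symm) hneg
    (c1 p hp).1.le (c1 p hp).2.le (c2 p hp).1.le (c2 p hp).2.le
  rwa [hr, hr'] at this

/-- Adjacency of the triangles of `𝒯`: they have a common edge. -/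
def edgeGraph (𝒯 : Finset (Finset E2)) : SimpleGraph 𝒯 where
  Adj t t' := t ≠ t' ∧ 2 ≤ (t.1 ∩ t'.1).card
  symm := ⟨fun t t' h => ⟨h.1.symm, by rw [Finset.inter_comm]; exact h.2⟩⟩
  loopless := ⟨fun t h => h.1 rfl⟩

theorem edgeGraph_reachable {𝒯 : Finset (Finset E2)} (hconf : Conforming 𝒯)
    (hcard : ∀ t ∈ 𝒯, t.card = 3) {U : Set E2} (hU : IsOpen U) (hUc : IsPreconnected U)
    (hcov : U ⊆ ⋃ t ∈ 𝒯, hull t) (hmeet : ∀ t ∈ 𝒯, (U ∩ hull t).Nonempty) (t₀ t₁ : 𝒯) :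
    (edgeGraph 𝒯).Reachable t₀ t₁ := by
  by_contra hcon
  set F₁ : Set E2 := ⋃ t ∈ {t : 𝒯 | (edgeGraph 𝒯).Reachable t₀ t}, hull t.1 with hF₁
  set F₂ : Set E2 := ⋃ t ∈ {t : 𝒯 | ¬ (edgeGraph 𝒯).Reachable t₀ t}, hull t.1 with hF₂
  have hc₁ : IsClosed F₁ := (Set.toFinite _).isClosed_biUnion fun t _ => isClosed_hull _
  have hc₂ : IsClosed F₂ := (Set.toFinite _).isClosed_biUnion fun t _ => isClosed_hull _
  have hcov' : U ⊆ F₁ ∪ F₂ := by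
    intro x hx
    obtain ⟨t, ht, hxt⟩ := Set.mem_iUnion₂.1 (hcov hx)
    by_cases h : (edgeGraph 𝒯).Reachable t₀ ⟨t, ht⟩
    · exact Or.inl (Set.mem_iUnion₂.2 ⟨⟨t, ht⟩, h, hxt⟩)
    · exact Or.inr (Set.mem_iUnion₂.2 ⟨⟨t, ht⟩, h, hxt⟩)
  have vertex : ∀ x ∈ F₁ ∩ F₂, ∃ t t' : 𝒯, (edgeGraph 𝒯).Reachable t₀ t ∧
      ¬ (edgeGraph 𝒯).Reachable t₀ t' ∧ x ∈ t.1 ∧ x ∈ t'.1 := by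
    rintro x ⟨h1, h2⟩
    obtain ⟨t, ht, hxt⟩ := Set.mem_iUnion₂.1 h1
    obtain ⟨t', ht', hxt'⟩ := Set.mem_iUnion₂.1 h2
    have hna : ¬ (edgeGraph 𝒯).Adj t t' := fun h => ht' (SimpleGraph.Reachable.trans ht h.reachable)
    have hne : t ≠ t' := fun h => ht' (h ▸ ht)
    have hc : (t.1 ∩ t'.1).card ≤ 1 := by
      by_contra! h
      exact hna ⟨hne, h⟩
    have hx := hconf _ t.2 _ t'.2 ⟨hxt, hxt'⟩
    have : x ∈ t.1 ∩ t'.1 := by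
      rcases Finset.card_le_one_iff_subset_singleton.1 hc with ⟨p, hp⟩
      rcases Finset.subset_singleton_iff.1 hp with h | h
      · rw [h] at hx; simp [hull] at hx
      · rw [h] at hx ⊢; simpa [hull] using hx
    rw [Finset.mem_inter] at this
    exact ⟨t, t', ht, ht', this.1, this.2⟩
  obtain ⟨V, hVU, hV⟩ := isPreconnected_closed_iff.1 hUc F₁ F₂ hc₁ hc₂ hcov'
    (by
      obtain ⟨x, hx, hx'⟩ := hmeet t₀.1 t₀.2
      exact ⟨x, hx, Set.mem_iUnion₂.2 ⟨t₀, SimpleGraph.Reachable.refl _, hx'⟩⟩)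
    (by
      obtain ⟨x, hx, hx'⟩ := hmeet t₁.1 t₁.2
      exact ⟨x, hx, Set.mem_iUnion₂.2 ⟨t₁, hcon, hx'⟩⟩)
  obtain ⟨t, t', ht, ht', hVt, hVt'⟩ := vertex V hV
  set 𝒱 : Set E2 := ((𝒯.biUnion id : Finset E2) : Set E2) with h𝒱
  have hev : U ∩ (𝒱 \ {V})ᶜ ∈ nhds V := by
    refine Filter.inter_mem (hU.mem_nhds hVU) ?_
    exact (((𝒯.biUnion id).finite_toSet.subset Set.sdiff_subset).isClosed.isOpen_compl).mem_nhds
      (by simp)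
  obtain ⟨r, hr, hball⟩ := Metric.nhds_basis_ball.mem_iff.1 hev
  have hsph : Metric.sphere V (r / 2) ⊆ Metric.ball V r := fun p hp => by
    rw [Metric.mem_sphere] at hp; rw [Metric.mem_ball]; linarith
  have hsc : IsPreconnected (Metric.sphere V (r / 2)) := isPreconnected_sphere (by
    rw [← Module.finrank_eq_rank]; norm_num) V (r / 2)
  have hsm : ∀ s ∈ 𝒯, V ∈ s → (Metric.sphere V (r / 2) ∩ hull s).Nonempty := by
    intro s hs hVs
    obtain ⟨y, hy, hyV⟩ := Finset.exists_mem_ne (by rw [hcard s hs]; norm_num) V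
    have hyr : r ≤ dist V y := by
      by_contra! h
      have := (hball (show y ∈ Metric.ball V r by rwa [Metric.mem_ball, dist_comm])).2
      exact this ⟨Finset.mem_biUnion.2 ⟨s, hs, hy⟩, hyV⟩
    have hd : 0 < dist V y := hr.trans_le hyr
    refine ⟨AffineMap.lineMap V y (r / 2 / dist V y), ?_, ?_⟩
    · rw [Metric.mem_sphere, dist_lineMap_left, Real.norm_of_nonneg (by positivity)]
      field_simp
    · refine (convex_convexHull ℝ (s : Set E2)).segment_subset (subset_hull hVs) (subset_hull hy) ?_
      rw [segment_eq_image_lineMap]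
      exact ⟨_, ⟨by positivity, by rw [div_le_one hd]; linarith⟩, rfl⟩
  obtain ⟨p, hp, hpF⟩ := isPreconnected_closed_iff.1 hsc F₁ F₂ hc₁ hc₂
    ((hsph.trans (fun q hq => (hball hq).1)).trans hcov')
    (by
      obtain ⟨x, hx, hx'⟩ := hsm t.1 t.2 hVt
      exact ⟨x, hx, Set.mem_iUnion₂.2 ⟨t, ht, hx'⟩⟩)
    (by
      obtain ⟨x, hx, hx'⟩ := hsm t'.1 t'.2 hVt'
      exact ⟨x, hx, Set.mem_iUnion₂.2 ⟨t', ht', hx'⟩⟩)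
  obtain ⟨s, -, -, -, hps, -⟩ := vertex p hpF
  refine (hball (hsph hp)).2 ⟨Finset.mem_biUnion.2 ⟨s.1, s.2, hps⟩, ?_⟩
  rintro rfl
  rw [Metric.mem_sphere, dist_self] at hp
  linarith

end

noncomputable section

theorem Conforming.eq_of_mem_interior {𝒯 : Finset (Finset E2)} (hconf : Conforming 𝒯) {κ : ℝ}
    (hκ : 0 < κ) (hfat : ∀ t ∈ 𝒯, Fat κ t) {t t' : Finset E2} (ht : t ∈ 𝒯) (ht' : t' ∈ 𝒯) {p : E2}
    (hp : p ∈ interior (hull t)) (hp' : p ∈ hull t') : t = t' := by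
  have hpi := hconf t ht t' ht' ⟨interior_subset hp, hp'⟩
  refine Finset.eq_of_subset_of_card_le (fun z hz => ?_)
    (by rw [(hfat t ht).card, (hfat t' ht').card])
  by_contra hz'
  obtain ⟨x, hx, hxz⟩ := Finset.exists_mem_ne (by rw [(hfat t ht).card]; norm_num : 1 < t.card) z
  have : ((t.erase z).erase x).Nonempty := by
    rw [← Finset.card_pos, Finset.card_erase_of_mem (Finset.mem_erase.2 ⟨hxz, hx⟩),
      Finset.card_erase_of_mem hz, (hfat t ht).card]
    norm_num
  obtain ⟨y, hy⟩ := this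
  simp only [Finset.mem_erase] at hy
  obtain ⟨T, h0, h1, h2, hr⟩ := (hfat t ht).exists_tri hκ hx hy.2.2 hz (Ne.symm hy.1) hy.2.1 hxz
  have hpos := T.mem_interior_iff.1 (by rw [hr]; exact hp) 2
  have hsub : ((t ∩ t' : Finset E2) : Set E2) ⊆ T.B.coord 2 ⁻¹' {0} := by
    intro q hq
    rw [Finset.coe_inter] at hq
    have hq1 : q ∈ Set.range T.B := hr ▸ hq.1
    obtain ⟨i, rfl⟩ := hq1
    have hi : (2 : Fin 3) ≠ i := by
      rintro rfl
      exact hz' (h2 ▸ hq.2)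
    simp [T.B.coord_apply_ne hi]
  have := convexHull_min hsub ((convex_singleton 0).affine_preimage _) hpi
  rw [Set.mem_preimage, Set.mem_singleton_iff] at this
  linarith

/-- The number of triangles with a given vertex is bounded. -/
theorem Conforming.card_filter_mem_le {𝒯 : Finset (Finset E2)} (hconf : Conforming 𝒯) {κ : ℝ}
    (hκ : 0 < κ) (hfat : ∀ t ∈ 𝒯, Fat κ t) (V : E2) :
    ((𝒯.filter (V ∈ ·)).card : ℝ) * κ ^ 2 ≤ 9 := by
  have hev : ∀ᶠ r : ℝ in nhdsWithin 0 (Set.Ioi 0), ∀ t ∈ 𝒯, ∀ x ∈ t, ∀ y ∈ t, x ≠ y →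
      4 * r ≤ ‖x - y‖ := by
    refine (Filter.eventually_all_finset 𝒯).2 fun t _ => (Filter.eventually_all_finset t).2 fun x _ =>
      (Filter.eventually_all_finset t).2 fun y _ => ?_
    by_cases hxy : x = y
    · simp [hxy]
    have hpos : 0 < ‖x - y‖ / 4 := by
      have := norm_pos_iff.2 (sub_ne_zero.2 hxy)
      positivity
    filter_upwards [nhdsWithin_le_nhds (gt_mem_nhds hpos)] with r hr _
    linarith [show r < ‖x - y‖ / 4 from hr]
  obtain ⟨r, hr, hr0⟩ := (hev.and self_mem_nhdsWithin).exists
  have hr0 : 0 < r := hr0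
  have hball : ∀ t ∈ 𝒯.filter (V ∈ ·), ∃ o, Metric.ball o (κ * r) ⊆ interior (hull t) ∧
      Metric.ball o (κ * r) ⊆ Metric.ball V (3 * r) := by
    intro t ht
    obtain ⟨ht, hV⟩ := Finset.mem_filter.1 ht
    obtain ⟨x, hx, hxV⟩ := Finset.exists_mem_ne (by rw [(hfat t ht).card]; norm_num : 1 < t.card) V
    have : ((t.erase V).erase x).Nonempty := by
      rw [← Finset.card_pos, Finset.card_erase_of_mem (Finset.mem_erase.2 ⟨hxV, hx⟩),
        Finset.card_erase_of_mem hV, (hfat t ht).card]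
      norm_num
    obtain ⟨y, hy⟩ := this
    simp only [Finset.mem_erase] at hy
    obtain ⟨T, h0, h1, h2, hrg⟩ := (hfat t ht).exists_tri hκ hV hx hy.2.2 (Ne.symm hxV) (Ne.symm hy.1)
      (Ne.symm hy.2.1)
    have hκ1 := T.κ_le_one
    set a := ‖T.B 1 - T.B 0‖ with ha
    set c := ‖T.B 2 - T.B 0‖ with hc
    have ha4 : 4 * r ≤ a := by rw [ha, h0, h1]; exact hr t ht x hx V hV hxV
    have hc4 : 4 * r ≤ c := by rw [hc, h0, h2]; exact hr t ht y hy.2.2 V hV hy.2.1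
    have ha0 : 0 < a := by linarith
    have hc0 : 0 < c := by linarith
    set o := (r / a) • (T.B 1 - T.B 0) + (r / c) • (T.B 2 - T.B 0) + T.B 0 with ho
    have hco : ∀ i, T.B.coord i o = (r / a) * (T.B.coord i (T.B 1) - T.B.coord i (T.B 0)) +
        (r / c) * (T.B.coord i (T.B 2) - T.B.coord i (T.B 0)) + T.B.coord i (T.B 0) := by
      intro i
      have e : ∀ v q : E2, T.B.coord i (v + q) = (T.B.coord i).linear v + T.B.coord i q := fun v q => by
        rw [← vadd_eq_add, AffineMap.map_vadd]; rfl
      have e2 : ∀ p q : E2, (T.B.coord i).linear (p - q) = T.B.coord i p - T.B.coord i q :=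
        fun p q => by rw [← vsub_eq_sub, AffineMap.linearMap_vsub]; rfl
      rw [ho, e, map_add, map_smul, map_smul, e2, e2]
      simp
    have hra : r / a ≤ 1 / 4 := by rw [div_le_iff₀ ha0]; linarith
    have hrc : r / c ≤ 1 / 4 := by rw [div_le_iff₀ hc0]; linarith
    refine ⟨o, fun p hp => ?_, fun p hp => ?_⟩
    · rw [hull, ← hrg, T.mem_interior_iff]
      intro i
      fin_cases i
      · refine T.ball_coord_pos hκ (s := a) (c := 1 / 2) 0 ⟨1, by decide, by rw [norm_sub_rev]⟩ ha0
          ?_ (by nlinarith) hp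
        rw [hco]; simp; linarith
      · refine T.ball_coord_pos hκ (s := a) (c := r / a) 1 ⟨0, by decide, le_rfl⟩ ha0 ?_
          (by rw [mul_assoc, mul_div_cancel₀ _ ha0.ne']) hp
        rw [hco]; simp
      · refine T.ball_coord_pos hκ (s := c) (c := r / c) 2 ⟨0, by decide, le_rfl⟩ hc0 ?_
          (by rw [mul_assoc, mul_div_cancel₀ _ hc0.ne']) hp
        rw [hco]; simp
    · rw [Metric.mem_ball] at hp ⊢
      have h3 : dist o V ≤ 2 * r := by
        rw [dist_eq_norm, ho, h0, add_sub_cancel_right]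
        refine (norm_add_le _ _).trans ?_
        rw [norm_smul, norm_smul, Real.norm_of_nonneg (by positivity),
          Real.norm_of_nonneg (by positivity), ← h0, ← ha, ← hc, div_mul_cancel₀ _ ha0.ne',
          div_mul_cancel₀ _ hc0.ne']
        linarith
      have : κ * r ≤ r := mul_le_of_le_one_left hr0.le hκ1
      linarith [dist_triangle p o V]
  choose! o ho1 ho2 using hball
  set 𝒮 := 𝒯.filter (V ∈ ·) with h𝒮
  have hdisj : (𝒮 : Set (Finset E2)).PairwiseDisjoint fun t => Metric.ball (o t) (κ * r) := by
    intro t ht t' ht' hne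
    rw [Function.onFun, Set.disjoint_left]
    intro p hp hp'
    exact hne (hconf.eq_of_mem_interior hκ hfat (Finset.mem_filter.1 ht).1 (Finset.mem_filter.1 ht').1
      (ho1 t ht hp) (interior_subset (ho1 t' ht' hp')))
  have hvol : ∑ t ∈ 𝒮, volume (Metric.ball (o t) (κ * r)) ≤ volume (Metric.ball V (3 * r)) := by
    rw [← measure_biUnion_finset hdisj fun t _ => measurableSet_ball]
    exact measure_mono (Set.iUnion₂_subset fun t ht => ho2 t ht)
  have hb : ∀ (q : E2) (s : ℝ), 0 ≤ s → volume (Metric.ball q s) =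
      ENNReal.ofReal (s ^ 2) * volume (Metric.ball (0 : E2) 1) := by
    intro q s hs
    rw [Measure.addHaar_ball _ _ hs]
    simp
  have hB0 : volume (Metric.ball (0 : E2) 1) ≠ 0 := (Metric.measure_ball_pos _ _ one_pos).ne'
  have hBt : volume (Metric.ball (0 : E2) 1) ≠ ⊤ := measure_ball_lt_top.ne
  rw [Finset.sum_congr rfl fun t _ => hb (o t) (κ * r) (by positivity), Finset.sum_const,
    hb V (3 * r) (by positivity), nsmul_eq_mul, ← mul_assoc, ENNReal.mul_le_mul_iff_left hB0 hBt,
    ← ENNReal.ofReal_natCast, ← ENNReal.ofReal_mul (by positivity),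
    ENNReal.ofReal_le_ofReal_iff (by positivity)] at hvol
  have : 0 < r ^ 2 := by positivity
  refine le_of_mul_le_mul_right ?_ this
  nlinarith

/-- The triangles of a shape regular triangulation of a connected set are joined by chains of
overlapping convex sets of comparable size. -/
theorem exists_chain {κ : ℝ} (hκ : 0 < κ) (N : ℕ) : ∃ ρ R : ℝ, 0 < ρ ∧ 0 < R ∧
    ∀ 𝒯 : Finset (Finset E2), Conforming 𝒯 → (∀ t ∈ 𝒯, Fat κ t) → 𝒯.card ≤ N →
    ∀ U : Set E2, IsOpen U → IsPreconnected U → U ⊆ (⋃ t ∈ 𝒯, hull t) →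
    (∀ t ∈ 𝒯, (U ∩ hull t).Nonempty) →
    ∀ t₀ ∈ 𝒯, ∀ X ∈ t₀, ∀ Y ∈ t₀, X ≠ Y → ∀ t ∈ 𝒯, ∃ n ≤ 2 * N, ∃ A : ℕ → Set E2,
      A 0 = interior (hull t₀) ∧ A n = interior (hull t) ∧
      (∀ i ≤ n, IsOpen (A i) ∧ Convex ℝ (A i) ∧ A i ⊆ (⋃ t ∈ 𝒯, hull t) ∧
        A i ⊆ Metric.ball X (R * ‖X - Y‖) ∧ ∃ o, Metric.ball o (ρ * ‖X - Y‖) ⊆ A i) ∧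
      ∀ i < n, ∃ o, Metric.ball o (ρ * ‖X - Y‖) ⊆ A i ∩ A (i + 1) := by
  by_cases hκ1 : κ ≤ 1
  swap
  · refine ⟨1, 1, one_pos, one_pos, fun 𝒯 _ hfat _ U _ _ _ _ t₀ ht₀ => ?_⟩
    exact absurd ((hfat t₀ ht₀).κ_le_one hκ) hκ1
  set η := κ ^ (N + 1) with hη
  have hη0 : 0 < η := by positivity
  have hη1 : η ≤ 1 := pow_le_one₀ hκ.le hκ1
  set ρ := κ ^ 2 * η ^ 3 / 4 with hρ
  set R := (N + 2) * η⁻¹ with hR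
  refine ⟨ρ, R, by positivity, by positivity, ?_⟩
  intro 𝒯 hconf hfat hN U hU hUc hcov hmeet t₀ ht₀ X hX Y hY hXY t ht
  set d := ‖X - Y‖ with hd
  have hd0 : 0 < d := norm_pos_iff.2 (sub_ne_zero.2 hXY)
  have hcard : ∀ t ∈ 𝒯, t.card = 3 := fun t ht => (hfat t ht).card
  obtain ⟨w, hw⟩ := (edgeGraph_reachable hconf hcard hU hUc hcov hmeet ⟨t₀, ht₀⟩
    ⟨t, ht⟩).exists_isPath
  have hlen : w.length < N := by
    have := hw.length_lt
    rw [Fintype.card_coe] at this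
    omega
  set s : ℕ → Finset E2 := fun i => (w.getVert i).1 with hs
  have hs𝒯 : ∀ i, s i ∈ 𝒯 := fun i => (w.getVert i).2
  have hadj : ∀ i < w.length, s i ≠ s (i + 1) ∧ 2 ≤ (s i ∩ s (i + 1)).card := fun i hi => by
    have := w.adj_getVert_succ hi
    exact ⟨fun h => this.1 (Subtype.ext h), this.2⟩
  have hsides' : ∀ i ≤ w.length, SidesIn (s i) (κ ^ (i + 1) * d) ((κ⁻¹) ^ (i + 1) * d) := by
    intro i
    induction i with
    | zero =>
      intro _
      have hs0 : s 0 = t₀ := by simp [hs]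
      rw [hs0]
      have := (hfat t₀ ht₀).sidesIn hκ hX hY hXY (le_refl d) (le_refl d)
      simpa using this
    | succ i ih =>
      intro hi
      obtain ⟨x, hx, y, hy, hxy⟩ := Finset.one_lt_card.1 (hadj i (by omega)).2
      rw [Finset.mem_inter] at hx hy
      obtain ⟨h1, h2⟩ := ih (by omega) x hx.1 y hy.1 hxy
      have := (hfat _ (hs𝒯 (i + 1))).sidesIn hκ hx.2 hy.2 hxy h1 h2
      rw [← mul_assoc, ← mul_assoc, ← pow_succ', ← pow_succ'] at this
      exact this
  have hsides : ∀ i ≤ w.length, SidesIn (s i) (η * d) (η⁻¹ * d) := by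
    intro i hi x hx y hy hxy
    obtain ⟨h1, h2⟩ := hsides' i hi x hx y hy hxy
    have h3 : η ≤ κ ^ (i + 1) := pow_le_pow_of_le_one hκ.le hκ1 (by omega)
    refine ⟨le_trans (by gcongr) h1, h2.trans ?_⟩
    rw [inv_pow]
    gcongr
  have hdist : ∀ i ≤ w.length, ∀ x ∈ s i, dist x X ≤ (i + 1) * (η⁻¹ * d) := by
    intro i
    have step : ∀ i ≤ w.length, ∀ x ∈ s i, ∀ y ∈ s i, dist x y ≤ η⁻¹ * d := by
      intro i hi x hx y hy
      rw [dist_eq_norm]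
      by_cases hxy : x = y
      · simp [hxy]; positivity
      · exact (hsides i hi x hx y hy hxy).2
    induction i with
    | zero =>
      intro h x hx
      have hs0 : s 0 = t₀ := by simp [hs]
      simpa using step 0 h x hx X (hs0 ▸ hX)
    | succ i ih =>
      intro hi x hx
      obtain ⟨y, hy⟩ : (s i ∩ s (i + 1)).Nonempty := by
        rw [← Finset.card_pos]; have := (hadj i (by omega)).2; omega
      rw [Finset.mem_inter] at hy
      have h1 := ih (by omega) y hy.1
      have h2 := step _ hi x hx y hy.2
      push_cast
      linarith [dist_triangle x y X]
  have hin : ∀ i ≤ w.length, hull (s i) ⊆ Metric.ball X (R * d) := by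
    intro i hi
    refine convexHull_min (fun x hx => ?_) (convex_ball _ _)
    rw [Metric.mem_ball]
    refine (hdist i hi x hx).trans_lt ?_
    rw [hR, mul_assoc]
    have : (i : ℝ) ≤ N := by exact_mod_cast (by omega : i ≤ N)
    have : 0 < η⁻¹ * d := by positivity
    nlinarith
  have hlink : ∀ i < w.length, ∃ m, Metric.ball m (κ * (η * d) / 2) ⊆ hull (s i) ∪ hull (s (i + 1)) ∧
      (∃ o, Metric.ball o (ρ * d) ⊆ Metric.ball m (κ * (η * d) / 2) ∩ interior (hull (s i))) ∧
      ∃ o, Metric.ball o (ρ * d) ⊆ Metric.ball m (κ * (η * d) / 2) ∩ interior (hull (s (i + 1))) := by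
    intro i hi
    have := (hfat _ (hs𝒯 i)).exists_link hκ (hfat _ (hs𝒯 (i + 1))) (hadj i hi).1
      (hconf _ (hs𝒯 i) _ (hs𝒯 (i + 1))) (hadj i hi).2 (hsides i hi.le) (hsides (i + 1) hi)
      (by positivity)
    have e : κ ^ 2 * (η * d) ^ 2 / (4 * (η⁻¹ * d)) = ρ * d := by
      rw [hρ]; field_simp
    rwa [e] at this
  choose! m hm1 hm2 hm3 using hlink
  set A : ℕ → Set E2 := fun k => if Even k then interior (hull (s (k / 2))) else
    Metric.ball (m (k / 2)) (κ * (η * d) / 2) with hA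
  have hAe : ∀ k, A (2 * k) = interior (hull (s k)) := fun k => by simp [hA]
  have hAo : ∀ k, A (2 * k + 1) = Metric.ball (m k) (κ * (η * d) / 2) := fun k => by
    have : (2 * k + 1) / 2 = k := by omega
    simp [hA, this]
  have hsub : ∀ i, hull (s i) ⊆ ⋃ t ∈ 𝒯, hull t := fun i =>
    Set.subset_biUnion_of_mem (u := fun t => hull t) (hs𝒯 i)
  have hρ1 : ρ * d ≤ κ * (η * d) / 3 := by
    rw [hρ]
    have : κ * η ^ 2 ≤ 1 := mul_le_one₀ hκ1 (by positivity) (pow_le_one₀ hη0.le hη1)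
    have h2 : 0 < κ * (η * d) := by positivity
    have h3 : κ ^ 2 * η ^ 3 / 4 * d = (κ * η ^ 2) * (κ * (η * d)) / 4 := by ring
    rw [h3]
    nlinarith
  refine ⟨2 * w.length, by omega, A, ?_, ?_, ?_, ?_⟩
  · have := hAe 0
    simpa [hs] using this
  · rw [hAe]; simp [hs]
  · intro i hi
    obtain ⟨k, rfl | rfl⟩ := Nat.even_or_odd' i
    · rw [hAe]
      refine ⟨isOpen_interior, (convex_convexHull ℝ _).interior, interior_subset.trans (hsub k),
        interior_subset.trans (hin k (by omega)), ?_⟩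
      obtain ⟨o, ho⟩ := (hfat _ (hs𝒯 k)).exists_ball hκ (hsides k (by omega)) (by positivity)
      exact ⟨o, (Metric.ball_subset_ball hρ1).trans ho⟩
    · rw [hAo]
      have hk : k < w.length := by omega
      refine ⟨Metric.isOpen_ball, convex_ball _ _, (hm1 k hk).trans (Set.union_subset (hsub k)
        (hsub (k + 1))), (hm1 k hk).trans (Set.union_subset (hin k hk.le) (hin (k + 1) hk)), ?_⟩
      obtain ⟨o, ho⟩ := hm2 k hk
      exact ⟨o, ho.trans Set.inter_subset_left⟩
  · intro i hi
    obtain ⟨k, rfl | rfl⟩ := Nat.even_or_odd' i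
    · rw [hAe, hAo, Set.inter_comm]
      exact hm2 k (by omega)
    · rw [hAo, show 2 * k + 1 + 1 = 2 * (k + 1) by ring, hAe]
      exact hm3 k (by omega)

end

noncomputable section

/-! ### Tetrahedra -/

theorem exists_affineBasis {T : Finset E3} (hc : T.card = 4)
    (hT : AffineIndependent ℝ ((↑) : T → E3)) {x y z w : E3} (h : (T : Set E3) = {x, y, z, w}) :
    ∃ B : AffineBasis (Fin 4) ℝ E3, ⇑B = ![x, y, z, w] ∧ Set.range B = T := by
  have hmem : ∀ i, ![x, y, z, w] i ∈ T := by
    intro i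
    rw [← Finset.mem_coe, h]
    fin_cases i <;> simp
  have hr : Set.range ![x, y, z, w] = (T : Set E3) := by
    rw [h]; ext p; simp; tauto
  have hinj : Function.Injective ![x, y, z, w] := by
    have hs : Function.Surjective (fun i : Fin 4 => (⟨![x, y, z, w] i, hmem i⟩ : T)) := by
      rintro ⟨p, hp⟩
      have : p ∈ Set.range ![x, y, z, w] := hr ▸ hp
      obtain ⟨i, hi⟩ := this
      exact ⟨i, Subtype.ext hi⟩
    have hb := (Fintype.bijective_iff_surjective_and_card _).2 ⟨hs, by simp [hc]⟩
    intro i j hij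
    exact hb.1 (Subtype.ext hij)
  have hind : AffineIndependent ℝ ![x, y, z, w] :=
    hT.comp_embedding ⟨fun i => (⟨![x, y, z, w] i, hmem i⟩ : T), fun i j hij =>
      hinj (congrArg Subtype.val hij)⟩
  exact ⟨⟨![x, y, z, w], hind, by
    rw [hind.affineSpan_eq_top_iff_card_eq_finrank_add_one]; simp⟩, rfl, hr⟩

theorem exists_affineBasis_range {T : Finset E3} (hc : T.card = 4)
    (hT : AffineIndependent ℝ ((↑) : T → E3)) :
    ∃ B : AffineBasis (Fin 4) ℝ E3, Set.range B = T := by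
  obtain ⟨x, y, z, w, -, -, -, -, -, -, h⟩ := Finset.card_eq_four.1 hc
  obtain ⟨B, -, hB⟩ := exists_affineBasis hc hT (x := x) (y := y) (z := z) (w := w) (by simp [h])
  exact ⟨B, hB⟩

theorem isClosed_cell (T : Finset E3) : IsClosed (cell T) :=
  Set.Finite.isClosed_convexHull ℝ T.finite_toSet

theorem convex_cell (T : Finset E3) : Convex ℝ (cell T) := convex_convexHull ℝ _

theorem interior_cell_nonempty {T : Finset E3} (hc : T.card = 4)
    (hT : AffineIndependent ℝ ((↑) : T → E3)) : (interior (cell T)).Nonempty := by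
  obtain ⟨B, hB⟩ := exists_affineBasis_range hc hT
  rw [cell, ← hB, B.interior_convexHull]
  exact ⟨Finset.univ.centroid ℝ B, fun i => by
    rw [B.coord_apply_centroid (Finset.mem_univ i)]; norm_num⟩

theorem closure_interior_cell {T : Finset E3} (h : (interior (cell T)).Nonempty) :
    closure (interior (cell T)) = cell T := by
  rw [(convex_cell T).closure_interior_eq_closure_of_nonempty_interior h, (isClosed_cell T).closure_eq]

/-! ### Coordinates adapted to a direction -/

variable (b : OrthonormalBasis (Fin 3) ℝ E3)

/-- The projection along `b 2`. -/
def proj : E3 →L[ℝ] E2 :=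
  (EuclideanSpace.equiv (Fin 2) ℝ).symm.toContinuousLinearMap.comp
    (ContinuousLinearMap.pi ![innerSL ℝ (b 0), innerSL ℝ (b 1)])

@[simp] theorem proj_zero (x : E3) : proj b x 0 = inner ℝ (b 0) x := rfl
@[simp] theorem proj_one (x : E3) : proj b x 1 = inner ℝ (b 1) x := rfl

theorem sum_inner_smul (x : E3) :
    x = inner ℝ (b 0) x • b 0 + inner ℝ (b 1) x • b 1 + inner ℝ (b 2) x • b 2 := by
  conv_lhs => rw [← b.sum_repr' x, Fin.sum_univ_three]

theorem inner_basis (i j : Fin 3) : inner ℝ (b i) (b j) = if i = j then (1 : ℝ) else 0 :=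
  orthonormal_iff_ite.1 b.orthonormal i j

/-- The linear isomorphism `(y, t) ↦ y₀ b₀ + y₁ b₁ + (s y + σ t) b₂`. -/
def shear (s : E2 →L[ℝ] ℝ) (σ : ℝ) (hσ : σ * σ = 1) : (E2 × ℝ) ≃L[ℝ] E3 :=
  LinearEquiv.toContinuousLinearEquiv
    { toFun := fun y => y.1 0 • b 0 + y.1 1 • b 1 + (s y.1 + σ * y.2) • b 2
      map_add' := fun y z => by simp; module
      map_smul' := fun c y => by simp; module
      invFun := fun x => (proj b x, σ * (inner ℝ (b 2) x - s (proj b x)))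
      left_inv := fun y => by
        have h : proj b (y.1 0 • b 0 + y.1 1 • b 1 + (s y.1 + σ * y.2) • b 2) = y.1 := by
          ext i; fin_cases i <;> simp
        refine Prod.ext h ?_
        simp only [h]
        simp only [inner_add_right, inner_smul_right, inner_basis]
        simp
        rw [← mul_assoc, hσ, one_mul]
      right_inv := fun x => by
        simp only
        rw [← mul_assoc, hσ, one_mul, add_sub_cancel, proj_zero, proj_one]
        exact (sum_inner_smul b x).symm }

theorem shear_apply (s : E2 →L[ℝ] ℝ) (σ : ℝ) (hσ : σ * σ = 1) (y : E2 × ℝ) :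
    shear b s σ hσ y = y.1 0 • b 0 + y.1 1 • b 1 + (s y.1 + σ * y.2) • b 2 := rfl

@[simp] theorem proj_shear (s : E2 →L[ℝ] ℝ) (σ : ℝ) (hσ : σ * σ = 1) (y : E2 × ℝ) :
    proj b (shear b s σ hσ y) = y.1 := by
  rw [shear_apply]
  ext i; fin_cases i <;> simp

@[simp] theorem inner_shear (s : E2 →L[ℝ] ℝ) (σ : ℝ) (hσ : σ * σ = 1) (y : E2 × ℝ) :
    inner ℝ (b 2) (shear b s σ hσ y) = s y.1 + σ * y.2 := by
  rw [shear_apply]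
  simp [inner_add_right, inner_smul_right]

theorem proj_surjective : Function.Surjective (proj b) := fun y =>
  ⟨shear b 0 1 (by norm_num) (y, 0), by simp⟩

theorem isOpenMap_proj : IsOpenMap (proj b) := (proj b).isOpenMap (proj_surjective b)

@[simp] theorem proj_basis_two : proj b (b 2) = 0 := by
  ext i; fin_cases i <;> simp

theorem eq_of_proj_eq {x y : E3} (h : proj b x = proj b y) (h2 : inner ℝ (b 2) x = inner ℝ (b 2) y) :
    x = y := by
  have h0 : inner ℝ (b 0) x = inner ℝ (b 0) y := by rw [← proj_zero, h, proj_zero]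
  have h1 : inner ℝ (b 1) x = inner ℝ (b 1) y := by rw [← proj_one, h, proj_one]
  rw [sum_inner_smul b x, sum_inner_smul b y, h0, h1, h2]

theorem norm_sq_eq (x : E3) : ‖x‖ ^ 2 = ‖proj b x‖ ^ 2 + inner ℝ (b 2) x ^ 2 := by
  rw [← b.sum_sq_inner_right x, Fin.sum_univ_three, EuclideanSpace.norm_sq_eq, Fin.sum_univ_two,
    proj_zero, proj_one]
  simp

theorem norm_proj_le (x : E3) : ‖proj b x‖ ≤ ‖x‖ := by
  refine abs_le_of_sq_le_sq' ?_ (norm_nonneg _) |>.2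
  rw [norm_sq_eq b x]
  nlinarith [sq_nonneg (inner ℝ (b 2) x)]

theorem norm_le_proj_add (x : E3) : ‖x‖ ≤ ‖proj b x‖ + |inner ℝ (b 2) x| := by
  refine abs_le_of_sq_le_sq' ?_ (by positivity) |>.2
  rw [norm_sq_eq b x, add_sq, sq_abs]
  have : 0 ≤ 2 * ‖proj b x‖ * |inner ℝ (b 2) x| := by positivity
  linarith

section
variable {b}
variable {e : Finset E3}

theorem projAlong_eq (he : vectorSpan ℝ (e : Set E3) = Submodule.span ℝ {b 2})
    (x : E3) : projAlong e x = x - inner ℝ (b 2) x • b 2 := by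
  unfold projAlong
  simp only [he, Submodule.starProjection_orthogonal']
  change x - (Submodule.span ℝ {b 2}).starProjection x = _
  rw [Submodule.starProjection_unit_singleton ℝ (b.norm_eq_one 2)]

theorem proj_projAlong (he : vectorSpan ℝ (e : Set E3) = Submodule.span ℝ {b 2})
    (x : E3) : proj b (projAlong e x) = proj b x := by
  rw [projAlong_eq he]; simp

theorem projAlong_eq_iff (he : vectorSpan ℝ (e : Set E3) = Submodule.span ℝ {b 2})
    {x y : E3} : projAlong e x = projAlong e y ↔ proj b x = proj b y := by
  constructor
  · intro h
    rw [← proj_projAlong he x, h, proj_projAlong he]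
  · intro h
    refine eq_of_proj_eq b (by rw [proj_projAlong he, proj_projAlong he, h]) ?_
    rw [projAlong_eq he, projAlong_eq he]
    simp [inner_sub_right, inner_smul_right]

theorem inner_projAlong_sub (he : vectorSpan ℝ (e : Set E3) = Submodule.span ℝ {b 2})
    (x y z : E3) :
    inner ℝ (projAlong e x - projAlong e y) (projAlong e z - projAlong e y) =
      inner ℝ (proj b x - proj b y) (proj b z - proj b y) := by
  have h1 : inner ℝ (proj b (x - y)) (proj b (z - y)) =
      inner ℝ (b 0) (x - y) * inner ℝ (b 0) (z - y) + inner ℝ (b 1) (x - y) * inner ℝ (b 1) (z - y) := by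
    rw [PiLp.inner_apply, Fin.sum_univ_two]
    simp only [proj_zero, proj_one, RCLike.inner_apply, conj_trivial]
    ring
  have h2 : ∀ x y, projAlong e x - projAlong e y = (x - y) - inner ℝ (b 2) (x - y) • b 2 := by
    intro x y
    rw [projAlong_eq he, projAlong_eq he, inner_sub_right]
    module
  rw [← map_sub, ← map_sub, h1, h2, h2]
  generalize x - y = u
  generalize z - y = v
  rw [inner_sub_left, inner_sub_right, inner_sub_right,
    inner_smul_left, inner_smul_right, inner_smul_left, inner_smul_right, inner_basis,
    ← b.sum_inner_mul_inner u v, Fin.sum_univ_three]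
  simp only [conj_trivial, if_true, real_inner_comm (b 0) u, real_inner_comm (b 1) u,
    real_inner_comm (b 2) u]
  ring

theorem norm_projAlong_sub (he : vectorSpan ℝ (e : Set E3) = Submodule.span ℝ {b 2})
    (x y : E3) :
    ‖projAlong e x - projAlong e y‖ = ‖proj b x - proj b y‖ := by
  have := inner_projAlong_sub he x y x
  rw [real_inner_self_eq_norm_sq, real_inner_self_eq_norm_sq] at this
  exact (sq_eq_sq₀ (norm_nonneg _) (norm_nonneg _)).1 this

end

end

noncomputable section

/-! ### Barycentric coordinates of a macro-element with a singular edge -/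

/-- `B` lists the vertices of `Λ`, first those of the edge `e`, which is parallel to `b 2`. -/
structure IsFrame (Λ e : Finset E3) (B : AffineBasis (Fin 4) ℝ E3)
    (b : OrthonormalBasis (Fin 3) ℝ E3) (ℓ : ℝ) : Prop where
  ne_zero : ℓ ≠ 0
  edge : B 1 - B 0 = ℓ • b 2
  range_eq : Set.range B = Λ
  edge_eq : (e : Set E3) = {B 0, B 1}

theorem MacroPartition.IsSingular.exists_affineBasis {P : MacroPartition} {Λ e : Finset E3}
    (h : P.IsSingular Λ e) : ∃ B : AffineBasis (Fin 4) ℝ E3, Set.range B = Λ ∧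
      (e : Set E3) = {B 0, B 1} := by
  obtain ⟨⟨hΛ, hc⟩, he, hsub⟩ := h
  obtain ⟨a, a', haa, rfl⟩ := Finset.card_eq_two.1 (P.singEdges_subset e he).2
  have hcard : (Λ \ {a, a'}).card = 2 := by
    rw [Finset.card_sdiff_of_subset hsub, hc, Finset.card_pair haa]
  obtain ⟨c, d, -, hcd⟩ := Finset.card_eq_two.1 hcard
  have hset : (Λ : Set E3) = {a, a', c, d} := by
    have : Λ = {a, a'} ∪ (Λ \ {a, a'}) := (Finset.union_sdiff_of_subset hsub).symm
    rw [this, hcd]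
    ext x; simp; tauto
  obtain ⟨B, hB, hr⟩ := _root_.exists_affineBasis hc (P.K.indep hΛ) hset
  exact ⟨B, hr, by simp [hB]⟩

theorem MacroPartition.IsSingular.isFrame {Λ e : Finset E3}
    {B : AffineBasis (Fin 4) ℝ E3} (hr : Set.range B = Λ) (he : (e : Set E3) = {B 0, B 1})
    {b : OrthonormalBasis (Fin 3) ℝ E3} (hb : b 2 ∈ vectorSpan ℝ (e : Set E3)) :
    ∃ ℓ, IsFrame Λ e B b ℓ := by
  rw [he, mem_vectorSpan_pair] at hb
  obtain ⟨r, hr'⟩ := hb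
  have hr0 : r ≠ 0 := by
    rintro rfl
    rw [zero_smul] at hr'
    have := b.norm_eq_one 2
    rw [← hr', norm_zero] at this
    exact zero_ne_one this
  refine ⟨-r⁻¹, by simpa using hr0, ?_, hr, he⟩
  rw [← hr', smul_smul, neg_mul, inv_mul_cancel₀ hr0, vsub_eq_sub]
  module

/-- The coordinate of the second vertex of the edge. -/
def lam (B : AffineBasis (Fin 4) ℝ E3) : E3 →ᵃ[ℝ] ℝ := B.coord 1

/-- The sum of the coordinates of the vertices of the edge. -/
def mu (B : AffineBasis (Fin 4) ℝ E3) : E3 →ᵃ[ℝ] ℝ := B.coord 0 + B.coord 1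

theorem mu_apply (B : AffineBasis (Fin 4) ℝ E3) (x : E3) : mu B x = B.coord 0 x + B.coord 1 x := rfl

theorem exists_lipschitz (B : AffineBasis (Fin 4) ℝ E3) : ∃ C > (0 : ℝ), (∀ i x y,
    |B.coord i x - B.coord i y| ≤ C * ‖x - y‖) ∧ (∀ x y, |lam B x - lam B y| ≤ C * ‖x - y‖) ∧
    ∀ x y, |mu B x - mu B y| ≤ C * ‖x - y‖ := by
  have key : ∀ f : E3 →ᵃ[ℝ] ℝ, ∃ C ≥ (0 : ℝ), ∀ x y, |f x - f y| ≤ C * ‖x - y‖ := by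
    intro f
    refine ⟨‖f.linear.toContinuousLinearMap‖, norm_nonneg _, fun x y => ?_⟩
    have := f.linear.toContinuousLinearMap.le_opNorm (x - y)
    rwa [LinearMap.coe_toContinuousLinearMap', ← vsub_eq_sub x y, AffineMap.linearMap_vsub,
      vsub_eq_sub, vsub_eq_sub, Real.norm_eq_abs] at this
  choose C hC0 hC using key
  have h0 : ∀ i, 0 ≤ C (B.coord i) := fun i => hC0 _
  have h1 := hC0 (mu B)
  have hs : ∀ i, C (B.coord i) ≤ ∑ i, C (B.coord i) := fun i =>
    Finset.single_le_sum (fun i _ => h0 i) (Finset.mem_univ i)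
  have hs0 : 0 ≤ ∑ i, C (B.coord i) := Finset.sum_nonneg fun i _ => h0 i
  have hi : ∀ i x y, |B.coord i x - B.coord i y| ≤ (∑ i, C (B.coord i) + C (mu B) + 1) * ‖x - y‖ :=
    fun i x y => (hC _ x y).trans (by gcongr; linarith [hs i])
  exact ⟨_, by positivity, hi, hi 1, fun x y => (hC _ x y).trans (by gcongr; linarith)⟩

namespace IsFrame

variable {Λ e : Finset E3} {B : AffineBasis (Fin 4) ℝ E3} {b : OrthonormalBasis (Fin 3) ℝ E3} {ℓ : ℝ}

theorem vectorSpan_eq (F : IsFrame Λ e B b ℓ) :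
    vectorSpan ℝ (e : Set E3) = Submodule.span ℝ {b 2} := by
  rw [F.edge_eq, vectorSpan_pair_rev, vsub_eq_sub, F.edge,
    Submodule.span_singleton_smul_eq (IsUnit.mk0 _ F.ne_zero)]

theorem coord_add_smul (F : IsFrame Λ e B b ℓ) (i : Fin 4) (x : E3) (s : ℝ) :
    B.coord i (x + s • b 2) = B.coord i x + s / ℓ * (B.coord i (B 1) - B.coord i (B 0)) := by
  have e : s • b 2 = (s / ℓ) • (B 1 - B 0) := by
    rw [F.edge, smul_smul, div_mul_cancel₀ _ F.ne_zero]
  rw [e, add_comm, ← vadd_eq_add, AffineMap.map_vadd, map_smul, ← vsub_eq_sub (B 1) (B 0),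
    AffineMap.linearMap_vsub, vadd_eq_add, vsub_eq_sub, smul_eq_mul, add_comm]

theorem lam_add_smul (F : IsFrame Λ e B b ℓ) (x : E3) (s : ℝ) :
    lam B (x + s • b 2) = lam B x + s / ℓ := by
  rw [lam, F.coord_add_smul, B.coord_apply_eq, B.coord_apply_ne (by decide)]
  ring

theorem mu_add_smul (F : IsFrame Λ e B b ℓ) (x : E3) (s : ℝ) :
    mu B (x + s • b 2) = mu B x := by
  rw [mu_apply, mu_apply, F.coord_add_smul, F.coord_add_smul, B.coord_apply_eq, B.coord_apply_eq,
    B.coord_apply_ne (by decide), B.coord_apply_ne (by decide)]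
  ring

theorem coord_add_smul' (F : IsFrame Λ e B b ℓ) {i : Fin 4} (h0 : i ≠ 0) (h1 : i ≠ 1) (x : E3) (s : ℝ) :
    B.coord i (x + s • b 2) = B.coord i x := by
  rw [F.coord_add_smul, B.coord_apply_ne h0, B.coord_apply_ne h1]
  ring

theorem eq_add_smul {x y : E3} (h : proj b x = proj b y) :
    x = y + (inner ℝ (b 2) x - inner ℝ (b 2) y) • b 2 := by
  refine eq_of_proj_eq b (by simp [h]) ?_
  rw [inner_add_right, inner_smul_right, inner_basis]
  simp

theorem mu_congr (F : IsFrame Λ e B b ℓ) {x y : E3} (h : proj b x = proj b y) : mu B x = mu B y := by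
  rw [eq_add_smul h, F.mu_add_smul]

theorem coord_congr (F : IsFrame Λ e B b ℓ) {x y : E3} (h : proj b x = proj b y) {i : Fin 4}
    (h0 : i ≠ 0) (h1 : i ≠ 1) : B.coord i x = B.coord i y := by
  rw [eq_add_smul h, F.coord_add_smul' h0 h1]

theorem lam_sub (F : IsFrame Λ e B b ℓ) {x y : E3} (h : proj b x = proj b y) :
    lam B x - lam B y = (inner ℝ (b 2) x - inner ℝ (b 2) y) / ℓ := by
  conv_lhs => rw [eq_add_smul h, F.lam_add_smul]
  ring

theorem eq_of_proj_eq_of_lam_eq (F : IsFrame Λ e B b ℓ) {x y : E3} (h : proj b x = proj b y)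
    (hl : lam B x = lam B y) : x = y := by
  refine eq_of_proj_eq b h ?_
  have := F.lam_sub h
  rw [hl, sub_self, eq_comm, div_eq_zero_iff] at this
  rcases this with h | h
  · linarith
  · exact absurd h F.ne_zero

theorem dist_eq (F : IsFrame Λ e B b ℓ) {x y : E3} (h : proj b x = proj b y) :
    dist x y = |ℓ| * |lam B x - lam B y| := by
  rw [F.lam_sub h, abs_div, mul_div_cancel₀ _ (abs_pos.2 F.ne_zero).ne', dist_eq_norm]
  conv_lhs => rw [eq_add_smul h, add_sub_cancel_left, norm_smul, b.norm_eq_one 2, mul_one]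
  rfl

theorem mem_cell_iff (F : IsFrame Λ e B b ℓ) {x : E3} : x ∈ cell Λ ↔ ∀ i, 0 ≤ B.coord i x := by
  rw [cell, ← F.range_eq, B.convexHull_eq_nonneg_coord]; rfl

theorem sum_coord (B : AffineBasis (Fin 4) ℝ E3) (x : E3) :
    B.coord 0 x + B.coord 1 x + B.coord 2 x + B.coord 3 x = 1 := by
  have := B.sum_coord_apply_eq_one x
  rwa [Fin.sum_univ_four] at this

theorem eq_sum (B : AffineBasis (Fin 4) ℝ E3) (x : E3) :
    x = B.coord 0 x • B 0 + B.coord 1 x • B 1 + B.coord 2 x • B 2 + B.coord 3 x • B 3 := by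
  have := B.linear_combination_coord_eq_self x
  rw [Fin.sum_univ_four] at this
  exact this.symm

theorem mem_cell_edge (F : IsFrame Λ e B b ℓ) {q : E3} (hq : q ∈ cell e) :
    q = (1 - lam B q) • B 0 + lam B q • B 1 ∧ mu B q = 1 ∧ 0 ≤ lam B q ∧ lam B q ≤ 1 := by
  rw [cell, F.edge_eq, convexHull_pair] at hq
  obtain ⟨s, t, hs, ht, hst, rfl⟩ := hq
  have e : s • B 0 + t • B 1 = AffineMap.lineMap (B 0) (B 1) t := by
    rw [AffineMap.lineMap_apply_module, ← hst]; congr 2; ring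
  have c : ∀ i, B.coord i (s • B 0 + t • B 1) = s * B.coord i (B 0) + t * B.coord i (B 1) := by
    intro i
    rw [e, AffineMap.apply_lineMap, AffineMap.lineMap_apply_module, smul_eq_mul, smul_eq_mul, ← hst]
    ring
  have hl : lam B (s • B 0 + t • B 1) = t := by
    rw [lam, c, B.coord_apply_eq, B.coord_apply_ne (by decide)]; ring
  rw [hl]
  refine ⟨by rw [← hst]; congr 2; ring, ?_, ht, by linarith⟩
  rw [mu_apply, c, c, B.coord_apply_eq, B.coord_apply_eq, B.coord_apply_ne (by decide),
    B.coord_apply_ne (by decide)]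
  linarith

theorem sdiff_eq (F : IsFrame Λ e B b ℓ) : ((Λ : Set E3) \ (e : Set E3)) = {B 2, B 3} := by
  rw [← F.range_eq, F.edge_eq]
  ext x
  constructor
  · rintro ⟨⟨i, rfl⟩, hi⟩
    fin_cases i <;> simp at hi ⊢
  · have hne : ∀ i j, i ≠ j → B i ≠ B j := fun i j h h' => h (B.ind.injective h')
    rintro (rfl | rfl)
    · exact ⟨⟨_, rfl⟩, by simp [hne 2 0 (by decide), hne 2 1 (by decide)]⟩
    · exact ⟨⟨_, rfl⟩, by simp [hne 3 0 (by decide), hne 3 1 (by decide)]⟩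

theorem lam_basis (B : AffineBasis (Fin 4) ℝ E3) : lam B (B 2) = 0 ∧ lam B (B 3) = 0 ∧
    mu B (B 2) = 0 ∧ mu B (B 3) = 0 := by
  refine ⟨?_, ?_, ?_, ?_⟩ <;> simp [lam, mu_apply]

theorem mem_cutPlane_iff (F : IsFrame Λ e B b ℓ) {q : E3} (hq : q ∈ cell e) {x : E3} :
    x ∈ cutPlane Λ e q ↔ lam B x = lam B q * mu B x := by
  obtain ⟨h1, h2, -, -⟩ := F.mem_cell_edge hq
  obtain ⟨l2, l3, m2, m3⟩ := lam_basis B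
  rw [cutPlane, F.sdiff_eq]
  constructor
  · intro hx
    set f : E3 →ᵃ[ℝ] ℝ := lam B - lam B q • mu B with hf
    have hfa : ∀ y, f y = lam B y - lam B q * mu B y := fun y => rfl
    have hle : affineSpan ℝ {q, B 2, B 3} ≤ (AffineSubspace.mk' (0 : ℝ) ⊥).comap f := by
      rw [affineSpan_le]
      rintro y (rfl | rfl | rfl)
      · simp [hfa, h2, AffineSubspace.mem_mk']
      · simp [hfa, l2, m2, AffineSubspace.mem_mk']
      · simp [hfa, l3, m3, AffineSubspace.mem_mk']
    have := hle hx
    simp only [AffineSubspace.mem_comap, AffineSubspace.mem_mk', vsub_eq_sub, sub_zero,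
      Submodule.mem_bot, hfa] at this
    linarith
  · intro hx
    have e : x = Finset.univ.affineCombination ℝ ![q, B 2, B 3] ![mu B x, B.coord 2 x, B.coord 3 x] := by
      rw [Finset.affineCombination_eq_linear_combination]
      · rw [Fin.sum_univ_three]
        simp only [Matrix.cons_val_zero, Matrix.cons_val_one, Matrix.cons_val]
        conv_lhs => rw [eq_sum B x]
        rw [h1]
        have a0 : B.coord 0 x = mu B x * (1 - lam B q) := by
          have : lam B x = B.coord 1 x := rfl
          rw [mu_apply] at *; linarith
        have a1 : B.coord 1 x = mu B x * lam B q := by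
          have : lam B x = B.coord 1 x := rfl
          linarith
        rw [a0, a1]
        module
      · rw [Fin.sum_univ_three]
        simp only [Matrix.cons_val_zero, Matrix.cons_val_one, Matrix.cons_val]
        rw [mu_apply]; exact sum_coord B x
    rw [e]
    have hr : ({q, B 2, B 3} : Set E3) = Set.range ![q, B 2, B 3] := by
      ext y; simp; tauto
    rw [hr]
    refine affineCombination_mem_affineSpan ?_ _
    rw [Fin.sum_univ_three]
    simp only [Matrix.cons_val_zero, Matrix.cons_val_one, Matrix.cons_val]
    rw [mu_apply]; exact sum_coord B x

/-- The part of `Λ` between the planes `lam = ρ₁ mu` and `lam = ρ₂ mu`. -/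
def layer (Λ : Finset E3) (B : AffineBasis (Fin 4) ℝ E3) (ρ₁ ρ₂ : ℝ) : Set E3 :=
  {x | x ∈ cell Λ ∧ ρ₁ * mu B x ≤ lam B x ∧ lam B x ≤ ρ₂ * mu B x}

theorem strip_eq (F : IsFrame Λ e B b ℓ) {p q : E3} (hp : p ∈ cell e) (hq : q ∈ cell e)
    (hpq : lam B p < lam B q) : strip Λ e p q = layer Λ B (lam B p) (lam B q) := by
  obtain ⟨p1, p2, p3, p4⟩ := F.mem_cell_edge hp
  obtain ⟨q1, q2, q3, q4⟩ := F.mem_cell_edge hq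
  obtain ⟨l2, l3, m2, m3⟩ := lam_basis B
  rw [strip, F.sdiff_eq]
  have hsub : cell e ⊆ cell Λ := by
    refine convexHull_mono ?_
    rw [F.edge_eq, ← F.range_eq]
    rintro x (rfl | rfl) <;> simp
  have hB : ∀ i, B i ∈ cell Λ := fun i => subset_convexHull ℝ _ (F.range_eq ▸ Set.mem_range_self i)
  apply subset_antisymm
  · refine convexHull_min ?_ ?_
    · rintro x ((rfl | rfl) | (rfl | rfl))
      · exact ⟨hsub hp, by rw [p2, mul_one], by rw [p2, mul_one]; exact hpq.le⟩
      · exact ⟨hsub hq, by rw [q2, mul_one]; exact hpq.le, by rw [q2, mul_one]⟩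
      · exact ⟨hB 2, by rw [l2, m2, mul_zero], by rw [l2, m2, mul_zero]⟩
      · exact ⟨hB 3, by rw [l3, m3, mul_zero], by rw [l3, m3, mul_zero]⟩
    · have h1 : Convex ℝ {x | lam B p * mu B x ≤ lam B x} := by
        have : {x | lam B p * mu B x ≤ lam B x} = (lam B - lam B p • mu B) ⁻¹' Set.Ici 0 := by
          ext x; simp
        rw [this]; exact (convex_Ici 0).affine_preimage _
      have h2 : Convex ℝ {x | lam B x ≤ lam B q * mu B x} := by
        have : {x | lam B x ≤ lam B q * mu B x} = (lam B q • mu B - lam B) ⁻¹' Set.Ici 0 := by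
          ext x; simp
        rw [this]; exact (convex_Ici 0).affine_preimage _
      exact (convex_cell Λ).inter (h1.inter h2)
  · rintro x ⟨hx, hx1, hx2⟩
    have hpos : 0 < lam B q - lam B p := by linarith
    have hx := F.mem_cell_iff.1 hx
    set wp := (lam B q * mu B x - lam B x) / (lam B q - lam B p) with hwp
    set wq := (lam B x - lam B p * mu B x) / (lam B q - lam B p) with hwq
    have hw : wp + wq = mu B x := by rw [hwp, hwq]; field_simp; ring
    have hl : lam B p * wp + lam B q * wq = lam B x := by rw [hwp, hwq]; field_simp; ring
    have h1 : 0 ≤ wp := div_nonneg (by linarith) hpos.le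
    have h2 : 0 ≤ wq := div_nonneg (by linarith) hpos.le
    have e : x = ∑ i, ![wp, wq, B.coord 2 x, B.coord 3 x] i • ![p, q, B 2, B 3] i := by
      rw [Fin.sum_univ_four]
      simp only [Matrix.cons_val_zero, Matrix.cons_val_one, Matrix.cons_val]
      conv_lhs => rw [eq_sum B x]
      rw [p1, q1]
      have a1 : B.coord 1 x = lam B p * wp + lam B q * wq := hl.symm
      have a0 : B.coord 0 x = (1 - lam B p) * wp + (1 - lam B q) * wq := by
        rw [mu_apply] at hw; linarith
      rw [a0, a1]
      module
    rw [e]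
    refine (convex_convexHull ℝ _).sum_mem ?_ ?_ ?_
    · intro i _
      fin_cases i
      · exact h1
      · exact h2
      · exact hx 2
      · exact hx 3
    · rw [Fin.sum_univ_four]
      simp only [Matrix.cons_val_zero, Matrix.cons_val_one, Matrix.cons_val]
      rw [hw, mu_apply]; exact sum_coord B x
    · intro i _
      apply subset_convexHull
      fin_cases i <;> simp

end IsFrame

theorem strip_comm (Λ e : Finset E3) (p q : E3) : strip Λ e p q = strip Λ e q p := by
  rw [strip, strip, Set.pair_comm]

end

noncomputable section

/-! ### The elements of the mesh in a macro-element with a singular edge -/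

/-- The elements of the mesh in `Λ`. -/
def meshIn {P : MacroPartition} (M : GradedMesh P) (Λ : Finset E3) : Set (Finset E3) :=
  {T | T ∈ tets M.K ∧ cell T ⊆ cell Λ}

/-- The projection of the element `T` (as a set of vertices). -/
def shadow (b : OrthonormalBasis (Fin 3) ℝ E3) (T : Finset E3) : Finset E2 := T.image (proj b)

theorem coe_shadow (b : OrthonormalBasis (Fin 3) ℝ E3) (T : Finset E3) :
    (shadow b T : Set E2) = proj b '' T := Finset.coe_image

theorem hull_shadow (b : OrthonormalBasis (Fin 3) ℝ E3) (T : Finset E3) :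
    hull (shadow b T) = proj b '' cell T := by
  rw [hull, cell, coe_shadow]
  exact ((proj b).toLinearMap.image_convexHull (T : Set E3)).symm

theorem proj_interior_subset (b : OrthonormalBasis (Fin 3) ℝ E3) (T : Finset E3) :
    proj b '' interior (cell T) ⊆ interior (hull (shadow b T)) :=
  interior_maximal (by rw [hull_shadow]; exact Set.image_mono interior_subset)
    (isOpenMap_proj b _ isOpen_interior)

theorem interior_hull_shadow_subset (b : OrthonormalBasis (Fin 3) ℝ E3) {T : Finset E3}
    (h : (interior (cell T)).Nonempty) :
    interior (hull (shadow b T)) ⊆ proj b '' interior (cell T) := by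
  have hO : IsOpen (proj b '' interior (cell T)) := isOpenMap_proj b _ isOpen_interior
  have hC : Convex ℝ (proj b '' interior (cell T)) :=
    ((convex_cell T).interior).linear_image (proj b).toLinearMap
  have hne : (interior (proj b '' interior (cell T))).Nonempty := by
    rw [hO.interior_eq]; exact h.image _
  have h1 : hull (shadow b T) ⊆ closure (proj b '' interior (cell T)) := by
    have := image_closure_subset_closure_image (proj b).continuous (s := interior (cell T))
    rwa [closure_interior_cell h, ← hull_shadow] at this
  calc interior (hull (shadow b T)) ⊆ interior (closure (proj b '' interior (cell T))) :=
        interior_mono h1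
    _ = proj b '' interior (cell T) := by
        rw [hC.interior_closure_eq_interior_of_nonempty_interior hne, hO.interior_eq]

section

variable {P : MacroPartition} {M : GradedMesh P} {Λ e : Finset E3} {B : AffineBasis (Fin 4) ℝ E3}
  {b : OrthonormalBasis (Fin 3) ℝ E3} {ℓ : ℝ}

theorem interior_cell_nonempty_of_mem {K : Geometry.SimplicialComplex ℝ E3} {T : Finset E3}
    (hT : T ∈ tets K) : (interior (cell T)).Nonempty :=
  interior_cell_nonempty hT.2 (K.indep hT.1)

theorem tets_finite (M : GradedMesh P) : (tets M.K).Finite :=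
  M.triangulation.finite.subset fun _ hT => hT.1

theorem exists_mem_meshIn (M : GradedMesh P) (hΛ : Λ ∈ tets P.K) {x : E3} (hx : x ∈ cell Λ) :
    ∃ T ∈ meshIn M Λ, x ∈ cell T := by
  have hfin : (meshIn M Λ).Finite := (tets_finite M).subset fun _ hT => hT.1
  have hclosed : IsClosed (⋃ T ∈ meshIn M Λ, cell T) :=
    hfin.isClosed_biUnion fun T _ => isClosed_cell T
  have hsub : interior (cell Λ) ⊆ ⋃ T ∈ meshIn M Λ, cell T := by
    intro y hy
    have h1 : y ∈ M.K.space := by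
      rw [M.space_eq]
      exact P.K.convexHull_subset_space hΛ.1 (interior_subset hy)
    obtain ⟨s, hs, hys⟩ := M.K.mem_space_iff.1 h1
    obtain ⟨T, hT, hsT⟩ := M.triangulation.pure s hs
    have hyT : y ∈ cell T := convexHull_mono (Finset.coe_subset.2 hsT) hys
    obtain ⟨Λ', hΛ', hTΛ'⟩ := M.subordinate T hT
    have hyI : y ∈ convexHull ℝ ((Λ : Set E3) ∩ (Λ' : Set E3)) :=
      P.K.inter_subset_convexHull hΛ.1 hΛ'.1 ⟨interior_subset hy, hTΛ' hyT⟩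
    obtain ⟨B, hB⟩ := exists_affineBasis_range hΛ.2 (P.K.indep hΛ.1)
    have hpos : ∀ i, 0 < B.coord i y := by
      have : y ∈ interior (convexHull ℝ (Set.range B)) := by rw [hB]; exact hy
      rw [B.interior_convexHull] at this
      exact this
    have hsubset : Λ ⊆ Λ' := by
      intro z hz
      by_contra hz'
      obtain ⟨i, rfl⟩ : z ∈ Set.range B := hB ▸ hz
      have h0 : (Λ : Set E3) ∩ (Λ' : Set E3) ⊆ B.coord i ⁻¹' {0} := by
        rintro q ⟨hq, hq'⟩
        obtain ⟨j, rfl⟩ : q ∈ Set.range B := hB ▸ hq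
        have hij : i ≠ j := by rintro rfl; exact hz' hq'
        simp [B.coord_apply_ne hij]
      have := convexHull_min h0 ((convex_singleton 0).affine_preimage _) hyI
      rw [Set.mem_preimage, Set.mem_singleton_iff] at this
      exact (hpos i).ne' this
    have heq : Λ = Λ' := Finset.eq_of_subset_of_card_le hsubset (by rw [hΛ.2, hΛ'.2])
    exact Set.mem_iUnion₂.2 ⟨T, ⟨hT, heq ▸ hTΛ'⟩, hyT⟩
  have := closure_minimal hsub hclosed
  rw [closure_interior_cell (interior_cell_nonempty_of_mem hΛ)] at this
  obtain ⟨T, hT, hxT⟩ := Set.mem_iUnion₂.1 (this hx)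
  exact ⟨T, hT, hxT⟩

theorem exists_vertical (F : IsFrame Λ e B b ℓ) (hs : P.IsSingular Λ e) {T : Finset E3}
    (hT : T ∈ meshIn M Λ) : ∃ x ∈ T, ∃ y ∈ T, x ≠ y ∧ proj b x = proj b y := by
  obtain ⟨x, hx, y, hy, hxy, h⟩ := M.vertical_edge Λ e hs T hT.1 hT.2
  refine ⟨x, hx, y, hy, hxy, ?_⟩
  rw [F.vectorSpan_eq, Submodule.mem_span_singleton] at h
  obtain ⟨c, hc⟩ := h
  have : y = x + c • b 2 := by rw [hc]; abel
  rw [this]; simp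

theorem card_shadow (F : IsFrame Λ e B b ℓ) (hs : P.IsSingular Λ e) {T : Finset E3}
    (hT : T ∈ meshIn M Λ) : (shadow b T).card = 3 := by
  apply le_antisymm
  · obtain ⟨x, hx, y, hy, hxy, h⟩ := exists_vertical F hs hT
    have : shadow b T ⊆ (T.erase x).image (proj b) := by
      intro p hp
      obtain ⟨z, hz, rfl⟩ := Finset.mem_image.1 hp
      by_cases hzx : z = x
      · subst hzx
        rw [h]
        exact Finset.mem_image_of_mem _ (Finset.mem_erase.2 ⟨hxy.symm, hy⟩)
      · exact Finset.mem_image_of_mem _ (Finset.mem_erase.2 ⟨hzx, hz⟩)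
    refine (Finset.card_le_card this).trans (Finset.card_image_le.trans ?_)
    rw [Finset.card_erase_of_mem hx, hT.1.2]
  · have hne : (interior (convexHull ℝ (shadow b T : Set E2))).Nonempty :=
      ((interior_cell_nonempty_of_mem hT.1).image (proj b)).mono (proj_interior_subset b T)
    have htop := interior_convexHull_nonempty_iff_affineSpan_eq_top.1 hne
    by_contra! hlt
    have hpos : 0 < (shadow b T).card := by
      rw [Finset.card_pos]
      by_contra! h0
      rw [h0] at hne
      simp at hne
    obtain ⟨n, hn⟩ : ∃ n, (shadow b T).card = n + 1 := ⟨(shadow b T).card - 1, by omega⟩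
    have h1 := finrank_vectorSpan_image_finset_le ℝ (id : E2 → E2) (shadow b T) hn
    rw [Finset.image_id, ← direction_affineSpan, htop, AffineSubspace.direction_top,
      finrank_top, finrank_euclideanSpace_fin] at h1
    omega

theorem sq_add_sq_le_of_angle {θ : ℝ} (h0 : 0 < θ) {x y : E3} (hx : θ ≤ InnerProductGeometry.angle x y)
    (hx' : InnerProductGeometry.angle x y + 2 * θ ≤ Real.pi) :
    Real.sin θ ^ 2 * (‖x‖ ^ 2 * ‖y‖ ^ 2) + inner ℝ x y ^ 2 ≤ ‖x‖ ^ 2 * ‖y‖ ^ 2 := by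
  rw [← InnerProductGeometry.cos_angle_mul_norm_mul_norm]
  set φ := InnerProductGeometry.angle x y
  have hs : Real.sin θ ≤ Real.sin φ := by
    rcases le_total φ (Real.pi / 2) with h | h
    · exact Real.sin_le_sin_of_le_of_le_pi_div_two (by linarith [Real.pi_pos]) h hx
    · rw [← Real.sin_pi_sub φ]
      exact Real.sin_le_sin_of_le_of_le_pi_div_two (by linarith [Real.pi_pos]) (by linarith)
        (by linarith)
  have hs0 : 0 ≤ Real.sin θ := Real.sin_nonneg_of_nonneg_of_le_pi h0.le (by linarith [Real.pi_pos])
  have h1 : Real.sin θ ^ 2 + Real.cos φ ^ 2 ≤ 1 := by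
    have := Real.sin_sq_add_cos_sq φ
    have : Real.sin θ ^ 2 ≤ Real.sin φ ^ 2 := by gcongr
    linarith
  have h2 : 0 ≤ ‖x‖ ^ 2 * ‖y‖ ^ 2 := by positivity
  nlinarith

theorem fat_shadow (F : IsFrame Λ e B b ℓ) (hs : P.IsSingular Λ e) {θ : ℝ} (hθ : 0 < θ)
    (hM : M.MinAngle θ) {T : Finset E3} (hT : T ∈ meshIn M Λ) : Fat (Real.sin θ) (shadow b T) := by
  refine ⟨card_shadow F hs hT, ?_⟩
  intro p hp q hq r hr hpq hrq hpr
  obtain ⟨x, hx, rfl⟩ := Finset.mem_image.1 hp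
  obtain ⟨y, hy, rfl⟩ := Finset.mem_image.1 hq
  obtain ⟨z, hz, rfl⟩ := Finset.mem_image.1 hr
  have hv := F.vectorSpan_eq
  have n1 : projAlong e x ≠ projAlong e y := fun h => hpq ((projAlong_eq_iff hv).1 h)
  have n2 : projAlong e z ≠ projAlong e y := fun h => hrq ((projAlong_eq_iff hv).1 h)
  have n3 : projAlong e x ≠ projAlong e z := fun h => hpr ((projAlong_eq_iff hv).1 h)
  have a1 := hM Λ e hs T hT.1 hT.2 x hx y hy z hz n1 n2.symm n3
  have a2 := hM Λ e hs T hT.1 hT.2 y hy z hz x hx n2.symm n3.symm n1.symm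
  have a3 := hM Λ e hs T hT.1 hT.2 z hz x hx y hy n3.symm n1 n2
  have hsum := EuclideanGeometry.angle_add_angle_add_angle_eq_pi (p₁ := projAlong e x)
    (p₂ := projAlong e y) (projAlong e z) n1.symm
  have key := sq_add_sq_le_of_angle hθ (x := projAlong e x - projAlong e y)
    (y := projAlong e z - projAlong e y) a1 (by
      change EuclideanGeometry.angle (projAlong e x) (projAlong e y) (projAlong e z) + 2 * θ ≤ _
      linarith)
  rwa [inner_projAlong_sub hv, norm_projAlong_sub hv, norm_projAlong_sub hv] at key

theorem conforming_shadow (F : IsFrame Λ e B b ℓ) (hs : P.IsSingular Λ e) {T T' : Finset E3}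
    (hT : T ∈ meshIn M Λ) (hT' : T' ∈ meshIn M Λ) :
    hull (shadow b T) ∩ hull (shadow b T') ⊆ hull (shadow b T ∩ shadow b T') := by
  rintro p ⟨hp, hp'⟩
  rw [hull_shadow] at hp hp'
  obtain ⟨x, hx, rfl⟩ := hp
  obtain ⟨y, hy, hxy⟩ := hp'
  have hv := F.vectorSpan_eq
  have h := M.proj_conforming Λ e hs T hT.1 T' hT'.1 hT.2 hT'.2
    ⟨⟨x, hx, rfl⟩, ⟨y, hy, (projAlong_eq_iff hv).2 hxy⟩⟩
  have h2 : proj b (projAlong e x) ∈ proj b '' convexHull ℝ (projAlong e '' (T : Set E3) ∩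
      projAlong e '' (T' : Set E3)) := ⟨_, h, rfl⟩
  have h3 := (proj b).toLinearMap.image_convexHull (projAlong e '' (T : Set E3) ∩
      projAlong e '' (T' : Set E3))
  rw [ContinuousLinearMap.coe_coe] at h3
  rw [h3, proj_projAlong hv] at h2
  refine convexHull_mono ?_ h2
  rintro _ ⟨_, ⟨⟨u, hu, rfl⟩, ⟨w, hw, hwu⟩⟩, rfl⟩
  rw [Finset.coe_inter, coe_shadow, coe_shadow]
  exact ⟨⟨u, hu, (proj_projAlong hv u).symm⟩, ⟨w, hw, by rw [← hwu, proj_projAlong hv]⟩⟩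

/-- An element lies on one side of each of the planes. -/
theorem le_or_ge_of_mem_cuts (F : IsFrame Λ e B b ℓ) (hs : P.IsSingular Λ e) {T : Finset E3}
    (hT : T ∈ meshIn M Λ) {q : E3} (hq : q ∈ M.cuts Λ e) :
    (∀ x ∈ cell T, lam B x ≤ lam B q * mu B x) ∨ ∀ x ∈ cell T, lam B q * mu B x ≤ lam B x := by
  set f : E3 →ᵃ[ℝ] ℝ := lam B - lam B q • mu B with hf
  have hfa : ∀ y, f y = lam B y - lam B q * mu B y := fun y => rfl
  have hfc : Continuous f := f.continuous_of_finiteDimensional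
  have hqe := M.cuts_subset Λ e hs hq
  have hI : IsPreconnected (f '' interior (cell T)) :=
    ((convex_cell T).interior.isPreconnected).image _ hfc.continuousOn
  have h0 : (0 : ℝ) ∉ f '' interior (cell T) := by
    rintro ⟨x, hx, hx0⟩
    refine Set.disjoint_left.1 (M.planes_split Λ e hs T hT.1 hT.2 q hq) hx ?_
    refine (F.mem_cutPlane_iff hqe).2 ?_
    rw [hfa] at hx0; linarith
  have hcl := closure_interior_cell (interior_cell_nonempty_of_mem hT.1)
  by_cases h : ∃ x ∈ interior (cell T), 0 < f x
  · right
    obtain ⟨x, hx, hx0⟩ := h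
    have hpos : interior (cell T) ⊆ f ⁻¹' Set.Ici 0 := by
      intro y hy
      by_contra hy0
      exact h0 (hI.ordConnected.out ⟨y, hy, rfl⟩ ⟨x, hx, rfl⟩ ⟨(not_le.1 hy0).le, hx0.le⟩)
    have := closure_minimal hpos (isClosed_Ici.preimage hfc)
    intro y hy
    rw [← hcl] at hy
    have := this hy
    rw [Set.mem_preimage, Set.mem_Ici, hfa] at this
    linarith
  · left
    push Not at h
    have := closure_minimal (show interior (cell T) ⊆ f ⁻¹' Set.Iic 0 from h)
      (isClosed_Iic.preimage hfc)
    intro y hy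
    rw [← hcl] at hy
    have := this hy
    rw [Set.mem_preimage, Set.mem_Iic, hfa] at this
    linarith

end

end

noncomputable section

/-! ### Columns -/

/-- The points over `A` strictly between the planes `lam = ρ₁ mu` and `lam = ρ₂ mu`. -/
def col (B : AffineBasis (Fin 4) ℝ E3) (b : OrthonormalBasis (Fin 3) ℝ E3) (A : Set E2)
    (ρ₁ ρ₂ : ℝ) : Set E3 :=
  {x | proj b x ∈ A ∧ ρ₁ * mu B x < lam B x ∧ lam B x < ρ₂ * mu B x}

/-- The point over `y` with `lam = τ`. -/
def liftTo (B : AffineBasis (Fin 4) ℝ E3) (b : OrthonormalBasis (Fin 3) ℝ E3) (ℓ : ℝ) (y : E2)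
    (τ : ℝ) : E3 :=
  shear b 0 1 (by norm_num) (y, ℓ * (τ - lam B (shear b 0 1 (by norm_num) (y, 0))))

variable {P : MacroPartition} {M : GradedMesh P} {Λ e : Finset E3} {B : AffineBasis (Fin 4) ℝ E3}
  {b : OrthonormalBasis (Fin 3) ℝ E3} {ℓ ρ₁ ρ₂ : ℝ} {A : Set E2}

theorem continuous_lam (B : AffineBasis (Fin 4) ℝ E3) : Continuous (lam B) :=
  (lam B).continuous_of_finiteDimensional

theorem continuous_mu (B : AffineBasis (Fin 4) ℝ E3) : Continuous (mu B) :=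
  (mu B).continuous_of_finiteDimensional

@[simp] theorem proj_liftTo (y : E2) (τ : ℝ) : proj b (liftTo B b ℓ y τ) = y := by simp [liftTo]

theorem lam_liftTo (F : IsFrame Λ e B b ℓ) (y : E2) (τ : ℝ) : lam B (liftTo B b ℓ y τ) = τ := by
  have h : liftTo B b ℓ y τ = shear b 0 1 (by norm_num) (y, 0) +
      (ℓ * (τ - lam B (shear b 0 1 (by norm_num) (y, 0)))) • b 2 := by
    rw [liftTo, shear_apply, shear_apply]; module
  rw [h, F.lam_add_smul]
  have := F.ne_zero
  field_simp
  ring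

theorem isOpen_col (hA : IsOpen A) : IsOpen (col B b A ρ₁ ρ₂) :=
  (hA.preimage (proj b).continuous).inter
    ((isOpen_lt (continuous_const.mul (continuous_mu B)) (continuous_lam B)).inter
      (isOpen_lt (continuous_lam B) (continuous_const.mul (continuous_mu B))))

theorem convex_col (hA : Convex ℝ A) : Convex ℝ (col B b A ρ₁ ρ₂) := by
  have h1 : Convex ℝ {x | ρ₁ * mu B x < lam B x} := by
    have : {x | ρ₁ * mu B x < lam B x} = (lam B - ρ₁ • mu B) ⁻¹' Set.Ioi 0 := by
      ext x; simp
    rw [this]; exact (convex_Ioi 0).affine_preimage _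
  have h2 : Convex ℝ {x | lam B x < ρ₂ * mu B x} := by
    have : {x | lam B x < ρ₂ * mu B x} = (ρ₂ • mu B - lam B) ⁻¹' Set.Ioi 0 := by
      ext x; simp
    rw [this]; exact (convex_Ioi 0).affine_preimage _
  exact (hA.linear_preimage (proj b).toLinearMap).inter (h1.inter h2)

theorem col_mono {A' : Set E2} (h : A ⊆ A') : col B b A ρ₁ ρ₂ ⊆ col B b A' ρ₁ ρ₂ :=
  fun _ hx => ⟨h hx.1, hx.2⟩

theorem mem_closure_col (hA : IsOpen A) (hAc : Convex ℝ A) (hne : (col B b A ρ₁ ρ₂).Nonempty)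
    {x : E3} (hx : proj b x ∈ closure A) (h1 : ρ₁ * mu B x ≤ lam B x) (h2 : lam B x ≤ ρ₂ * mu B x) :
    x ∈ closure (col B b A ρ₁ ρ₂) := by
  obtain ⟨k, hk, hk1, hk2⟩ := hne
  have hmem : ∀ s ∈ Set.Ioo (0 : ℝ) 1, AffineMap.lineMap x k s ∈ col B b A ρ₁ ρ₂ := by
    rintro s ⟨hs0, hs1⟩
    have hs1' : 0 < 1 - s := by linarith
    refine ⟨?_, ?_, ?_⟩
    · have := hAc.openSegment_closure_interior_subset_interior hx (by rwa [hA.interior_eq])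
      rw [hA.interior_eq] at this
      apply this
      rw [openSegment_eq_image_lineMap]
      exact ⟨s, ⟨hs0, hs1⟩, (AffineMap.apply_lineMap (proj b).toLinearMap.toAffineMap x k s).symm⟩
    · rw [AffineMap.apply_lineMap, AffineMap.apply_lineMap, AffineMap.lineMap_apply_module,
        AffineMap.lineMap_apply_module]
      simp only [smul_eq_mul]
      nlinarith
    · rw [AffineMap.apply_lineMap, AffineMap.apply_lineMap, AffineMap.lineMap_apply_module,
        AffineMap.lineMap_apply_module]
      simp only [smul_eq_mul]
      nlinarith
  have hlim : Filter.Tendsto (fun s : ℝ => AffineMap.lineMap x k s) (nhdsWithin 0 (Set.Ioo 0 1))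
      (nhds x) := by
    have : Filter.Tendsto (fun s : ℝ => AffineMap.lineMap x k s) (nhds 0)
        (nhds (AffineMap.lineMap x k (0 : ℝ))) := AffineMap.lineMap_continuous.tendsto 0
    rw [AffineMap.lineMap_apply_zero] at this
    exact this.mono_left nhdsWithin_le_nhds
  have : (nhdsWithin (0 : ℝ) (Set.Ioo 0 1)).NeBot := by
    rw [← mem_closure_iff_nhdsWithin_neBot, closure_Ioo zero_ne_one]
    simp
  exact mem_closure_of_tendsto hlim (Filter.eventually_of_mem self_mem_nhdsWithin hmem)

/-- Interior points of a set between two planes are strictly between the planes. -/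
theorem lt_of_mem_interior (F : IsFrame Λ e B b ℓ) {C : Set E3} (ρ : ℝ)
    {x : E3} (hx : x ∈ interior C) :
    ((∀ y ∈ C, ρ * mu B y ≤ lam B y) → ρ * mu B x < lam B x) ∧
    ((∀ y ∈ C, lam B y ≤ ρ * mu B y) → lam B x < ρ * mu B x) := by
  have hc : Filter.Tendsto (fun s : ℝ => x + s • b 2) (nhds 0) (nhds x) := by
    have : Continuous fun s : ℝ => x + s • b 2 := by fun_prop
    have := this.tendsto 0
    simpa using this
  have hev := hc.eventually (mem_interior_iff_mem_nhds.1 hx)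
  obtain ⟨ε, hε, hball⟩ := Metric.eventually_nhds_iff.1 hev
  have hin : ∀ s : ℝ, |s| < ε → x + s • b 2 ∈ C := fun s hs => hball (by simpa using hs)
  have hs1 : |ε / 2| < ε := by rw [abs_of_pos (by positivity)]; linarith
  have hs2 : |-(ε / 2)| < ε := by rwa [abs_neg]
  have key : ∃ s : ℝ, |s| < ε ∧ 0 < s / ℓ := by
    rcases lt_or_gt_of_ne F.ne_zero with h | h
    · exact ⟨_, hs2, div_pos_of_neg_of_neg (by linarith) h⟩
    · exact ⟨_, hs1, div_pos (by linarith) h⟩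
  obtain ⟨s, hs, hsl⟩ := key
  constructor
  · intro h
    have := h _ (hin (-s) (by rwa [abs_neg]))
    rw [F.mu_add_smul, F.lam_add_smul, neg_div] at this
    linarith
  · intro h
    have := h _ (hin s hs)
    rw [F.mu_add_smul, F.lam_add_smul] at this
    linarith

theorem mem_layer_of_proj (F : IsFrame Λ e B b ℓ) (h0 : 0 ≤ ρ₁) (h1 : ρ₂ ≤ 1) {x : E3}
    (hx : proj b x ∈ proj b '' cell Λ) (hx1 : ρ₁ * mu B x ≤ lam B x) (hx2 : lam B x ≤ ρ₂ * mu B x) :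
    x ∈ IsFrame.layer Λ B ρ₁ ρ₂ := by
  obtain ⟨y, hy, hyx⟩ := hx
  rw [F.mem_cell_iff] at hy
  have hmu : 0 ≤ mu B x := by
    rw [← F.mu_congr hyx, mu_apply]; linarith [hy 0, hy 1]
  refine ⟨F.mem_cell_iff.2 fun i => ?_, hx1, hx2⟩
  have hl : B.coord 1 x = lam B x := rfl
  have hm : mu B x = B.coord 0 x + B.coord 1 x := rfl
  have a1 : 0 ≤ ρ₁ * mu B x := mul_nonneg h0 hmu
  have a2 : ρ₂ * mu B x ≤ mu B x := mul_le_of_le_one_left hmu h1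
  fin_cases i
  · change 0 ≤ B.coord 0 x; linarith
  · change 0 ≤ B.coord 1 x; linarith
  · change 0 ≤ B.coord 2 x
    rw [← F.coord_congr hyx (by decide) (by decide)]; exact hy 2
  · change 0 ≤ B.coord 3 x
    rw [← F.coord_congr hyx (by decide) (by decide)]; exact hy 3

theorem interior_cell_subset_col (F : IsFrame Λ e B b ℓ) {T : Finset E3}
    (hT : cell T ⊆ IsFrame.layer Λ B ρ₁ ρ₂) :
    interior (cell T) ⊆ col B b (interior (hull (shadow b T))) ρ₁ ρ₂ := fun _ hx =>
  ⟨proj_interior_subset b T ⟨_, hx, rfl⟩,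
    (lt_of_mem_interior F ρ₁ hx).1 fun _ hy => (hT hy).2.1,
    (lt_of_mem_interior F ρ₂ hx).2 fun _ hy => (hT hy).2.2⟩

/-! ### The shadows of the elements -/

theorem meshIn_finite (M : GradedMesh P) (Λ : Finset E3) : (meshIn M Λ).Finite :=
  (tets_finite M).subset fun _ hT => hT.1

open Classical in
/-- The projections of the elements of `Q`. -/
def shadows (b : OrthonormalBasis (Fin 3) ℝ E3) (Q : Finset (Finset E3)) : Finset (Finset E2) :=
  Q.image (shadow b)

theorem mem_shadows {Q : Finset (Finset E3)} {t : Finset E2} :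
    t ∈ shadows b Q ↔ ∃ T ∈ Q, shadow b T = t := Finset.mem_image

theorem shadow_mem_shadows {Q : Finset (Finset E3)} {T : Finset E3} (h : T ∈ Q) :
    shadow b T ∈ shadows b Q := mem_shadows.2 ⟨T, h, rfl⟩

theorem conforming_shadows (F : IsFrame Λ e B b ℓ) (hs : P.IsSingular Λ e) {Q : Finset (Finset E3)}
    (hQ : ∀ T ∈ Q, T ∈ meshIn M Λ) : Conforming (shadows b Q) := by
  intro t ht t' ht'
  obtain ⟨T, hT, rfl⟩ := mem_shadows.1 ht
  obtain ⟨T', hT', rfl⟩ := mem_shadows.1 ht'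
  exact conforming_shadow F hs (hQ T hT) (hQ T' hT')

theorem fat_shadows (F : IsFrame Λ e B b ℓ) (hs : P.IsSingular Λ e) {θ : ℝ} (hθ : 0 < θ)
    (hM : M.MinAngle θ) {Q : Finset (Finset E3)} (hQ : ∀ T ∈ Q, T ∈ meshIn M Λ) :
    ∀ t ∈ shadows b Q, Fat (Real.sin θ) t := by
  intro t ht
  obtain ⟨T, hT, rfl⟩ := mem_shadows.1 ht
  exact fat_shadow F hs hθ hM (hQ T hT)

theorem shadow_eq_of_mem_interior (F : IsFrame Λ e B b ℓ) (hs : P.IsSingular Λ e) {θ : ℝ}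
    (hθ : 0 < θ) (hκ : 0 < Real.sin θ) (hM : M.MinAngle θ) {T T' : Finset E3} (hT : T ∈ meshIn M Λ)
    (hT' : T' ∈ meshIn M Λ) {p : E2} (hp : p ∈ interior (hull (shadow b T)))
    (hp' : p ∈ hull (shadow b T')) : shadow b T = shadow b T' := by
  have hQ : ∀ T'' ∈ (meshIn_finite M Λ).toFinset, T'' ∈ meshIn M Λ := fun T'' h => by simpa using h
  exact (conforming_shadows F hs hQ).eq_of_mem_interior hκ (fat_shadows F hs hθ hM hQ)
    (shadow_mem_shadows (by simpa using hT)) (shadow_mem_shadows (by simpa using hT')) hp hp'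

theorem isClosed_biUnion_cell (Q : Finset (Finset E3)) : IsClosed (⋃ T ∈ Q, cell T) :=
  Q.finite_toSet.isClosed_biUnion fun T _ => isClosed_cell T

theorem interior_cell_subset_patchSet {Q : Finset (Finset E3)} {T : Finset E3} (h : T ∈ Q) :
    interior (cell T) ⊆ patchSet Q :=
  interior_mono (Set.subset_biUnion_of_mem (u := fun T => cell T) h)

theorem closure_patchSet_subset (Q : Finset (Finset E3)) : closure (patchSet Q) ⊆ ⋃ T ∈ Q, cell T :=
  closure_minimal interior_subset (isClosed_biUnion_cell Q)

theorem cell_subset_closure_patchSet {K : Geometry.SimplicialComplex ℝ E3} {Q : Finset (Finset E3)}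
    {T : Finset E3} (h : T ∈ Q) (hT : T ∈ tets K) : cell T ⊆ closure (patchSet Q) := by
  rw [← closure_interior_cell (interior_cell_nonempty_of_mem hT)]
  exact closure_mono (interior_cell_subset_patchSet h)

/-- The closed elements of `Q` fill the part of the layer over their projections. -/
def Fills (B : AffineBasis (Fin 4) ℝ E3) (b : OrthonormalBasis (Fin 3) ℝ E3) (Λ : Finset E3)
    (Q : Finset (Finset E3)) (ρ₁ ρ₂ : ℝ) : Prop :=
  (∀ T ∈ Q, cell T ⊆ IsFrame.layer Λ B ρ₁ ρ₂) ∧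
  ∀ x ∈ IsFrame.layer Λ B ρ₁ ρ₂, ∀ t ∈ shadows b Q, proj b x ∈ hull t → x ∈ ⋃ T ∈ Q, cell T

theorem fills_of_col_subset (F : IsFrame Λ e B b ℓ) {Q : Finset (Finset E3)}
    (hQ : ∀ T ∈ Q, T ∈ meshIn M Λ) (hl : ∀ T ∈ Q, cell T ⊆ IsFrame.layer Λ B ρ₁ ρ₂)
    (h : ∀ t ∈ shadows b Q, col B b (interior (hull t)) ρ₁ ρ₂ ⊆ ⋃ T ∈ Q, cell T) :
    Fills B b Λ Q ρ₁ ρ₂ := by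
  refine ⟨hl, fun x hx t ht hxt => ?_⟩
  obtain ⟨T, hT, rfl⟩ := mem_shadows.1 ht
  have hne := interior_cell_nonempty_of_mem (hQ T hT).1
  have hcol := hne.mono (interior_cell_subset_col F (hl T hT))
  refine closure_minimal (h _ ht) (isClosed_biUnion_cell Q) (mem_closure_col isOpen_interior
    ((convex_convexHull ℝ _).interior) hcol ?_ hx.2.1 hx.2.2)
  have hC : Convex ℝ (hull (shadow b T)) := convex_convexHull ℝ _
  change proj b x ∈ closure (interior (hull (shadow b T)))
  rw [hC.closure_interior_eq_closure_of_nonempty_interior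
    ((hne.image (proj b)).mono (proj_interior_subset b T))]
  exact subset_closure hxt

/-- The open patch is the column over the interior of its projection. -/
theorem Fills.patchSet_eq (F : IsFrame Λ e B b ℓ) (h0 : 0 ≤ ρ₁) (h1 : ρ₂ ≤ 1)
    {Q : Finset (Finset E3)} (hQ : ∀ T ∈ Q, T ∈ meshIn M Λ) (h : Fills B b Λ Q ρ₁ ρ₂) :
    patchSet Q = col B b (interior (⋃ t ∈ shadows b Q, hull t)) ρ₁ ρ₂ := by
  have hsub : (⋃ t ∈ shadows b Q, hull t) ⊆ proj b '' cell Λ := by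
    refine Set.iUnion₂_subset fun t ht => ?_
    obtain ⟨T, hT, rfl⟩ := mem_shadows.1 ht
    rw [hull_shadow]
    exact Set.image_mono (hQ T hT).2
  apply subset_antisymm
  · intro x hx
    refine ⟨?_, (lt_of_mem_interior F ρ₁ hx).1 ?_, (lt_of_mem_interior F ρ₂ hx).2 ?_⟩
    · have himg : proj b '' patchSet Q ⊆ ⋃ t ∈ shadows b Q, hull t := by
        rintro _ ⟨z, hz, rfl⟩
        obtain ⟨T, hT, hzT⟩ := Set.mem_iUnion₂.1 (interior_subset hz)
        refine Set.mem_iUnion₂.2 ⟨_, shadow_mem_shadows hT, ?_⟩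
        rw [hull_shadow]; exact ⟨z, hzT, rfl⟩
      exact interior_maximal himg (isOpenMap_proj b _ isOpen_interior) ⟨x, hx, rfl⟩
    · intro y hy
      obtain ⟨T, hT, hyT⟩ := Set.mem_iUnion₂.1 hy
      exact (h.1 T hT hyT).2.1
    · intro y hy
      obtain ⟨T, hT, hyT⟩ := Set.mem_iUnion₂.1 hy
      exact (h.1 T hT hyT).2.2
  · refine interior_maximal (fun x hx => ?_) (isOpen_col isOpen_interior)
    obtain ⟨t, ht, hxt⟩ := Set.mem_iUnion₂.1 (interior_subset hx.1)
    exact h.2 x (mem_layer_of_proj F h0 h1 (hsub (interior_subset hx.1)) hx.2.1.le hx.2.2.le) t ht hxt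

/-- Every admissible patch fills the layer between two planes over its projection. -/
theorem GradedMesh.IsAdmissible.fills (F : IsFrame Λ e B b ℓ) (hs : P.IsSingular Λ e)
    {T : Finset E3} {Q : Finset (Finset E3)} (h : M.IsAdmissible Λ e T Q) :
    (∀ T ∈ Q, T ∈ meshIn M Λ) ∧ ∃ p ∈ M.cuts Λ e, ∃ q ∈ M.cuts Λ e, lam B p < lam B q ∧
      Fills B b Λ Q (lam B p) (lam B q) := by
  have hQ : ∀ T ∈ Q, T ∈ meshIn M Λ := by
    intro T' hT'
    refine ⟨h.subset T' hT', ?_⟩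
    refine (cell_subset_closure_patchSet hT' (h.subset T' hT')).trans ?_
    exact closure_minimal (GradedMesh.IsAdmissible.subset_macro h) (isClosed_cell Λ)
  refine ⟨hQ, ?_⟩
  obtain ⟨p, hp, q, hq, hpq, D, hD⟩ := h.prism
  have hpe := M.cuts_subset Λ e hs hp
  have hqe := M.cuts_subset Λ e hs hq
  have hne : lam B p ≠ lam B q := by
    intro heq
    apply hpq
    rw [(F.mem_cell_edge hpe).1, (F.mem_cell_edge hqe).1, heq]
  wlog hlt : lam B p < lam B q generalizing p q
  · exact this q hq p hp hpq.symm (by rwa [strip_comm]) hqe hpe hne.symm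
      (lt_of_le_of_ne (not_lt.1 hlt) hne.symm)
  refine ⟨p, hp, q, hq, hlt, ?_⟩
  rw [F.strip_eq hpe hqe hlt] at hD
  have hp0 := (F.mem_cell_edge hpe).2.2.1
  have hq1 := (F.mem_cell_edge hqe).2.2.2
  have hclosed : IsClosed (IsFrame.layer Λ B (lam B p) (lam B q)) :=
    (isClosed_cell Λ).inter ((isClosed_le (continuous_const.mul (continuous_mu B))
      (continuous_lam B)).inter (isClosed_le (continuous_lam B)
      (continuous_const.mul (continuous_mu B))))
  refine fills_of_col_subset F hQ (fun T' hT' => ?_) fun t ht => ?_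
  · refine (cell_subset_closure_patchSet hT' (h.subset T' hT')).trans (closure_minimal ?_ hclosed)
    rw [hD]
    exact Set.inter_subset_left.trans interior_subset
  · obtain ⟨T', hT', rfl⟩ := mem_shadows.1 ht
    refine Set.Subset.trans ?_ (interior_subset (s := ⋃ T ∈ Q, cell T))
    change _ ⊆ patchSet Q
    rw [hD]
    intro x hx
    have hxT := interior_hull_shadow_subset b (interior_cell_nonempty_of_mem (h.subset T' hT')) hx.1
    constructor
    · refine interior_maximal (fun y hy => ?_) (isOpen_col isOpen_interior) hx
      refine mem_layer_of_proj F hp0 hq1 ?_ hy.2.1.le hy.2.2.le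
      have := interior_subset hy.1
      rw [hull_shadow] at this
      exact Set.image_mono (hQ T' hT').2 this
    · obtain ⟨x', hx', hxx⟩ := hxT
      have hx'D := interior_cell_subset_patchSet hT' hx'
      rw [hD] at hx'D
      have := hx'D.2
      rwa [Set.mem_preimage, (projAlong_eq_iff F.vectorSpan_eq).2 hxx] at this

end

noncomputable section

/-! ### The number of elements of a patch -/

theorem Conforming.mem_of_mem_hull {𝒯 : Finset (Finset E2)} (hconf : Conforming 𝒯) {κ : ℝ}
    (hκ : 0 < κ) (hfat : ∀ t ∈ 𝒯, Fat κ t) {t t' : Finset E2} (ht : t ∈ 𝒯) (ht' : t' ∈ 𝒯) {V : E2}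
    (hV : V ∈ t) (hV' : V ∈ hull t') : V ∈ t' := by
  obtain ⟨x, y, z, hxy, hxz, hyz, htx⟩ := Finset.card_eq_three.1 (hfat t ht).card
  obtain ⟨T, -, -, -, hr⟩ := (hfat t ht).exists_tri hκ (x := x) (y := y) (z := z)
    (by simp [htx]) (by simp [htx]) (by simp [htx]) hxy hyz hxz
  obtain ⟨i, rfl⟩ : V ∈ Set.range T.B := hr ▸ hV
  by_contra hcon
  have hsub : ((t ∩ t' : Finset E2) : Set E2) ⊆ T.B.coord i ⁻¹' {0} := by
    intro q hq
    rw [Finset.coe_inter] at hq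
    obtain ⟨j, rfl⟩ : q ∈ Set.range T.B := hr ▸ hq.1
    have hij : i ≠ j := by rintro rfl; exact hcon hq.2
    simp [T.B.coord_apply_ne hij]
  have := convexHull_min hsub ((convex_singleton 0).affine_preimage _)
    (hconf t ht t' ht' ⟨subset_hull hV, hV'⟩)
  simp at this

theorem exists_gap (V : Finset ℝ) {a c d : ℝ} (ha : a ∈ V) (hd : d ∈ V) (hac : a ≤ c) (hcd : c < d) :
    ∃ r ∈ V, ∃ s ∈ V, a ≤ r ∧ r ≤ c ∧ c < s ∧ s ≤ d ∧ ∀ v ∈ V, v ≤ r ∨ s ≤ v := by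
  have h1 : (V.filter (· ≤ c)).Nonempty := ⟨a, Finset.mem_filter.2 ⟨ha, hac⟩⟩
  have h2 : (V.filter (c < ·)).Nonempty := ⟨d, Finset.mem_filter.2 ⟨hd, hcd⟩⟩
  have m1 := Finset.mem_filter.1 (Finset.max'_mem _ h1)
  have m2 := Finset.mem_filter.1 (Finset.min'_mem _ h2)
  refine ⟨_, m1.1, _, m2.1, Finset.le_max' _ _ (Finset.mem_filter.2 ⟨ha, hac⟩), m1.2, m2.2,
    Finset.min'_le _ _ (Finset.mem_filter.2 ⟨hd, hcd⟩), fun v hv => ?_⟩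
  rcases le_or_gt v c with h | h
  · exact Or.inl (Finset.le_max' _ _ (Finset.mem_filter.2 ⟨hv, h⟩))
  · exact Or.inr (Finset.min'_le _ _ (Finset.mem_filter.2 ⟨hv, h⟩))

open Classical in
/-- The pairs of neighbouring values of the finite set `V` between `ρ₁` and `ρ₂`. -/
def gaps (V : Finset ℝ) (ρ₁ ρ₂ : ℝ) : Finset (ℝ × ℝ) :=
  (V ×ˢ V).filter fun g => ρ₁ ≤ g.1 ∧ g.1 < g.2 ∧ g.2 ≤ ρ₂ ∧ ∀ v ∈ V, v ≤ g.1 ∨ g.2 ≤ v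

theorem mem_gaps {V : Finset ℝ} {ρ₁ ρ₂ : ℝ} {g : ℝ × ℝ} : g ∈ gaps V ρ₁ ρ₂ ↔
    (g.1 ∈ V ∧ g.2 ∈ V) ∧ ρ₁ ≤ g.1 ∧ g.1 < g.2 ∧ g.2 ≤ ρ₂ ∧ ∀ v ∈ V, v ≤ g.1 ∨ g.2 ≤ v := by
  rw [gaps, Finset.mem_filter, Finset.mem_product]

variable {P : MacroPartition} {M : GradedMesh P} {Λ e : Finset E3} {B : AffineBasis (Fin 4) ℝ E3}
  {b : OrthonormalBasis (Fin 3) ℝ E3} {ℓ ρ₁ ρ₂ : ℝ}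

open Classical in
/-- The values of `lam` at the points where the planes meet the singular edge. -/
def cutVals (M : GradedMesh P) (Λ e : Finset E3) (B : AffineBasis (Fin 4) ℝ E3) : Finset ℝ :=
  (M.cuts Λ e).image (lam B)

theorem mem_cutVals {r : ℝ} : r ∈ cutVals M Λ e B ↔ ∃ p ∈ M.cuts Λ e, lam B p = r :=
  Finset.mem_image

theorem cutVals_mem_Icc (F : IsFrame Λ e B b ℓ) (hs : P.IsSingular Λ e) {r : ℝ}
    (hr : r ∈ cutVals M Λ e B) : 0 ≤ r ∧ r ≤ 1 := by
  obtain ⟨p, hp, rfl⟩ := mem_cutVals.1 hr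
  exact (F.mem_cell_edge (M.cuts_subset Λ e hs hp)).2.2

theorem le_or_ge_of_mem_cutVals (F : IsFrame Λ e B b ℓ) (hs : P.IsSingular Λ e) {T : Finset E3}
    (hT : T ∈ meshIn M Λ) {r : ℝ} (hr : r ∈ cutVals M Λ e B) :
    (∀ x ∈ cell T, lam B x ≤ r * mu B x) ∨ ∀ x ∈ cell T, r * mu B x ≤ lam B x := by
  obtain ⟨p, hp, rfl⟩ := mem_cutVals.1 hr
  exact le_or_ge_of_mem_cuts F hs hT hp

theorem mu_nonneg (F : IsFrame Λ e B b ℓ) {x : E3} (hx : x ∈ cell Λ) : 0 ≤ mu B x := by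
  rw [F.mem_cell_iff] at hx
  rw [mu_apply]
  linarith [hx 0, hx 1]

theorem mu_pos_of_mem_interior (F : IsFrame Λ e B b ℓ) {x : E3} (hx : x ∈ interior (cell Λ)) :
    0 < mu B x := by
  rw [cell, ← F.range_eq, B.interior_convexHull] at hx
  rw [mu_apply]
  linarith [hx 0, hx 1]

theorem mu_pos_of_proj (F : IsFrame Λ e B b ℓ) (hs : P.IsSingular Λ e) {x : E3}
    (hx : proj b x ∈ interior (hull (shadow b Λ))) : 0 < mu B x := by
  obtain ⟨y, hy, hyx⟩ := interior_hull_shadow_subset b (interior_cell_nonempty_of_mem hs.1) hx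
  rw [← F.mu_congr hyx]
  exact mu_pos_of_mem_interior F hy

theorem exists_mem_col (F : IsFrame Λ e B b ℓ) (hs : P.IsSingular Λ e) (h12 : ρ₁ < ρ₂) {A : Set E2}
    {y : E2} (hyA : y ∈ A) (hy : y ∈ interior (hull (shadow b Λ))) :
    ∃ x ∈ col B b A ρ₁ ρ₂, proj b x = y := by
  set m := mu B (liftTo B b ℓ y 0)
  set x := liftTo B b ℓ y ((ρ₁ + ρ₂) / 2 * m) with hx
  have hpx : proj b x = y := proj_liftTo _ _
  have hl : lam B x = (ρ₁ + ρ₂) / 2 * m := lam_liftTo F _ _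
  have hm : mu B x = m := F.mu_congr (by rw [hpx, proj_liftTo])
  have hpos : 0 < m := by rw [← hm]; exact mu_pos_of_proj F hs (hpx ▸ hy)
  refine ⟨x, ⟨hpx ▸ hyA, ?_, ?_⟩, hpx⟩ <;> rw [hl, hm] <;> nlinarith

theorem hull_shadow_subset {T : Finset E3} (hT : T ∈ meshIn M Λ) :
    hull (shadow b T) ⊆ hull (shadow b Λ) := by
  rw [hull_shadow, hull_shadow]; exact Set.image_mono hT.2

theorem interior_hull_shadow_nonempty {T : Finset E3} (hT : T ∈ tets M.K) :
    (interior (hull (shadow b T))).Nonempty :=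
  ((interior_cell_nonempty_of_mem hT).image (proj b)).mono (proj_interior_subset b T)

theorem closure_interior_hull_shadow {T : Finset E3} (hT : T ∈ tets M.K) :
    closure (interior (hull (shadow b T))) = hull (shadow b T) := by
  have hC : Convex ℝ (hull (shadow b T)) := convex_convexHull ℝ _
  rw [hC.closure_interior_eq_closure_of_nonempty_interior (interior_hull_shadow_nonempty hT),
    (isClosed_hull _).closure_eq]

/-- An element that has a point strictly between two planes of the family lies between them. -/
theorem cell_subset_layer (F : IsFrame Λ e B b ℓ) (hs : P.IsSingular Λ e) {T : Finset E3}
    (hT : T ∈ meshIn M Λ) (h1 : ρ₁ ∈ cutVals M Λ e B) (h2 : ρ₂ ∈ cutVals M Λ e B)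
    (hx1 : ∃ x ∈ cell T, ρ₁ * mu B x < lam B x) (hx2 : ∃ x ∈ cell T, lam B x < ρ₂ * mu B x) :
    cell T ⊆ IsFrame.layer Λ B ρ₁ ρ₂ := by
  obtain ⟨x, hx, hx1⟩ := hx1
  obtain ⟨y, hy, hy2⟩ := hx2
  intro z hz
  refine ⟨hT.2 hz, ?_, ?_⟩
  · rcases le_or_ge_of_mem_cutVals F hs hT h1 with h | h
    · exact absurd (h x hx) (not_le.2 hx1)
    · exact h z hz
  · rcases le_or_ge_of_mem_cutVals F hs hT h2 with h | h
    · exact h z hz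
    · exact absurd (h y hy) (not_le.2 hy2)

/-- Every element between two planes lies between two neighbouring ones. -/
theorem exists_mem_gaps (F : IsFrame Λ e B b ℓ) (hs : P.IsSingular Λ e) {T : Finset E3}
    (hT : T ∈ meshIn M Λ) (h1 : ρ₁ ∈ cutVals M Λ e B) (h2 : ρ₂ ∈ cutVals M Λ e B)
    (hl : cell T ⊆ IsFrame.layer Λ B ρ₁ ρ₂) :
    ∃ g ∈ gaps (cutVals M Λ e B) ρ₁ ρ₂, cell T ⊆ IsFrame.layer Λ B g.1 g.2 := by
  obtain ⟨x, hx⟩ := interior_cell_nonempty_of_mem hT.1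
  have hmu := mu_pos_of_mem_interior F (interior_mono hT.2 hx)
  have l1 : ρ₁ ≤ lam B x / mu B x := by
    rw [le_div_iff₀ hmu]; exact (hl (interior_subset hx)).2.1
  have l2 : lam B x / mu B x < ρ₂ := by
    rw [div_lt_iff₀ hmu]; exact (lt_of_mem_interior F ρ₂ hx).2 fun y hy => (hl hy).2.2
  obtain ⟨r, hr, s, hsV, a1, a2, a3, a4, a5⟩ := exists_gap _ h1 h2 l1 l2
  rw [le_div_iff₀ hmu] at a2
  rw [div_lt_iff₀ hmu] at a3
  refine ⟨(r, s), mem_gaps.2 ⟨⟨hr, hsV⟩, a1, ?_, a4, a5⟩, cell_subset_layer F hs hT hr hsV ?_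
    ⟨x, interior_subset hx, a3⟩⟩
  · exact lt_of_mul_lt_mul_right (lt_of_le_of_lt a2 a3) hmu.le
  · by_contra! hcon
    exact absurd ((lt_of_mem_interior F r hx).2 hcon) (not_lt.2 a2)

/-- Over each projected element there is an element between the given planes. -/
theorem exists_mem_between (F : IsFrame Λ e B b ℓ) (hs : P.IsSingular Λ e) {θ : ℝ} (hθ : 0 < θ)
    (hκ : 0 < Real.sin θ) (hM : M.MinAngle θ) {T : Finset E3} (hT : T ∈ meshIn M Λ)
    (h1 : ρ₁ ∈ cutVals M Λ e B) (h2 : ρ₂ ∈ cutVals M Λ e B) {x : E3}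
    (hx : x ∈ col B b (interior (hull (shadow b T))) ρ₁ ρ₂) :
    ∃ T' ∈ meshIn M Λ, x ∈ cell T' ∧ shadow b T' = shadow b T ∧
      cell T' ⊆ IsFrame.layer Λ B ρ₁ ρ₂ := by
  have hxL := mem_layer_of_proj F (cutVals_mem_Icc F hs h1).1 (cutVals_mem_Icc F hs h2).2 (x := x)
    (by rw [← hull_shadow]; exact hull_shadow_subset hT (interior_subset hx.1)) hx.2.1.le hx.2.2.le
  obtain ⟨T', hT', hxT'⟩ := exists_mem_meshIn M hs.1 hxL.1
  refine ⟨T', hT', hxT', ?_, cell_subset_layer F hs hT' h1 h2 ⟨x, hxT', hx.2.1⟩ ⟨x, hxT', hx.2.2⟩⟩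
  exact (shadow_eq_of_mem_interior F hs hθ hκ hM hT hT' hx.1
    (by rw [hull_shadow]; exact ⟨x, hxT', rfl⟩)).symm

section

variable {θ : ℝ} {T : Finset E3}

/-- The elements between the planes whose projections meet that of `T`. -/
def neighbours (M : GradedMesh P) (Λ T : Finset E3) (B : AffineBasis (Fin 4) ℝ E3)
    (b : OrthonormalBasis (Fin 3) ℝ E3) (ρ₁ ρ₂ : ℝ) : Finset (Finset E3) :=
  Set.Finite.toFinset (s := {T' ∈ meshIn M Λ | cell T' ⊆ IsFrame.layer Λ B ρ₁ ρ₂ ∧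
    (shadow b T' ∩ shadow b T).Nonempty}) ((meshIn_finite M Λ).subset (Set.sep_subset _ _))

theorem mem_neighbours {T' : Finset E3} : T' ∈ neighbours M Λ T B b ρ₁ ρ₂ ↔
    T' ∈ meshIn M Λ ∧ cell T' ⊆ IsFrame.layer Λ B ρ₁ ρ₂ ∧ (shadow b T' ∩ shadow b T).Nonempty := by
  rw [neighbours, Set.Finite.mem_toFinset]; rfl

theorem neighbours_fills (F : IsFrame Λ e B b ℓ) (hs : P.IsSingular Λ e) (hθ : 0 < θ)
    (hκ : 0 < Real.sin θ) (hM : M.MinAngle θ) (h1 : ρ₁ ∈ cutVals M Λ e B)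
    (h2 : ρ₂ ∈ cutVals M Λ e B) : Fills B b Λ (neighbours M Λ T B b ρ₁ ρ₂) ρ₁ ρ₂ := by
  refine fills_of_col_subset F (fun T' h => (mem_neighbours.1 h).1) (fun T' h => (mem_neighbours.1 h).2.1)
    fun t ht x hx => ?_
  obtain ⟨T', hT', rfl⟩ := mem_shadows.1 ht
  have hT' := mem_neighbours.1 hT'
  obtain ⟨T'', a1, a2, a3, a4⟩ := exists_mem_between F hs hθ hκ hM hT'.1 h1 h2 hx
  exact Set.mem_iUnion₂.2 ⟨T'', mem_neighbours.2 ⟨a1, a4, a3 ▸ hT'.2.2⟩, a2⟩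

/-- Near a vertex `V` of the projection of `T`, the projection of the macro-element is covered by
the projected elements with vertex `V`. -/
theorem exists_ball_inter_subset (F : IsFrame Λ e B b ℓ) (hs : P.IsSingular Λ e) (hθ : 0 < θ)
    (hκ : 0 < Real.sin θ) (hM : M.MinAngle θ) (hT : T ∈ meshIn M Λ) {V : E2} (hV : V ∈ shadow b T) :
    ∃ r > 0, ∀ T' ∈ meshIn M Λ, (Metric.ball V r ∩ hull (shadow b T')).Nonempty → V ∈ shadow b T' := by
  have hQ : ∀ T'' ∈ (meshIn_finite M Λ).toFinset, T'' ∈ meshIn M Λ := fun T'' h => by simpa using h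
  have hcl : IsClosed (⋃ T' ∈ {T' ∈ meshIn M Λ | V ∉ shadow b T'}, hull (shadow b T')) :=
    ((meshIn_finite M Λ).subset (Set.sep_subset _ _)).isClosed_biUnion fun _ _ => isClosed_hull _
  have hVn : V ∉ ⋃ T' ∈ {T' ∈ meshIn M Λ | V ∉ shadow b T'}, hull (shadow b T') := by
    intro h
    obtain ⟨T', hT', hV'⟩ := Set.mem_iUnion₂.1 h
    exact hT'.2 ((conforming_shadows F hs hQ).mem_of_mem_hull hκ (fat_shadows F hs hθ hM hQ)
      (shadow_mem_shadows (by simpa using hT)) (shadow_mem_shadows (by simpa using hT'.1)) hV hV')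
  obtain ⟨r, hr, hball⟩ := Metric.isOpen_iff.1 hcl.isOpen_compl V hVn
  refine ⟨r, hr, fun T' hT' ⟨p, hp, hpT⟩ => ?_⟩
  by_contra hcon
  exact hball hp (Set.mem_iUnion₂.2 ⟨T', ⟨hT', hcon⟩, hpT⟩)

theorem neighbours_connected (F : IsFrame Λ e B b ℓ) (hs : P.IsSingular Λ e) (hθ : 0 < θ)
    (hκ : 0 < Real.sin θ) (hM : M.MinAngle θ) (h1 : ρ₁ ∈ cutVals M Λ e B)
    (h2 : ρ₂ ∈ cutVals M Λ e B) (h12 : ρ₁ < ρ₂) (hT : T ∈ meshIn M Λ)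
    (hTl : cell T ⊆ IsFrame.layer Λ B ρ₁ ρ₂) :
    IsConnected (patchSet (neighbours M Λ T B b ρ₁ ρ₂)) := by
  set Q := neighbours M Λ T B b ρ₁ ρ₂ with hQdef
  have hfill := neighbours_fills F hs hθ hκ hM h1 h2 (T := T)
  have hQ : ∀ T' ∈ Q, T' ∈ meshIn M Λ := fun T' h => (mem_neighbours.1 h).1
  have hρ1 := (cutVals_mem_Icc F hs h1).1
  have hρ2 := (cutVals_mem_Icc F hs h2).2
  have hpatch := hfill.patchSet_eq F hρ1 hρ2 hQ
  have hTQ : T ∈ Q := mem_neighbours.2 ⟨hT, hTl, by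
    rw [Finset.inter_self]; exact Finset.card_pos.1 (by rw [card_shadow F hs hT]; norm_num)⟩
  choose! r hr0 hr using fun V (hV : V ∈ shadow b T) => exists_ball_inter_subset F hs hθ hκ hM hT hV
  set I := interior (hull (shadow b Λ)) with hI
  set W : E2 → Set E2 := fun V => Metric.ball V (r V) ∩ I with hW
  set D : Finset E3 → Set E2 := fun T' => interior (hull (shadow b T')) with hD
  have hWo : ∀ V, IsOpen (W V) := fun V => Metric.isOpen_ball.inter isOpen_interior
  have hWc : ∀ V, Convex ℝ (W V) := fun V =>
    (convex_ball V _).inter ((convex_convexHull ℝ _).interior)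
  have hDI : ∀ T' ∈ meshIn M Λ, D T' ⊆ I := fun T' h => interior_mono (hull_shadow_subset h)
  have hDc : ∀ T', Convex ℝ (D T') := fun T' => (convex_convexHull ℝ _).interior
  have hmeet : ∀ T' ∈ meshIn M Λ, ∀ V ∈ shadow b T', V ∈ shadow b T → (W V ∩ D T').Nonempty := by
    intro T' hT' V hV hVT
    have : V ∈ closure (D T') := by
      rw [hD]; simp only; rw [closure_interior_hull_shadow hT'.1]; exact subset_hull hV
    obtain ⟨p, hp, hpD⟩ := mem_closure_iff.1 this _ Metric.isOpen_ball (Metric.mem_ball_self (hr0 V hVT))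
    exact ⟨p, ⟨hp, hDI T' hT' hpD⟩, hpD⟩
  have hWsub : ∀ V ∈ shadow b T, W V ⊆ interior (⋃ t ∈ shadows b Q, hull t) := by
    intro V hV
    refine interior_maximal (fun p hp => ?_) (hWo V)
    obtain ⟨x, hx, hxp⟩ := exists_mem_col F hs h12 (Set.mem_univ p) hp.2
    have hxL := mem_layer_of_proj F hρ1 hρ2 (x := x)
      (by rw [← hull_shadow, hxp]; exact interior_subset hp.2) hx.2.1.le hx.2.2.le
    obtain ⟨T', hT', hxT'⟩ := exists_mem_meshIn M hs.1 hxL.1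
    have hpT' : p ∈ hull (shadow b T') := by rw [hull_shadow, ← hxp]; exact ⟨x, hxT', rfl⟩
    have hVT' := hr V hV T' hT' ⟨p, hp.1, hpT'⟩
    exact Set.mem_iUnion₂.2 ⟨_, shadow_mem_shadows (mem_neighbours.2 ⟨hT',
      cell_subset_layer F hs hT' h1 h2 ⟨x, hxT', hx.2.1⟩ ⟨x, hxT', hx.2.2⟩,
      ⟨V, Finset.mem_inter.2 ⟨hVT', hV⟩⟩⟩), hpT'⟩
  have hDsub : ∀ T' ∈ Q, D T' ⊆ interior (⋃ t ∈ shadows b Q, hull t) := fun T' h =>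
    interior_mono (Set.subset_biUnion_of_mem (u := fun t => hull t) (shadow_mem_shadows h))
  have hcolmeet : ∀ T' ∈ meshIn M Λ, ∀ V ∈ shadow b T', V ∈ shadow b T →
      (col B b (W V) ρ₁ ρ₂ ∩ col B b (D T') ρ₁ ρ₂).Nonempty := by
    intro T' hT' V hV hVT
    obtain ⟨p, hpW, hpD⟩ := hmeet T' hT' V hV hVT
    obtain ⟨x, hx, hxp⟩ := exists_mem_col F hs h12 (A := W V ∩ D T') ⟨hpW, hpD⟩ hpW.2
    exact ⟨x, ⟨hx.1.1, hx.2⟩, ⟨hx.1.2, hx.2⟩⟩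
  set C : Set E3 := (⋃ V ∈ shadow b T, col B b (W V) ρ₁ ρ₂) ∪ ⋃ T' ∈ Q, col B b (D T') ρ₁ ρ₂ with hC
  obtain ⟨y₀, hy₀⟩ := interior_hull_shadow_nonempty (b := b) hT.1
  obtain ⟨x₀, hx₀, -⟩ := exists_mem_col F hs h12 hy₀ (hDI T hT hy₀)
  have hVstar : ∀ V ∈ shadow b T, IsPreconnected (col B b (D T) ρ₁ ρ₂ ∪ col B b (W V) ρ₁ ρ₂) := by
    intro V hV
    refine IsPreconnected.union' ?_ (convex_col (hDc T)).isPreconnected (convex_col (hWc V)).isPreconnected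
    rw [Set.inter_comm]
    exact hcolmeet T hT V hV hV
  have hCpre : IsPreconnected C := by
    refine isPreconnected_of_forall x₀ ?_
    rintro x (hx | hx)
    · obtain ⟨V, hV, hxV⟩ := Set.mem_iUnion₂.1 hx
      refine ⟨_, Set.union_subset ?_ ?_, Or.inl hx₀, Or.inr hxV, hVstar V hV⟩
      · exact (Set.subset_biUnion_of_mem (u := fun T' => col B b (D T') ρ₁ ρ₂) hTQ).trans
          Set.subset_union_right
      · exact (Set.subset_biUnion_of_mem (u := fun V => col B b (W V) ρ₁ ρ₂) hV).trans
          Set.subset_union_left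
    · obtain ⟨T', hT', hxT'⟩ := Set.mem_iUnion₂.1 hx
      obtain ⟨V, hV⟩ := (mem_neighbours.1 hT').2.2
      obtain ⟨hV', hV⟩ := Finset.mem_inter.1 hV
      refine ⟨_, Set.union_subset (Set.union_subset ?_ ?_) ?_, Or.inl (Or.inl hx₀), Or.inr hxT',
        IsPreconnected.union' ?_ (hVstar V hV) (convex_col (hDc T')).isPreconnected⟩
      · exact (Set.subset_biUnion_of_mem (u := fun T' => col B b (D T') ρ₁ ρ₂) hTQ).trans
          Set.subset_union_right
      · exact (Set.subset_biUnion_of_mem (u := fun V => col B b (W V) ρ₁ ρ₂) hV).trans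
          Set.subset_union_left
      · exact (Set.subset_biUnion_of_mem (u := fun T' => col B b (D T') ρ₁ ρ₂) hT').trans
          Set.subset_union_right
      · obtain ⟨q, hq1, hq2⟩ := hcolmeet T' (hQ T' hT') V hV' hV
        exact ⟨q, Or.inr hq1, hq2⟩
  have hCsub : C ⊆ patchSet Q := by
    rw [hpatch]
    exact Set.union_subset (Set.iUnion₂_subset fun V hV => col_mono (hWsub V hV))
      (Set.iUnion₂_subset fun T' hT' => col_mono (hDsub T' hT'))
  have hsubC : patchSet Q ⊆ closure C := by
    intro x hx
    obtain ⟨T', hT', hxT'⟩ := Set.mem_iUnion₂.1 (interior_subset hx)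
    rw [← closure_interior_cell (interior_cell_nonempty_of_mem (hQ T' hT').1)] at hxT'
    refine closure_mono ?_ hxT'
    exact (interior_cell_subset_col F (mem_neighbours.1 hT').2.1).trans
      ((Set.subset_biUnion_of_mem (u := fun T' => col B b (D T') ρ₁ ρ₂) hT').trans
        Set.subset_union_right)
  exact ⟨⟨x₀, hCsub (Or.inr (Set.mem_iUnion₂.2 ⟨T, hTQ, hx₀⟩))⟩, hCpre.subset_closure hCsub hsubC⟩

/-- The edge `σ_n` is an edge of an element of the patch. -/
theorem GradedMesh.IsAdmissible.exists_edge_mem {Q : Finset (Finset E3)}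
    (h : M.IsAdmissible Λ e T Q) {n : E3} (hn : n ∈ T) (hf : n ∈ freeNodes P M.K) :
    ∃ T' ∈ Q, n ∈ T' ∧ M.sigma n ∈ T' := by
  obtain ⟨hne, s, hs, hsn⟩ := M.sigma_edge n hf
  set m := midpoint ℝ n (M.sigma n) with hm
  have hmem : m ∈ closure (patchSet Q) := h.sigma_subset n hn hf (midpoint_mem_segment _ _)
  obtain ⟨T', hT', hmT'⟩ := Set.mem_iUnion₂.1 (closure_patchSet_subset Q hmem)
  have hms : m ∈ convexHull ℝ (s : Set E3) := by
    rw [hsn, convexHull_pair]; exact midpoint_mem_segment _ _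
  have hI := M.K.inter_subset_convexHull hs (h.subset T' hT').1 ⟨hms, hmT'⟩
  rw [hsn] at hI
  refine ⟨T', hT', ?_, ?_⟩ <;> by_contra hcon
  · have : (({n, M.sigma n} : Set E3) ∩ T') ⊆ {M.sigma n} := by
      rintro x ⟨rfl | rfl, hx⟩
      · exact absurd hx hcon
      · rfl
    have := convexHull_mono this hI
    rw [convexHull_singleton, Set.mem_singleton_iff, hm, midpoint_eq_right_iff] at this
    exact hne this
  · have : (({n, M.sigma n} : Set E3) ∩ T') ⊆ {n} := by
      rintro x ⟨rfl | rfl, hx⟩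
      · rfl
      · exact absurd hx hcon
    have := convexHull_mono this hI
    rw [convexHull_singleton, Set.mem_singleton_iff, hm, midpoint_eq_left_iff] at this
    exact hne this

theorem GradedMesh.IsAdmissible.neighbours (F : IsFrame Λ e B b ℓ) (hs : P.IsSingular Λ e)
    (hθ : 0 < θ) (hκ : 0 < Real.sin θ) (hM : M.MinAngle θ) {Q : Finset (Finset E3)}
    (h : M.IsAdmissible Λ e T Q) (h1 : ρ₁ ∈ cutVals M Λ e B) (h2 : ρ₂ ∈ cutVals M Λ e B)
    (h12 : ρ₁ < ρ₂) (hfill : Fills B b Λ Q ρ₁ ρ₂) :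
    M.IsAdmissible Λ e T (neighbours M Λ T B b ρ₁ ρ₂) := by
  have hQ := (h.fills F hs).1
  have hN : ∀ T' ∈ _root_.neighbours M Λ T B b ρ₁ ρ₂, T' ∈ meshIn M Λ :=
    fun T' h => (mem_neighbours.1 h).1
  have hρ1 := (cutVals_mem_Icc F hs h1).1
  have hρ2 := (cutVals_mem_Icc F hs h2).2
  refine ⟨fun T' h => (hN T' h).1, ?_, neighbours_connected F hs hθ hκ hM h1 h2 h12 (hQ T h.mem)
    (hfill.1 T h.mem), fun n hn hf => ?_, ?_, ?_⟩
  · exact mem_neighbours.2 ⟨hQ T h.mem, hfill.1 T h.mem, by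
      rw [Finset.inter_self]
      exact Finset.card_pos.1 (by rw [card_shadow F hs (hQ T h.mem)]; norm_num)⟩
  · obtain ⟨T', hT', hnT', hσT'⟩ := h.exists_edge_mem hn hf
    have hmem : T' ∈ _root_.neighbours M Λ T B b ρ₁ ρ₂ := mem_neighbours.2 ⟨hQ T' hT',
      hfill.1 T' hT', ⟨proj b n, Finset.mem_inter.2 ⟨Finset.mem_image_of_mem _ hnT',
        Finset.mem_image_of_mem _ hn⟩⟩⟩
    refine Set.Subset.trans ?_ (cell_subset_closure_patchSet hmem (hQ T' hT').1)
    exact (convex_cell T').segment_subset (subset_convexHull ℝ _ hnT') (subset_convexHull ℝ _ hσT')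
  · exact interior_subset.trans (Set.iUnion₂_subset fun T' hT' => (hN T' hT').2)
  · obtain ⟨p, hp, rfl⟩ := mem_cutVals.1 h1
    obtain ⟨q, hq, rfl⟩ := mem_cutVals.1 h2
    refine ⟨p, hp, q, hq, by rintro rfl; exact lt_irrefl _ h12, ?_⟩
    have hpatch := (neighbours_fills F hs hθ hκ hM h1 h2 (T := T)).patchSet_eq F hρ1 hρ2 hN
    set I := interior (⋃ t ∈ shadows b (_root_.neighbours M Λ T B b (lam B p) (lam B q)), hull t)
    have hIsub : I ⊆ hull (shadow b Λ) := by
      refine interior_subset.trans (Set.iUnion₂_subset fun t ht => ?_)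
      obtain ⟨T', hT', rfl⟩ := mem_shadows.1 ht
      exact hull_shadow_subset (hN T' hT')
    refine ⟨proj b ⁻¹' I, ?_⟩
    rw [hpatch, F.strip_eq (M.cuts_subset Λ e hs hp) (M.cuts_subset Λ e hs hq) h12]
    apply subset_antisymm
    · intro x hx
      refine ⟨interior_maximal (fun y hy => mem_layer_of_proj F hρ1 hρ2 ?_ hy.2.1.le hy.2.2.le)
        (isOpen_col isOpen_interior) hx, ?_⟩
      · rw [← hull_shadow]; exact hIsub hy.1
      · rw [Set.mem_preimage, Set.mem_preimage, proj_projAlong F.vectorSpan_eq]; exact hx.1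
    · rintro x ⟨hx, hxI⟩
      rw [Set.mem_preimage, Set.mem_preimage, proj_projAlong F.vectorSpan_eq] at hxI
      exact ⟨hxI, (lt_of_mem_interior F _ hx).1 fun y hy => hy.2.1,
        (lt_of_mem_interior F _ hx).2 fun y hy => hy.2.2⟩

theorem card_shadows_mul_le (F : IsFrame Λ e B b ℓ) (hs : P.IsSingular Λ e) (hθ : 0 < θ)
    (hκ : 0 < Real.sin θ) (hM : M.MinAngle θ) {Q : Finset (Finset E3)}
    (hQ : ∀ T' ∈ Q, T' ∈ meshIn M Λ) (hfill : Fills B b Λ Q ρ₁ ρ₂) :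
    (shadows b Q).card * (gaps (cutVals M Λ e B) ρ₁ ρ₂).card ≤ Q.card := by
  rw [← Finset.card_product]
  have key : ∀ tg ∈ shadows b Q ×ˢ gaps (cutVals M Λ e B) ρ₁ ρ₂, ∃ T' ∈ Q, shadow b T' = tg.1 ∧
      cell T' ⊆ IsFrame.layer Λ B tg.2.1 tg.2.2 := by
    rintro ⟨t, g⟩ htg
    obtain ⟨ht, hg⟩ := Finset.mem_product.1 htg
    obtain ⟨T', hT', rfl⟩ := mem_shadows.1 ht
    obtain ⟨⟨g1, g2⟩, a1, a2, a3, -⟩ := mem_gaps.1 hg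
    obtain ⟨y, hy⟩ := interior_hull_shadow_nonempty (b := b) (hQ T' hT').1
    obtain ⟨x, hx, hxy⟩ := exists_mem_col F hs a2 hy (interior_mono (hull_shadow_subset (hQ T' hT')) hy)
    have hmu := mu_pos_of_proj F hs (x := x)
      (hxy ▸ interior_mono (hull_shadow_subset (hQ T' hT')) hy)
    have hxL := mem_layer_of_proj F (cutVals_mem_Icc F hs g1).1 (cutVals_mem_Icc F hs g2).2 (x := x)
      (by rw [← hull_shadow]; exact hull_shadow_subset (hQ T' hT') (interior_subset hx.1))
      hx.2.1.le hx.2.2.le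
    have hxL' : x ∈ IsFrame.layer Λ B ρ₁ ρ₂ := ⟨hxL.1,
      (mul_le_mul_of_nonneg_right a1 hmu.le).trans hxL.2.1,
      hxL.2.2.trans (mul_le_mul_of_nonneg_right a3 hmu.le)⟩
    obtain ⟨T'', hT'', hxT''⟩ := Set.mem_iUnion₂.1 (hfill.2 x hxL' _ ht (interior_subset hx.1))
    refine ⟨T'', hT'', (shadow_eq_of_mem_interior F hs hθ hκ hM (hQ T' hT') (hQ T'' hT'') hx.1
      (by rw [hull_shadow]; exact ⟨x, hxT'', rfl⟩)).symm, ?_⟩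
    exact cell_subset_layer F hs (hQ T'' hT'') g1 g2 ⟨x, hxT'', hx.2.1⟩ ⟨x, hxT'', hx.2.2⟩
  choose! f hf hf1 hf2 using key
  refine Finset.card_le_card_of_injOn f hf fun tg htg tg' htg' hff => ?_
  refine Prod.ext (by rw [← hf1 tg htg, hff, hf1 tg' htg']) ?_
  obtain ⟨x, hx⟩ := interior_cell_nonempty_of_mem (hQ _ (hf tg htg)).1
  have hmu := mu_pos_of_mem_interior F (interior_mono (hQ _ (hf tg htg)).2 hx)
  have l1 := (lt_of_mem_interior F _ hx).1 fun y hy => (hf2 tg htg hy).2.1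
  have l2 := (lt_of_mem_interior F _ hx).2 fun y hy => (hf2 tg htg hy).2.2
  rw [hff] at hx
  have l1' := (lt_of_mem_interior F _ hx).1 fun y hy => (hf2 tg' htg' hy).2.1
  have l2' := (lt_of_mem_interior F _ hx).2 fun y hy => (hf2 tg' htg' hy).2.2
  have b1 := lt_of_mul_lt_mul_right (l1.trans l2') hmu.le
  have b2 := lt_of_mul_lt_mul_right (l1'.trans l2) hmu.le
  obtain ⟨⟨g1, g2⟩, -, -, -, a⟩ := mem_gaps.1 (Finset.mem_product.1 htg).2
  obtain ⟨⟨g1', g2'⟩, -, -, -, a'⟩ := mem_gaps.1 (Finset.mem_product.1 htg').2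
  refine Prod.ext (le_antisymm ?_ ?_) (le_antisymm ?_ ?_)
  · exact (a' _ g1).resolve_right (not_le.2 b1)
  · exact (a _ g1').resolve_right (not_le.2 b2)
  · exact (a _ g2').resolve_left (not_le.2 b1)
  · exact (a' _ g2).resolve_left (not_le.2 b2)

theorem card_le_mul_card_shadows (F : IsFrame Λ e B b ℓ) (hs : P.IsSingular Λ e)
    {Q : Finset (Finset E3)} (hQ : ∀ T' ∈ Q, T' ∈ meshIn M Λ) (h1 : ρ₁ ∈ cutVals M Λ e B)
    (h2 : ρ₂ ∈ cutVals M Λ e B) (hl : ∀ T' ∈ Q, cell T' ⊆ IsFrame.layer Λ B ρ₁ ρ₂) :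
    Q.card ≤ (shadows b Q).card * (gaps (cutVals M Λ e B) ρ₁ ρ₂).card * 64 := by
  classical
  set N : Finset E2 × (ℝ × ℝ) → Finset E3 := fun tg =>
    tg.1.image (fun y => liftTo B b ℓ y (tg.2.1 * mu B (liftTo B b ℓ y 0))) ∪
    tg.1.image (fun y => liftTo B b ℓ y (tg.2.2 * mu B (liftTo B b ℓ y 0))) with hN
  have hsub : Q ⊆ ((shadows b Q ×ˢ gaps (cutVals M Λ e B) ρ₁ ρ₂).biUnion fun tg =>
      if tg.1.card = 3 then (N tg).powerset else ∅) := by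
    intro T' hT'
    obtain ⟨g, hg, hTg⟩ := exists_mem_gaps F hs (hQ T' hT') h1 h2 (hl T' hT')
    refine Finset.mem_biUnion.2 ⟨(shadow b T', g),
      Finset.mem_product.2 ⟨shadow_mem_shadows hT', hg⟩, ?_⟩
    rw [if_pos (card_shadow F hs (hQ T' hT')), Finset.mem_powerset]
    intro x hx
    have hxc : x ∈ cell T' := subset_convexHull ℝ _ hx
    have hxK : x ∈ M.K.vertices :=
      M.K.down_closed (hQ T' hT').1.1 (Finset.singleton_subset_iff.2 hx) (Finset.singleton_nonempty x)
    obtain ⟨p, hp, hxp⟩ := M.nodes_on_planes Λ e hs x hxK ((hQ T' hT').2 hxc)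
    rw [F.mem_cutPlane_iff (M.cuts_subset Λ e hs hp)] at hxp
    have hxl := hTg hxc
    have hmu := mu_nonneg F hxl.1
    have hpx : ∀ τ, proj b (liftTo B b ℓ (proj b x) τ) = proj b x := fun τ => proj_liftTo _ _
    have hm : mu B (liftTo B b ℓ (proj b x) 0) = mu B x := F.mu_congr (hpx 0)
    have hor : lam B x = g.1 * mu B x ∨ lam B x = g.2 * mu B x := by
      rcases (mem_gaps.1 hg).2.2.2.2 _ (mem_cutVals.2 ⟨p, hp, rfl⟩) with h | h
      · left; exact le_antisymm (hxp ▸ mul_le_mul_of_nonneg_right h hmu) hxl.2.1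
      · right; exact le_antisymm hxl.2.2 (hxp ▸ mul_le_mul_of_nonneg_right h hmu)
    rw [hN, Finset.mem_union, Finset.mem_image, Finset.mem_image]
    refine hor.imp (fun h => ?_) fun h => ?_
    all_goals
      refine ⟨proj b x, Finset.mem_image_of_mem _ hx, F.eq_of_proj_eq_of_lam_eq (hpx _) ?_⟩
      rw [lam_liftTo F, h, hm]
  refine (Finset.card_le_card hsub).trans (Finset.card_biUnion_le.trans ?_)
  rw [← Finset.card_product]
  refine Finset.sum_le_card_nsmul _ _ 64 fun tg _ => ?_
  split_ifs with h3
  · rw [Finset.card_powerset]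
    calc 2 ^ (N tg).card ≤ 2 ^ 6 := by
          refine Nat.pow_le_pow_right (by norm_num) ((Finset.card_union_le _ _).trans ?_)
          have a1 := Finset.card_image_le (s := tg.1)
            (f := fun y => liftTo B b ℓ y (tg.2.1 * mu B (liftTo B b ℓ y 0)))
          have a2 := Finset.card_image_le (s := tg.1)
            (f := fun y => liftTo B b ℓ y (tg.2.2 * mu B (liftTo B b ℓ y 0)))
          omega
      _ = 64 := by norm_num
  · simp

/-- The number of projected elements of a minimal patch is bounded. -/
theorem GradedMesh.IsPatch.card_shadows_le (F : IsFrame Λ e B b ℓ) (hs : P.IsSingular Λ e)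
    (hθ : 0 < θ) (hκ : 0 < Real.sin θ) (hM : M.MinAngle θ) {Q : Finset (Finset E3)}
    (h : M.IsPatch Λ e T Q) : ((shadows b Q).card : ℝ) * Real.sin θ ^ 2 ≤ 1728 := by
  obtain ⟨hQ, p, hp, q, hq, hpq, hfill⟩ := h.1.fills F hs
  have h1 : lam B p ∈ cutVals M Λ e B := mem_cutVals.2 ⟨p, hp, rfl⟩
  have h2 : lam B q ∈ cutVals M Λ e B := mem_cutVals.2 ⟨q, hq, rfl⟩
  set N := neighbours M Λ T B b (lam B p) (lam B q) with hN
  have hNm : ∀ T' ∈ N, T' ∈ meshIn M Λ := fun T' h => (mem_neighbours.1 h).1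
  have c1 := card_shadows_mul_le F hs hθ hκ hM hQ hfill
  have c2 := h.2 _ (h.1.neighbours F hs hθ hκ hM h1 h2 hpq hfill)
  have c3 := card_le_mul_card_shadows F hs hNm h1 h2 fun T' h => (mem_neighbours.1 h).2.1
  have hg : 0 < (gaps (cutVals M Λ e B) (lam B p) (lam B q)).card := by
    obtain ⟨r, hr, s, hs', a1, a2, a3, a4, a5⟩ := exists_gap _ h1 h2 le_rfl hpq
    exact Finset.card_pos.2 ⟨(r, s), mem_gaps.2 ⟨⟨hr, hs'⟩, a1, a2.trans_lt a3, a4, a5⟩⟩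
  have c4 : (shadows b Q).card ≤ 64 * (shadows b N).card := by
    have := c1.trans (c2.trans c3)
    refine Nat.le_of_mul_le_mul_right (this.trans (le_of_eq (by ring))) hg
  have c5 : ((shadows b N).card : ℝ) * Real.sin θ ^ 2 ≤ 27 := by
    classical
    have hsub : shadows b N ⊆ (shadow b T).biUnion fun V => (shadows b N).filter (V ∈ ·) := by
      intro t ht
      obtain ⟨T', hT', rfl⟩ := mem_shadows.1 ht
      obtain ⟨V, hV⟩ := (mem_neighbours.1 hT').2.2
      obtain ⟨hV', hV⟩ := Finset.mem_inter.1 hV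
      exact Finset.mem_biUnion.2 ⟨V, hV, Finset.mem_filter.2 ⟨ht, hV'⟩⟩
    have := (Finset.card_le_card hsub).trans Finset.card_biUnion_le
    calc ((shadows b N).card : ℝ) * Real.sin θ ^ 2
        ≤ ((∑ V ∈ shadow b T, ((shadows b N).filter (V ∈ ·)).card : ℕ) : ℝ) * Real.sin θ ^ 2 := by
          gcongr
      _ = ∑ V ∈ shadow b T, (((shadows b N).filter (V ∈ ·)).card : ℝ) * Real.sin θ ^ 2 := by
          rw [Nat.cast_sum, Finset.sum_mul]
      _ ≤ ∑ V ∈ shadow b T, (9 : ℝ) := Finset.sum_le_sum fun V _ =>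
          (conforming_shadows F hs hNm).card_filter_mem_le hκ (fat_shadows F hs hθ hM hNm) V
      _ = 27 := by
          rw [Finset.sum_const, card_shadow F hs (hQ T h.1.mem)]; norm_num
  have c6 : ((shadows b Q).card : ℝ) ≤ 64 * (shadows b N).card := by exact_mod_cast c4
  nlinarith [sq_nonneg (Real.sin θ)]

end

end

noncomputable section

/-! ### Columns between the graphs of two affine functions -/

/-- The points over `A` between the graphs of `φ` and `ψ`. -/
def pcol (b : OrthonormalBasis (Fin 3) ℝ E3) (φ ψ : E2 →ᵃ[ℝ] ℝ) (A : Set E2) : Set E3 :=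
  {x | proj b x ∈ A ∧ φ (proj b x) < inner ℝ (b 2) x ∧ inner ℝ (b 2) x < ψ (proj b x)}

section

variable {b : OrthonormalBasis (Fin 3) ℝ E3} {φ ψ : E2 →ᵃ[ℝ] ℝ} {A A' : Set E2}

theorem pcol_mono (h : A ⊆ A') : pcol b φ ψ A ⊆ pcol b φ ψ A' := fun _ hx => ⟨h hx.1, hx.2⟩

theorem pcol_inter : pcol b φ ψ A ∩ pcol b φ ψ A' = pcol b φ ψ (A ∩ A') := by
  ext x; simp only [pcol, Set.mem_inter_iff, Set.mem_ofPred_eq]; tauto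

theorem isOpen_pcol (hA : IsOpen A) : IsOpen (pcol b φ ψ A) := by
  have h1 : Continuous φ := φ.continuous_of_finiteDimensional
  have h2 : Continuous ψ := ψ.continuous_of_finiteDimensional
  exact (hA.preimage (proj b).continuous).inter
    ((isOpen_lt (h1.comp (proj b).continuous) (by fun_prop)).inter
      (isOpen_lt (by fun_prop) (h2.comp (proj b).continuous)))

theorem convex_pcol (hA : Convex ℝ A) : Convex ℝ (pcol b φ ψ A) := by
  set p : E3 →ᵃ[ℝ] E2 := (proj b).toLinearMap.toAffineMap
  set q : E3 →ᵃ[ℝ] ℝ := (innerSL ℝ (b 2)).toLinearMap.toAffineMap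
  have h1 : {x : E3 | φ (proj b x) < inner ℝ (b 2) x} = (q - φ.comp p) ⁻¹' Set.Ioi 0 := by
    ext x; simp [p, q]
  have h2 : {x : E3 | inner ℝ (b 2) x < ψ (proj b x)} = (ψ.comp p - q) ⁻¹' Set.Ioi 0 := by
    ext x; simp [p, q]
  refine (hA.linear_preimage (proj b).toLinearMap).inter (Convex.inter ?_ ?_)
  · change Convex ℝ {x : E3 | φ (proj b x) < inner ℝ (b 2) x}
    rw [h1]; exact (convex_Ioi 0).affine_preimage _
  · change Convex ℝ {x : E3 | inner ℝ (b 2) x < ψ (proj b x)}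
    rw [h2]; exact (convex_Ioi 0).affine_preimage _

/-- The affine function `y ↦ χ y + η`. -/
def addConst (χ : E2 →ᵃ[ℝ] ℝ) (η : ℝ) : E2 →ᵃ[ℝ] ℝ := χ + AffineMap.const ℝ E2 η

@[simp] theorem addConst_apply (χ : E2 →ᵃ[ℝ] ℝ) (η : ℝ) (y : E2) : addConst χ η y = χ y + η := rfl

/-- The parametrization of the points over `E2` by their signed distance from the graph of `χ`. -/
def graphPt (b : OrthonormalBasis (Fin 3) ℝ E3) (χ : E2 →ᵃ[ℝ] ℝ) {σ : ℝ} (hσ : σ * σ = 1)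
    (y : E2) (t : ℝ) : E3 :=
  param (shear b χ.linear.toContinuousLinearMap σ hσ) (χ 0 • b 2) (y, t)

variable {χ : E2 →ᵃ[ℝ] ℝ} {σ : ℝ} (hσ : σ * σ = 1)

@[simp] theorem proj_graphPt (y : E2) (t : ℝ) : proj b (graphPt b χ hσ y t) = y := by
  simp [graphPt, param]

@[simp] theorem inner_graphPt (y : E2) (t : ℝ) :
    inner ℝ (b 2) (graphPt b χ hσ y t) = χ y + σ * t := by
  have h : χ y = χ.linear y + χ 0 := by
    have := χ.linearMap_vsub y 0
    simp only [vsub_eq_sub, sub_zero] at this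
    rw [this]; ring
  rw [graphPt, param, inner_add_right, inner_shear, inner_smul_right, inner_basis, h,
    LinearMap.coe_toContinuousLinearMap']
  simp only [if_true]
  ring

theorem eq_graphPt (x : E3) :
    x = graphPt b χ hσ (proj b x) (σ * (inner ℝ (b 2) x - χ (proj b x))) := by
  refine eq_of_proj_eq b (by simp) ?_
  rw [inner_graphPt, ← mul_assoc, hσ]
  ring

theorem exists_volume_pcol (b : OrthonormalBasis (Fin 3) ℝ E3) : ∃ c : ENNReal, c ≠ 0 ∧ c ≠ ⊤ ∧
    ∀ (φ ψ : E2 →ᵃ[ℝ] ℝ) (A : Set E2), IsOpen A →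
      c * volume (pcol b φ ψ A) = ∫⁻ y in A, ENNReal.ofReal (ψ y - φ y) := by
  have h1 : (1 : ℝ) * 1 = 1 := by norm_num
  obtain ⟨c, hc0, hct, hc⟩ := exists_map_param (shear b 0 1 h1)
  refine ⟨c, hc0, hct, fun φ ψ A hA => ?_⟩
  have hφ : Continuous φ := φ.continuous_of_finiteDimensional
  have hψ : Continuous ψ := ψ.continuous_of_finiteDimensional
  have hop : IsOpen (regionBetween φ ψ A) :=
    (hA.preimage continuous_fst).inter ((isOpen_lt (hφ.comp continuous_fst) continuous_snd).inter
      (isOpen_lt continuous_snd (hψ.comp continuous_fst)))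
  have himg : pcol b φ ψ A = param (shear b 0 1 h1) 0 '' regionBetween φ ψ A := by
    ext x
    constructor
    · intro hx
      refine ⟨(proj b x, inner ℝ (b 2) x), hx, eq_of_proj_eq b ?_ ?_⟩ <;> simp [param]
    · rintro ⟨⟨y, t⟩, ⟨hy, ht⟩, rfl⟩
      simpa [pcol, param] using ⟨hy, ht⟩
  rw [himg, ← volume_param_image (hc 0) hop, Measure.volume_eq_prod,
    volume_regionBetween_eq_lintegral' hφ.measurable hψ.measurable hA.measurableSet]
  rfl

/-- Two-sided bounds for the volumes of columns. -/
theorem exists_volume_bounds {ρ R ε Γ : ℝ} (hρ : 0 < ρ) (hε : 0 < ε) :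
    ∃ K₀ : ENNReal, K₀ ≠ ⊤ ∧ 1 ≤ K₀ ∧ ∀ (b : OrthonormalBasis (Fin 3) ℝ E3) (d h : ℝ), 0 < d → 0 < h →
      ∃ V₀ : ENNReal, V₀ ≠ 0 ∧ V₀ ≠ ⊤ ∧ ∀ (φ ψ : E2 →ᵃ[ℝ] ℝ) (A : Set E2), IsOpen A →
        ((∃ o, Metric.ball o (ρ * d) ⊆ A ∧ ∀ y ∈ Metric.ball o (ρ * d), ε * h ≤ ψ y - φ y) →
          V₀ ≤ volume (pcol b φ ψ A)) ∧
        ((∃ X, A ⊆ Metric.ball X (R * d) ∧ ∀ y ∈ A, ψ y - φ y ≤ Γ * h) →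
          volume (pcol b φ ψ A) ≤ K₀ * V₀) := by
  refine ⟨1 + ENNReal.ofReal (R ^ 2 * |Γ| / (ρ ^ 2 * ε)),
    ENNReal.add_ne_top.2 ⟨ENNReal.one_ne_top, ENNReal.ofReal_ne_top⟩, le_self_add,
    fun b d h hd hh => ?_⟩
  obtain ⟨c, hc0, hct, hc⟩ := exists_volume_pcol b
  set β := volume (Metric.ball (0 : E2) 1) with hβ
  have hβ0 : β ≠ 0 := (Metric.measure_ball_pos volume _ one_pos).ne'
  have hβt : β ≠ ⊤ := measure_ball_lt_top.ne
  have hball : ∀ (o : E2) (r : ℝ), 0 ≤ r → volume (Metric.ball o r) = ENNReal.ofReal (r ^ 2) * β := by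
    intro o r hr
    rw [Measure.addHaar_ball _ _ hr, finrank_euclideanSpace_fin]
  have hcV : ∀ V : ENNReal, c * (c⁻¹ * V) = V := fun V => by
    rw [← mul_assoc, ENNReal.mul_inv_cancel hc0 hct, one_mul]
  have hcc : ∀ V W : ENNReal, c * V ≤ c * W → V ≤ W := fun V W h =>
    (ENNReal.mul_le_mul_iff_right hc0 hct).1 h
  refine ⟨c⁻¹ * (ENNReal.ofReal ((ρ * d) ^ 2) * β * ENNReal.ofReal (ε * h)), ?_, ?_,
    fun φ ψ A hA => ⟨?_, ?_⟩⟩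
  · refine mul_ne_zero (ENNReal.inv_ne_zero.2 hct) (mul_ne_zero (mul_ne_zero ?_ hβ0) ?_)
    · exact (ENNReal.ofReal_pos.2 (by positivity)).ne'
    · exact (ENNReal.ofReal_pos.2 (by positivity)).ne'
  · exact ENNReal.mul_ne_top (ENNReal.inv_ne_top.2 hc0)
      (ENNReal.mul_ne_top (ENNReal.mul_ne_top ENNReal.ofReal_ne_top hβt) ENNReal.ofReal_ne_top)
  · rintro ⟨o, ho, hlow⟩
    apply hcc
    rw [hcV, hc φ ψ A hA, ← hball o _ (by positivity)]
    calc volume (Metric.ball o (ρ * d)) * ENNReal.ofReal (ε * h)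
        = ∫⁻ _ in Metric.ball o (ρ * d), ENNReal.ofReal (ε * h) := by
          rw [setLIntegral_const, mul_comm]
      _ ≤ ∫⁻ y in Metric.ball o (ρ * d), ENNReal.ofReal (ψ y - φ y) :=
          setLIntegral_mono' measurableSet_ball fun y hy => ENNReal.ofReal_le_ofReal (hlow y hy)
      _ ≤ _ := lintegral_mono_set ho
  · rintro ⟨X, hX, hup⟩
    apply hcc
    rw [mul_left_comm, hcV, hc φ ψ A hA]
    rcases lt_or_ge 0 R with hR | hR
    swap
    · have : A = ∅ := Set.subset_empty_iff.1 (hX.trans (Metric.ball_eq_empty.2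
        (mul_nonpos_of_nonpos_of_nonneg hR hd.le)).subset)
      simp [this]
    calc ∫⁻ y in A, ENNReal.ofReal (ψ y - φ y) ≤ ∫⁻ _ in A, ENNReal.ofReal (|Γ| * h) :=
          setLIntegral_mono' hA.measurableSet fun y hy => ENNReal.ofReal_le_ofReal
            ((hup y hy).trans (mul_le_mul_of_nonneg_right (le_abs_self Γ) hh.le))
      _ = ENNReal.ofReal (|Γ| * h) * volume A := by rw [setLIntegral_const]
      _ ≤ ENNReal.ofReal (|Γ| * h) * (ENNReal.ofReal ((R * d) ^ 2) * β) := by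
          rw [← hball X _ (by positivity)]; gcongr
      _ = ENNReal.ofReal (R ^ 2 * |Γ| / (ρ ^ 2 * ε)) *
          (ENNReal.ofReal ((ρ * d) ^ 2) * β * ENNReal.ofReal (ε * h)) := by
          have e : ∀ a : ENNReal, ENNReal.ofReal (R ^ 2 * |Γ| / (ρ ^ 2 * ε)) * (a * β *
              ENNReal.ofReal (ε * h)) = ENNReal.ofReal (R ^ 2 * |Γ| / (ρ ^ 2 * ε)) * a *
              ENNReal.ofReal (ε * h) * β := fun a => by ring
          rw [e, ← ENNReal.ofReal_mul (by positivity), ← ENNReal.ofReal_mul (by positivity),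
            ← mul_assoc, ← ENNReal.ofReal_mul (by positivity)]
          congr 2
          field_simp
      _ ≤ _ := by gcongr; exact le_add_self

end

/-! ### Estimates along chains of columns -/

variable {b : OrthonormalBasis (Fin 3) ℝ E3} {U S : Set E3} {v : E3 → ℝ} {g : Fin 3 → E3 → ℝ}
  {g2 : Fin 3 → Fin 3 → E3 → ℝ} {w w' : Fin 3 → ℝ}

/-- The sum `∑ wₖ |gₖ|` of the seminorms of the first derivatives. -/
def hNorm (U : Set E3) (w : Fin 3 → ℝ) (g2 : Fin 3 → Fin 3 → E3 → ℝ) : ENNReal :=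
  ∑ k, ENNReal.ofReal (w k) * ∑ j, eLpNorm (g2 k j) 2 (volume.restrict U)

theorem IsH2.wNorm1_le_hNorm (h : IsH2 b S v g g2) (hS : IsOpen S) (j : Fin 3) :
    wNorm1 S w (g2 j) ≤ hNorm S w g2 := by
  refine Finset.sum_le_sum fun k _ => mul_le_mul_right ?_ _
  rw [h.eLpNorm_symm hS]
  exact Finset.single_le_sum (f := fun j => eLpNorm (g2 k j) 2 (volume.restrict S))
    (fun _ _ => zero_le) (Finset.mem_univ j)

theorem IsH2.wNorm2_le_hNorm (h : IsH2 b S v g g2) (hS : IsOpen S) (hw' : ∀ i, 0 ≤ w' i) :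
    wNorm2 S w' w g2 ≤ (∑ i, ENNReal.ofReal (w' i)) * hNorm S w g2 := by
  rw [Finset.sum_mul]
  refine Finset.sum_le_sum fun i _ => ?_
  refine le_trans (le_of_eq ?_) (mul_le_mul_right (h.wNorm1_le_hNorm hS i) _)
  rw [wNorm1, Finset.mul_sum]
  refine Finset.sum_congr rfl fun k _ => ?_
  rw [ENNReal.ofReal_mul (hw' i), mul_assoc]

theorem wNorm1_le_of_le {G : ENNReal} {f : Fin 3 → E3 → ℝ}
    (h : ∀ j, eLpNorm (f j) 2 (volume.restrict U) ≤ G) :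
    wNorm1 U w f ≤ (∑ i, ENNReal.ofReal (w i)) * G := by
  rw [Finset.sum_mul]
  exact Finset.sum_le_sum fun i _ => mul_le_mul_right (h i) _

/-- A chain of columns of comparable volumes with large overlaps. -/
structure ColChain (b : OrthonormalBasis (Fin 3) ℝ E3) (φ ψ : E2 →ᵃ[ℝ] ℝ) (S : Set E3)
    (V₀ K₀ : ENNReal) (A : ℕ → Set E2) (n : ℕ) (a a₃ : ℝ) : Prop where
  isOpen : ∀ i ≤ n, IsOpen (A i)
  convex : ∀ i ≤ n, Convex ℝ (A i)
  subset : ∀ i ≤ n, pcol b φ ψ (A i) ⊆ S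
  upper : ∀ i ≤ n, volume (pcol b φ ψ (A i)) ≤ K₀ * V₀
  lower : ∀ i ≤ n, V₀ ≤ volume (pcol b φ ψ (A i))
  inter : ∀ i < n, V₀ ≤ volume (pcol b φ ψ (A i ∩ A (i + 1)))
  norm_sub_le : ∀ i ≤ n, ∀ y ∈ A i, ∀ z ∈ A i, ‖y - z‖ ≤ a
  inner_sub_le : ∀ i ≤ n, ∀ x ∈ pcol b φ ψ (A i), ∀ y ∈ pcol b φ ψ (A i), |inner ℝ (b 2) (x - y)| ≤ a₃

namespace ColChain

variable {φ ψ : E2 →ᵃ[ℝ] ℝ} {V₀ K₀ : ENNReal} {A : ℕ → Set E2} {n : ℕ} {a a₃ : ℝ}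

theorem abs_inner_le (C : ColChain b φ ψ S V₀ K₀ A n a a₃) : ∀ i ≤ n, ∀ x ∈ pcol b φ ψ (A i),
    ∀ y ∈ pcol b φ ψ (A i), ∀ l, |inner ℝ (b l) (x - y)| ≤ ![a, a, a₃] l := by
  intro i hi x hx y hy l
  have h := C.norm_sub_le i hi _ hx.1 _ hy.1
  rw [← map_sub] at h
  fin_cases l
  · exact (PiLp.norm_apply_le (p := 2) (proj b (x - y)) 0).trans h
  · exact (PiLp.norm_apply_le (p := 2) (proj b (x - y)) 1).trans h
  · exact C.inner_sub_le i hi x hx y hy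

theorem eLpNorm_le (C : ColChain b φ ψ S V₀ K₀ A n a a₃) (hV : V₀ ≠ 0) (hV' : V₀ ≠ ⊤)
    (hK : K₀ ≠ ⊤) (hK1 : 1 ≤ K₀) (h : IsH2 b S v g g2) (hS : IsOpen S) (j : Fin 3) {c : ℝ}
    (hc : ∫⁻ y in pcol b φ ψ (A 0), ‖g j y - c‖ₑ ^ 2 ≤ 8 * wNorm1 S ![a, a, a₃] (g2 j) ^ 2) :
    ∀ i ≤ n, eLpNorm (fun x => g j x - c) 2 (volume.restrict (pcol b φ ψ (A i))) ≤
      3 * (4 * K₀) ^ n * hNorm S ![a, a, a₃] g2 := by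
  intro i hi
  have key := poincare_chain hS (K := fun i => pcol b φ ψ (A i)) (n := n)
    (fun i hi => isOpen_pcol (C.isOpen i hi)) (fun i hi => convex_pcol (C.convex i hi)) C.subset
    (fun i hi => ((C.upper i hi).trans_lt (ENNReal.mul_lt_top hK.lt_top hV'.lt_top)).ne)
    (fun i hi => by
      rw [pcol_inter]
      exact nonempty_of_measure_ne_zero (ne_of_gt ((pos_iff_ne_zero.2 hV).trans_le (C.inter i hi))))
    hK1 (fun i hi => by
      rw [pcol_inter]
      exact (C.upper (i + 1) hi).trans (mul_le_mul_right (C.inter i hi) _))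
    C.abs_inner_le (h.mem1 j) (h.mem2 j) (h.partial2 j) hc i hi
  refine le_trans (b := 3 * (4 * K₀) ^ n * wNorm1 S ![a, a, a₃] (g2 j)) ?_
    (mul_le_mul_right (h.wNorm1_le_hNorm hS j) _)
  rw [← ENNReal.pow_le_pow_left_iff two_ne_zero, eLpNorm_two_sq]
  refine key.trans ?_
  have h1 : (1 : ENNReal) ≤ (4 * K₀) ^ n := one_le_pow₀ (by
    calc (1 : ENNReal) ≤ 4 * 1 := by norm_num
      _ ≤ 4 * K₀ := by gcongr)
  generalize (4 * K₀) ^ n = p at h1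
  rw [mul_pow, mul_pow]
  gcongr
  · norm_num
  · rw [sq]; exact le_mul_of_one_le_left' h1

theorem enorm_sub_le (C : ColChain b φ ψ S V₀ K₀ A n a a₃) (hV : V₀ ≠ 0) (hV' : V₀ ≠ ⊤)
    (hK : K₀ ≠ ⊤) (hK1 : 1 ≤ K₀) (ha : 0 ≤ a) (ha₃ : 0 ≤ a₃) (h : IsH2 b S v g g2) (hS : IsOpen S)
    (hbd : Bornology.IsBounded S) (hcont : ContinuousOn v S) (L : E3 →L[ℝ] ℝ)
    (hc : ∀ j, ∫⁻ y in pcol b φ ψ (A 0), ‖g j y - L (b j)‖ₑ ^ 2 ≤ 8 * wNorm1 S ![a, a, a₃] (g2 j) ^ 2)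
    {x y : E3} (hx : x ∈ pcol b φ ψ (A 0)) (hy : y ∈ pcol b φ ψ (A n)) :
    V₀ ^ (1 / 2 : ℝ) * ‖(v x - L x) - (v y - L y)‖ₑ ≤ (n + 1) * (6 * ((∑ i, ENNReal.ofReal (![a, a, a₃] i)) *
      (3 * (4 * K₀) ^ n + 4) * hNorm S ![a, a, a₃] g2)) := by
  have hf := h.sub_affine hS hbd.measure_lt_top.ne hbd L 0
  simp only [add_zero] at hf
  have hcf : ContinuousOn (fun x => v x - L x) S := hcont.sub L.continuous.continuousOn
  have hw0 : ∀ i, 0 ≤ ![a, a, a₃] i := by intro i; fin_cases i <;> simpa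
  refine osc_chain (v := fun x => v x - L x) (Z := fun i => pcol b φ ψ (A i)) (n := n) ?_ ?_ hx n le_rfl y hy
  · intro i hi x hx y hy
    have hKo := isOpen_pcol (b := b) (φ := φ) (ψ := ψ) (C.isOpen i hi)
    have e := (hf.mono hS (C.subset i hi)).enorm_sub_le hKo (convex_pcol (C.convex i hi))
      ((C.upper i hi).trans_lt (ENNReal.mul_lt_top hK.lt_top hV'.lt_top)).ne
      (hcf.mono (C.subset i hi)) (C.abs_inner_le i hi) hx hy
    calc V₀ ^ (1 / 2 : ℝ) * ‖(v x - L x) - (v y - L y)‖ₑ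
        ≤ volume (pcol b φ ψ (A i)) ^ (1 / 2 : ℝ) * ‖(v x - L x) - (v y - L y)‖ₑ := by
          gcongr; exact C.lower i hi
      _ ≤ _ := e
      _ ≤ 6 * ((∑ i, ENNReal.ofReal (![a, a, a₃] i)) * (3 * (4 * K₀) ^ n * hNorm S ![a, a, a₃] g2) +
          4 * ((∑ i, ENNReal.ofReal (![a, a, a₃] i)) * hNorm S ![a, a, a₃] g2)) := by
          gcongr
          · exact wNorm1_le_of_le fun j => C.eLpNorm_le hV hV' hK hK1 h hS j (hc j) i hi
          · exact (wNorm2_mono (C.subset i hi) _ _ _).trans (h.wNorm2_le_hNorm hS hw0)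
      _ = _ := by ring
  · intro i hi
    rw [pcol_inter]
    exact nonempty_of_measure_ne_zero (ne_of_gt ((pos_iff_ne_zero.2 hV).trans_le (C.inter i hi)))

theorem enorm_sub_le_slab (C : ColChain b φ ψ S V₀ K₀ A n a a₃) (hV : V₀ ≠ 0) (hV' : V₀ ≠ ⊤)
    (hK : K₀ ≠ ⊤) (hK1 : 1 ≤ K₀) (ha : 0 ≤ a) (h : IsH2 b S v g g2) (hS : IsOpen S)
    (hbd : Bornology.IsBounded S) (hcont : ContinuousOn v S) (L : E3 →L[ℝ] ℝ)
    (hc : ∀ j, ∫⁻ y in pcol b φ ψ (A 0), ‖g j y - L (b j)‖ₑ ^ 2 ≤ 8 * wNorm1 S ![a, a, a₃] (g2 j) ^ 2)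
    {φ' χ : E2 →ᵃ[ℝ] ℝ} {η σ : ℝ} (hη : 0 < η) (hσ : σ * σ = 1)
    (hsub : ∀ i ≤ n, pcol b φ' (addConst φ' η) (A i) ⊆ pcol b φ ψ (A i))
    (hV₀ : ∀ i ≤ n, V₀ ≤ volume (pcol b φ' (addConst φ' η) (A i)))
    (hχ : σ = 1 ∧ χ = φ' ∨ σ = -1 ∧ χ = addConst φ' η)
    (hslope : ∀ i ≤ n, ∀ y ∈ A i, ∀ z ∈ A i, |χ y - χ z| ≤ a) (haη : a + η ≤ a₃)
    {y z : E2} (hy : y ∈ A 0) (hz : z ∈ A n) {δ : ℝ} (hδ : δ ∈ Set.Ioo 0 (η / 4)) :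
    V₀ ^ (1 / 2 : ℝ) * ‖(v (graphPt b χ hσ y δ) - L (graphPt b χ hσ y δ)) -
        (v (graphPt b χ hσ z δ) - L (graphPt b χ hσ z δ))‖ₑ ≤
      (n + 1) * (6 * ((∑ i, ENNReal.ofReal (![a, a, a] i)) *
        (3 * (4 * K₀) ^ n + 8) * hNorm S ![a, a, a₃] g2)) := by
  have hf := h.sub_affine hS hbd.measure_lt_top.ne hbd L 0
  simp only [add_zero] at hf
  have hcf : ContinuousOn (fun x => v x - L x) S := hcont.sub L.continuous.continuousOn
  have hw0 : ∀ i, 0 ≤ ![a, a, a] i := by intro i; fin_cases i <;> simpa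
  have hσ1 : |σ| = 1 := by rcases hχ with h | h <;> rw [h.1] <;> norm_num
  refine osc_chain (v := fun y => v (graphPt b χ hσ y δ) - L (graphPt b χ hσ y δ))
    (Z := A) (n := n) ?_ ?_ hy n le_rfl z hz
  · intro i hi y hy z hz
    set K := pcol b φ' (addConst φ' η) (A i) with hKdef
    have hKS := (hsub i hi).trans (C.subset i hi)
    have himg : K = param (shear b χ.linear.toContinuousLinearMap σ hσ) (χ 0 • b 2) ''
        (A i ×ˢ Set.Ioo 0 η) := by
      ext x
      constructor
      · intro hx
        refine ⟨(proj b x, σ * (inner ℝ (b 2) x - χ (proj b x))), ⟨hx.1, ?_⟩,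
          (eq_graphPt hσ x).symm⟩
        have h1 := hx.2.1
        have h2 := hx.2.2
        rw [addConst_apply] at h2
        rcases hχ with ⟨rfl, rfl⟩ | ⟨rfl, rfl⟩
        · constructor <;> linarith
        · rw [addConst_apply]; constructor <;> linarith
      · rintro ⟨⟨p, t⟩, ⟨hp, ht0, htη⟩, rfl⟩
        change graphPt b χ hσ p t ∈ K
        refine ⟨by simpa using hp, ?_, ?_⟩ <;> rw [inner_graphPt, proj_graphPt]
        · rcases hχ with ⟨rfl, rfl⟩ | ⟨rfl, rfl⟩
          · linarith
          · rw [addConst_apply]; linarith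
        · rw [addConst_apply]
          rcases hχ with ⟨rfl, rfl⟩ | ⟨rfl, rfl⟩
          · linarith
          · rw [addConst_apply]; linarith
    have hin : ∀ (q : E2) (t : ℝ) (l : Fin 3) (m : ℝ), ‖q‖ ≤ a → |χ.linear q| + |t| ≤ m →
        |inner ℝ (b l) (shear b χ.linear.toContinuousLinearMap σ hσ (q, t))| ≤ ![a, a, m] l := by
      intro q t l m hq hm
      fin_cases l
      · change |proj b (shear b χ.linear.toContinuousLinearMap σ hσ (q, t)) 0| ≤ a
        rw [proj_shear]; exact (PiLp.norm_apply_le (p := 2) q 0).trans hq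
      · change |proj b (shear b χ.linear.toContinuousLinearMap σ hσ (q, t)) 1| ≤ a
        rw [proj_shear]; exact (PiLp.norm_apply_le (p := 2) q 1).trans hq
      · change |inner ℝ (b 2) _| ≤ m
        rw [inner_shear]
        refine (abs_add_le _ _).trans ?_
        rw [abs_mul, hσ1, one_mul]
        exact hm
    have hlin : ∀ p ∈ A i, ∀ q ∈ A i, |χ.linear (p - q)| ≤ a := by
      intro p hp q hq
      rw [← vsub_eq_sub, χ.linearMap_vsub]
      exact hslope i hi p hp q hq
    have hfinA : volume (A i) ≠ ⊤ := by
      have : Bornology.IsBounded (A i) := by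
        rw [Metric.isBounded_iff]
        exact ⟨a, fun p hp q hq => by rw [dist_eq_norm]; exact C.norm_sub_le i hi p hp q hq⟩
      exact this.measure_lt_top.ne
    have e := (hf.mono hS hKS).enorm_sub_le_slab himg (C.isOpen i hi) (C.convex i hi) hfinA
      (hcf.mono hKS) (w := ![a, a, a]) (w2 := ![a, a, a₃])
      (fun p hp q hq l => hin _ _ l a (C.norm_sub_le i hi p hp q hq) (by
        rw [abs_zero, add_zero]; exact hlin p hp q hq))
      (fun p hp q hq t ht l => hin _ _ l a₃ (C.norm_sub_le i hi p hp q hq) (by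
        rw [abs_of_pos ht.1]; linarith [hlin p hp q hq, ht.2]))
      (fun l => hin _ _ l a₃ (by simpa using ha) (by
        rw [map_zero, abs_zero, abs_of_pos hη]; linarith)) hy hz hδ
    calc V₀ ^ (1 / 2 : ℝ) * _ ≤ volume K ^ (1 / 2 : ℝ) * _ := by
          gcongr
          · exact hV₀ i hi
          · exact le_rfl
      _ ≤ _ := e
      _ ≤ 6 * ((∑ i, ENNReal.ofReal (![a, a, a] i)) * (3 * (4 * K₀) ^ n * hNorm S ![a, a, a₃] g2) +
          8 * ((∑ i, ENNReal.ofReal (![a, a, a] i)) * hNorm S ![a, a, a₃] g2)) := by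
          gcongr
          · exact wNorm1_le_of_le fun j => (eLpNorm_mono_measure _ (Measure.restrict_mono (hsub i hi)
              le_rfl)).trans (C.eLpNorm_le hV hV' hK hK1 h hS j (hc j) i hi)
          · exact (wNorm2_mono hKS _ _ _).trans (h.wNorm2_le_hNorm hS hw0)
      _ = _ := by ring
  · intro i hi
    obtain ⟨x, hx⟩ := nonempty_of_measure_ne_zero (ne_of_gt ((pos_iff_ne_zero.2 hV).trans_le (C.inter i hi)))
    exact ⟨_, hx.1⟩

end ColChain

end

noncomputable section

/-! ### Oscillation on a patch -/

/-- The geometry of a patch: columns over the triangles of `𝒯` between the graphs of `φ` and `ψ`.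
The element `T` has a vertical edge of length `h` over `X`. -/
structure PatchGeom (κ Γ : ℝ) (N : ℕ) (b : OrthonormalBasis (Fin 3) ℝ E3) (φ ψ : E2 →ᵃ[ℝ] ℝ)
    (S : Set E3) (𝒯 : Finset (Finset E2)) (T : Finset E3) (s : E3 → E3) (X Z : E2) (h : ℝ) :
    Prop where
  isOpen : IsOpen S
  isBounded : Bornology.IsBounded S
  conforming : Conforming 𝒯
  fat : ∀ t ∈ 𝒯, Fat κ t
  card_le : 𝒯.card ≤ N
  exists_open : ∃ U, IsOpen U ∧ IsPreconnected U ∧ U ⊆ (⋃ t ∈ 𝒯, hull t) ∧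
    ∀ t ∈ 𝒯, (U ∩ hull t).Nonempty
  mem : shadow b T ∈ 𝒯
  X_mem : X ∈ shadow b T
  Z_mem : Z ∈ shadow b T
  ne : X ≠ Z
  h_pos : 0 < h
  dist_le : ‖X - Z‖ ≤ Γ * h
  slope : ∀ p q, |φ p - φ q| ≤ Γ * ‖p - q‖ ∧ |ψ p - ψ q| ≤ Γ * ‖p - q‖
  height : h ≤ ψ X - φ X ∧ ψ X - φ X ≤ Γ * h
  le : ∀ t ∈ 𝒯, ∀ p ∈ hull t, φ p ≤ ψ p
  pcol_subset : pcol b φ ψ (interior (⋃ t ∈ 𝒯, hull t)) ⊆ S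
  cell_subset : interior (cell T) ⊆ pcol b φ ψ (interior (hull (shadow b T)))
  node : ∀ n ∈ T, ∃ t ∈ 𝒯, ∀ p ∈ openSegment ℝ n (s n), proj b p ∈ hull t ∧
    φ (proj b p) ≤ inner ℝ (b 2) p ∧ inner ℝ (b 2) p ≤ ψ (proj b p)

theorem affine_extrapolate_le {f : E2 →ᵃ[ℝ] ℝ} {o X y : E2} {ρ R h : ℝ} (hρ : 0 < ρ) (hR : 0 < R)
    (h0 : ∀ p ∈ Metric.ball o ρ, 0 ≤ f p) (hX : h ≤ f X) (hy : y ∈ Metric.ball o (ρ / 2))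
    (hyX : y ∈ Metric.ball X R) : ρ / (2 * R + ρ) * h ≤ f y := by
  have hp : AffineMap.lineMap X y (1 + ρ / (2 * R)) ∈ Metric.ball o ρ := by
    have e : AffineMap.lineMap X y (1 + ρ / (2 * R)) - o = (y - o) + (ρ / (2 * R)) • (y - X) := by
      rw [AffineMap.lineMap_apply_module']; module
    rw [mem_ball_iff_norm] at *
    rw [e]
    refine (norm_add_le _ _).trans_lt ?_
    rw [norm_smul, Real.norm_of_nonneg (by positivity)]
    have : ρ / (2 * R) * ‖y - X‖ ≤ ρ / (2 * R) * R := by gcongr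
    have e2 : ρ / (2 * R) * R = ρ / 2 := by field_simp
    linarith
  have := h0 _ hp
  rw [AffineMap.apply_lineMap, AffineMap.lineMap_apply_module, smul_eq_mul, smul_eq_mul] at this
  rw [div_mul_eq_mul_div, div_le_iff₀ (by positivity)]
  have e : (1 - (1 + ρ / (2 * R))) * f X + (1 + ρ / (2 * R)) * f y =
      ((2 * R + ρ) * f y - ρ * f X) / (2 * R) := by field_simp; ring
  rw [e] at this
  rw [le_div_iff₀ (by positivity), zero_mul] at this
  nlinarith

theorem exists_colChain {κ Γ : ℝ} (hκ : 0 < κ) (hΓ : 1 ≤ Γ) (N : ℕ) :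
    ∃ (D : ℝ) (K₀ : ENNReal), 1 ≤ D ∧ K₀ ≠ ⊤ ∧ 1 ≤ K₀ ∧
    ∀ {b φ ψ S 𝒯 T s X Z h}, PatchGeom κ Γ N b φ ψ S 𝒯 T s X Z h →
      ∃ V₀ : ENNReal, V₀ ≠ 0 ∧ V₀ ≠ ⊤ ∧ ∀ t ∈ 𝒯, ∃ n ≤ 2 * N, ∃ A : ℕ → Set E2,
        A 0 = interior (hull (shadow b T)) ∧ A n = interior (hull t) ∧
        ColChain b φ ψ S V₀ K₀ A n (D * ‖X - Z‖) (D * h) ∧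
        (∀ i ≤ n, ∀ y ∈ A i, ∀ z ∈ A i, |φ y - φ z| ≤ D * ‖X - Z‖ ∧ |ψ y - ψ z| ≤ D * ‖X - Z‖) ∧
        (∀ i ≤ n, ∀ φ', V₀ ≤ volume (pcol b φ' (addConst φ' (h / 2)) (A i))) ∧
        (4 * (D * ‖X - Z‖) ≤ h → ∀ i ≤ n, ∀ y ∈ A i, h / 2 ≤ ψ y - φ y) := by
  obtain ⟨ρ, R, hρ, hR, hchain⟩ := exists_chain hκ N
  set ε := min (ρ / (2 * R + ρ)) (1 / 2) with hε
  have hε0 : 0 < ε := lt_min (by positivity) (by norm_num)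
  obtain ⟨K₀, hK₀, hK1, hvol⟩ := exists_volume_bounds (ρ := ρ / 2) (R := R) (ε := ε)
    (Γ := Γ + 2 * Γ ^ 2 * R) (by positivity) hε0
  have hD : 1 ≤ 2 * Γ + 4 * Γ ^ 2 * R := by nlinarith [sq_nonneg Γ]
  refine ⟨2 * Γ + 4 * Γ ^ 2 * R, K₀, hD, hK₀, hK1, fun {b φ ψ S 𝒯 T s X Z h} H => ?_⟩
  set d := ‖X - Z‖ with hd
  have hd0 : 0 < d := norm_pos_iff.2 (sub_ne_zero.2 H.ne)
  have hh := H.h_pos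
  have hdh := H.dist_le
  obtain ⟨V₀, hV, hV', hb⟩ := hvol b d h hd0 hh
  refine ⟨V₀, hV, hV', fun t ht => ?_⟩
  obtain ⟨U, hU, hUc, hUs, hUm⟩ := H.exists_open
  obtain ⟨n, hn, A, hA0, hAn, hA, hint⟩ := hchain 𝒯 H.conforming H.fat H.card_le U hU hUc hUs hUm
    _ H.mem X H.X_mem Z H.Z_mem H.ne t ht
  have hle : ∀ i ≤ n, ∀ y ∈ A i, φ y ≤ ψ y := by
    intro i hi y hy
    obtain ⟨t, ht, hyt⟩ := Set.mem_iUnion₂.1 ((hA i hi).2.2.1 hy)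
    exact H.le t ht y hyt
  have hnorm : ∀ i ≤ n, ∀ y ∈ A i, ∀ z ∈ A i, ‖y - z‖ ≤ 2 * R * d := by
    intro i hi y hy z hz
    have h1 := mem_ball_iff_norm.1 ((hA i hi).2.2.2.1 hy)
    have h2 := mem_ball_iff_norm.1 ((hA i hi).2.2.2.1 hz)
    have := norm_sub_le (y - X) (z - X)
    rw [sub_sub_sub_cancel_right] at this
    linarith
  have hdiff : ∀ i ≤ n, ∀ y ∈ A i, |(ψ y - φ y) - (ψ X - φ X)| ≤ 2 * Γ * (R * d) := by
    intro i hi y hy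
    have h1 := (mem_ball_iff_norm.1 ((hA i hi).2.2.2.1 hy)).le
    have h2 := H.slope y X
    have h3 := mul_le_mul_of_nonneg_left h1 (by linarith : 0 ≤ Γ)
    have : (ψ y - φ y) - (ψ X - φ X) = (ψ y - ψ X) - (φ y - φ X) := by ring
    rw [this]
    have := abs_sub (ψ y - ψ X) (φ y - φ X)
    linarith [h2.1, h2.2]
  have hRd : Γ * R * d ≤ Γ ^ 2 * R * h := by
    have := mul_le_mul_of_nonneg_left hdh (by positivity : 0 ≤ Γ * R)
    nlinarith
  have hup : ∀ i ≤ n, ∀ y ∈ A i, ψ y - φ y ≤ (Γ + 2 * Γ ^ 2 * R) * h := by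
    intro i hi y hy
    have := (abs_le.1 (hdiff i hi y hy)).2
    nlinarith [H.height.2]
  have hlow : ∀ A' : Set E2, (∀ y ∈ A', φ y ≤ ψ y) → A' ⊆ Metric.ball X (R * d) → IsOpen A' →
      (∃ o, Metric.ball o (ρ * d) ⊆ A') → V₀ ≤ volume (pcol b φ ψ A') := by
    rintro A' hle' hX hop ⟨o, ho⟩
    refine (hb φ ψ A' hop).1 ⟨o, (Metric.ball_subset_ball (by nlinarith)).trans ho, fun y hy => ?_⟩
    have h2 : ρ / 2 * d = ρ * d / 2 := by ring
    rw [h2] at hy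
    have := affine_extrapolate_le (f := ψ - φ) (o := o) (X := X) (y := y) (ρ := ρ * d) (R := R * d)
      (h := h) (by positivity) (by positivity) (fun p hp => sub_nonneg.2 (hle' p (ho hp)))
      H.height.1 hy (hX (ho (Metric.ball_subset_ball (by nlinarith) hy)))
    have e : ρ * d / (2 * (R * d) + ρ * d) = ρ / (2 * R + ρ) := by field_simp
    rw [e] at this
    exact (mul_le_mul_of_nonneg_right (min_le_left _ _) hh.le).trans this
  have hslope : ∀ i ≤ n, ∀ y ∈ A i, ∀ z ∈ A i,
      |φ y - φ z| ≤ 2 * Γ * R * d ∧ |ψ y - ψ z| ≤ 2 * Γ * R * d := by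
    intro i hi y hy z hz
    have h1 := mul_le_mul_of_nonneg_left (hnorm i hi y hy z hz) (by linarith : 0 ≤ Γ)
    have h2 := H.slope y z
    constructor <;> linarith [h2.1, h2.2]
  have hGR : 2 * Γ * R * d ≤ (2 * Γ + 4 * Γ ^ 2 * R) * d := by
    have : 2 * Γ * R ≤ 2 * Γ + 4 * Γ ^ 2 * R := by nlinarith
    gcongr
  have h2R : 2 * R * d ≤ 2 * Γ * R * d := by
    have : 2 * R ≤ 2 * Γ * R := by nlinarith
    gcongr
  refine ⟨n, hn, A, hA0, hAn, ⟨fun i hi => (hA i hi).1, fun i hi => (hA i hi).2.1, ?_, ?_, ?_, ?_, ?_,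
    ?_⟩, ?_, ?_, ?_⟩
  · exact fun i hi => (pcol_mono (interior_maximal (hA i hi).2.2.1 (hA i hi).1)).trans H.pcol_subset
  · exact fun i hi => (hb φ ψ _ (hA i hi).1).2 ⟨X, (hA i hi).2.2.2.1, hup i hi⟩
  · exact fun i hi => hlow _ (hle i hi) (hA i hi).2.2.2.1 (hA i hi).1 (hA i hi).2.2.2.2
  · exact fun i hi => hlow _ (fun y hy => hle i hi.le y hy.1)
      (Set.inter_subset_left.trans (hA i hi.le).2.2.2.1) ((hA i hi.le).1.inter (hA (i + 1) hi).1)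
      (hint i hi)
  · exact fun i hi y hy z hz => (hnorm i hi y hy z hz).trans (h2R.trans hGR)
  · intro i hi x hx y hy
    rw [inner_sub_right]
    have a1 := (abs_le.1 (hslope i hi _ hx.1 _ hy.1).1)
    have a2 := hup i hi _ hx.1
    have a3 := hup i hi _ hy.1
    obtain ⟨-, x1, x2⟩ := hx
    obtain ⟨-, y1, y2⟩ := hy
    rw [abs_le]
    constructor <;> nlinarith
  · exact fun i hi y hy z hz => ⟨(hslope i hi y hy z hz).1.trans hGR, (hslope i hi y hy z hz).2.trans hGR⟩
  · intro i hi φ'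
    obtain ⟨o, ho⟩ := (hA i hi).2.2.2.2
    refine (hb φ' _ _ (hA i hi).1).1 ⟨o, (Metric.ball_subset_ball (by nlinarith)).trans ho, fun y _ => ?_⟩
    rw [addConst_apply, add_sub_cancel_left]
    have : ε * h ≤ 1 / 2 * h := mul_le_mul_of_nonneg_right (min_le_right _ _) hh.le
    linarith
  · intro h4 i hi y hy
    have := (abs_le.1 (hdiff i hi y hy)).1
    have := H.height.1
    nlinarith

end

noncomputable section

variable {b : OrthonormalBasis (Fin 3) ℝ E3} {φ ψ : E2 →ᵃ[ℝ] ℝ}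

theorem lineMap_mem_interior_of_mem_closure {E : Type*} [NormedAddCommGroup E] [NormedSpace ℝ E]
    {A : Set E} (hA : IsOpen A) (hAc : Convex ℝ A) {y m : E} (hy : y ∈ closure A) (hm : m ∈ A) {s : ℝ}
    (hs : s ∈ Set.Ioo (0 : ℝ) 1) : AffineMap.lineMap y m s ∈ A := by
  have := hAc.openSegment_closure_interior_subset_interior hy (by rwa [hA.interior_eq])
  rw [hA.interior_eq] at this
  exact this (by rw [openSegment_eq_image_lineMap]; exact ⟨s, hs, rfl⟩)

theorem lineMap_mem_pcol {A : Set E2} (hA : IsOpen A) (hAc : Convex ℝ A) {p q : E3}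
    (hp : proj b p ∈ closure A) (h1 : φ (proj b p) ≤ inner ℝ (b 2) p)
    (h2 : inner ℝ (b 2) p ≤ ψ (proj b p)) (hq : q ∈ pcol b φ ψ A) {s : ℝ}
    (hs : s ∈ Set.Ioo (0 : ℝ) 1) : AffineMap.lineMap p q s ∈ pcol b φ ψ A := by
  have e : proj b (AffineMap.lineMap p q s) = AffineMap.lineMap (proj b p) (proj b q) s :=
    AffineMap.apply_lineMap (proj b).toLinearMap.toAffineMap p q s
  have e2 : inner ℝ (b 2) (AffineMap.lineMap p q s) =
      (1 - s) * inner ℝ (b 2) p + s * inner ℝ (b 2) q := by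
    rw [AffineMap.lineMap_apply_module, inner_add_right, inner_smul_right, inner_smul_right]
  obtain ⟨hqA, q1, q2⟩ := hq
  obtain ⟨hs0, hs1⟩ := hs
  refine ⟨?_, ?_, ?_⟩ <;> rw [e]
  · exact lineMap_mem_interior_of_mem_closure hA hAc hp hqA ⟨hs0, hs1⟩
  · rw [e2, AffineMap.apply_lineMap, AffineMap.lineMap_apply_module, smul_eq_mul, smul_eq_mul]
    nlinarith
  · rw [e2, AffineMap.apply_lineMap, AffineMap.lineMap_apply_module, smul_eq_mul, smul_eq_mul]
    nlinarith

instance neBot_nhdsWithin_Ioo : (nhdsWithin (0 : ℝ) (Set.Ioo 0 1)).NeBot := by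
  rw [← mem_closure_iff_nhdsWithin_neBot, closure_Ioo zero_ne_one]
  simp

theorem tendsto_curve {f : E3 → ℝ} {S : Set E3} {p : E3} (hf : ContinuousWithinAt f S p)
    {c : ℝ → E3} (hc : Continuous c) (h0 : c 0 = p) (hm : ∀ s ∈ Set.Ioo (0 : ℝ) 1, c s ∈ S) :
    Filter.Tendsto (fun s => f (c s)) (nhdsWithin 0 (Set.Ioo 0 1)) (nhds (f p)) := by
  refine hf.tendsto.comp (tendsto_nhdsWithin_iff.2 ⟨?_, Filter.eventually_of_mem self_mem_nhdsWithin hm⟩)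
  rw [← h0]
  exact (hc.tendsto 0).mono_left nhdsWithin_le_nhds

theorem Continuous.graphPt {χ : E2 →ᵃ[ℝ] ℝ} {σ : ℝ} (hσ : σ * σ = 1) {f : ℝ → E2} {t : ℝ → ℝ}
    (hf : Continuous f) (ht : Continuous t) : Continuous fun r => graphPt b χ hσ (f r) (t r) :=
  (continuous_param _ _).comp (hf.prodMk ht)

theorem sum_weights_le {D Γ d h : ℝ} (hD : 1 ≤ D) (hΓ : 1 ≤ Γ) (hd : 0 ≤ d) (hh : 0 ≤ h)
    (hdh : d ≤ Γ * h) : (∑ i, ENNReal.ofReal (![D * d, D * d, D * h] i)) ≤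
      ENNReal.ofReal (D * (2 * Γ + 1)) * ENNReal.ofReal h ∧
    (∑ i, ENNReal.ofReal (![D * d, D * d, D * d] i)) ≤
      ENNReal.ofReal (D * (2 * Γ + 1)) * ENNReal.ofReal d := by
  have h1 : 0 ≤ D * d := by positivity
  have h2 : 0 ≤ D * h := by positivity
  simp only [Fin.sum_univ_three, Matrix.cons_val_zero, Matrix.cons_val_one, Matrix.cons_val]
  rw [← ENNReal.ofReal_add h1 h1, ← ENNReal.ofReal_add (by linarith) h2,
    ← ENNReal.ofReal_add (by linarith) h1, ← ENNReal.ofReal_mul (by positivity),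
    ← ENNReal.ofReal_mul (by positivity)]
  constructor <;> apply ENNReal.ofReal_le_ofReal <;> nlinarith

theorem hNorm_scale {S : Set E3} {g2 : Fin 3 → Fin 3 → E3 → ℝ} {D d h : ℝ} (hD : 0 ≤ D) :
    hNorm S ![D * d, D * d, D * h] g2 = ENNReal.ofReal D * hNorm S ![d, d, h] g2 := by
  rw [hNorm, hNorm, Finset.mul_sum]
  refine Finset.sum_congr rfl fun k _ => ?_
  have : (![D * d, D * d, D * h] : Fin 3 → ℝ) k = D * (![d, d, h] : Fin 3 → ℝ) k := by
    fin_cases k <;> rfl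
  rw [this, ENNReal.ofReal_mul hD, mul_assoc]

theorem hNorm_ne_top {S : Set E3} {v : E3 → ℝ} {g : Fin 3 → E3 → ℝ} {g2 : Fin 3 → Fin 3 → E3 → ℝ}
    (h : IsH2 b S v g g2) (w : Fin 3 → ℝ) : hNorm S w g2 ≠ ⊤ :=
  ENNReal.sum_ne_top.2 fun _ _ => ENNReal.mul_ne_top ENNReal.ofReal_ne_top
    (ENNReal.sum_ne_top.2 fun _ _ => (h.mem2 _ _).eLpNorm_ne_top)

theorem mul_abs_le_of_enorm {V₀ C : ENNReal} (hC : C ≠ ⊤) {r t : ℝ} {G : ENNReal}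
    (hG : G ≠ ⊤) (ht : 0 ≤ t)
    (h : V₀ ^ (1 / 2 : ℝ) * ‖r‖ₑ ≤ C * ENNReal.ofReal t * G) :
    (V₀ ^ (1 / 2 : ℝ)).toReal * |r| ≤ C.toReal * t * G.toReal := by
  have := ENNReal.toReal_mono (ENNReal.mul_ne_top (ENNReal.mul_ne_top hC ENNReal.ofReal_ne_top) hG) h
  rwa [ENNReal.toReal_mul, ENNReal.toReal_mul, ENNReal.toReal_mul, ENNReal.toReal_ofReal ht,
    toReal_enorm, Real.norm_eq_abs] at this

set_option maxHeartbeats 1000000 in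
/-- On a patch, a function in `H²` differs from a suitable affine function by little. -/
theorem exists_affine_approx {κ Γ : ℝ} (hκ : 0 < κ) (hΓ : 1 ≤ Γ) (N : ℕ) : ∃ C : ℝ, 0 < C ∧
    ∀ {b φ ψ S 𝒯 T s X Z h}, PatchGeom κ Γ N b φ ψ S 𝒯 T s X Z h → ∀ {v g g2},
      IsH2 b S v g g2 → ContinuousOn v (S ∪ ⋃ n ∈ T, openSegment ℝ n (s n)) →
      (∀ n ∈ T, MemLp (fun r : ℝ => v (AffineMap.lineMap n (s n) r)) 2
        (volume.restrict (Set.Icc 0 1))) →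
      ∃ (L : E3 →L[ℝ] ℝ) (V : ℝ), 0 < V ∧
        (∀ c : ℝ, eLpNorm (fun _ => c) 2 (volume.restrict (interior (cell T))) ≤
          ENNReal.ofReal (C * (V * |c|))) ∧
        (∀ j, eLpNorm (fun x => g j x - L (b j)) 2 (volume.restrict (interior (cell T))) ≤
          ENNReal.ofReal (C * (hNorm S ![‖X - Z‖, ‖X - Z‖, h] g2).toReal)) ∧
        (∀ n ∈ T, ∀ m ∈ T, V * |(edgeProjValue v n (s n) - L n) - (edgeProjValue v m (s m) - L m)| ≤
          C * h * (hNorm S ![‖X - Z‖, ‖X - Z‖, h] g2).toReal) ∧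
        ∀ n ∈ T, ∀ m ∈ T, (Γ * ‖X - Z‖ < h → ∃ χ : E2 →ᵃ[ℝ] ℝ, (χ = φ ∨ χ = ψ) ∧
            (∀ p ∈ openSegment ℝ n (s n), inner ℝ (b 2) p = χ (proj b p)) ∧
            ∀ p ∈ openSegment ℝ m (s m), inner ℝ (b 2) p = χ (proj b p)) →
          V * |(edgeProjValue v n (s n) - L n) - (edgeProjValue v m (s m) - L m)| ≤
          C * ‖X - Z‖ * (hNorm S ![‖X - Z‖, ‖X - Z‖, h] g2).toReal := by
  obtain ⟨D, K₀, hD, hK, hK1, hchain⟩ := exists_colChain hκ hΓ N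
  set P : ENNReal := (4 * K₀) ^ (2 * N) with hP
  have hPt : P ≠ ⊤ := ENNReal.pow_ne_top (ENNReal.mul_ne_top (by norm_num) hK)
  have h4K : (1 : ENNReal) ≤ 4 * K₀ := by
    calc (1 : ENNReal) ≤ 4 * 1 := by norm_num
      _ ≤ 4 * K₀ := by gcongr
  set C₁ : ENNReal := (2 * N + 1) * (6 * (ENNReal.ofReal (D * (2 * Γ + 1)) * (3 * P + 8) *
    ENNReal.ofReal D)) with hC₁
  have hC₁t : C₁ ≠ ⊤ := by
    refine ENNReal.mul_ne_top ?_ (ENNReal.mul_ne_top (by norm_num) (ENNReal.mul_ne_top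
      (ENNReal.mul_ne_top ENNReal.ofReal_ne_top ?_) ENNReal.ofReal_ne_top))
    · exact ENNReal.add_ne_top.2 ⟨ENNReal.mul_ne_top (by norm_num) (ENNReal.natCast_ne_top N), by norm_num⟩
    · exact ENNReal.add_ne_top.2 ⟨ENNReal.mul_ne_top (by norm_num) hPt, by norm_num⟩
  set c₁ := C₁.toReal with hc₁
  set c₂ := (3 * P * ENNReal.ofReal D).toReal with hc₂
  set c₃ := (K₀ ^ (1 / 2 : ℝ)).toReal with hc₃
  have hPK : ∀ n ≤ 2 * N, (4 * K₀) ^ n ≤ P := fun n hn => pow_le_pow_right₀ h4K hn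
  clear_value P
  have h1 : 0 ≤ c₁ := ENNReal.toReal_nonneg
  have h2 : 0 ≤ c₂ := ENNReal.toReal_nonneg
  have h3 : 0 ≤ c₃ := ENNReal.toReal_nonneg
  set C : ℝ := 8 * c₁ * (Γ + 4 * D) + c₂ + c₃ + 1 with hC
  have hCc : 8 * c₁ * (Γ + 4 * D) ≤ C := by rw [hC]; linarith
  have hCc' : 8 * c₁ ≤ C := by nlinarith
  have hCc₂ : c₂ ≤ C := by rw [hC]; nlinarith
  have hCc₃ : c₃ ≤ C := by rw [hC]; nlinarith
  have hC0 : 0 < C := by positivity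
  clear_value C
  refine ⟨C, hC0, fun {b φ ψ S 𝒯 T s X Z h} H {v g g2} hv hcont hmem => ?_⟩
  obtain ⟨V₀, hV, hV', hch⟩ := hchain H
  set d := ‖X - Z‖ with hd
  have hd0 : 0 < d := norm_pos_iff.2 (sub_ne_zero.2 H.ne)
  have hh := H.h_pos
  have hdh := H.dist_le
  rw [← hd] at hdh
  obtain ⟨hw1, hw2⟩ := sum_weights_le hD hΓ hd0.le hh.le hdh
  set G := hNorm S ![d, d, h] g2 with hG
  have hGt : G ≠ ⊤ := hNorm_ne_top hv _
  clear_value d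
  set K := pcol b φ ψ (interior (hull (shadow b T))) with hKd
  obtain ⟨n₀, hn₀, A₀, hA₀, -, hC₀, -⟩ := hch _ H.mem
  have hKA : K = pcol b φ ψ (A₀ 0) := by rw [hA₀]
  have hKo : IsOpen K := isOpen_pcol isOpen_interior
  have hKc : Convex ℝ K := convex_pcol ((convex_convexHull ℝ _).interior)
  have hKV : V₀ ≤ volume K := hKA ▸ hC₀.lower 0 (Nat.zero_le _)
  have hK0 : volume K ≠ 0 := ne_of_gt ((pos_iff_ne_zero.2 hV).trans_le hKV)
  have hKup : volume K ≤ K₀ * V₀ := hKA ▸ hC₀.upper 0 (Nat.zero_le _)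
  have hKfin : volume K ≠ ⊤ := (hKup.trans_lt (ENNReal.mul_lt_top hK.lt_top hV'.lt_top)).ne
  have hKS : K ⊆ S := hKA ▸ hC₀.subset 0 (Nat.zero_le _)
  have hmono := Measure.restrict_mono hKS (le_refl (volume : Measure E3))
  have hconst : ∀ j, ∃ c : ℝ, ∫⁻ y in K, ‖g j y - c‖ₑ ^ 2 ≤
      8 * wNorm1 S ![D * d, D * d, D * h] (g2 j) ^ 2 := by
    intro j
    obtain ⟨c, hc⟩ := exists_const_lintegral_sq_le hK0 hKfin
      ((hv.mem1 j).mono_measure hmono).aestronglyMeasurable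
      (poincare_convex hKo hKc (nonempty_of_measure_ne_zero hK0) ((hv.mem1 j).mono_measure hmono)
        (fun i => (hv.mem2 j i).mono_measure hmono) (fun i => (hv.partial2 j i).mono H.isOpen hKS)
        (w := ![D * d, D * d, D * h]) (by rw [hKA]; exact hC₀.abs_inner_le 0 (Nat.zero_le _)))
    exact ⟨c, hc.trans (by gcongr; exact wNorm1_mono hKS _ _)⟩
  choose c hc using hconst
  set L : E3 →L[ℝ] ℝ := ∑ j, c j • innerSL ℝ (b j) with hL
  have hLb : ∀ j, L (b j) = c j := by
    intro j
    simp only [hL, sum_apply, smul_apply, innerSL_apply_apply,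
      inner_basis, smul_eq_mul]
    simp
  clear_value L
  have hc' : ∀ (A : ℕ → Set E2), A 0 = interior (hull (shadow b T)) → ∀ j,
      ∫⁻ y in pcol b φ ψ (A 0), ‖g j y - L (b j)‖ₑ ^ 2 ≤
        8 * wNorm1 S ![D * d, D * d, D * h] (g2 j) ^ 2 := by
    intro A hA j; rw [hA, hLb]; exact hc j
  set V := (V₀ ^ (1 / 2 : ℝ)).toReal with hVdef
  have hVt : V₀ ^ (1 / 2 : ℝ) ≠ ⊤ := ENNReal.rpow_ne_top_of_nonneg (by norm_num) hV'
  have hVpos : 0 < V := ENNReal.toReal_pos (by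
    rw [Ne, ENNReal.rpow_eq_zero_iff]; simp [hV]) hVt
  have hcS : ContinuousOn v S := hcont.mono Set.subset_union_left
  set f := fun x => v x - L x with hf
  have hfc : ContinuousOn f (S ∪ ⋃ n ∈ T, openSegment ℝ n (s n)) := hcont.sub L.continuous.continuousOn
  have hbound : ∀ (n : ℕ) (e W : ENNReal) (t : ℝ), n ≤ 2 * N → e ≤ 8 →
      W ≤ ENNReal.ofReal (D * (2 * Γ + 1)) * ENNReal.ofReal t →
      (n + 1) * (6 * (W * (3 * (4 * K₀) ^ n + e) * hNorm S ![D * d, D * d, D * h] g2)) ≤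
        C₁ * ENNReal.ofReal t * G := by
    intro n e W t hn he hW
    rw [hNorm_scale (by linarith)]
    have hn' : (n : ENNReal) ≤ 2 * N := by exact_mod_cast hn
    calc (n + 1) * (6 * (W * (3 * (4 * K₀) ^ n + e) * (ENNReal.ofReal D * G)))
        ≤ (2 * N + 1) * (6 * ((ENNReal.ofReal (D * (2 * Γ + 1)) * ENNReal.ofReal t) * (3 * P + 8) *
          (ENNReal.ofReal D * G))) := by
          gcongr
          exact hPK _ hn
      _ = C₁ * ENNReal.ofReal t * G := by rw [hC₁]; ring
  clear_value G
  obtain ⟨q₀, hq₀⟩ := nonempty_of_measure_ne_zero hK0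
  -- oscillation between `q₀` and the points of the edges
  have hE : ∀ n ∈ T, ∀ p ∈ openSegment ℝ n (s n), V * |f q₀ - f p| ≤ c₁ * h * G.toReal := by
    intro n hn p hp
    obtain ⟨t, ht, hseg⟩ := H.node n hn
    obtain ⟨m, hm, A, hA0, hAm, hCC, -⟩ := hch t ht
    obtain ⟨q, hq⟩ := nonempty_of_measure_ne_zero (ne_of_gt ((pos_iff_ne_zero.2 hV).trans_le
      (hCC.lower m le_rfl)))
    have hAne : (interior (hull t)).Nonempty := hAm ▸ ⟨_, hq.1⟩
    have hcl : hull t ⊆ closure (A m) := by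
      have hCv : Convex ℝ (hull t) := convex_convexHull ℝ _
      rw [hAm, hCv.closure_interior_eq_closure_of_nonempty_interior hAne]
      exact subset_closure
    obtain ⟨hp1, hp2, hp3⟩ := hseg p hp
    have hline := fun s hs => lineMap_mem_pcol (s := s) (hCC.isOpen m le_rfl) (hCC.convex m le_rfl)
      (hcl hp1) hp2 hp3 hq hs
    have hlim := tendsto_curve (hfc p (Or.inr (Set.mem_iUnion₂.2 ⟨n, hn, hp⟩)))
      (c := fun s => AffineMap.lineMap p q s) AffineMap.lineMap_continuous (by simp)
      (fun s hs => Or.inl (hCC.subset m le_rfl (hline s hs)))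
    refine le_of_tendsto ((tendsto_const_nhds.sub hlim).abs.const_mul V)
      (Filter.eventually_of_mem self_mem_nhdsWithin fun s hs => ?_)
    refine mul_abs_le_of_enorm hC₁t hGt hh.le ((hCC.enorm_sub_le hV hV' hK hK1 (by positivity)
      (by positivity) hv H.isOpen H.isBounded hcS L (hc' A hA0) (hA0 ▸ hq₀) (hline s hs)).trans
      (hbound m 4 _ h hm (by norm_num) hw1))
  -- from the edges to the projections
  have hproj : ∀ n ∈ T, ∀ m ∈ T, ∀ B : ℝ, (∀ r ∈ Set.Ioo (0 : ℝ) 1,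
      V * |f (AffineMap.lineMap n (s n) r) - f (AffineMap.lineMap m (s m) r)| ≤ B) →
      V * |(edgeProjValue v n (s n) - L n) - (edgeProjValue v m (s m) - L m)| ≤ 4 * B := by
    intro n hn m hm B hB
    have hLm : ∀ k, MemLp (fun r : ℝ => L (AffineMap.lineMap k (s k) r)) 2
        (volume.restrict (Set.Icc 0 1)) := by
      intro k
      have hk : Continuous fun r : ℝ => L (AffineMap.lineMap k (s k) r) :=
        L.continuous.comp AffineMap.lineMap_continuous
      obtain ⟨B, hB⟩ := isCompact_Icc.exists_bound_of_continuousOn (s := Set.Icc (0 : ℝ) 1) hk.continuousOn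
      exact MemLp.of_bound hk.aestronglyMeasurable B
        ((ae_restrict_iff' measurableSet_Icc).2 (Filter.Eventually.of_forall hB))
    have e : ∀ k ∈ T, edgeProjValue v k (s k) - L k = edgeProjValue f k (s k) := by
      intro k hk
      rw [hf, edgeProjValue_sub (hmem k hk) (hLm k)]
      have := edgeProjValue_affine L 0 k (s k)
      simp only [add_zero] at this
      rw [this]
    rw [e n hn, e m hm]
    have := edgeProjValue_sub_le (B := B / V) ((hmem n hn).sub (hLm n)) ((hmem m hm).sub (hLm m))
      fun r hr => by rw [le_div_iff₀' hVpos]; exact hB r hr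
    calc V * |edgeProjValue f n (s n) - edgeProjValue f m (s m)| ≤ V * (4 * (B / V)) := by gcongr
      _ = 4 * B := by field_simp
  have hseg : ∀ n, ∀ r ∈ Set.Ioo (0 : ℝ) 1, AffineMap.lineMap n (s n) r ∈ openSegment ℝ n (s n) := by
    intro n r hr; rw [openSegment_eq_image_lineMap]; exact ⟨r, hr, rfl⟩
  have hEE : ∀ n ∈ T, ∀ m ∈ T, V * |(edgeProjValue v n (s n) - L n) - (edgeProjValue v m (s m) - L m)| ≤
      8 * c₁ * h * G.toReal := by
    intro n hn m hm
    refine (hproj n hn m hm (2 * (c₁ * h * G.toReal)) fun r hr => ?_).trans (le_of_eq (by ring))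
    have a1 := hE n hn _ (hseg n r hr)
    have a2 := hE m hm _ (hseg m r hr)
    have := abs_sub_le (f (AffineMap.lineMap n (s n) r)) (f q₀) (f (AffineMap.lineMap m (s m) r))
    rw [abs_sub_comm (f (AffineMap.lineMap n (s n) r)) (f q₀)] at this
    nlinarith
  have hG0 : 0 ≤ G.toReal := ENNReal.toReal_nonneg
  refine ⟨L, V, hVpos, fun a => ?_, fun j => ?_, fun n hn m hm => ?_, fun n hn m hm hpl => ?_⟩
  · rw [eLpNorm_const' _ two_ne_zero ENNReal.ofNat_ne_top, Measure.restrict_apply_univ]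
    have e1 : volume (interior (cell T)) ^ (1 / (2 : ENNReal).toReal) ≤ ENNReal.ofReal (c₃ * V) := by
      rw [ENNReal.ofReal_mul h3, hc₃, hVdef, ENNReal.ofReal_toReal hVt, ENNReal.ofReal_toReal
        (ENNReal.rpow_ne_top_of_nonneg (by norm_num) hK), ← ENNReal.mul_rpow_of_nonneg _ _ (by norm_num)]
      simp only [ENNReal.toReal_ofNat]
      gcongr
      exact (measure_mono H.cell_subset).trans hKup
    calc ‖a‖ₑ * volume (interior (cell T)) ^ (1 / (2 : ENNReal).toReal)
        ≤ ENNReal.ofReal |a| * ENNReal.ofReal (c₃ * V) := by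
          rw [Real.enorm_eq_ofReal_abs]; gcongr
      _ = ENNReal.ofReal (c₃ * (V * |a|)) := by
          rw [← ENNReal.ofReal_mul (abs_nonneg a)]; ring_nf
      _ ≤ _ := ENNReal.ofReal_le_ofReal (by gcongr)
  · have e1 := hC₀.eLpNorm_le hV hV' hK hK1 hv H.isOpen j (hc' A₀ hA₀ j) 0 (Nat.zero_le _)
    rw [hNorm_scale (by linarith), ← hKA, ← hG] at e1
    refine (eLpNorm_mono_measure _ (Measure.restrict_mono H.cell_subset le_rfl)).trans (e1.trans ?_)
    calc 3 * (4 * K₀) ^ n₀ * (ENNReal.ofReal D * G) ≤ 3 * P * (ENNReal.ofReal D * G) := by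
          gcongr; exact hPK _ hn₀
      _ = ENNReal.ofReal (c₂ * G.toReal) := by
          rw [ENNReal.ofReal_mul h2, hc₂, ENNReal.ofReal_toReal hGt, ENNReal.ofReal_toReal
            (ENNReal.mul_ne_top (ENNReal.mul_ne_top (by norm_num) hPt) ENNReal.ofReal_ne_top)]
          ring
      _ ≤ _ := ENNReal.ofReal_le_ofReal (by gcongr)
  · exact (hEE n hn m hm).trans (by gcongr)
  · rcases le_or_gt h ((Γ + 4 * D) * d) with hcase | hcase
    · refine (hEE n hn m hm).trans ?_
      calc 8 * c₁ * h * G.toReal ≤ 8 * c₁ * ((Γ + 4 * D) * d) * G.toReal := by gcongr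
        _ = 8 * c₁ * (Γ + 4 * D) * d * G.toReal := by ring
        _ ≤ _ := by gcongr
    · have hΓd : 0 ≤ Γ * d := by positivity
      have hDd : 0 ≤ D * d := by positivity
      obtain ⟨χ, hχ, hχn, hχm⟩ := hpl (by nlinarith)
      have h4 : 4 * (D * d) ≤ h := by nlinarith
      have hh2 : 0 < h / 2 := by positivity
      have haη : D * d + h / 2 ≤ D * h := by nlinarith
      obtain ⟨σ, φ', hσ, hχ', hφ'⟩ : ∃ (σ : ℝ) (φ' : E2 →ᵃ[ℝ] ℝ), σ * σ = 1 ∧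
          (σ = 1 ∧ χ = φ' ∨ σ = -1 ∧ χ = addConst φ' (h / 2)) ∧
          ∀ y, h / 2 ≤ ψ y - φ y → φ y ≤ φ' y ∧ φ' y + h / 2 ≤ ψ y := by
        rcases hχ with rfl | rfl
        · exact ⟨1, χ, by norm_num, Or.inl ⟨rfl, rfl⟩, fun y hy => ⟨le_rfl, by linarith⟩⟩
        · refine ⟨-1, addConst χ (-(h / 2)), by norm_num, Or.inr ⟨rfl, ?_⟩, fun y hy => ?_⟩
          · ext y; simp
          · rw [addConst_apply]; constructor <;> linarith
      obtain ⟨y₀, hy₀⟩ : (interior (hull (shadow b T))).Nonempty := ⟨_, hq₀.1⟩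
      -- the points near the edges, on the parallel surfaces
      have hP : ∀ k ∈ T, (∀ p ∈ openSegment ℝ k (s k), inner ℝ (b 2) p = χ (proj b p)) →
          ∀ p ∈ openSegment ℝ k (s k), ∃ y : ℝ → E2,
            (∀ r ∈ Set.Ioo (0 : ℝ) 1, V * |f (graphPt b χ hσ y₀ (r * (h / 2 / 4))) -
              f (graphPt b χ hσ (y r) (r * (h / 2 / 4)))| ≤ c₁ * d * G.toReal) ∧
            Filter.Tendsto (fun r => f (graphPt b χ hσ (y r) (r * (h / 2 / 4))))
              (nhdsWithin 0 (Set.Ioo 0 1)) (nhds (f p)) := by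
        intro k hk hχk p hp
        obtain ⟨t, ht, hseg⟩ := H.node k hk
        obtain ⟨m, hm, A, hA0, hAm, hCC, hsl, hslV, hlow⟩ := hch t ht
        obtain ⟨q, hq⟩ := nonempty_of_measure_ne_zero (ne_of_gt ((pos_iff_ne_zero.2 hV).trans_le
          (hCC.lower m le_rfl)))
        have hAne : (interior (hull t)).Nonempty := hAm ▸ ⟨_, hq.1⟩
        have hcl : hull t ⊆ closure (A m) := by
          have hCv : Convex ℝ (hull t) := convex_convexHull ℝ _
          rw [hAm, hCv.closure_interior_eq_closure_of_nonempty_interior hAne]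
          exact subset_closure
        have hy : ∀ r ∈ Set.Ioo (0 : ℝ) 1, AffineMap.lineMap (proj b p) (proj b q) r ∈ A m := fun r hr =>
          lineMap_mem_interior_of_mem_closure (hCC.isOpen m le_rfl) (hCC.convex m le_rfl)
            (hcl (hseg p hp).1) hq.1 hr
        have hsub : ∀ i ≤ m, pcol b φ' (addConst φ' (h / 2)) (A i) ⊆ pcol b φ ψ (A i) := by
          rintro i hi x ⟨x0, x1, x2⟩
          rw [addConst_apply] at x2
          obtain ⟨a1, a2⟩ := hφ' _ (hlow h4 i hi _ x0)
          exact ⟨x0, by linarith, by linarith⟩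
        have hδ : ∀ r ∈ Set.Ioo (0 : ℝ) 1, r * (h / 2 / 4) ∈ Set.Ioo 0 (h / 2 / 4) := fun r hr =>
          ⟨by have := hr.1; positivity, by nlinarith [hr.2]⟩
        have hslope : ∀ i ≤ m, ∀ y ∈ A i, ∀ z ∈ A i, |χ y - χ z| ≤ D * d := by
          intro i hi y hy z hz
          rcases hχ with h | h <;> rw [h]
          · exact (hsl i hi y hy z hz).1
          · exact (hsl i hi y hy z hz).2
        have hcurve : Continuous fun r : ℝ =>
            graphPt b χ hσ (AffineMap.lineMap (proj b p) (proj b q) r) (r * (h / 2 / 4)) :=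
          Continuous.graphPt hσ AffineMap.lineMap_continuous (by fun_prop)
        refine ⟨fun r => AffineMap.lineMap (proj b p) (proj b q) r, fun r hr => ?_, ?_⟩
        · have e1 := hCC.enorm_sub_le_slab hV hV' hK hK1 hDd hv H.isOpen H.isBounded hcS L (hc' A hA0)
            hh2 hσ hsub (fun i hi => hslV i hi φ') hχ' hslope haη (hA0 ▸ hy₀) (hy r hr) (hδ r hr)
          have e2 := e1.trans (hbound m 8 _ d hm le_rfl hw2)
          exact mul_abs_le_of_enorm hC₁t hGt hd0.le e2
        · refine tendsto_curve (hfc p (Or.inr (Set.mem_iUnion₂.2 ⟨k, hk, hp⟩)))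
            (c := fun r => graphPt b χ hσ (AffineMap.lineMap (proj b p) (proj b q) r) (r * (h / 2 / 4)))
            hcurve ?_ ?_
          · simp only [AffineMap.lineMap_apply_zero, zero_mul]
            refine eq_of_proj_eq b (by simp) ?_
            rw [inner_graphPt, hχk p hp]; simp
          · intro r hr
            refine Or.inl (hCC.subset m le_rfl (hsub m le_rfl ⟨by simpa using hy r hr, ?_⟩))
            rw [inner_graphPt, proj_graphPt, addConst_apply]
            obtain ⟨r1, r2⟩ := hδ r hr
            rcases hχ' with ⟨rfl, rfl⟩ | ⟨rfl, rfl⟩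
            · constructor <;> linarith
            · rw [addConst_apply]; constructor <;> linarith
      refine (hproj n hn m hm (2 * (c₁ * d * G.toReal)) fun r hr => ?_).trans ?_
      · obtain ⟨y, hy, hylim⟩ := hP n hn hχn _ (hseg n r hr)
        obtain ⟨z, hz, hzlim⟩ := hP m hm hχm _ (hseg m r hr)
        refine le_of_tendsto ((hylim.sub hzlim).abs.const_mul V)
          (Filter.eventually_of_mem self_mem_nhdsWithin fun r hr => ?_)
        have a1 := hy r hr
        have a2 := hz r hr
        have := abs_sub_le (f (graphPt b χ hσ (y r) (r * (h / 2 / 4))))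
          (f (graphPt b χ hσ y₀ (r * (h / 2 / 4)))) (f (graphPt b χ hσ (z r) (r * (h / 2 / 4))))
        rw [abs_sub_comm (f (graphPt b χ hσ (y r) (r * (h / 2 / 4))))
          (f (graphPt b χ hσ y₀ (r * (h / 2 / 4))))] at this
        nlinarith
      · calc 4 * (2 * (c₁ * d * G.toReal)) = 8 * c₁ * d * G.toReal := by ring
          _ ≤ _ := by gcongr

end

noncomputable section

/-! ### The interpolant on an element -/

variable {b : OrthonormalBasis (Fin 3) ℝ E3}

/-- The gradient of an affine function is controlled by its differences along three edges. -/
theorem abs_apply_basis_le {κ Γ β h : ℝ} (hκ : 0 < κ) (hΓ : 0 ≤ Γ) (hβ : 0 ≤ β) (hh : 0 < h)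
    {t : Finset E2} (ht : Fat κ t) {x y z w x' y' : E3} (hx : proj b x ∈ t) (hz : proj b z ∈ t)
    (hw : proj b w ∈ t) (hxy : proj b y = proj b x) (hx' : proj b x' = proj b x)
    (hy' : proj b y' = proj b x) (hxz : proj b x ≠ proj b z) (hxw : proj b x ≠ proj b w)
    (hzw : proj b z ≠ proj b w) (γ : E3 →ₗ[ℝ] ℝ) (hlen : |inner ℝ (b 2) (y - x)| = h)
    (h1 : |γ (y - x)| ≤ β * h) (h2 : |γ (z - x')| ≤ β * ‖proj b x - proj b z‖)
    (h3 : |γ (w - y')| ≤ β * ‖proj b x - proj b z‖)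
    (hsz : |inner ℝ (b 2) (z - x')| ≤ Γ * ‖proj b x - proj b z‖)
    (hsw : |inner ℝ (b 2) (w - y')| ≤ Γ * ‖proj b x - proj b z‖) (j : Fin 3) :
    |γ (b j)| ≤ β * ((1 + Γ) * (2 * κ⁻¹ ^ 2 + 1)) := by
  set d := ‖proj b x - proj b z‖ with hd
  have hd0 : 0 < d := norm_pos_iff.2 (sub_ne_zero.2 hxz)
  have hsplit : ∀ q : E3, γ q = γ (proj b q 0 • b 0 + proj b q 1 • b 1) + inner ℝ (b 2) q * γ (b 2) := by
    intro q
    conv_lhs => rw [sum_inner_smul b q]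
    rw [map_add, map_smul γ (inner ℝ (b 2) q), smul_eq_mul]
    simp
  have hγ2 : |γ (b 2)| ≤ β := by
    have e : γ (y - x) = inner ℝ (b 2) (y - x) * γ (b 2) := by
      rw [hsplit (y - x), map_sub, hxy, sub_self]; simp
    rw [e, abs_mul, hlen, mul_comm] at h1
    exact le_of_mul_le_mul_right h1 hh
  set δ : E2 →ₗ[ℝ] ℝ := γ ∘ₗ ((shear b 0 1 (by norm_num)).toLinearMap ∘ₗ LinearMap.inl ℝ E2 ℝ) with hδ
  have hδa : ∀ q : E2, δ q = γ (q 0 • b 0 + q 1 • b 1) := by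
    intro q
    simp [hδ, shear_apply]
  have hside : ∀ p q : E3, proj b q = proj b x → |γ (p - q)| ≤ β * d →
      |inner ℝ (b 2) (p - q)| ≤ Γ * d → |δ (proj b p - proj b x)| ≤ β * (1 + Γ) * d := by
    intro p q hq e1 e2
    rw [hδa, ← hq, ← map_sub]
    have := hsplit (p - q)
    have e3 : |inner ℝ (b 2) (p - q) * γ (b 2)| ≤ Γ * d * β := by
      rw [abs_mul]; gcongr
    have e4 : γ (proj b (p - q) 0 • b 0 + proj b (p - q) 1 • b 1) =
        γ (p - q) - inner ℝ (b 2) (p - q) * γ (b 2) := by rw [this]; ring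
    rw [e4]
    have := abs_sub (γ (p - q)) (inner ℝ (b 2) (p - q) * γ (b 2))
    nlinarith
  have dz := hside z x' hx' h2 hsz
  have dw := hside w y' hy' h3 hsw
  have hdw : κ * d ≤ ‖proj b x - proj b w‖ := by
    exact ht.side_le hκ hx hz hx hw hxz hxw
  obtain ⟨T, hT0, hT1, hT2, -⟩ := ht.exists_tri hκ hx hz hw hxz hzw hxw
  have hκ1 : κ ≤ 1 := T.κ_le_one
  have hplane : ∀ e : E2, ‖e‖ = 1 → |δ e| ≤ β * ((1 + Γ) * (2 * κ⁻¹ ^ 2)) := by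
    intro e he
    have a := T.sub_eq (proj b x + e) (proj b x) 1 0 2 (by decide) (by decide) (by decide)
    rw [hT0, hT1, hT2, add_sub_cancel_left] at a
    have c1 := T.abs_coord_sub_le (proj b x + e) (proj b x) (i := 1) (j := 0) (by decide)
    have c2 := T.abs_coord_sub_le (proj b x + e) (proj b x) (i := 2) (j := 0) (by decide)
    rw [hT0, hT1, add_sub_cancel_left, he, norm_sub_rev] at c1
    rw [hT0, hT2, add_sub_cancel_left, he, norm_sub_rev] at c2
    set α := T.B.coord 1 (proj b x + e) - T.B.coord 1 (proj b x)
    set α' := T.B.coord 2 (proj b x + e) - T.B.coord 2 (proj b x)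
    rw [a, map_add, map_smul, map_smul, smul_eq_mul, smul_eq_mul]
    refine (abs_add_le _ _).trans ?_
    rw [abs_mul, abs_mul]
    have b1 : |α| * d ≤ κ⁻¹ ^ 2 := by
      rw [inv_pow, ← one_div, le_div_iff₀ (by positivity)]
      nlinarith [mul_nonneg (abs_nonneg α) hd0.le]
    have b2 : |α'| * d ≤ κ⁻¹ ^ 2 := by
      rw [inv_pow, ← one_div, le_div_iff₀ (by positivity)]
      have := mul_le_mul_of_nonneg_left hdw (mul_nonneg hκ.le (abs_nonneg α'))
      nlinarith
    have hBΓ : 0 ≤ β * (1 + Γ) := by positivity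
    have f1 := mul_le_mul_of_nonneg_left dz (abs_nonneg α)
    have f2 := mul_le_mul_of_nonneg_left dw (abs_nonneg α')
    have f3 := mul_le_mul_of_nonneg_left b1 hBΓ
    have f4 := mul_le_mul_of_nonneg_left b2 hBΓ
    nlinarith
  have hpos : 0 ≤ β * ((1 + Γ) * (2 * κ⁻¹ ^ 2)) := by positivity
  have hone : β ≤ β * (1 + Γ) := by nlinarith
  have hfin : ∀ r : ℝ, r ≤ β * ((1 + Γ) * (2 * κ⁻¹ ^ 2)) ∨ r ≤ β →
      r ≤ β * ((1 + Γ) * (2 * κ⁻¹ ^ 2 + 1)) := by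
    have : β * ((1 + Γ) * (2 * κ⁻¹ ^ 2 + 1)) = β * ((1 + Γ) * (2 * κ⁻¹ ^ 2)) + β * (1 + Γ) := by ring
    rintro r (h | h) <;> linarith
  have hbasis : ∀ i : Fin 2, ‖(EuclideanSpace.single i (1 : ℝ) : E2)‖ = 1 := by simp
  apply hfin
  fin_cases j
  · left
    have := hplane _ (hbasis 0)
    rw [hδa] at this
    simpa using this
  · left
    have := hplane _ (hbasis 1)
    rw [hδa] at this
    simpa using this
  · right; exact hγ2

/-- In the interior of an element the nodal basis functions are the barycentric coordinates. -/
theorem nodalBasis_eq {K : Geometry.SimplicialComplex ℝ E3} {T : Finset E3} (hT : T ∈ tets K)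
    {B : AffineBasis (Fin 4) ℝ E3} (hB : Set.range B = T) {q : E3} (hq : q ∈ interior (cell T)) :
    (∀ i, nodalBasis K (B i) q = B.coord i q) ∧ ∀ n ∉ T, nodalBasis K n q = 0 := by
  classical
  have hpos : ∀ i, 0 < B.coord i q := by
    rw [cell, ← hB, B.interior_convexHull] at hq
    exact hq
  have hex : ∃ w, IsBarycentric K q w := by
    have hqT : q ∈ convexHull ℝ (T : Set E3) := interior_subset hq
    rw [Finset.mem_convexHull'] at hqT
    obtain ⟨w, h0, h1, h2⟩ := hqT
    refine ⟨fun m => if m ∈ T then w m else 0, T, hT.1, fun m => ?_, fun m hm => if_neg hm, ?_, ?_⟩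
    · by_cases hm : m ∈ T
      · simpa [hm] using h0 m hm
      · simp [hm]
    · rw [← h1]; exact Finset.sum_congr rfl fun m hm => if_pos hm
    · rw [← h2]; exact Finset.sum_congr rfl fun m hm => by simp only [if_pos hm]
  obtain ⟨s, hs, h0, h1, h2, h3⟩ := hex.choose_spec
  have hdef : ∀ n, nodalBasis K n q = hex.choose n := fun n => by rw [nodalBasis, dif_pos hex]
  set w := hex.choose
  have hqs : q ∈ convexHull ℝ (s : Set E3) := by
    rw [Finset.mem_convexHull']; exact ⟨w, fun m _ => h0 m, h2, h3⟩
  have hI := K.inter_subset_convexHull hT.1 hs ⟨interior_subset hq, hqs⟩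
  have hTs : T ⊆ s := by
    intro m hm
    by_contra hms
    obtain ⟨i, rfl⟩ : m ∈ Set.range B := hB ▸ hm
    have hsub : (T : Set E3) ∩ s ⊆ B.coord i ⁻¹' {0} := by
      rintro p ⟨hp, hps⟩
      obtain ⟨k, rfl⟩ : p ∈ Set.range B := hB ▸ hp
      have hik : i ≠ k := by rintro rfl; exact hms hps
      simp [B.coord_apply_ne hik]
    have := convexHull_min hsub ((convex_singleton 0).affine_preimage _) hI
    exact (hpos i).ne' this
  have hcard : s.card ≤ 4 := by
    have := (K.indep hs).card_le_finrank_succ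
    rw [Fintype.card_coe] at this
    have h4 := Submodule.finrank_le (vectorSpan ℝ (Set.range ((↑) : s → E3)))
    rw [finrank_euclideanSpace_fin] at h4
    omega
  have hTeq : T = s := Finset.eq_of_subset_of_card_le hTs (by rw [hT.2]; exact hcard)
  subst hTeq
  refine ⟨fun i => ?_, fun n hn => by rw [hdef, h1 n hn]⟩
  rw [hdef]
  have e : B.coord i q = ∑ m ∈ T, w m * B.coord i m := by
    have := Finset.map_affineCombination T id w h2 (B.coord i)
    rw [Finset.affineCombination_eq_linear_combination _ _ _ h2,
      Finset.affineCombination_eq_linear_combination _ _ _ h2] at this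
    simp only [id, h3, Function.comp] at this
    simpa using this
  have hiT : B i ∈ T := by rw [← Finset.mem_coe, ← hB]; exact ⟨i, rfl⟩
  rw [e, Finset.sum_eq_single_of_mem (B i) hiT fun m hm hmi => ?_, B.coord_apply_eq, mul_one]
  obtain ⟨k, rfl⟩ : m ∈ Set.range B := hB ▸ hm
  rw [B.coord_apply_ne (by rintro rfl; exact hmi rfl), mul_zero]

/-- The quasi-interpolant is affine on an element without coupling or singular nodes. -/
theorem GradedMesh.exists_affine_Dh {P : MacroPartition} (M : GradedMesh P) {T : Finset E3}
    (hT : T ∈ tets M.K) (hf : ∀ n ∈ T, n ∈ freeNodes P M.K) (v : E3 → ℝ) :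
    ∃ (L : E3 →L[ℝ] ℝ) (c : ℝ), (∀ q ∈ interior (cell T), M.Dh v q = L q + c) ∧
      ∀ n ∈ T, edgeProjValue v n (M.sigma n) = L n + c := by
  classical
  obtain ⟨B, hB⟩ := exists_affineBasis_range hT.2 (M.K.indep hT.1)
  have hiT : ∀ i, B i ∈ T := fun i => by rw [← Finset.mem_coe, ← hB]; exact ⟨i, rfl⟩
  set J : E3 →ᵃ[ℝ] ℝ := ∑ i, edgeProjValue v (B i) (M.sigma (B i)) • B.coord i with hJ
  have hJa : ∀ q, J q = ∑ i, edgeProjValue v (B i) (M.sigma (B i)) * B.coord i q := by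
    intro q
    simp [hJ, Fin.sum_univ_four]
  have hJL : ∀ q, J q = J.linear.toContinuousLinearMap q + J 0 := by
    intro q
    have := J.linearMap_vsub q 0
    simp only [vsub_eq_sub, sub_zero] at this
    rw [LinearMap.coe_toContinuousLinearMap', this]; ring
  refine ⟨J.linear.toContinuousLinearMap, J 0, fun q hq => ?_, fun n hn => ?_⟩
  · rw [← hJL, hJa]
    obtain ⟨h1, h2⟩ := nodalBasis_eq hT hB hq
    have hsub : T ⊆ M.freeNodes_finite.toFinset := fun n hn => by simpa using hf n hn
    rw [GradedMesh.Dh, ← Finset.sum_subset hsub fun n _ hn => by rw [h2 n hn, mul_zero]]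
    have himg : T = Finset.univ.image B := by
      rw [← Finset.coe_inj, Finset.coe_image, Finset.coe_univ, Set.image_univ, hB]
    rw [himg, Finset.sum_image fun i _ j _ h => B.ind.injective h]
    exact Finset.sum_congr rfl fun i _ => by rw [h1]
  · obtain ⟨i, rfl⟩ : n ∈ Set.range B := hB ▸ hn
    rw [← hJL, hJa, Finset.sum_eq_single_of_mem i (Finset.mem_univ i) fun k _ hk => by
      rw [B.coord_apply_ne hk, mul_zero], B.coord_apply_eq, mul_one]

theorem memH1_sub_and_h1Seminorm_le {S U : Set E3} (hS : IsOpen S) (hU : IsOpen U) (hUS : U ⊆ S)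
    (hbd : Bornology.IsBounded U) {u F : E3 → ℝ} (hu : MemH1 S u) {L : E3 →L[ℝ] ℝ} {c : ℝ}
    (hF : ∀ x ∈ U, F x = L x + c) {E : ℝ} (hE : 0 ≤ E)
    (h : ∀ i, eLpNorm (fun x => weakPartial S (b i) u x - L (b i)) 2 (volume.restrict U) ≤
      ENNReal.ofReal E) :
    MemH1 U (fun x => u x - F x) ∧ h1Seminorm b U (fun x => u x - F x) ≤ 3 * E := by
  have hmono := Measure.restrict_mono hUS (le_refl (volume : Measure E3))
  have : IsFiniteMeasure (volume.restrict U) := ⟨by simpa using hbd.measure_lt_top⟩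
  have hae : (fun x => u x - (L x + c)) =ᵐ[volume.restrict U] fun x => u x - F x := by
    rw [Filter.EventuallyEq, ae_restrict_iff' hU.measurableSet]
    exact Filter.Eventually.of_forall fun x hx => by simp only [hF x hx]
  have hpart : ∀ e, HasWeakPartial U e (fun x => u x - F x) (fun x => weakPartial S e u x - L e) := fun e =>
    ((((hu.hasWeakPartial e).mono hS hUS).sub hU (hasWeakPartial_affine U e L c)).congr_ae hU hae
      (Filter.EventuallyEq.refl _ _))
  have hmem : ∀ e, MemLp (fun x => weakPartial S e u x - L e) 2 (volume.restrict U) := fun e =>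
    ((hu.memLp_weakPartial hS e).mono_measure hmono).sub (memLp_const _)
  have haff : MemLp (fun x => L x + c) 2 (volume.restrict U) := by
    obtain ⟨R, hR⟩ := hbd.subset_closedBall 0
    refine MemLp.of_bound (by fun_prop : Continuous fun x => L x + c).aestronglyMeasurable
      (‖L‖ * R + |c|) ((ae_restrict_iff' hU.measurableSet).2 (Filter.Eventually.of_forall fun x hx => ?_))
    have hx' : ‖x‖ ≤ R := by simpa using hR hx
    refine (norm_add_le _ _).trans (add_le_add ((L.le_opNorm x).trans ?_) le_rfl)
    gcongr
  have hH1 : MemH1 U (fun x => u x - F x) :=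
    ⟨((hu.1.mono_measure hmono).sub haff).ae_eq hae, fun e => ⟨_, hpart e, hmem e⟩⟩
  refine ⟨hH1, ?_⟩
  have hl : ∀ i, l2Norm U (weakPartial U (b i) (fun x => u x - F x)) ≤ E := by
    intro i
    rw [l2Norm, eLpNorm_congr_ae ((hH1.hasWeakPartial (b i)).ae_eq hU (hpart (b i)))]
    exact ENNReal.toReal_le_of_le_ofReal hE (h i)
  rw [h1Seminorm, Real.sqrt_le_left (by positivity), Fin.sum_univ_three]
  have hsq : ∀ i, l2Norm U (weakPartial U (b i) (fun x => u x - F x)) ^ 2 ≤ E ^ 2 := fun i =>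
    pow_le_pow_left₀ ENNReal.toReal_nonneg (hl i) 2
  nlinarith [hsq 0, hsq 1, hsq 2]

theorem toReal_hNorm_le {S : Set E3} {u : E3 → ℝ} (hS : IsOpen S) (hu : MemH2 S u) {w : Fin 3 → ℝ}
    (hw : ∀ i, 0 ≤ w i) :
    (hNorm S w fun i k => weakPartial S (b k) (weakPartial S (b i) u)).toReal ≤
      ∑ i, w i * (3 * h1Seminorm b S (weakPartial S (b i) u)) := by
  have hfin : ∀ k j, eLpNorm (weakPartial S (b j) (weakPartial S (b k) u)) 2 (volume.restrict S) ≠ ⊤ :=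
    fun k j => (((hu.2 (b k)).memLp_weakPartial hS (b j))).eLpNorm_ne_top
  rw [hNorm, ENNReal.toReal_sum fun k _ => ENNReal.mul_ne_top ENNReal.ofReal_ne_top
    (ENNReal.sum_ne_top.2 fun j _ => hfin k j)]
  refine Finset.sum_le_sum fun k _ => ?_
  rw [ENNReal.toReal_mul, ENNReal.toReal_ofReal (hw k), ENNReal.toReal_sum fun j _ => hfin k j]
  refine mul_le_mul_of_nonneg_left ?_ (hw k)
  have hj : ∀ j ∈ Finset.univ, (eLpNorm (weakPartial S (b j) (weakPartial S (b k) u)) 2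
      (volume.restrict S)).toReal ≤ h1Seminorm b S (weakPartial S (b k) u) := fun j _ =>
    Real.le_sqrt_of_sq_le (Finset.single_le_sum
      (f := fun j => l2Norm S (weakPartial S (b j) (weakPartial S (b k) u)) ^ 2)
      (fun _ _ => sq_nonneg _) (Finset.mem_univ j))
  have := Finset.sum_le_card_nsmul _ _ _ hj
  simpa using this

end

noncomputable section

/-! ### Traces on the edges -/

/-- Near an inner point of an edge, the triangulation is a half plane or a plane. -/
theorem Conforming.exists_ball_of_mem_openSegment {𝒯 : Finset (Finset E2)} (hconf : Conforming 𝒯)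
    {κ : ℝ} (hκ : 0 < κ) (hfat : ∀ t ∈ 𝒯, Fat κ t) {t : Finset E2} (ht : t ∈ 𝒯) {x y p : E2}
    (hx : x ∈ t) (hy : y ∈ t) (hxy : x ≠ y) (hp : p ∈ openSegment ℝ x y) :
    ∃ r > 0, (∀ t' ∈ 𝒯, (Metric.ball p r ∩ hull t').Nonempty → t' = t) ∨
      Metric.ball p r ⊆ ⋃ t ∈ 𝒯, hull t := by
  have hpt : p ∈ hull t := (convex_convexHull ℝ _).segment_subset (subset_hull hx) (subset_hull hy)
    (openSegment_subset_segment ℝ x y hp)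
  have hcoord : ∀ x y, p ∈ openSegment ℝ x y → ∀ (T : Tri κ), T.B 0 = x → T.B 1 = y → 0 < T.B.coord 0 p ∧ 0 < T.B.coord 1 p := by
    intro x y hp T h0 h1
    rw [openSegment_eq_image_lineMap] at hp
    obtain ⟨s, hs, rfl⟩ := hp
    rw [AffineMap.apply_lineMap, AffineMap.apply_lineMap, ← h0, ← h1]
    simpa [AffineMap.lineMap_apply] using ⟨hs.2, hs.1⟩
  by_cases hex : ∃ t' ∈ 𝒯, t ≠ t' ∧ p ∈ hull t'
  · obtain ⟨t', ht', hne, hpt'⟩ := hex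
    have hmem : ∀ x ∈ t, ∀ y ∈ t, x ≠ y → p ∈ openSegment ℝ x y → x ∈ t ∩ t' := by
      intro x hx y hy hxy hp
      refine Finset.mem_inter.2 ⟨hx, by_contra fun hxt' => ?_⟩
      obtain ⟨z, hz, hzy, hzx⟩ : ∃ z ∈ t, z ≠ y ∧ z ≠ x := by
        have : ((t.erase x).erase y).Nonempty := by
          rw [← Finset.card_pos, Finset.card_erase_of_mem (Finset.mem_erase.2 ⟨hxy.symm, hy⟩),
            Finset.card_erase_of_mem hx, (hfat t ht).card]
          norm_num
        obtain ⟨z, hz⟩ := this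
        simp only [Finset.mem_erase] at hz
        exact ⟨z, hz.2.2, hz.1, hz.2.1⟩
      obtain ⟨T, h0, h1, h2, hr⟩ := (hfat t ht).exists_tri hκ hx hy hz hxy hzy.symm hzx.symm
      have hsub : ((t ∩ t' : Finset E2) : Set E2) ⊆ T.B.coord 0 ⁻¹' {0} := by
        intro q hq
        rw [Finset.mem_coe, Finset.mem_inter] at hq
        obtain ⟨i, rfl⟩ : q ∈ Set.range T.B := hr ▸ hq.1
        have : (0 : Fin 3) ≠ i := by rintro rfl; exact hxt' (h0 ▸ hq.2)
        simp [T.B.coord_apply_ne this]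
      have := convexHull_min hsub ((convex_singleton 0).affine_preimage _)
        (hconf t ht t' ht' ⟨hpt, hpt'⟩)
      exact (hcoord x y hp T h0 h1).1.ne' this
    obtain ⟨T, T', h0, h1, h0', h1', hr, hr', hneg⟩ := (hfat t ht).exists_tri_pair hκ (hfat t' ht')
      hne (hconf t ht t' ht') (hmem x hx y hy hxy hp)
      (hmem y hy x hx hxy.symm (openSegment_symm ℝ x y ▸ hp)) hxy
    have hc : ∀ (S : Tri κ) i, Continuous (S.B.coord i) := fun S i =>
      (S.B.coord i).continuous_of_finiteDimensional
    have hev : ∀ᶠ q in nhds p, (0 < T.B.coord 0 q ∧ 0 < T.B.coord 1 q) ∧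
        0 < T'.B.coord 0 q ∧ 0 < T'.B.coord 1 q := by
      obtain ⟨a0, a1⟩ := hcoord x y hp T h0 h1
      obtain ⟨b0, b1⟩ := hcoord x y hp T' h0' h1'
      exact (((hc T 0).continuousAt.eventually_const_lt a0).and
        ((hc T 1).continuousAt.eventually_const_lt a1)).and
        (((hc T' 0).continuousAt.eventually_const_lt b0).and
        ((hc T' 1).continuousAt.eventually_const_lt b1))
    obtain ⟨r, hr0, hball⟩ := Metric.eventually_nhds_iff_ball.1 hev
    refine ⟨r, hr0, Or.inr fun q hq => ?_⟩
    obtain ⟨⟨a0, a1⟩, b0, b1⟩ := hball q hq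
    have := Tri.mem_union_of_coord_nonneg (h0.trans h0'.symm) (h1.trans h1'.symm) hneg a0.le a1.le
      b0.le b1.le
    rw [hr, hr'] at this
    rcases this with h | h
    · exact Set.mem_iUnion₂.2 ⟨t, ht, h⟩
    · exact Set.mem_iUnion₂.2 ⟨t', ht', h⟩
  · push Not at hex
    have hcl : IsClosed (⋃ t' ∈ 𝒯.erase t, hull t') :=
      (Finset.finite_toSet _).isClosed_biUnion fun t' _ => isClosed_hull t'
    have hp' : p ∈ (⋃ t' ∈ 𝒯.erase t, hull t')ᶜ := by
      intro h
      obtain ⟨t', ht', hpt'⟩ := Set.mem_iUnion₂.1 h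
      exact hex t' (Finset.mem_of_mem_erase ht') (Finset.ne_of_mem_erase ht').symm hpt'
    obtain ⟨r, hr, hball⟩ := Metric.isOpen_iff.1 hcl.isOpen_compl p hp'
    refine ⟨r, hr, Or.inl fun t' ht' ⟨q, hq, hqt'⟩ => by_contra fun hne => hball hq ?_⟩
    exact Set.mem_iUnion₂.2 ⟨t', Finset.mem_erase.2 ⟨hne, ht'⟩, hqt'⟩

variable {P : MacroPartition} {M : GradedMesh P} {Λ e : Finset E3} {B : AffineBasis (Fin 4) ℝ E3}
  {b : OrthonormalBasis (Fin 3) ℝ E3} {ℓ ρ₁ ρ₂ θ : ℝ} {T : Finset E3} {Q : Finset (Finset E3)}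

/-- The edges `σ_n` are not parallel to the singular edge. -/
theorem proj_sigma_ne (F : IsFrame Λ e B b ℓ) (hs : P.IsSingular Λ e) {n : E3}
    (hn : n ∈ freeNodes P M.K) (hnΛ : n ∈ cell Λ) : proj b n ≠ proj b (M.sigma n) := by
  intro h
  obtain ⟨p, hp, h1, h2⟩ := M.sigma_plane n hn Λ e hs hnΛ
  have hpe := M.cuts_subset Λ e hs hp
  rw [F.mem_cutPlane_iff hpe] at h1 h2
  exact (M.sigma_edge n hn).1 (F.eq_of_proj_eq_of_lam_eq h (by rw [h1, h2, F.mu_congr h]))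

theorem isBounded_patchSet (Q : Finset (Finset E3)) : Bornology.IsBounded (patchSet Q) :=
  ((Bornology.isBounded_biUnion_finset Q).2 fun T _ =>
    (isBounded_convexHull.2 T.finite_toSet.isBounded)).subset interior_subset

/-- A function on a patch that is uniformly continuous on convex sets has limits at the inner points
of the edges that are not parallel to the singular edge; it is bounded near these edges. -/
theorem Fills.exists_tendsto (F : IsFrame Λ e B b ℓ) (hs : P.IsSingular Λ e) (hθ : 0 < θ)
    (hκ : 0 < Real.sin θ) (hM : M.MinAngle θ) (h0 : 0 ≤ ρ₁) (h12 : ρ₁ < ρ₂) (h1 : ρ₂ ≤ 1)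
    (hQ : ∀ T ∈ Q, T ∈ meshIn M Λ) (h : Fills B b Λ Q ρ₁ ρ₂) (hT : T ∈ Q) {n m : E3} (hn : n ∈ T)
    (hm : m ∈ T) (hnm : proj b n ≠ proj b m) {f : E3 → ℝ} (hf : ContinuousOn f (patchSet Q))
    (hfu : ∀ K ⊆ patchSet Q, IsOpen K → Convex ℝ K → Bornology.IsBounded K →
      UniformContinuousOn f K) :
    ∃ R, ∀ p ∈ openSegment ℝ n m, p ∈ closure (patchSet Q) ∧
      ∃ l, |l| ≤ R ∧ Filter.Tendsto f (nhdsWithin p (patchSet Q)) (nhds l) := by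
  have hS := h.patchSet_eq F h0 h1 hQ
  have hTl := h.1 T hT
  set t := shadow b T with ht
  have htQ : t ∈ shadows b Q := shadow_mem_shadows hT
  have hsub : interior (hull t) ⊆ interior (⋃ t ∈ shadows b Q, hull t) :=
    interior_mono (Set.subset_biUnion_of_mem (u := fun t => hull t) htQ)
  have hKS : col B b (interior (hull t)) ρ₁ ρ₂ ⊆ patchSet Q := by rw [hS]; exact col_mono hsub
  have hKo : IsOpen (col B b (interior (hull t)) ρ₁ ρ₂) := isOpen_col isOpen_interior
  have hKc : Convex ℝ (col B b (interior (hull t)) ρ₁ ρ₂) :=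
    convex_col (convex_convexHull ℝ _).interior
  have hne : (col B b (interior (hull t)) ρ₁ ρ₂).Nonempty :=
    (interior_cell_nonempty_of_mem (hQ T hT).1).mono (interior_cell_subset_col F hTl)
  have hKu := hfu _ hKS hKo hKc ((isBounded_patchSet Q).subset hKS)
  have hcl : closure (interior (hull t)) = hull t := closure_interior_hull_shadow (hQ T hT).1
  obtain ⟨R, hR⟩ : ∃ R, ∀ x ∈ col B b (interior (hull t)) ρ₁ ρ₂, |f x| ≤ R := by
    obtain ⟨δ, hδ, hd⟩ := Metric.uniformContinuousOn_iff.1 hKu 1 one_pos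
    obtain ⟨A, hA, hAf, hAc⟩ := Metric.finite_approx_of_totallyBounded
      ((Metric.isCompact_of_isClosed_isBounded isClosed_closure
        ((isBounded_patchSet Q).subset hKS).closure).totallyBounded.subset subset_closure) δ hδ
    obtain ⟨R, hR⟩ := (hAf.image fun x => |f x|).bddAbove
    refine ⟨R + 1, fun x hx => ?_⟩
    obtain ⟨y, hy, hxy⟩ := Set.mem_iUnion₂.1 (hAc hx)
    have h1 := hd x hx y (hA hy) hxy
    have h2 := hR ⟨y, hy, rfl⟩
    rw [Real.dist_eq] at h1
    have := abs_sub_abs_le_abs_sub (f x) (f y)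
    simp only at h2
    linarith
  refine ⟨R, fun p hp => ?_⟩
  have hpT : p ∈ cell T := (convex_cell T).segment_subset (subset_convexHull ℝ _ hn)
    (subset_convexHull ℝ _ hm) (openSegment_subset_segment ℝ _ _ hp)
  have hpt : proj b p ∈ hull t := by rw [ht, hull_shadow]; exact ⟨p, hpT, rfl⟩
  have hpK : p ∈ closure (col B b (interior (hull t)) ρ₁ ρ₂) :=
    mem_closure_col isOpen_interior (convex_convexHull ℝ _).interior hne (hcl ▸ hpt)
      (hTl hpT).2.1 (hTl hpT).2.2
  have hpp : proj b p ∈ openSegment ℝ (proj b n) (proj b m) := by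
    have := image_openSegment ℝ (proj b).toLinearMap.toAffineMap n m
    exact this ▸ ⟨p, hp, rfl⟩
  have hlim : ∃ l, Filter.Tendsto f (nhdsWithin p (patchSet Q)) (nhds l) := by
    obtain ⟨r, hr, hcase⟩ := (conforming_shadows F hs hQ).exists_ball_of_mem_openSegment hκ
      (fat_shadows F hs hθ hM hQ) htQ (Finset.mem_image_of_mem _ hn) (Finset.mem_image_of_mem _ hm)
      hnm hpp
    have hO : proj b ⁻¹' Metric.ball (proj b p) r ∈ nhds p :=
      (proj b).continuous.continuousAt.preimage_mem_nhds (Metric.ball_mem_nhds _ hr)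
    rcases hcase with hcase | hcase
    · refine exists_tendsto_nhdsWithin isOpen_interior hf hKu hO (fun x hx => ?_) hpK
      obtain ⟨hxS, hxO⟩ := hx
      change x ∈ patchSet Q at hxS
      rw [hS] at hxS
      obtain ⟨t', ht', hxt'⟩ := Set.mem_iUnion₂.1 (interior_subset hxS.1)
      obtain rfl := hcase t' ht' ⟨_, hxO, hxt'⟩
      exact mem_closure_col isOpen_interior (convex_convexHull ℝ _).interior hne (hcl ▸ hxt')
        hxS.2.1.le hxS.2.2.le
    · have hsubS : col B b (Metric.ball (proj b p) r) ρ₁ ρ₂ ⊆ patchSet Q := by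
        rw [hS]; exact col_mono (interior_maximal hcase Metric.isOpen_ball)
      refine exists_tendsto_nhdsWithin isOpen_interior hf (hfu _ hsubS (isOpen_col Metric.isOpen_ball)
        (convex_col (convex_ball _ _)) ((isBounded_patchSet Q).subset hsubS)) hO
        (fun x hx => ?_) ?_
      · obtain ⟨hxS, hxO⟩ := hx
        change x ∈ patchSet Q at hxS
        rw [hS] at hxS
        exact subset_closure ⟨hxO, hxS.2⟩
      · obtain ⟨y, hy, hyt⟩ := mem_closure_iff.1 (hcl.symm ▸ hpt : proj b p ∈ closure _)
          _ Metric.isOpen_ball (Metric.mem_ball_self hr)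
        obtain ⟨x, hx, -⟩ := exists_mem_col F hs h12 hy
          (interior_mono (hull_shadow_subset (hQ T hT)) hyt)
        exact mem_closure_col Metric.isOpen_ball (convex_ball _ _) ⟨x, hx⟩
          (subset_closure (Metric.mem_ball_self hr)) (hTl hpT).2.1 (hTl hpT).2.2
  obtain ⟨l, hl⟩ := hlim
  refine ⟨closure_mono hKS hpK, l, ?_, hl⟩
  have : (nhdsWithin p (col B b (interior (hull t)) ρ₁ ρ₂)).NeBot :=
    mem_closure_iff_nhdsWithin_neBot.1 hpK
  refine le_of_tendsto ((hl.mono_left (nhdsWithin_mono p hKS)).abs) ?_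
  filter_upwards [self_mem_nhdsWithin] with x hx using hR x hx

theorem GradedMesh.IsAdmissible.exists_isTraceRep (F : IsFrame Λ e B b ℓ) (hs : P.IsSingular Λ e)
    (hθ : 0 < θ) (hκ : 0 < Real.sin θ) (hM : M.MinAngle θ) (h : M.IsAdmissible Λ e T Q)
    (hf : ∀ n ∈ T, n ∈ freeNodes P M.K) {u : E3 → ℝ} (hu : MemH2 (patchSet Q) u) :
    ∃ v, M.IsTraceRep T Q u v := by
  obtain ⟨hQ, p, hp, q, hq, hpq, hfill⟩ := h.fills F hs
  have hp0 := (F.mem_cell_edge (M.cuts_subset Λ e hs hp)).2.2.1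
  have hq1 := (F.mem_cell_edge (M.cuts_subset Λ e hs hq)).2.2.2
  obtain ⟨f, hae, hfc, hfu⟩ := (hu.isH2 b isOpen_interior).exists_continuous_rep isOpen_interior
  have hlim : ∀ n ∈ T, ∃ R, ∀ x ∈ openSegment ℝ n (M.sigma n), x ∈ closure (patchSet Q) ∧
      ∃ l, |l| ≤ R ∧ Filter.Tendsto f (nhdsWithin x (patchSet Q)) (nhds l) := by
    intro n hn
    obtain ⟨T', hT', hnT', hsT'⟩ := h.exists_edge_mem hn (hf n hn)
    exact hfill.exists_tendsto F hs hθ hκ hM hp0 hpq hq1 hQ hT' hnT' hsT'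
      (proj_sigma_ne F hs (hf n hn) ((hQ T h.mem).2 (subset_convexHull ℝ _ hn))) hfc hfu
  have hext : ∀ x ∈ patchSet Q, extendFrom (patchSet Q) f x = f x := fun x hx =>
    extendFrom_eq (subset_closure hx) (hfc x hx)
  have hcont : ContinuousOn (extendFrom (patchSet Q) f)
      (patchSet Q ∪ ⋃ n ∈ T, openSegment ℝ n (M.sigma n)) := by
    refine continuousOn_extendFrom ?_ ?_
    · rintro x (hx | hx)
      · exact subset_closure hx
      · obtain ⟨n, hn, hx⟩ := Set.mem_iUnion₂.1 hx
        obtain ⟨R, hR⟩ := hlim n hn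
        exact (hR x hx).1
    · rintro x (hx | hx)
      · exact ⟨_, hfc x hx⟩
      · obtain ⟨n, hn, hx⟩ := Set.mem_iUnion₂.1 hx
        obtain ⟨R, hR⟩ := hlim n hn
        obtain ⟨l, -, hl⟩ := (hR x hx).2
        exact ⟨l, hl⟩
  refine ⟨extendFrom (patchSet Q) f, ?_, hcont, fun n hn => ?_⟩
  · refine Filter.EventuallyEq.trans ?_ hae.symm
    exact (ae_restrict_iff' isOpen_interior.measurableSet).2 (Filter.Eventually.of_forall hext)
  · obtain ⟨R, hR⟩ := hlim n hn
    rw [← restrict_Ioo_eq_restrict_Icc]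
    have hmaps : Set.MapsTo (AffineMap.lineMap n (M.sigma n) : ℝ → E3) (Set.Ioo 0 1)
        (openSegment ℝ n (M.sigma n)) := fun s hs => by
      rw [openSegment_eq_image_lineMap]; exact ⟨s, hs, rfl⟩
    refine MemLp.of_bound (C := R) ?_ ?_
    · refine ContinuousOn.aestronglyMeasurable ?_ measurableSet_Ioo
      refine hcont.comp (AffineMap.lineMap_continuous.continuousOn) fun s hs => ?_
      exact Or.inr (Set.mem_iUnion₂.2 ⟨n, hn, hmaps hs⟩)
    · refine (ae_restrict_iff' measurableSet_Ioo).2 (Filter.Eventually.of_forall fun s hs => ?_)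
      obtain ⟨hc, l, hl, hlt⟩ := hR _ (hmaps hs)
      rw [extendFrom_eq hc hlt]
      exact hl

end

noncomputable section

/-! ### The geometry of a patch -/

/-- The plane `lam = r mu` as a graph over `E2`. -/
def cutGraph (B : AffineBasis (Fin 4) ℝ E3) (b : OrthonormalBasis (Fin 3) ℝ E3) (ℓ r : ℝ) :
    E2 →ᵃ[ℝ] ℝ :=
  ℓ • ((r • mu B - lam B).comp
    ((shear b 0 1 (by norm_num)).toLinearMap ∘ₗ LinearMap.inl ℝ E2 ℝ).toAffineMap)

variable {P : MacroPartition} {M : GradedMesh P} {Λ e : Finset E3} {B : AffineBasis (Fin 4) ℝ E3}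
  {b : OrthonormalBasis (Fin 3) ℝ E3} {ℓ : ℝ}

theorem inner_sub_cutGraph (F : IsFrame Λ e B b ℓ) (r : ℝ) (x : E3) :
    inner ℝ (b 2) x - cutGraph B b ℓ r (proj b x) = ℓ * (lam B x - r * mu B x) := by
  set y := shear b 0 1 (by norm_num) (proj b x, 0) with hy
  have hp : proj b x = proj b y := by rw [hy, proj_shear]
  have hi : inner ℝ (b 2) y = 0 := by
    rw [hy, shear_apply]; simp [inner_add_right, inner_smul_right]
  have e1 : cutGraph B b ℓ r (proj b x) = ℓ * (r * mu B y - lam B y) := by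
    simp [cutGraph, hy]
  have e2 := F.lam_sub hp
  have := F.ne_zero
  rw [hi, sub_zero, eq_div_iff this] at e2
  rw [e1, F.mu_congr hp, ← e2]
  ring

theorem abs_cutGraph_sub_le {C r : ℝ} (hC : 0 ≤ C) (h1 : ∀ x y, |lam B x - lam B y| ≤ C * ‖x - y‖)
    (h2 : ∀ x y, |mu B x - mu B y| ≤ C * ‖x - y‖) (hℓ : 0 ≤ ℓ) (hr : 0 ≤ r ∧ r ≤ 1) (p q : E2) :
    |cutGraph B b ℓ r p - cutGraph B b ℓ r q| ≤ 2 * C * ℓ * ‖p - q‖ := by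
  set y : E2 → E3 := fun p => shear b 0 1 (by norm_num) (p, 0) with hy
  have e1 : ∀ p, cutGraph B b ℓ r p = ℓ * (r * mu B (y p) - lam B (y p)) := fun p => by
    simp [cutGraph, hy]
  have hi : ∀ p, proj b (y p) = p ∧ inner ℝ (b 2) (y p) = 0 := fun p =>
    ⟨proj_shear b _ _ _ _, by
      change inner ℝ (b 2) (shear b 0 1 (by norm_num) (p, 0)) = 0
      rw [shear_apply]; simp [inner_add_right, inner_smul_right]⟩
  have hn : ‖y p - y q‖ ≤ ‖p - q‖ := by
    refine (norm_le_proj_add b _).trans (le_of_eq ?_)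
    rw [map_sub, inner_sub_right, (hi p).1, (hi p).2, (hi q).1, (hi q).2]
    simp
  have e2 : cutGraph B b ℓ r p - cutGraph B b ℓ r q =
      ℓ * (r * (mu B (y p) - mu B (y q)) - (lam B (y p) - lam B (y q))) := by
    rw [e1, e1]; ring
  rw [e2, abs_mul, abs_of_nonneg hℓ]
  have h3 : |r * (mu B (y p) - mu B (y q)) - (lam B (y p) - lam B (y q))| ≤ 2 * (C * ‖y p - y q‖) := by
    refine (abs_sub _ _).trans ?_
    rw [abs_mul, abs_of_nonneg hr.1]
    have := mul_le_mul hr.2 (h2 (y p) (y q)) (abs_nonneg _) zero_le_one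
    linarith [h1 (y p) (y q)]
  have h4 : C * ‖y p - y q‖ ≤ C * ‖p - q‖ := by gcongr
  calc ℓ * _ ≤ ℓ * (2 * (C * ‖p - q‖)) := by gcongr; linarith
    _ = _ := by ring

theorem cutGraph_le_iff (F : IsFrame Λ e B b ℓ) (hℓ : 0 < ℓ) (r : ℝ) (x : E3) :
    cutGraph B b ℓ r (proj b x) ≤ inner ℝ (b 2) x ↔ r * mu B x ≤ lam B x := by
  rw [← sub_nonneg, inner_sub_cutGraph F, mul_nonneg_iff_of_pos_left hℓ, sub_nonneg]

theorem le_cutGraph_iff (F : IsFrame Λ e B b ℓ) (hℓ : 0 < ℓ) (r : ℝ) (x : E3) :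
    inner ℝ (b 2) x ≤ cutGraph B b ℓ r (proj b x) ↔ lam B x ≤ r * mu B x := by
  rw [← sub_nonneg, ← neg_sub, inner_sub_cutGraph F, ← mul_neg, mul_nonneg_iff_of_pos_left hℓ,
    neg_sub, sub_nonneg]

theorem eq_cutGraph_iff (F : IsFrame Λ e B b ℓ) (hℓ : 0 < ℓ) (r : ℝ) (x : E3) :
    inner ℝ (b 2) x = cutGraph B b ℓ r (proj b x) ↔ lam B x = r * mu B x := by
  rw [← sub_eq_zero, inner_sub_cutGraph F, mul_eq_zero, or_iff_right hℓ.ne', sub_eq_zero]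

theorem col_eq_pcol (F : IsFrame Λ e B b ℓ) (hℓ : 0 < ℓ) (A : Set E2) (r s : ℝ) :
    col B b A r s = pcol b (cutGraph B b ℓ r) (cutGraph B b ℓ s) A := by
  ext x
  have e1 := le_cutGraph_iff F hℓ r x
  have e2 := cutGraph_le_iff F hℓ s x
  rw [← not_iff_not, not_le, not_le] at e1 e2
  exact and_congr_right' (and_congr e1.symm e2.symm)

/-- A point of a plane of the family in a layer without planes in its interior is on the boundary of
the layer. -/
theorem eq_or_eq_of_mem_layer {V : Finset ℝ} {ρ₁ ρ₂ v : ℝ} {g : ℝ × ℝ} (hg : g ∈ gaps V ρ₁ ρ₂)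
    (hv : v ∈ V) {x : E3} (hx : x ∈ IsFrame.layer Λ B g.1 g.2) (hmu : 0 < mu B x)
    (h : lam B x = v * mu B x) : v = g.1 ∨ v = g.2 := by
  obtain ⟨-, -, -, -, hgap⟩ := mem_gaps.1 hg
  have h1 := hx.2.1
  have h2 := hx.2.2
  rw [h] at h1 h2
  have h1 := le_of_mul_le_mul_right h1 hmu
  have h2 := le_of_mul_le_mul_right h2 hmu
  rcases hgap v hv with h3 | h3
  · exact Or.inl (le_antisymm h3 h1)
  · exact Or.inr (le_antisymm h2 h3)

end

noncomputable section

variable {P : MacroPartition} {M : GradedMesh P} {Λ e : Finset E3} {B : AffineBasis (Fin 4) ℝ E3}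
  {b : OrthonormalBasis (Fin 3) ℝ E3} {ℓ : ℝ} {T : Finset E3} {Q : Finset (Finset E3)}

theorem isPreconnected_proj_patchSet (hc : IsConnected (patchSet Q)) :
    ∃ U, IsOpen U ∧ IsPreconnected U ∧ U ⊆ (⋃ t ∈ shadows b Q, hull t) ∧
      ∀ T ∈ Q, (interior (cell T)).Nonempty → (U ∩ hull (shadow b T)).Nonempty := by
  refine ⟨proj b '' patchSet Q, isOpenMap_proj b _ isOpen_interior,
    hc.isPreconnected.image _ (proj b).continuous.continuousOn, ?_, ?_⟩
  · rintro _ ⟨z, hz, rfl⟩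
    obtain ⟨T, hT, hzT⟩ := Set.mem_iUnion₂.1 (interior_subset hz)
    refine Set.mem_iUnion₂.2 ⟨_, shadow_mem_shadows hT, ?_⟩
    rw [hull_shadow]; exact ⟨z, hzT, rfl⟩
  · rintro T hT ⟨x, hx⟩
    refine ⟨proj b x, ⟨x, interior_cell_subset_patchSet hT hx, rfl⟩, ?_⟩
    rw [hull_shadow]; exact ⟨x, interior_subset hx, rfl⟩

/-- The strip of the patch in which the edges `σ_n` of the vertices of `T` lie: the layer `g` of `T`
unless `T` has a vertex on the edge opposite to the singular one. -/
theorem GradedMesh.IsAdmissible.exists_strip (F : IsFrame Λ e B b ℓ) (hs : P.IsSingular Λ e)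
    (h : M.IsAdmissible Λ e T Q) (hQ : ∀ T ∈ Q, T ∈ meshIn M Λ)
    (hf : ∀ n ∈ T, n ∈ freeNodes P M.K) {ρ₁ ρ₂ : ℝ}
    (hl : ∀ T ∈ Q, cell T ⊆ IsFrame.layer Λ B ρ₁ ρ₂) {g : ℝ × ℝ}
    (hg : g ∈ gaps (cutVals M Λ e B) ρ₁ ρ₂) (hTg : cell T ⊆ IsFrame.layer Λ B g.1 g.2) :
    ∃ r s, ρ₁ ≤ r ∧ r ≤ g.1 ∧ g.2 ≤ s ∧ s ≤ ρ₂ ∧ ((∀ n ∈ T, 0 < mu B n) → r = g.1 ∧ s = g.2) ∧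
      (s - r ≤ g.2 - g.1 ∨ ∃ n ∈ T, mu B n = 0) ∧
      ∀ n ∈ T, ∃ T' ∈ Q, ∀ p ∈ openSegment ℝ n (M.sigma n), p ∈ cell T' ∧
        r * mu B p ≤ lam B p ∧ lam B p ≤ s * mu B p := by
  have hg' := mem_gaps.1 hg
  have hnT : ∀ n ∈ T, n ∈ cell T := fun n hn => subset_convexHull ℝ _ hn
  have hcell : ∀ n ∈ T, ∃ T' ∈ Q, ∀ p ∈ openSegment ℝ n (M.sigma n), p ∈ cell T' := by
    intro n hn
    obtain ⟨T', hT', hn', hs'⟩ := h.exists_edge_mem hn (hf n hn)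
    exact ⟨T', hT', fun p hp => (convex_cell T').segment_subset (subset_convexHull ℝ _ hn')
      (subset_convexHull ℝ _ hs') (openSegment_subset_segment ℝ _ _ hp)⟩
  by_cases hpos : ∀ n ∈ T, 0 < mu B n
  · refine ⟨g.1, g.2, hg'.2.1, le_rfl, le_rfl, hg'.2.2.2.1, fun _ => ⟨rfl, rfl⟩, Or.inl le_rfl,
      fun n hn => ?_⟩
    obtain ⟨T', hT', hp'⟩ := hcell n hn
    refine ⟨T', hT', fun p hp => ⟨hp' p hp, ?_⟩⟩
    have hmu : 0 ≤ mu B p := mu_nonneg F ((hQ T' hT').2 (hp' p hp))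
    obtain ⟨q, hq, hnq, hsq⟩ := M.sigma_plane n (hf n hn) Λ e hs ((hQ T h.mem).2 (hnT n hn))
    have hqe := M.cuts_subset Λ e hs hq
    have hpq : p ∈ cutPlane Λ e q := by
      rw [openSegment_eq_image_lineMap] at hp
      obtain ⟨c, -, rfl⟩ := hp
      exact AffineMap.lineMap_mem c hnq hsq
    rw [F.mem_cutPlane_iff hqe] at hnq hpq
    have hg12 := hg'.2.2.1.le
    rw [hpq]
    rcases eq_or_eq_of_mem_layer hg (mem_cutVals.2 ⟨q, hq, rfl⟩) (hTg (hnT n hn)) (hpos n hn) hnq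
      with h | h <;> rw [h]
    · exact ⟨le_rfl, mul_le_mul_of_nonneg_right hg12 hmu⟩
    · exact ⟨mul_le_mul_of_nonneg_right hg12 hmu, le_rfl⟩
  · refine ⟨ρ₁, ρ₂, le_rfl, hg'.2.1, hg'.2.2.2.1, le_rfl, fun h => absurd h hpos, Or.inr ?_,
      fun n hn => ?_⟩
    · push Not at hpos
      obtain ⟨n, hn, hle⟩ := hpos
      exact ⟨n, hn, le_antisymm hle (mu_nonneg F ((hQ T h.mem).2 (hnT n hn)))⟩
    · obtain ⟨T', hT', hp'⟩ := hcell n hn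
      exact ⟨T', hT', fun p hp => ⟨hp' p hp, (hl T' hT' (hp' p hp)).2⟩⟩

theorem abs_mu_sub_le_norm_proj (F : IsFrame Λ e B b ℓ) {C : ℝ}
    (hC : ∀ x y, |mu B x - mu B y| ≤ C * ‖x - y‖) (x y : E3) :
    |mu B x - mu B y| ≤ C * ‖proj b x - proj b y‖ := by
  set x' := y + (x - y - inner ℝ (b 2) (x - y) • b 2) with hx'
  have e1 : mu B x = mu B x' := F.mu_congr (by rw [hx']; simp)
  have e2 : ‖x' - y‖ = ‖proj b x - proj b y‖ := by
    have := norm_sq_eq b (x' - y)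
    rw [hx', add_sub_cancel_left] at this ⊢
    have hi : inner ℝ (b 2) (x - y - inner ℝ (b 2) (x - y) • b 2) = 0 := by
      rw [inner_sub_right, inner_smul_right]; simp
    rw [hi, map_sub, map_smul, proj_basis_two, smul_zero, sub_zero, map_sub] at this
    nlinarith [norm_nonneg (x - y - inner ℝ (b 2) (x - y) • b 2), norm_nonneg (proj b x - proj b y)]
  rw [e1, ← e2]
  exact hC _ _

/-- Two points in a plane of the family. -/
theorem abs_inner_sub_le_of_mem_cutPlane (F : IsFrame Λ e B b ℓ) (hℓ : 0 < ℓ) {C : ℝ} (hC : 0 ≤ C)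
    (h1 : ∀ x y, |lam B x - lam B y| ≤ C * ‖x - y‖) (h2 : ∀ x y, |mu B x - mu B y| ≤ C * ‖x - y‖)
    {q : E3} (hq : q ∈ cell e) {x y : E3} (hx : x ∈ cutPlane Λ e q) (hy : y ∈ cutPlane Λ e q) :
    |inner ℝ (b 2) (x - y)| ≤ 2 * C * ℓ * ‖proj b y - proj b x‖ := by
  rw [F.mem_cutPlane_iff hq, ← eq_cutGraph_iff F hℓ] at hx hy
  have := F.mem_cell_edge hq
  rw [inner_sub_right, hx, hy, norm_sub_rev]
  exact abs_cutGraph_sub_le hC h1 h2 hℓ.le this.2.2 _ _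

/-- The geometry of an element `T` and its patch `S`: `T` has the vertical edge `[x, y]` of length
`h₃` and two edges `[x', z]`, `[y', w]` that are short if `h₁` is small. -/
structure NeedleGeom (κ Γ : ℝ) (N : ℕ) (b : OrthonormalBasis (Fin 3) ℝ E3) (S : Set E3)
    (𝒯 : Finset (Finset E2)) (s : E3 → E3) (T : Finset E3) (h₁ h₃ : ℝ) (φ ψ : E2 →ᵃ[ℝ] ℝ)
    (x y z w x' y' : E3) : Prop where
  geom : PatchGeom κ Γ N b φ ψ S 𝒯 T s (proj b x) (proj b z) h₃
  mem : x ∈ T ∧ y ∈ T ∧ z ∈ T ∧ w ∈ T ∧ x' ∈ T ∧ y' ∈ T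
  proj_eq : proj b y = proj b x ∧ proj b x' = proj b x ∧ proj b y' = proj b x
  ne : proj b x ≠ proj b z ∧ proj b x ≠ proj b w ∧ proj b z ≠ proj b w
  length : |inner ℝ (b 2) (y - x)| = h₃
  dist_le : ‖proj b x - proj b z‖ ≤ 2 * h₁
  slope : |inner ℝ (b 2) (z - x')| ≤ Γ * ‖proj b x - proj b z‖ ∧
    |inner ℝ (b 2) (w - y')| ≤ Γ * ‖proj b x - proj b z‖
  plane : Γ * ‖proj b x - proj b z‖ < h₃ → ∀ q : E3 × E3, q = (z, x') ∨ q = (w, y') →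
    ∃ χ : E2 →ᵃ[ℝ] ℝ, (χ = φ ∨ χ = ψ) ∧
      (∀ p ∈ openSegment ℝ q.1 (s q.1), inner ℝ (b 2) p = χ (proj b p)) ∧
      ∀ p ∈ openSegment ℝ q.2 (s q.2), inner ℝ (b 2) p = χ (proj b p)

theorem exists_needleGeom (hs : P.IsSingular Λ e) (B : AffineBasis (Fin 4) ℝ E3) {θ : ℝ} (hθ : 0 < θ)
    (hκ : 0 < Real.sin θ) (C₀ : ℝ) : ∃ (Γ : ℝ) (N : ℕ), 1 ≤ Γ ∧
    ∀ (M : GradedMesh P), M.MinAngle θ → ∀ {b ℓ}, IsFrame Λ e B b ℓ → 0 < ℓ →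
    ∀ {T}, T ∈ meshIn M Λ → (∀ n ∈ T, n ∈ freeNodes P M.K) → ∀ {h₁ h₃}, M.IsLengths Λ e T h₁ h₃ →
    h₁ ≤ C₀ * h₃ → ∀ {Q}, M.IsPatch Λ e T Q → ∃ φ ψ x y z w x' y',
      NeedleGeom (Real.sin θ) Γ N b (patchSet Q) (shadows b Q) M.sigma T h₁ h₃ φ ψ x y z w x' y' := by
  obtain ⟨C, hC, -, hlam, hmu⟩ := exists_lipschitz B
  set κ := Real.sin θ with hκd
  set c := max C₀ 1 with hc
  set ℓ₀ := ‖B 1 - B 0‖ with hℓ₀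
  have hc1 : 1 ≤ c := le_max_right _ _
  have hℓ₀' : 0 ≤ ℓ₀ := norm_nonneg _
  set Γ := 1 + 2 * c + 2 * C * ℓ₀ * κ⁻¹ + 2 * c * C * ℓ₀ with hΓ
  have hκi : 0 < κ⁻¹ := inv_pos.2 hκ
  have hG1 : 0 ≤ 2 * C * ℓ₀ * κ⁻¹ := by positivity
  have hG2 : 0 ≤ 2 * c * C * ℓ₀ := by positivity
  refine ⟨Γ, ⌈1728 / κ ^ 2⌉₊, by rw [hΓ]; linarith, ?_⟩
  intro M hM b ℓ F hℓ T hT hf h₁ h₃ hlen hh Q hpatch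
  obtain rfl : ℓ₀ = ℓ := by rw [hℓ₀, F.edge, norm_smul]; simp [abs_of_pos hℓ]
  obtain ⟨x, y, z, w, x', y', hTeq, hxy, hspan, hh3, hx', hy', ⟨p, hp, hpx, hpz⟩, ⟨q, hq, hqy, hqw⟩,
    hh1⟩ := hlen
  have hadm := hpatch.1
  obtain ⟨hQ, ρ₁, hρ₁, ρ₂, hρ₂, hρ, hfill⟩ := hadm.fills F hs
  have hρ0 := (F.mem_cell_edge (M.cuts_subset Λ e hs hρ₁)).2.2.1
  have hρ1 := (F.mem_cell_edge (M.cuts_subset Λ e hs hρ₂)).2.2.2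
  obtain ⟨g, hg, hTg⟩ := exists_mem_gaps F hs hT (mem_cutVals.2 ⟨ρ₁, hρ₁, rfl⟩)
    (mem_cutVals.2 ⟨ρ₂, hρ₂, rfl⟩) (hfill.1 T hadm.mem)
  obtain ⟨r, s, hρr, hrg, hgs, hsρ, hown, hwide, hnode⟩ :=
    hadm.exists_strip F hs hQ hf hfill.1 hg hTg
  have hg' := mem_gaps.1 hg
  have hmem : ∀ n, n ∈ T ↔ n = x ∨ n = y ∨ n = z ∨ n = w := fun n => by
    rw [← Finset.mem_coe, hTeq]; simp
  have hxT : x ∈ T := by simp [hmem]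
  have hyT : y ∈ T := by simp [hmem]
  have hzT : z ∈ T := by simp [hmem]
  have hwT : w ∈ T := by simp [hmem]
  have hnT : ∀ n ∈ T, n ∈ cell T := fun n hn => subset_convexHull ℝ _ hn
  have hmu0 : ∀ n ∈ T, 0 ≤ mu B n := fun n hn => mu_nonneg F (hT.2 (hnT n hn))
  have hyx : proj b y = proj b x := by
    rw [F.vectorSpan_eq, Submodule.mem_span_singleton] at hspan
    obtain ⟨a, ha⟩ := hspan
    rw [← sub_eq_zero, ← map_sub, ← ha]; simp
  have hx'T : x' ∈ T ∧ proj b x' = proj b x := by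
    rcases hx' with h | h <;> rw [h]
    exacts [⟨hxT, rfl⟩, ⟨hyT, hyx⟩]
  have hy'T : y' ∈ T ∧ proj b y' = proj b x := by
    rcases hy' with h | h <;> rw [h]
    exacts [⟨hxT, rfl⟩, ⟨hyT, hyx⟩]
  have hval : ∀ n ∈ T, 0 < mu B n → ∀ o ∈ M.cuts Λ e, n ∈ cutPlane Λ e o →
      lam B o = g.1 ∨ lam B o = g.2 := fun n hn hpos o ho hno =>
    eq_or_eq_of_mem_layer hg (mem_cutVals.2 ⟨o, ho, rfl⟩) (hTg (hnT n hn)) hpos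
      ((F.mem_cutPlane_iff (M.cuts_subset Λ e hs ho)).1 hno)
  have hlamn : ∀ n ∈ T, 0 < mu B n → lam B n = g.1 * mu B n ∨ lam B n = g.2 * mu B n := by
    intro n hn hpos
    obtain ⟨o, ho, hno⟩ := M.nodes_on_planes Λ e hs n (hf n hn).1 (hT.2 (hnT n hn))
    have := (F.mem_cutPlane_iff (M.cuts_subset Λ e hs ho)).1 hno
    exact (hval n hn hpos o ho hno).imp (fun h => by rw [this, h]) fun h => by rw [this, h]
  have hmuy : mu B y = mu B x := F.mu_congr hyx
  have hmux : 0 < mu B x := by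
    refine (hmu0 x hxT).lt_of_ne fun h => hxy (F.eq_of_proj_eq_of_lam_eq hyx.symm ?_)
    have a1 := hTg (hnT x hxT)
    have a2 := hTg (hnT y hyT)
    have b1 := a1.2; have b2 := a2.2
    rw [hmuy] at b2
    rw [← h, mul_zero, mul_zero] at b1 b2
    rw [le_antisymm b1.2 b1.1, le_antisymm b2.2 b2.1]
  have hh3' : h₃ = ℓ₀ * ((g.2 - g.1) * mu B x) := by
    rw [hh3, F.dist_eq hyx.symm, abs_of_pos hℓ]
    have hne : lam B x ≠ lam B y := fun h => hxy (F.eq_of_proj_eq_of_lam_eq hyx.symm h)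
    have hgm : 0 ≤ (g.2 - g.1) * mu B x := mul_nonneg (by linarith [hg'.2.2.1]) hmux.le
    rcases hlamn x hxT hmux with h1 | h1 <;> rcases hlamn y hyT (hmuy ▸ hmux) with h2 | h2 <;>
      rw [hmuy] at h2
    · exact absurd (h1.trans h2.symm) hne
    · rw [h1, h2, abs_sub_comm, ← sub_mul, abs_of_nonneg hgm]
    · rw [h1, h2, ← sub_mul, abs_of_nonneg hgm]
    · exact absurd (h1.trans h2.symm) hne
  have hh3p : 0 < h₃ := by rw [hh3]; exact dist_pos.2 hxy
  have hd : ‖proj b x - proj b z‖ ≤ 2 * h₁ ∧ ‖proj b x - proj b w‖ ≤ 2 * h₁ := by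
    have a1 := norm_proj_le b (x' - z)
    have a2 := norm_proj_le b (y' - w)
    rw [map_sub, hx'T.2, ← dist_eq_norm x' z] at a1
    rw [map_sub, hy'T.2, ← dist_eq_norm y' w] at a2
    have := dist_nonneg (x := x') (y := z)
    have := dist_nonneg (x := y') (y := w)
    constructor <;> linarith
  have hh1c : 2 * h₁ ≤ 2 * c * h₃ := by
    have : C₀ * h₃ ≤ c * h₃ := by gcongr; exact le_max_left _ _
    linarith
  have hshadow : shadow b T = {proj b x, proj b z, proj b w} := by
    ext v
    simp only [shadow, Finset.mem_image, hmem, Finset.mem_insert, Finset.mem_singleton]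
    constructor
    · rintro ⟨n, rfl | rfl | rfl | rfl, rfl⟩ <;> simp [hyx]
    · rintro (rfl | rfl | rfl)
      · exact ⟨x, by simp⟩
      · exact ⟨z, by simp⟩
      · exact ⟨w, by simp⟩
  obtain ⟨hxz, hxw, hzw⟩ : proj b x ≠ proj b z ∧ proj b x ≠ proj b w ∧ proj b z ≠ proj b w := by
    have h3 := card_shadow F hs hT
    rw [hshadow] at h3
    refine ⟨?_, ?_, ?_⟩ <;> intro h <;> rw [h] at h3
    · have := Finset.card_le_two (a := proj b z) (b := proj b w)
      rw [Finset.insert_idem] at h3; omega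
    · have := Finset.card_le_two (a := proj b z) (b := proj b w)
      rw [Finset.insert_eq_of_mem (by simp)] at h3; omega
    · have := Finset.card_le_two (a := proj b x) (b := proj b w)
      rw [Finset.pair_eq_singleton] at h3; omega
  have hfat := fat_shadow F hs hθ hM hT
  have hside : ‖proj b x - proj b w‖ ≤ κ⁻¹ * ‖proj b x - proj b z‖ := by
    rw [le_inv_mul_iff₀ hκ]
    exact hfat.side_le hκ (by simp [hshadow]) (by simp [hshadow]) (by simp [hshadow])
      (by simp [hshadow]) hxw hxz
  have hκ1 : 1 ≤ κ⁻¹ := (one_le_inv₀ hκ).2 (Real.sin_le_one θ)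
  set d := ‖proj b x - proj b z‖ with hdd
  have hd0 : 0 ≤ d := norm_nonneg _
  have hmuxz : ∀ n ∈ T, mu B n = 0 → mu B x ≤ C * (κ⁻¹ * d) ∧ mu B x ≤ C * (2 * h₁) := by
    intro n hn h0
    have hkey := abs_mu_sub_le_norm_proj F hmu x n
    rw [h0, sub_zero, abs_of_pos hmux] at hkey
    have hdκ : d ≤ κ⁻¹ * d := le_mul_of_one_le_left hd0 hκ1
    rcases (hmem n).1 hn with rfl | rfl | rfl | rfl
    · exact absurd h0 hmux.ne'
    · exact absurd (hmuy ▸ h0) hmux.ne'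
    · exact ⟨hkey.trans (by gcongr), hkey.trans (by gcongr; exact hd.1)⟩
    · exact ⟨hkey.trans (by gcongr), hkey.trans (by gcongr; exact hd.2)⟩
  have hS := hfill.patchSet_eq F hρ0 hρ1 hQ
  have hr01 : 0 ≤ r ∧ r ≤ 1 := ⟨by linarith, by linarith [hg'.2.2.1]⟩
  have hs01 : 0 ≤ s ∧ s ≤ 1 := ⟨by linarith [hg'.2.2.1], by linarith⟩
  have hgap : ∀ v : E3, cutGraph B b ℓ₀ s (proj b v) - cutGraph B b ℓ₀ r (proj b v) =
      ℓ₀ * ((s - r) * mu B v) := by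
    intro v
    have e1 := inner_sub_cutGraph F s v
    have e2 := inner_sub_cutGraph F r v
    linarith
  have hslopeΓ : 2 * C * ℓ₀ ≤ Γ := by
    have : 2 * C * ℓ₀ ≤ 2 * C * ℓ₀ * κ⁻¹ := le_mul_of_one_le_right (by positivity) hκ1
    rw [hΓ]; linarith
  have hlip : ∀ t : ℝ, 0 ≤ t ∧ t ≤ 1 → ∀ p q,
      |cutGraph B b ℓ₀ t p - cutGraph B b ℓ₀ t q| ≤ Γ * ‖p - q‖ := fun t ht p q =>
    (abs_cutGraph_sub_le hC.le hlam hmu hℓ.le ht p q).trans (by gcongr)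
  have hTrs : cell T ⊆ IsFrame.layer Λ B r s := fun v hv => by
    have h0 := mu_nonneg F (hT.2 hv)
    obtain ⟨h1, h2, h3⟩ := hTg hv
    exact ⟨h1, (mul_le_mul_of_nonneg_right hrg h0).trans h2,
      h3.trans (mul_le_mul_of_nonneg_right hgs h0)⟩
  refine ⟨cutGraph B b ℓ₀ r, cutGraph B b ℓ₀ s, x, y, z, w, x', y', ?_⟩
  refine ⟨⟨isOpen_interior, isBounded_patchSet Q, conforming_shadows F hs hQ,
    fat_shadows F hs hθ hM hQ, ?_, ?_, shadow_mem_shadows hadm.mem, by simp [hshadow],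
    by simp [hshadow], hxz, hh3p, ?_, fun p q => ⟨hlip r hr01 p q, hlip s hs01 p q⟩, ?_, ?_, ?_, ?_,
    ?_⟩, ⟨hxT, hyT, hzT, hwT, hx'T.1, hy'T.1⟩, ⟨hyx, hx'T.2, hy'T.2⟩, ⟨hxz, hxw, hzw⟩, ?_, hd.1,
    ⟨?_, ?_⟩, ?_⟩
  · have := hpatch.card_shadows_le F hs hθ hκ hM
    rw [← Nat.cast_le (α := ℝ)]
    refine le_trans ?_ (Nat.le_ceil _)
    rw [le_div_iff₀ (by positivity)]
    exact this
  · obtain ⟨U, hU, hUc, hUs, hUm⟩ := isPreconnected_proj_patchSet (b := b) hadm.connected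
    refine ⟨U, hU, hUc, hUs, fun t ht => ?_⟩
    obtain ⟨T', hT', rfl⟩ := mem_shadows.1 ht
    exact hUm T' hT' (interior_cell_nonempty_of_mem (hQ T' hT').1)
  · refine (hd.1.trans hh1c).trans ?_
    gcongr
    rw [hΓ]; linarith
  · rw [hgap, hh3']
    constructor
    · gcongr
    · rcases hwide with hw | ⟨n, hn, h0⟩
      · have h1 : ℓ₀ * ((s - r) * mu B x) ≤ ℓ₀ * ((g.2 - g.1) * mu B x) := by gcongr
        refine h1.trans (le_mul_of_one_le_left (by rw [← hh3']; exact hh3p.le) ?_)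
        rw [hΓ]; linarith
      · have h1 := (hmuxz n hn h0).2
        have h2 : C * (2 * h₁) ≤ C * (2 * c * (ℓ₀ * ((g.2 - g.1) * mu B x))) := by
          rw [← hh3']; gcongr
        have h3 : ℓ₀ * ((s - r) * mu B x) ≤ ℓ₀ * (1 * mu B x) := by
          gcongr; linarith
        have h4 : ℓ₀ * mu B x ≤ ℓ₀ * (C * (2 * c * (ℓ₀ * ((g.2 - g.1) * mu B x)))) := by
          gcongr; exact h1.trans h2
        have h5 : 0 ≤ ℓ₀ * ((g.2 - g.1) * mu B x) := by rw [← hh3']; exact hh3p.le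
        have h6 : ℓ₀ * (C * (2 * c * (ℓ₀ * ((g.2 - g.1) * mu B x)))) ≤
            Γ * (ℓ₀ * ((g.2 - g.1) * mu B x)) := by
          have : 2 * c * C * ℓ₀ * (ℓ₀ * ((g.2 - g.1) * mu B x)) ≤ Γ * (ℓ₀ * ((g.2 - g.1) * mu B x)) := by
            gcongr
            rw [hΓ]; linarith
          linarith
        linarith
  · intro t ht p hp
    obtain ⟨T', hT', rfl⟩ := mem_shadows.1 ht
    rw [hull_shadow] at hp
    obtain ⟨v, hv, rfl⟩ := hp
    have h0 := mu_nonneg F ((hQ T' hT').2 hv)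
    rw [← sub_nonneg, hgap]
    have : 0 ≤ s - r := by linarith [hg'.2.2.1]
    positivity
  · rw [← col_eq_pcol F hℓ, hS]
    rintro v ⟨hv, h1, h2⟩
    have h0 : 0 < mu B v := by
      have : 0 < (s - r) * mu B v := by linarith
      exact pos_of_mul_pos_right this (by linarith [hg'.2.2.1])
    exact ⟨hv, (mul_le_mul_of_nonneg_right hρr h0.le).trans_lt h1,
      h2.trans_le (mul_le_mul_of_nonneg_right hsρ h0.le)⟩
  · rw [← col_eq_pcol F hℓ]
    exact interior_cell_subset_col F hTrs
  · intro n hn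
    obtain ⟨T', hT', hp⟩ := hnode n hn
    refine ⟨_, shadow_mem_shadows hT', fun p hpn => ?_⟩
    obtain ⟨h1, h2, h3⟩ := hp p hpn
    exact ⟨by rw [hull_shadow]; exact ⟨p, h1, rfl⟩, (cutGraph_le_iff F hℓ r p).2 h2,
      (le_cutGraph_iff F hℓ s p).2 h3⟩
  · rw [hh3, dist_comm, dist_eq_norm]
    have := norm_sq_eq b (y - x)
    rw [map_sub, hyx, sub_self, norm_zero] at this
    rw [← abs_norm, ← sq_eq_sq_iff_abs_eq_abs, this]; ring
  · have := abs_inner_sub_le_of_mem_cutPlane F hℓ hC.le hlam hmu (M.cuts_subset Λ e hs hp) hpz hpx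
    rw [hx'T.2] at this
    exact this.trans (by gcongr)
  · have := abs_inner_sub_le_of_mem_cutPlane F hℓ hC.le hlam hmu (M.cuts_subset Λ e hs hq) hqw hqy
    rw [hy'T.2] at this
    refine this.trans ?_
    have h1 : 2 * C * ℓ₀ * ‖proj b x - proj b w‖ ≤ 2 * C * ℓ₀ * (κ⁻¹ * d) := by gcongr
    have h2 : 2 * C * ℓ₀ * κ⁻¹ * d ≤ Γ * d := by
      gcongr
      rw [hΓ]; linarith
    linarith
  · intro hlt
    have hpos : ∀ n ∈ T, 0 < mu B n := by
      intro n hn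
      refine (hmu0 n hn).lt_of_ne fun h0 => hlt.not_ge ?_
      have h1 := (hmuxz n hn h0.symm).1
      have h2 : (g.2 - g.1) * mu B x ≤ 1 * mu B x := by
        gcongr; linarith
      have h3 : h₃ ≤ ℓ₀ * (C * (κ⁻¹ * d)) := by
        rw [hh3']; exact mul_le_mul_of_nonneg_left (by linarith) hℓ.le
      have h4 : 2 * C * ℓ₀ * κ⁻¹ * d ≤ Γ * d := by
        gcongr
        rw [hΓ]; linarith
      have h5 : 0 ≤ ℓ₀ * (C * (κ⁻¹ * d)) := by positivity
      linarith
    obtain ⟨rfl, rfl⟩ := hown hpos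
    have hgraph : ∀ n ∈ T, ∀ o ∈ M.cuts Λ e, n ∈ cutPlane Λ e o →
        ∀ p ∈ openSegment ℝ n (M.sigma n), inner ℝ (b 2) p = cutGraph B b ℓ₀ (lam B o) (proj b p) := by
      intro n hn o ho hno p hpn
      obtain ⟨o', ho', hno', hso'⟩ := M.sigma_plane n (hf n hn) Λ e hs (hT.2 (hnT n hn))
      have hoe := M.cuts_subset Λ e hs ho
      have hoe' := M.cuts_subset Λ e hs ho'
      have hpo' : p ∈ cutPlane Λ e o' := by
        rw [openSegment_eq_image_lineMap] at hpn
        obtain ⟨a, -, rfl⟩ := hpn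
        exact AffineMap.lineMap_mem a hno' hso'
      rw [F.mem_cutPlane_iff hoe] at hno
      rw [F.mem_cutPlane_iff hoe'] at hno' hpo'
      rw [eq_cutGraph_iff F hℓ, hpo', mul_right_cancel₀ (hpos n hn).ne' (hno.symm.trans hno')]
    have hmain : ∀ n ∈ T, ∀ m ∈ T, ∀ o ∈ M.cuts Λ e, n ∈ cutPlane Λ e o → m ∈ cutPlane Λ e o →
        ∃ χ : E2 →ᵃ[ℝ] ℝ, (χ = cutGraph B b ℓ₀ g.1 ∨ χ = cutGraph B b ℓ₀ g.2) ∧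
          (∀ p ∈ openSegment ℝ n (M.sigma n), inner ℝ (b 2) p = χ (proj b p)) ∧
          ∀ p ∈ openSegment ℝ m (M.sigma m), inner ℝ (b 2) p = χ (proj b p) :=
      fun n hn m hm o ho hno hmo => ⟨cutGraph B b ℓ₀ (lam B o),
        (hval n hn (hpos n hn) o ho hno).imp (fun h => by rw [h]) fun h => by rw [h],
        hgraph n hn o ho hno, hgraph m hm o ho hmo⟩
    rintro q' (rfl | rfl)
    · exact hmain z hzT x' hx'T.1 p hp hpz hpx
    · exact hmain w hwT y' hy'T.1 q hq hqw hqy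

end

noncomputable section

/-! ### The interpolation error -/

/-- The error estimate on one element; the constant depends on its shape parameters only. -/
theorem exists_interpolation_bound {κ Γ : ℝ} (hκ : 0 < κ) (hΓ : 1 ≤ Γ) (N : ℕ) : ∃ C : ℝ, 0 < C ∧
    ∀ {P : MacroPartition} {M : GradedMesh P} {b T Q h₁ h₃ φ ψ x y z w x' y'},
      T ∈ tets M.K → (∀ n ∈ T, n ∈ freeNodes P M.K) → T ∈ Q →
      NeedleGeom κ Γ N b (patchSet Q) (shadows b Q) M.sigma T h₁ h₃ φ ψ x y z w x' y' →
      ∀ {u v}, MemH2 (patchSet Q) u → M.IsTraceRep T Q u v →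
        MemH1 (interior (cell T)) (fun x => u x - M.Dh v x) ∧
        h1Seminorm b (interior (cell T)) (fun x => u x - M.Dh v x) ≤
          C * ∑ i : Fin 3, ![h₁, h₁, h₃] i *
            h1Seminorm b (patchSet Q) (weakPartial (patchSet Q) (b i) u) := by
  obtain ⟨C, hC, happ⟩ := exists_affine_approx hκ hΓ N
  set A := (1 + Γ) * (2 * κ⁻¹ ^ 2 + 1) with hA
  have hA0 : 0 ≤ A := by positivity
  refine ⟨3 * (C + C * (C * A)) * 6, by positivity, ?_⟩
  intro P M b T Q h₁ h₃ φ ψ x y z w x' y' hT hf hTQ H u v hu hv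
  set S := patchSet Q with hS
  have hSo : IsOpen S := isOpen_interior
  have hUS : interior (cell T) ⊆ S := interior_cell_subset_patchSet hTQ
  have hUb : Bornology.IsBounded (interior (cell T)) := H.geom.isBounded.subset hUS
  obtain ⟨L, V, hV, hconst, hgrad, hD, hD'⟩ :=
    happ H.geom ((hu.isH2 b hSo).congr hSo hv.1.symm) hv.2.1 hv.2.2
  obtain ⟨L', c, hDh, hval⟩ := M.exists_affine_Dh hT hf v
  set d := ‖proj b x - proj b z‖ with hd
  set G := (hNorm S ![d, d, h₃] fun i k => weakPartial S (b k) (weakPartial S (b i) u)).toReal with hG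
  have hG0 : 0 ≤ G := ENNReal.toReal_nonneg
  set β := C * G / V with hβ
  have hβ0 : 0 ≤ β := by positivity
  obtain ⟨hx, hy, hz, hw, hx', hy'⟩ := H.mem
  have hγ : ∀ n ∈ T, ∀ m ∈ T, edgeProjValue v n (M.sigma n) - L n -
      (edgeProjValue v m (M.sigma m) - L m) = (L' - L) (n - m) := by
    intro n hn m hm
    rw [hval n hn, hval m hm, map_sub]
    simp only [sub_apply]
    ring
  have hdiv : ∀ {t a : ℝ}, V * |t| ≤ C * a * G → |t| ≤ β * a := by
    intro t a h
    rw [hβ, div_mul_eq_mul_div, le_div_iff₀ hV]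
    linarith
  have hbase : ∀ j, |(L' - L) (b j)| ≤ β * A := by
    refine abs_apply_basis_le (γ := (L' - L).toLinearMap) hκ (by linarith) hβ0 H.geom.h_pos
      (H.geom.fat _ H.geom.mem) H.geom.X_mem H.geom.Z_mem (Finset.mem_image_of_mem _ hw)
      H.proj_eq.1 H.proj_eq.2.1 H.proj_eq.2.2 H.ne.1 H.ne.2.1 H.ne.2.2 H.length ?_ ?_ ?_
      H.slope.1 H.slope.2
    · have := hdiv (hD y hy x hx)
      rwa [hγ y hy x hx] at this
    · have := hdiv (hD' z hz x' hx' fun hlt => H.plane hlt (z, x') (Or.inl rfl))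
      rwa [hγ z hz x' hx'] at this
    · have := hdiv (hD' w hw y' hy' fun hlt => H.plane hlt (w, y') (Or.inr rfl))
      rwa [hγ w hw y' hy'] at this
  have hE : 0 ≤ (C + C * (C * A)) * G := by positivity
  have key := memH1_sub_and_h1Seminorm_le (b := b) hSo isOpen_interior hUS hUb hu.1 hDh hE fun i => by
    have hsum : (fun x => weakPartial S (b i) u x - L' (b i)) =
        (fun x => weakPartial S (b i) u x - L (b i)) + fun _ => -((L' - L) (b i)) := by
      funext x
      simp only [Pi.add_apply, sub_apply]
      ring
    have hm : AEStronglyMeasurable (fun x => weakPartial S (b i) u x - L (b i))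
        (volume.restrict (interior (cell T))) :=
      (((hu.isH2 b hSo).mem1 i).mono_measure
        (Measure.restrict_mono hUS le_rfl)).aestronglyMeasurable.sub aestronglyMeasurable_const
    rw [hsum]
    refine (eLpNorm_add_le hm aestronglyMeasurable_const (by norm_num)).trans ?_
    refine (add_le_add (hgrad i) (hconst _)).trans ?_
    rw [← ENNReal.ofReal_add (by positivity) (by positivity)]
    refine ENNReal.ofReal_le_ofReal ?_
    rw [abs_neg, add_mul]
    have h1 : V * |(L' - L) (b i)| ≤ C * G * A := by
      have := mul_le_mul_of_nonneg_left (hbase i) hV.le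
      rw [hβ] at this
      refine this.trans (le_of_eq ?_)
      field_simp
    have := mul_le_mul_of_nonneg_left h1 hC.le
    linarith
  refine ⟨key.1, key.2.trans ?_⟩
  have hd0 : 0 ≤ d := norm_nonneg _
  have hw0 : ∀ i, 0 ≤ ![d, d, h₃] i := by
    intro i; fin_cases i <;> simp [hd0, H.geom.h_pos.le]
  have hGle := toReal_hNorm_le (b := b) hSo hu hw0
  have hfin : ∑ i, ![d, d, h₃] i * (3 * h1Seminorm b S (weakPartial S (b i) u)) ≤
      6 * ∑ i : Fin 3, ![h₁, h₁, h₃] i * h1Seminorm b S (weakPartial S (b i) u) := by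
    rw [Finset.mul_sum]
    refine Finset.sum_le_sum fun i _ => ?_
    have h0 : 0 ≤ h1Seminorm b S (weakPartial S (b i) u) := Real.sqrt_nonneg _
    have h1 : ![d, d, h₃] i ≤ 2 * ![h₁, h₁, h₃] i := by
      have := H.dist_le
      have := H.geom.h_pos
      fin_cases i
      · simpa using H.dist_le
      · simpa using H.dist_le
      · simp; linarith
    nlinarith
  have : (C + C * (C * A)) * G ≤ (C + C * (C * A)) *
      (6 * ∑ i : Fin 3, ![h₁, h₁, h₃] i * h1Seminorm b S (weakPartial S (b i) u)) := by
    gcongr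
    exact hGle.trans hfin
  linarith

/-- The error estimate in one macro-element with a fixed order of its vertices. -/
theorem exists_interpolation_bound_of_frame {P : MacroPartition} {Λ e : Finset E3}
    (hs : P.IsSingular Λ e) (B : AffineBasis (Fin 4) ℝ E3) {θ : ℝ} (hθ : 0 < θ)
    (hκ : 0 < Real.sin θ) (C₀ : ℝ) : ∃ C : ℝ, 0 < C ∧
      ∀ M : GradedMesh P, M.MinAngle θ → ∀ {b ℓ}, IsFrame Λ e B b ℓ → 0 < ℓ →
      ∀ T ∈ tets M.K, cell T ⊆ cell Λ → (∀ n ∈ T, n ∈ freeNodes P M.K) →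
      ∀ h₁ h₃ : ℝ, M.IsLengths Λ e T h₁ h₃ → h₁ ≤ C₀ * h₃ →
      ∀ Q : Finset (Finset E3), M.IsPatch Λ e T Q →
      ∀ u : E3 → ℝ, MemH2 (patchSet Q) u → ∀ v, M.IsTraceRep T Q u v →
          MemH1 (interior (cell T)) (fun x => u x - M.Dh v x) ∧
          h1Seminorm b (interior (cell T)) (fun x => u x - M.Dh v x) ≤
            C * ∑ i : Fin 3, ![h₁, h₁, h₃] i *
              h1Seminorm b (patchSet Q) (weakPartial (patchSet Q) (b i) u) := by
  obtain ⟨Γ, N, hΓ, hgeom⟩ := exists_needleGeom hs B hθ hκ C₀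
  obtain ⟨C, hC, hbound⟩ := exists_interpolation_bound hκ hΓ N
  refine ⟨C, hC, fun M hM b ℓ F hℓ T hT hTΛ hf h₁ h₃ hlen hle Q hQ u hu v hv => ?_⟩
  obtain ⟨φ, ψ, x, y, z, w, x', y', H⟩ := hgeom M hM F hℓ ⟨hT, hTΛ⟩ hf hlen hle hQ
  exact hbound hT hf hQ.1.mem H hu hv

theorem MacroPartition.finite_isSingular (P : MacroPartition) :
    {p : Finset E3 × Finset E3 | P.IsSingular p.1 p.2}.Finite := by
  refine (P.triangulation.finite.prod P.triangulation.finite).subset ?_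
  rintro ⟨Λ, e⟩ ⟨h1, h2, -⟩
  exact ⟨h1.1, (P.singEdges_subset e h2).1⟩

theorem mainTheorem4 (P : MacroPartition) (θ : ℝ) (hθ : 0 < θ) (C₀ : ℝ) :
    ∃ C : ℝ, 0 < C ∧
      ∀ M : GradedMesh P, M.MinAngle θ →
      ∀ Λ e : Finset E3, P.IsSingular Λ e →
      ∀ b : OrthonormalBasis (Fin 3) ℝ E3, b 2 ∈ vectorSpan ℝ (e : Set E3) →
      ∀ T ∈ tets M.K, cell T ⊆ cell Λ → (∀ n ∈ T, n ∈ freeNodes P M.K) →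
      ∀ h₁ h₃ : ℝ, M.IsLengths Λ e T h₁ h₃ → h₁ ≤ C₀ * h₃ →
      ∀ Q : Finset (Finset E3), M.IsPatch Λ e T Q →
      ∀ u : E3 → ℝ, MemH2 (patchSet Q) u →
        (∃ v, M.IsTraceRep T Q u v) ∧
        ∀ v, M.IsTraceRep T Q u v →
          MemH1 (interior (cell T)) (fun x => u x - M.Dh v x) ∧
          h1Seminorm b (interior (cell T)) (fun x => u x - M.Dh v x) ≤
            C * ∑ i : Fin 3, ![h₁, h₁, h₃] i *
              h1Seminorm b (patchSet Q) (weakPartial (patchSet Q) (b i) u) := by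
  classical
  set θ' := min θ 1 with hθ'd
  have hθ' : 0 < θ' := lt_min hθ one_pos
  have hκ : 0 < Real.sin θ' :=
    Real.sin_pos_of_pos_of_lt_pi hθ' ((min_le_right _ _).trans_lt (by linarith [Real.pi_gt_three]))
  have hang : ∀ M : GradedMesh P, M.MinAngle θ → M.MinAngle θ' :=
    fun M h Λ e hs T hT hTΛ x hx y hy z hz h1 h2 h3 =>
      (min_le_left _ _).trans (h Λ e hs T hT hTΛ x hx y hy z hz h1 h2 h3)
  have hloc : ∀ p : Finset E3 × Finset E3, ∃ C : ℝ, 0 < C ∧ (P.IsSingular p.1 p.2 →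
      ∀ M : GradedMesh P, M.MinAngle θ' →
      ∀ b : OrthonormalBasis (Fin 3) ℝ E3, b 2 ∈ vectorSpan ℝ (p.2 : Set E3) →
      ∀ T ∈ tets M.K, cell T ⊆ cell p.1 → (∀ n ∈ T, n ∈ freeNodes P M.K) →
      ∀ h₁ h₃ : ℝ, M.IsLengths p.1 p.2 T h₁ h₃ → h₁ ≤ C₀ * h₃ →
      ∀ Q : Finset (Finset E3), M.IsPatch p.1 p.2 T Q →
      ∀ u : E3 → ℝ, MemH2 (patchSet Q) u → ∀ v, M.IsTraceRep T Q u v →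
          MemH1 (interior (cell T)) (fun x => u x - M.Dh v x) ∧
          h1Seminorm b (interior (cell T)) (fun x => u x - M.Dh v x) ≤
            C * ∑ i : Fin 3, ![h₁, h₁, h₃] i *
              h1Seminorm b (patchSet Q) (weakPartial (patchSet Q) (b i) u)) := by
    rintro ⟨Λ, e⟩
    by_cases hs : P.IsSingular Λ e
    swap
    · exact ⟨1, one_pos, fun h => absurd h hs⟩
    obtain ⟨B, hBr, hBe⟩ := hs.exists_affineBasis
    set B' := B.reindex (Equiv.swap 0 1) with hB'
    obtain ⟨C, hC, h⟩ := exists_interpolation_bound_of_frame hs B hθ' hκ C₀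
    obtain ⟨C', hC', h'⟩ := exists_interpolation_bound_of_frame hs B' hθ' hκ C₀
    refine ⟨max C C', lt_max_of_lt_left hC, fun _ M hM b hb T hT hTΛ hf h₁ h₃ hl hle Q hQ u hu v hv => ?_⟩
    obtain ⟨ℓ, F⟩ := MacroPartition.IsSingular.isFrame hBr hBe hb
    have hpos : 0 ≤ ∑ i : Fin 3, ![h₁, h₁, h₃] i *
        h1Seminorm b (patchSet Q) (weakPartial (patchSet Q) (b i) u) := by
      obtain ⟨x, y, z, w, x', y', -, -, -, rfl, -, -, -, -, rfl⟩ := hl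
      refine Finset.sum_nonneg fun i _ => mul_nonneg ?_ (Real.sqrt_nonneg _)
      fin_cases i <;> simp <;> positivity
    rcases lt_or_gt_of_ne F.ne_zero with hneg | hpos'
    · have F' : IsFrame Λ e B' b (-ℓ) := by
        refine ⟨neg_ne_zero.2 F.ne_zero, ?_, ?_, ?_⟩
        · have := F.edge
          simp only [hB', AffineBasis.reindex_apply]
          simp only [Equiv.symm_swap, Equiv.swap_apply_left, Equiv.swap_apply_right]
          rw [neg_smul, ← this, neg_sub]
        · rw [← hBr, hB', AffineBasis.coe_reindex, EquivLike.range_comp]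
        · rw [hBe, hB', AffineBasis.reindex_apply, AffineBasis.reindex_apply]
          simp only [Equiv.symm_swap, Equiv.swap_apply_left, Equiv.swap_apply_right]
          exact Set.pair_comm _ _
      obtain ⟨a1, a2⟩ := h' M hM F' (neg_pos.2 hneg) T hT hTΛ hf h₁ h₃ hl hle Q hQ u hu v hv
      exact ⟨a1, a2.trans (mul_le_mul_of_nonneg_right (le_max_right _ _) hpos)⟩
    · obtain ⟨a1, a2⟩ := h M hM F hpos' T hT hTΛ hf h₁ h₃ hl hle Q hQ u hu v hv
      exact ⟨a1, a2.trans (mul_le_mul_of_nonneg_right (le_max_left _ _) hpos)⟩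
  choose C hC hbound using hloc
  set I := P.finite_isSingular.toFinset with hI
  refine ⟨1 + ∑ p ∈ I, C p, add_pos_of_pos_of_nonneg one_pos
    (Finset.sum_nonneg fun p _ => (hC p).le), ?_⟩
  intro M hM Λ e hs b hb T hT hTΛ hf h₁ h₃ hl hle Q hQ u hu
  constructor
  · obtain ⟨B, hBr, hBe⟩ := hs.exists_affineBasis
    obtain ⟨ℓ, F⟩ := MacroPartition.IsSingular.isFrame hBr hBe hb
    exact hQ.1.exists_isTraceRep F hs hθ' hκ (hang M hM) hf hu
  · intro v hv
    obtain ⟨a1, a2⟩ := hbound (Λ, e) hs M (hang M hM) b hb T hT hTΛ hf h₁ h₃ hl hle Q hQ u hu v hv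
    refine ⟨a1, a2.trans (mul_le_mul_of_nonneg_right ?_ ?_)⟩
    · have : C (Λ, e) ≤ ∑ p ∈ I, C p :=
        Finset.single_le_sum (fun p _ => (hC p).le) (by rw [hI, Set.Finite.mem_toFinset]; exact hs)
      linarith
    · by_contra! hneg
      have := mul_neg_of_pos_of_neg (hC (Λ, e)) hneg
      have h0 : 0 ≤ h1Seminorm b (interior (cell T)) (fun x => u x - M.Dh v x) := Real.sqrt_nonneg _
      linarith

end
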